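/- Let $K$ be a field of characteristic $0$ (for instance $\mathbb C$) and let $(A,d,\Delta)$ be a differential $\mathbb Z/2$-graded Batalin--Vilkovisky algebra over $K$: $A$ is a $\mathbb Z/2$-graded supercommutative associative unital $K$-algebra, and $d,\Delta:A\to A$ are odd $K$-linear maps with $d(1)=\Delta(1)=0$, $d$ a differential operator of order $\le 1$, $\Delta$ a differential operator of order $\le 2$, and $d^2=\Delta^2=d\Delta+\Delta d=0$. Let $\mathfrak g=\Pi A$ be the associated Lie superalgebra with bracket $[a,b]=\Delta(ab)-\Delta(a)b-(-1)^{|a|}a\Delta(b)$, so that $(\mathfrak g,d)$ is a differential $\mathbb Z/2$-graded Lie algebra and $\Pi H^\bullet(\mathfrak g,d)=H^\bullet(A,d)$. Write $\mathrm{Mod}_{(\mathfrak g,d)}=\mathrm{Spf}\,H^\bullet(\mathfrak g,K)$, where $H^\bullet(\mathfrak g,K)$ is the cohomology of the Chevalley--Eilenberg complex $\prod_{n\ge 0}\mathrm{Hom}(\mathrm{Sym}^n\Pi\mathfrak g,K)$ with its product and its topology (induced by pointwise convergence, $K$ being discrete). The formal neighbourhood of $0$ in a super vector space $V$ is $\mathrm{Spf}\prod_{n\ge0}\mathrm{Hom}(\mathrm{Sym}^nV,K)$.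 Assume that $(A,d,\Delta)$ has the degeneration property: for every $N\ge 1$, $H^\bullet(A[u]/(u^N),d+u\Delta)$ is a free $K[u]/(u^N)$-module. Then: (1) $(\mathfrak g,d)$ is homotopy abelian: there is an $L_\infty$-quasi-isomorphism to $(\mathfrak g,d)$ from $H^\bullet(\mathfrak g,d)$ endowed with the zero bracket and the zero differential. In particular $\mathrm{Mod}_{(\mathfrak g,d)}$ is isomorphic, as a formal supermanifold, to the formal neighbourhood of $0$ in $\Pi H^\bullet(\mathfrak g,d)=H^\bullet(A,d)$. (2) Let $T:H^\bullet(A[[u]],d+u\Delta)\to H^\bullet(A,d)[[u]]$ be any normalized degeneration isomorphism, that is, an even isomorphism of topological $K[[u]]$-modules with $T|_{u=0}=\mathrm{id}_{H^\bullet(A,d)}$. Then there is exactly one isomorphism of formal supermanifolds $$\Phi_T:\mathrm{Mod}_{(\mathfrak g,d)}\longrightarrow\bigl(\text{formal neighbourhood of }0\text{ in }\Pi H^\bullet(\mathfrak g,d)=H^\bullet(A,d)\bigr)$$ with the following property. Let $R$ be any finite-dimensional local supercommutative $K$-algebra with residue field $K$ and maximal ideal $\mathfrak m$ (for instance $R=K[\varepsilon]/(\varepsilon^{n})$),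 and let $a\in(A\otimes\mathfrak m)^{\mathrm{even}}$ satisfy $da+\frac12[a,a]=0$. Then $a$ has a lift $\tilde a\in (A\otimes\mathfrak m)^{\mathrm{even}}[[u]]$ with $\tilde a|_{u=0}=a$ and $(d+u\Delta)\tilde a+\frac12[\tilde a,\tilde a]=0$ such that, with $\tilde b=u\bigl(\exp(\tilde a/u)-1\bigr)$ and $T$ extended $K((u))\otimes R$-linearly, $$T[\tilde b]\in H^\bullet(A,d)[u^{-1}]\otimes\mathfrak m ,$$ and for every such lift $\Phi_T$ sends the $R$-point of $\mathrm{Mod}_{(\mathfrak g,d)}$ defined by $a$ to the value of $T[\tilde b]$ at $u=\infty$, i.e. to its coefficient at $u^0$, an element of $(H^\bullet(A,d)\otimes\mathfrak m)^{\mathrm{even}}$. -/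

import Mathlib

open scoped TensorProduct PowerSeries DirectSum

noncomputable section

namespace BVModuli

universe u v w

/-! ### Super vector spaces: `ZMod 2`-graded modules -/

section Super

variable {K : Type u} [Field K] {V : Type v} [AddCommGroup V] [Module K V]
variable (𝒱 : ZMod 2 → Submodule K V) [DirectSum.Decomposition 𝒱]

/-- The component of parity `i`. -/
def comp (i : ZMod 2) : V →ₗ[K] V :=
  (𝒱 i).subtype ∘ₗ DirectSum.component K (ZMod 2) (fun j => 𝒱 j) i ∘ₗ
    (DirectSum.decomposeLinearEquiv 𝒱).toLinearMap

/-- The parity involution `v ↦ (-1)^|v| v`. -/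
def parity : V →ₗ[K] V := comp 𝒱 0 - comp 𝒱 1

lemma zmod2_cases (i : ZMod 2) : i = 0 ∨ i = 1 := by revert i; decide

lemma zmod2_one_add_one : (1 + 1 : ZMod 2) = 0 := by decide

lemma comp_mem (i : ZMod 2) (v : V) : comp 𝒱 i v ∈ 𝒱 i := by
  simp [comp]

lemma comp_same {i : ZMod 2} {v : V} (h : v ∈ 𝒱 i) : comp 𝒱 i v = v :=
  DirectSum.decompose_of_mem_same 𝒱 h

lemma comp_ne {i j : ZMod 2} {v : V} (h : v ∈ 𝒱 i) (hij : i ≠ j) : comp 𝒱 j v = 0 :=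
  DirectSum.decompose_of_mem_ne 𝒱 h hij

lemma comp_add (v : V) : comp 𝒱 0 v + comp 𝒱 1 v = v := by
  have h := DirectSum.Decomposition.inductionOn 𝒱 (motive := fun v => comp 𝒱 0 v + comp 𝒱 1 v = v)
    (by simp) (fun {i} m => by
      rcases zmod2_cases i with rfl | rfl
      · rw [comp_same 𝒱 m.2, comp_ne 𝒱 m.2 (by decide), add_zero]
      · rw [comp_same 𝒱 m.2, comp_ne 𝒱 m.2 (by decide), zero_add])
    (fun m n hm hn => by rw [map_add, map_add]; nth_rw 3 [← hm]; nth_rw 3 [← hn]; abel)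
  exact h v

lemma parity_mem {i : ZMod 2} {v : V} (h : v ∈ 𝒱 i) : parity 𝒱 v = (-1 : ℤˣ) ^ i • v := by
  rcases zmod2_cases i with rfl | rfl
  · simp [parity, comp_same 𝒱 h, comp_ne 𝒱 h (show (0 : ZMod 2) ≠ 1 by decide)]
  · simp [parity, comp_same 𝒱 h, comp_ne 𝒱 h (show (1 : ZMod 2) ≠ 0 by decide)]

lemma homogeneous_induction {P : V → Prop} (hadd : ∀ v w, P v → P w → P (v + w))
    (hom : ∀ i, ∀ v ∈ 𝒱 i, P v) (v : V) : P v := by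
  rw [← comp_add 𝒱 v]
  exact hadd _ _ (hom 0 _ (comp_mem 𝒱 0 v)) (hom 1 _ (comp_mem 𝒱 1 v))

end Super

/-! ### Cohomology of a square-zero endomorphism -/

/-- `ker D / im D`. -/
abbrev Coh {R : Type u} [Ring R] {M : Type v} [AddCommGroup M] [Module R M] (D : M →ₗ[R] M) :
    Type v :=
  LinearMap.ker D ⧸ (LinearMap.range D).submoduleOf (LinearMap.ker D)

/-- The class of a cocycle. -/
abbrev Coh.mk {R : Type u} [Ring R] {M : Type v} [AddCommGroup M] [Module R M] (D : M →ₗ[R] M) :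
    LinearMap.ker D →ₗ[R] Coh D :=
  ((LinearMap.range D).submoduleOf (LinearMap.ker D)).mkQ

section CohGrading

variable {K : Type u} [Field K] {V : Type v} [AddCommGroup V] [Module K V]
variable (𝒱 : ZMod 2 → Submodule K V)

/-- Parity on cohomology: the classes represented by cocycles of parity `i`. -/
def cohGrading (d : V →ₗ[K] V) (i : ZMod 2) : Submodule K (Coh d) :=
  ((𝒱 i).submoduleOf (LinearMap.ker d)).map (Coh.mk d)

variable [DirectSum.Decomposition 𝒱]

lemma comp_odd {d : V →ₗ[K] V} (hd : ∀ i, ∀ v ∈ 𝒱 i, d v ∈ 𝒱 (i + 1)) (i : ZMod 2) (v : V) :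
    comp 𝒱 (i + 1) (d v) = d (comp 𝒱 i v) := by
  refine homogeneous_induction 𝒱 (P := fun v => comp 𝒱 (i + 1) (d v) = d (comp 𝒱 i v)) ?_ ?_ v
  · intro v w hv hw; simp only [map_add, hv, hw]
  · intro j v hv
    by_cases h : j = i
    · subst h; rw [comp_same 𝒱 hv, comp_same 𝒱 (hd _ _ hv)]
    · rw [comp_ne 𝒱 hv h, comp_ne 𝒱 (hd _ _ hv) (by simpa using h), map_zero]

lemma comp_ker {d : V →ₗ[K] V} (hd : ∀ i, ∀ v ∈ 𝒱 i, d v ∈ 𝒱 (i + 1)) (i : ZMod 2) {v : V}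
    (hv : d v = 0) : d (comp 𝒱 i v) = 0 := by
  rw [← comp_odd 𝒱 hd, hv, map_zero]

lemma comp_range {d : V →ₗ[K] V} (hd : ∀ i, ∀ v ∈ 𝒱 i, d v ∈ 𝒱 (i + 1)) (i : ZMod 2) {v : V}
    (hv : v ∈ LinearMap.range d) : comp 𝒱 i v ∈ LinearMap.range d := by
  obtain ⟨w, rfl⟩ := hv
  refine ⟨comp 𝒱 (i + 1) w, ?_⟩
  rw [← comp_odd 𝒱 hd, add_assoc, zmod2_one_add_one, add_zero]

lemma isCompl_cohGrading (d : V →ₗ[K] V) (hd : ∀ i, ∀ v ∈ 𝒱 i, d v ∈ 𝒱 (i + 1)) :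
    IsCompl (cohGrading 𝒱 d 0) (cohGrading 𝒱 d 1) := by
  constructor
  · rw [Submodule.disjoint_def]
    rintro _ ⟨x, hx, rfl⟩ ⟨y, hy, hxy⟩
    rw [← sub_eq_zero, ← map_sub] at hxy
    replace hxy := (Submodule.Quotient.mk_eq_zero _).1 hxy
    have h := comp_range 𝒱 hd 0 (show ((y - x : LinearMap.ker d) : V) ∈ LinearMap.range d from hxy)
    rw [Submodule.coe_sub, map_sub, comp_ne 𝒱 (show (y : V) ∈ 𝒱 1 from hy) (by decide),
      comp_same 𝒱 (show (x : V) ∈ 𝒱 0 from hx), zero_sub] at h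
    have h' : (x : V) ∈ LinearMap.range d := by simpa only [neg_neg] using neg_mem h
    exact (Submodule.Quotient.mk_eq_zero _).2 h'
  · rw [codisjoint_iff, eq_top_iff]
    rintro x -
    obtain ⟨x, rfl⟩ := Submodule.mkQ_surjective _ x
    have h : x = ⟨comp 𝒱 0 x, comp_ker 𝒱 hd 0 x.2⟩ + ⟨comp 𝒱 1 x, comp_ker 𝒱 hd 1 x.2⟩ :=
      Subtype.ext (comp_add 𝒱 (x : V)).symm
    rw [h, map_add]
    exact Submodule.add_mem_sup (Submodule.mem_map_of_mem (comp_mem 𝒱 0 _))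
      (Submodule.mem_map_of_mem (comp_mem 𝒱 1 _))

end CohGrading

/-- Two complementary submodules form a `ZMod 2`-grading. -/
@[reducible] def decompositionOfIsCompl {K : Type u} [Field K] {V : Type v} [AddCommGroup V] [Module K V]
    (𝒱 : ZMod 2 → Submodule K V) (h : IsCompl (𝒱 0) (𝒱 1)) : DirectSum.Decomposition 𝒱 :=
  ((DirectSum.isInternal_submodule_iff_isCompl 𝒱 (i := 0) (j := 1) (by decide) (by
    ext i; rcases zmod2_cases i with rfl | rfl <;> simp)).2 h).chooseDecomposition

/-! ### The supersymmetric bialgebra -/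

section SSym

variable {K : Type u} [Field K] {V : Type v} [AddCommGroup V] [Module K V]
variable (𝒱 : ZMod 2 → Submodule K V)

/-- The relations `v w = (-1)^(|v||w|) w v`. -/
inductive SSym.Rel : TensorAlgebra K V → TensorAlgebra K V → Prop
  | comm {i j : ZMod 2} {v w : V} (hv : v ∈ 𝒱 i) (hw : w ∈ 𝒱 j) :
      SSym.Rel (TensorAlgebra.ι K v * TensorAlgebra.ι K w)
        ((-1 : ℤˣ) ^ (i * j) • (TensorAlgebra.ι K w * TensorAlgebra.ι K v))

/-- The free supercommutative algebra `Sym V = ⨁ₙ Symⁿ V` on a super vector space. -/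
def SSym : Type (max u v) := RingQuot (SSym.Rel 𝒱)

namespace SSym

instance : Ring (SSym 𝒱) := inferInstanceAs (Ring (RingQuot (SSym.Rel 𝒱)))

instance : Algebra K (SSym 𝒱) := inferInstanceAs (Algebra K (RingQuot (SSym.Rel 𝒱)))

/-- The quotient map from the tensor algebra. -/
def ofTensor : TensorAlgebra K V →ₐ[K] SSym 𝒱 := RingQuot.mkAlgHom K (Rel 𝒱)

/-- The inclusion of `V = Sym¹ V`. -/
def ι : V →ₗ[K] SSym 𝒱 :=
  (ofTensor 𝒱).toLinearMap ∘ₗ TensorAlgebra.ι K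

lemma ι_comm {i j : ZMod 2} {v w : V} (hv : v ∈ 𝒱 i) (hw : w ∈ 𝒱 j) :
    ι 𝒱 v * ι 𝒱 w = (-1 : ℤˣ) ^ (i * j) • (ι 𝒱 w * ι 𝒱 v) := by
  have h : ofTensor 𝒱 _ = ofTensor 𝒱 _ := RingQuot.mkAlgHom_rel K (Rel.comm hv hw)
  rw [map_mul] at h
  refine h.trans ?_
  rcases Int.units_eq_one_or ((-1 : ℤˣ) ^ (i * j)) with e | e <;> simp [e, ι]

variable {B : Type w} [Ring B] [Algebra K B]

/-- The universal property of `Sym V`. -/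
def lift (f : V →ₗ[K] B) (hf : ∀ i j, ∀ v ∈ 𝒱 i, ∀ w ∈ 𝒱 j,
    f v * f w = (-1 : ℤˣ) ^ (i * j) • (f w * f v)) : SSym 𝒱 →ₐ[K] B :=
  RingQuot.liftAlgHom K ⟨TensorAlgebra.lift K f, by
    rintro _ _ ⟨hv, hw⟩
    rename_i i j v w
    have := hf i j v hv w hw
    rcases Int.units_eq_one_or ((-1 : ℤˣ) ^ (i * j)) with e | e <;>
      rw [e] at this ⊢ <;> simpa using this⟩

@[simp] lemma lift_ι (f : V →ₗ[K] B) (hf) (v : V) : lift 𝒱 f hf (ι 𝒱 v) = f v := by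
  exact (RingQuot.liftAlgHom_mkAlgHom_apply K _ _ _).trans (TensorAlgebra.lift_ι_apply f v)

lemma algHom_ext {f g : SSym 𝒱 →ₐ[K] B} (h : ∀ v, f (ι 𝒱 v) = g (ι 𝒱 v)) : f = g := by
  refine RingQuot.ringQuot_ext' K (s := Rel 𝒱) f g ?_
  ext v
  exact h v

lemma induction {P : SSym 𝒱 → Prop} (halg : ∀ c : K, P (algebraMap K _ c))
    (hι : ∀ v, P (ι 𝒱 v)) (hmul : ∀ x y, P x → P y → P (x * y))
    (hadd : ∀ x y, P x → P y → P (x + y)) (x : SSym 𝒱) : P x := by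
  obtain ⟨t, rfl⟩ : ∃ t, ofTensor 𝒱 t = x := RingQuot.mkAlgHom_surjective K (Rel 𝒱) x
  induction t using TensorAlgebra.induction with
  | algebraMap c => rw [AlgHom.commutes]; exact halg c
  | ι v => exact hι v
  | mul a b ha hb => rw [map_mul]; exact hmul _ _ ha hb
  | add a b ha hb => rw [map_add]; exact hadd _ _ ha hb

variable [DirectSum.Decomposition 𝒱]

/-- The parity involution of `Sym V`. -/
def par : SSym 𝒱 →ₐ[K] SSym 𝒱 :=
  lift 𝒱 (ι 𝒱 ∘ₗ parity 𝒱) (by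
    intro i j v hv w hw
    have := ι_comm 𝒱 hv hw
    simp only [LinearMap.comp_apply, parity_mem 𝒱 hv, parity_mem 𝒱 hw]
    rcases zmod2_cases i with rfl | rfl <;> rcases zmod2_cases j with rfl | rfl <;>
      simpa using this)

lemma par_ι (v : V) : par 𝒱 (ι 𝒱 v) = ι 𝒱 (parity 𝒱 v) := by simp [par]

lemma par_ι_mem {i : ZMod 2} {v : V} (hv : v ∈ 𝒱 i) :
    par 𝒱 (ι 𝒱 v) = (-1 : ℤˣ) ^ i • ι 𝒱 v := by
  rw [par_ι, parity_mem 𝒱 hv]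
  rcases zmod2_cases i with rfl | rfl <;> simp

lemma par_par (x : SSym 𝒱) : par 𝒱 (par 𝒱 x) = x := by
  suffices h : (par 𝒱).comp (par 𝒱) = AlgHom.id K _ from DFunLike.congr_fun h x
  apply algHom_ext
  intro v
  refine homogeneous_induction 𝒱
    (P := fun v => (par 𝒱).comp (par 𝒱) (ι 𝒱 v) = AlgHom.id K _ (ι 𝒱 v)) ?_ ?_ v
  · intro v w hv hw; simp only [map_add, hv, hw]
  · intro i v hv
    rw [AlgHom.comp_apply, par_ι_mem 𝒱 hv]
    rcases zmod2_cases i with rfl | rfl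
    · simpa using par_ι_mem 𝒱 hv
    · have := par_ι_mem 𝒱 hv
      simp only [uzpow_one, Units.neg_smul, one_smul, map_neg] at this ⊢
      simp [this]

/-- The parity grading of `Sym V`. -/
def grading (i : ZMod 2) : Submodule K (SSym 𝒱) where
  carrier := {x | par 𝒱 x = (-1 : ℤˣ) ^ i • x}
  add_mem' {x y} hx hy := by
    simp only [Set.mem_ofPred_eq] at hx hy ⊢
    rw [map_add, hx, hy, smul_add]
  zero_mem' := by simp
  smul_mem' c x hx := by
    simp only [Set.mem_ofPred_eq] at hx ⊢
    rw [map_smul, hx, smul_comm]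

lemma mem_grading {i : ZMod 2} {x : SSym 𝒱} :
    x ∈ grading 𝒱 i ↔ par 𝒱 x = (-1 : ℤˣ) ^ i • x := Iff.rfl

lemma ι_mem {i : ZMod 2} {v : V} (hv : v ∈ 𝒱 i) : ι 𝒱 v ∈ grading 𝒱 i := par_ι_mem 𝒱 hv

variable [CharZero K]

lemma isCompl_grading : IsCompl (grading 𝒱 0) (grading 𝒱 1) := by
  constructor
  · rw [Submodule.disjoint_def]
    intro x h0 h1
    rw [mem_grading] at h0 h1
    rw [h0] at h1
    simp only [uzpow_zero, one_smul, uzpow_one, Units.neg_smul] at h1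
    have h2 : (2 : K) • x = 0 := by rw [two_smul]; nth_rw 1 [h1]; simp
    exact (smul_eq_zero.1 h2).resolve_left two_ne_zero
  · rw [codisjoint_iff, eq_top_iff]
    rintro x -
    have h : x = (2⁻¹ : K) • (x + par 𝒱 x) + (2⁻¹ : K) • (x - par 𝒱 x) := by
      rw [← smul_add, add_add_sub_cancel, ← two_smul K x, smul_smul, inv_mul_cancel₀ two_ne_zero,
        one_smul]
    rw [h]
    refine Submodule.add_mem_sup (Submodule.smul_mem _ _ ?_) (Submodule.smul_mem _ _ ?_)
    · simp [mem_grading, par_par, add_comm]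
    · simp [mem_grading, par_par]

instance : GradedAlgebra (grading 𝒱) where
  one_mem := by
    change par 𝒱 1 = _
    simp
  mul_mem := by
    intro i j x y hx hy
    rw [mem_grading] at hx hy ⊢
    rw [map_mul, hx, hy]
    rcases zmod2_cases i with rfl | rfl <;> rcases zmod2_cases j with rfl | rfl <;>
      simp [zmod2_one_add_one]
  toDecomposition := decompositionOfIsCompl _ (isCompl_grading 𝒱)

/-- The comultiplication as an algebra map into the graded tensor product;
every `v ∈ V` is primitive: `v ↦ v ⊗ 1 + 1 ⊗ v`. -/
def comulAlg : SSym 𝒱 →ₐ[K] GradedTensorProduct K (grading 𝒱) (grading 𝒱) :=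
  lift 𝒱 ((GradedTensorProduct.includeLeft (grading 𝒱) (grading 𝒱)).toLinearMap ∘ₗ ι 𝒱 +
      (GradedTensorProduct.includeRight (grading 𝒱) (grading 𝒱)).toLinearMap ∘ₗ ι 𝒱) (by
    intro i j v hv w hw
    have e2 : ∀ {i j : ZMod 2} {v w : V}, v ∈ 𝒱 i → w ∈ 𝒱 j →
        GradedTensorProduct.includeRight (grading 𝒱) (grading 𝒱) (ι 𝒱 v) *
        GradedTensorProduct.includeLeft (grading 𝒱) (grading 𝒱) (ι 𝒱 w) =
        (-1 : ℤˣ) ^ (i * j) • (GradedTensorProduct.includeLeft (grading 𝒱) (grading 𝒱) (ι 𝒱 w) *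
          GradedTensorProduct.includeRight (grading 𝒱) (grading 𝒱) (ι 𝒱 v)) := by
      intro i j v w hv hw
      have h1 := GradedTensorProduct.tmul_coe_mul_coe_tmul (R := K) (grading 𝒱) (grading 𝒱)
        1 ⟨ι 𝒱 v, ι_mem 𝒱 hv⟩ ⟨ι 𝒱 w, ι_mem 𝒱 hw⟩ 1
      have h2 := GradedTensorProduct.tmul_one_mul_one_tmul (R := K) (grading 𝒱) (grading 𝒱)
        (ι 𝒱 w) (ι 𝒱 v)
      rw [one_mul, mul_one] at h1
      rw [GradedTensorProduct.includeLeft_apply, GradedTensorProduct.includeRight_apply, h2]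
      exact h1
    have l1 := ι_comm 𝒱 hv hw
    have r1 := l1
    have a1 := e2 hv hw
    have a2 := e2 hw hv
    apply_fun GradedTensorProduct.includeLeft (grading 𝒱) (grading 𝒱) at l1
    apply_fun GradedTensorProduct.includeRight (grading 𝒱) (grading 𝒱) at r1
    rw [mul_comm j i] at a2
    simp only [LinearMap.add_apply, LinearMap.comp_apply, AlgHom.toLinearMap_apply, mul_add,
      add_mul]
    rcases Int.units_eq_one_or ((-1 : ℤˣ) ^ (i * j)) with e | e <;>
      simp only [e, one_smul, Units.neg_smul, map_neg, map_mul] at l1 r1 a1 a2 ⊢ <;>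
      rw [l1, r1, a1, a2] <;> abel)

/-- The comultiplication of `Sym V`. -/
def comul : SSym 𝒱 →ₗ[K] SSym 𝒱 ⊗[K] SSym 𝒱 :=
  (GradedTensorProduct.of K (grading 𝒱) (grading 𝒱)).symm.toLinearMap ∘ₗ (comulAlg 𝒱).toLinearMap


end SSym

end SSym
/-! ### dg Lie superalgebras and their Chevalley–Eilenberg coalgebras -/

section DGLie

variable {K : Type u} [Field K] {V : Type v} [AddCommGroup V] [Module K V]

/-- A differential `ℤ/2`-graded Lie algebra structure on `𝔤 = Π V`, written on the parity shift
`V = Π 𝔤`: a Lie bracket on `𝔤` is an odd supersymmetric bracket on `V`. -/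
structure DGLie (𝒱 : ZMod 2 → Submodule K V) where
  d : V →ₗ[K] V
  br : V →ₗ[K] V →ₗ[K] V
  d_odd : ∀ i, ∀ v ∈ 𝒱 i, d v ∈ 𝒱 (i + 1)
  d_sq : ∀ v, d (d v) = 0
  br_odd : ∀ i j, ∀ v ∈ 𝒱 i, ∀ w ∈ 𝒱 j, br v w ∈ 𝒱 (i + j + 1)
  br_symm : ∀ i j, ∀ v ∈ 𝒱 i, ∀ w ∈ 𝒱 j, br v w = (-1 : ℤˣ) ^ (i * j) • br w v
  leibniz : ∀ i, ∀ v ∈ 𝒱 i, ∀ w, d (br v w) = -br (d v) w - (-1 : ℤˣ) ^ i • br v (d w)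
  jacobi : ∀ i j k, ∀ a ∈ 𝒱 i, ∀ b ∈ 𝒱 j, ∀ c ∈ 𝒱 k,
    br (br a b) c + (-1 : ℤˣ) ^ (j * k) • br (br a c) b
      + (-1 : ℤˣ) ^ (i * (j + k)) • br (br b c) a = 0

/-- The vector space `V` as an abelian dg Lie algebra with zero differential. -/
def DGLie.trivial (𝒱 : ZMod 2 → Submodule K V) : DGLie 𝒱 where
  d := 0
  br := 0
  d_odd := by simp
  d_sq := by simp
  br_odd := by simp
  br_symm := by simp
  leibniz := by simp
  jacobi := by simp

variable {𝒱 : ZMod 2 → Submodule K V} [DirectSum.Decomposition 𝒱]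

namespace DGLie

variable (L : DGLie 𝒱)

/-- Left multiplication by `v ∈ V` on triples `(x, Q x, v' ↦ ad v' x)`; see `Q_ι_mul` and
`ad_ι_mul` for the recursion that it encodes. -/
def step : V →ₗ[K] Module.End K (SSym 𝒱 × SSym 𝒱 × (V →ₗ[K] SSym 𝒱)) :=
  LinearMap.mk₂ K
    (fun v s => (SSym.ι 𝒱 v * s.1,
      SSym.ι 𝒱 (L.d v) * s.1 + SSym.ι 𝒱 (parity 𝒱 v) * s.2.1 + s.2.2 v,
      LinearMap.mulRight K s.1 ∘ₗ SSym.ι 𝒱 ∘ₗ L.br.flip v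
        + LinearMap.mulLeft K (SSym.ι 𝒱 (comp 𝒱 0 v)) ∘ₗ s.2.2
        - LinearMap.mulLeft K (SSym.ι 𝒱 (comp 𝒱 1 v)) ∘ₗ s.2.2 ∘ₗ parity 𝒱))
    (by
      intro v w s
      refine Prod.ext ?_ (Prod.ext ?_ (LinearMap.ext fun u => ?_))
      · simp [add_mul]
      · simp [add_mul]; abel
      · simp [add_mul]; abel)
    (by
      intro c v s
      refine Prod.ext ?_ (Prod.ext ?_ (LinearMap.ext fun u => ?_))
      · simp
      · simp [smul_add]
      · simp [smul_add, smul_sub])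
    (by
      intro v s t
      refine Prod.ext ?_ (Prod.ext ?_ (LinearMap.ext fun u => ?_))
      · simp [mul_add]
      · simp [mul_add]; abel
      · simp [mul_add]; abel)
    (by
      intro c v s
      refine Prod.ext ?_ (Prod.ext ?_ (LinearMap.ext fun u => ?_))
      · simp
      · simp [smul_add]
      · simp [smul_add, smul_sub])

lemma step_fst (v : V) (s : SSym 𝒱 × SSym 𝒱 × (V →ₗ[K] SSym 𝒱)) :
    (L.step v s).1 = SSym.ι 𝒱 v * s.1 := rfl

lemma step_snd (v : V) (s : SSym 𝒱 × SSym 𝒱 × (V →ₗ[K] SSym 𝒱)) :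
    (L.step v s).2.1
      = SSym.ι 𝒱 (L.d v) * s.1 + SSym.ι 𝒱 (parity 𝒱 v) * s.2.1 + s.2.2 v := rfl

lemma step_thd {i j : ZMod 2} {v w : V} (hv : v ∈ 𝒱 i) (hw : w ∈ 𝒱 j)
    (s : SSym 𝒱 × SSym 𝒱 × (V →ₗ[K] SSym 𝒱)) :
    (L.step w s).2.2 v
      = SSym.ι 𝒱 (L.br v w) * s.1 + (-1 : ℤˣ) ^ ((i + 1) * j) • (SSym.ι 𝒱 w * s.2.2 v) := by
  have h : (L.step w s).2.2 v = SSym.ι 𝒱 (L.br v w) * s.1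
      + SSym.ι 𝒱 (comp 𝒱 0 w) * s.2.2 v - SSym.ι 𝒱 (comp 𝒱 1 w) * s.2.2 (parity 𝒱 v) := rfl
  rw [h, parity_mem 𝒱 hv]
  rcases zmod2_cases j with rfl | rfl
  · simp [comp_same 𝒱 hw, comp_ne 𝒱 hw (show (0 : ZMod 2) ≠ 1 by decide)]
  · rw [comp_same 𝒱 hw, comp_ne 𝒱 hw (show (1 : ZMod 2) ≠ 0 by decide)]
    rcases zmod2_cases i with rfl | rfl <;> simp [zmod2_one_add_one, sub_eq_add_neg]

lemma step_comm (i j : ZMod 2) (v : V) (hv : v ∈ 𝒱 i) (w : V) (hw : w ∈ 𝒱 j) :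
    L.step v * L.step w = (-1 : ℤˣ) ^ (i * j) • (L.step w * L.step v) := by
  have key : ∀ {i j : ZMod 2} {v w : V}, v ∈ 𝒱 i → w ∈ 𝒱 j → ∀ x : SSym 𝒱,
      SSym.ι 𝒱 v * (SSym.ι 𝒱 w * x) = (-1 : ℤˣ) ^ (i * j) • (SSym.ι 𝒱 w * (SSym.ι 𝒱 v * x)) := by
    intro i j v w hv hw x
    rw [← mul_assoc, SSym.ι_comm 𝒱 hv hw, ← mul_assoc]
    rcases zmod2_cases i with rfl | rfl <;> rcases zmod2_cases j with rfl | rfl <;> simp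
  have c4 := L.br_symm i j v hv w hw
  refine LinearMap.ext fun s => ?_
  have hs : ((-1 : ℤˣ) ^ (i * j) • (L.step w * L.step v)) s
      = (-1 : ℤˣ) ^ (i * j) • L.step w (L.step v s) := by
    rcases zmod2_cases i with rfl | rfl <;> rcases zmod2_cases j with rfl | rfl <;> simp
  rw [hs, Module.End.mul_apply]
  refine Prod.ext ?_ (Prod.ext ?_ ?_)
  · have h := key hv hw s.1
    rcases zmod2_cases i with rfl | rfl <;> rcases zmod2_cases j with rfl | rfl <;>
      simpa [step_fst] using h
  · have c1 := key (L.d_odd i v hv) hw s.1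
    have c2 := key (L.d_odd j w hw) hv s.1
    have c3 := key hv hw s.2.1
    have e1 := L.step_thd hv hw s
    have e2 := L.step_thd hw hv s
    have l : (L.step v (L.step w s)).2.1 = SSym.ι 𝒱 (L.d v) * (SSym.ι 𝒱 w * s.1)
        + SSym.ι 𝒱 (parity 𝒱 v) * (SSym.ι 𝒱 (L.d w) * s.1 + SSym.ι 𝒱 (parity 𝒱 w) * s.2.1 + s.2.2 w)
        + (L.step w s).2.2 v := rfl
    have r : (L.step w (L.step v s)).2.1 = SSym.ι 𝒱 (L.d w) * (SSym.ι 𝒱 v * s.1)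
        + SSym.ι 𝒱 (parity 𝒱 w) * (SSym.ι 𝒱 (L.d v) * s.1 + SSym.ι 𝒱 (parity 𝒱 v) * s.2.1 + s.2.2 v)
        + (L.step v s).2.2 w := rfl
    have hr : ((-1 : ℤˣ) ^ (i * j) • L.step w (L.step v s)).2.1
        = (-1 : ℤˣ) ^ (i * j) • (L.step w (L.step v s)).2.1 := by
      rcases zmod2_cases i with rfl | rfl <;> rcases zmod2_cases j with rfl | rfl <;> simp
    rw [hr, l, r, e1, e2, parity_mem 𝒱 hv, parity_mem 𝒱 hw, c4]
    simp only [mul_add, c1, c2]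
    rcases zmod2_cases i with rfl | rfl <;> rcases zmod2_cases j with rfl | rfl <;>
      simp [zmod2_one_add_one] at c3 ⊢ <;> rw [c3] <;> abel
  · refine LinearMap.ext fun u => ?_
    have hr : ∀ u, ((-1 : ℤˣ) ^ (i * j) • L.step w (L.step v s)).2.2 u
        = (-1 : ℤˣ) ^ (i * j) • (L.step w (L.step v s)).2.2 u := by
      intro u
      rcases zmod2_cases i with rfl | rfl <;> rcases zmod2_cases j with rfl | rfl <;> simp
    rw [hr]
    refine homogeneous_induction 𝒱 (P := fun u => (L.step v (L.step w s)).2.2 u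
      = (-1 : ℤˣ) ^ (i * j) • (L.step w (L.step v s)).2.2 u) ?_ ?_ u
    · intro u u' hu hu'
      rw [map_add, map_add, hu, hu', smul_add]
    · intro k u hu
      have c5 := key (L.br_odd k i u hu v hv) hw s.1
      have c6 := key (L.br_odd k j u hu w hw) hv s.1
      have c7 := key hv hw (s.2.2 u)
      rw [L.step_thd hu hv (L.step w s), L.step_thd hu hw s, L.step_thd hu hw (L.step v s),
        L.step_thd hu hv s, step_fst,
        step_fst, c5, mul_add, mul_add, c6]
      rcases zmod2_cases i with rfl | rfl <;> rcases zmod2_cases j with rfl | rfl <;>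
      rcases zmod2_cases k with rfl | rfl <;>
      simp [zmod2_one_add_one] at c7 ⊢ <;> rw [c7] <;> abel

/-- The algebra map generated by `step`. -/
def stepAlg : SSym 𝒱 →ₐ[K] Module.End K (SSym 𝒱 × SSym 𝒱 × (V →ₗ[K] SSym 𝒱)) :=
  SSym.lift 𝒱 (B := Module.End K (SSym 𝒱 × SSym 𝒱 × (V →ₗ[K] SSym 𝒱))) L.step L.step_comm

/-- The Chevalley–Eilenberg codifferential on `Sym(Π 𝔤)`:
`Q(v₁⋯vₙ) = ∑ᵢ ± dvᵢ v₁⋯v̂ᵢ⋯vₙ + ∑_{i<j} ± [vᵢ,vⱼ] v₁⋯v̂ᵢ⋯v̂ⱼ⋯vₙ` with Koszul signs. -/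
def Q : SSym 𝒱 →ₗ[K] SSym 𝒱 :=
  LinearMap.fst K _ _ ∘ₗ LinearMap.snd K _ _ ∘ₗ LinearMap.applyₗ ((1, 0, 0) : SSym 𝒱 × SSym 𝒱 × (V →ₗ[K] SSym 𝒱)) ∘ₗ
    L.stepAlg.toLinearMap

/-- `ad v` is the derivation of `Sym V` that extends `w ↦ [v, w]`. -/
def ad (v : V) : SSym 𝒱 →ₗ[K] SSym 𝒱 :=
  LinearMap.applyₗ v ∘ₗ LinearMap.snd K _ _ ∘ₗ LinearMap.snd K _ _ ∘ₗ
    LinearMap.applyₗ ((1, 0, 0) : SSym 𝒱 × SSym 𝒱 × (V →ₗ[K] SSym 𝒱)) ∘ₗ L.stepAlg.toLinearMap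

lemma stepAlg_fst (x : SSym 𝒱) (s : SSym 𝒱 × SSym 𝒱 × (V →ₗ[K] SSym 𝒱)) : (L.stepAlg x s).1 = x * s.1 := by
  revert s
  refine SSym.induction 𝒱 (P := fun x => ∀ s, (L.stepAlg x s).1 = x * s.1) ?_ ?_ ?_ ?_ x
  · intro c s; simp [Module.algebraMap_end_apply, Algebra.smul_def]
  · intro v s; rw [stepAlg, SSym.lift_ι]; simp [step]
  · intro x y hx hy s; rw [map_mul, Module.End.mul_apply, hx, hy, mul_assoc]
  · intro x y hx hy s; rw [map_add, LinearMap.add_apply, Prod.fst_add, hx, hy, add_mul]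

lemma Q_one : L.Q 1 = 0 := by simp [Q]

lemma ad_one (v : V) : L.ad v 1 = 0 := by simp [ad]

lemma stepAlg_ι_mul (v : V) (x : SSym 𝒱) (s : SSym 𝒱 × SSym 𝒱 × (V →ₗ[K] SSym 𝒱)) :
    L.stepAlg (SSym.ι 𝒱 v * x) s = L.step v (L.stepAlg x s) := by
  rw [map_mul, Module.End.mul_apply, stepAlg, SSym.lift_ι]

lemma Q_ι_mul (v : V) (x : SSym 𝒱) :
    L.Q (SSym.ι 𝒱 v * x)
      = SSym.ι 𝒱 (L.d v) * x + SSym.ι 𝒱 (parity 𝒱 v) * L.Q x + L.ad v x := by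
  have h := L.stepAlg_fst x (1, 0, 0)
  rw [mul_one] at h
  change (L.stepAlg _ _).2.1 = _ * _ + _ * (L.stepAlg _ _).2.1 + (L.stepAlg _ _).2.2 v
  rw [stepAlg_ι_mul, step_snd, h]

lemma ad_ι_mul {i j : ZMod 2} {v w : V} (hv : v ∈ 𝒱 i) (hw : w ∈ 𝒱 j) (x : SSym 𝒱) :
    L.ad v (SSym.ι 𝒱 w * x)
      = SSym.ι 𝒱 (L.br v w) * x + (-1 : ℤˣ) ^ ((i + 1) * j) • (SSym.ι 𝒱 w * L.ad v x) := by
  have h := L.stepAlg_fst x (1, 0, 0)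
  rw [mul_one] at h
  change (L.stepAlg _ _).2.2 v = _ * _ + _ • (_ * (L.stepAlg _ _).2.2 v)
  rw [stepAlg_ι_mul, L.step_thd hv hw, h]

end DGLie

end DGLie

/-! ### dg Batalin–Vilkovisky algebras -/

section BV

variable {K : Type u} [Field K] {A : Type v} [Ring A] [Algebra K A]

/-- The supercommutator `[D, a] = D ∘ a - (-1)^(|D||a|) a ∘ D` of an operator `D` of parity `p`
with multiplication by an element `a` of parity `i`. -/
def superComm (p i : ZMod 2) (D : A →ₗ[K] A) (a : A) : A →ₗ[K] A :=
  D ∘ₗ LinearMap.mulLeft K a - (-1 : ℤˣ) ^ (p * i) • (LinearMap.mulLeft K a ∘ₗ D)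

lemma superComm_apply (p i : ZMod 2) (D : A →ₗ[K] A) (a y : A) :
    superComm p i D a y = D (a * y) - (-1 : ℤˣ) ^ (p * i) • (a * D y) := rfl

/-- An operator `D` of parity `p` is a differential operator of order `≤ n` on the
supercommutative algebra `A`. -/
def IsDiffOp (𝒜 : ZMod 2 → Submodule K A) : ℕ → ZMod 2 → (A →ₗ[K] A) → Prop
  | 0, p, D => ∀ i, ∀ a ∈ 𝒜 i, superComm p i D a = 0
  | n + 1, p, D => ∀ i, ∀ a ∈ 𝒜 i, IsDiffOp 𝒜 n (p + i) (superComm p i D a)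

/-- A differential `ℤ/2`-graded Batalin–Vilkovisky algebra `(A, d, Δ)`. -/
structure DGBV (𝒜 : ZMod 2 → Submodule K A) [GradedAlgebra 𝒜] where
  supercomm : ∀ i j, ∀ a ∈ 𝒜 i, ∀ b ∈ 𝒜 j, a * b = (-1 : ℤˣ) ^ (i * j) • (b * a)
  d : A →ₗ[K] A
  Δ : A →ₗ[K] A
  d_odd : ∀ i, ∀ a ∈ 𝒜 i, d a ∈ 𝒜 (i + 1)
  Δ_odd : ∀ i, ∀ a ∈ 𝒜 i, Δ a ∈ 𝒜 (i + 1)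
  d_one : d 1 = 0
  Δ_one : Δ 1 = 0
  d_order : IsDiffOp 𝒜 1 1 d
  Δ_order : IsDiffOp 𝒜 2 1 Δ
  d_sq : ∀ a, d (d a) = 0
  Δ_sq : ∀ a, Δ (Δ a) = 0
  d_Δ : ∀ a, d (Δ a) + Δ (d a) = 0

namespace DGBV

variable {𝒜 : ZMod 2 → Submodule K A} [GradedAlgebra 𝒜] (𝓑 : DGBV 𝒜)

/-- The bracket `[a, b] = Δ(ab) - Δ(a) b - (-1)^|a| a Δ(b)`. -/
def br : A →ₗ[K] A →ₗ[K] A :=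
  LinearMap.mk₂ K (fun a b => 𝓑.Δ (a * b) - 𝓑.Δ a * b - parity 𝒜 a * 𝓑.Δ b)
    (by intro a b c; simp [add_mul]; abel) (by intro c a b; simp [smul_sub])
    (by intro a b c; simp [mul_add]; abel) (by intro c a b; simp [smul_sub])

lemma br_apply {i : ZMod 2} {a : A} (ha : a ∈ 𝒜 i) (b : A) :
    𝓑.br a b = 𝓑.Δ (a * b) - 𝓑.Δ a * b - (-1 : ℤˣ) ^ i • (a * 𝓑.Δ b) := by
  have : 𝓑.br a b = 𝓑.Δ (a * b) - 𝓑.Δ a * b - parity 𝒜 a * 𝓑.Δ b := rfl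
  rw [this, parity_mem 𝒜 ha]
  rcases zmod2_cases i with rfl | rfl <;> simp

lemma d_mul {i : ZMod 2} {a : A} (ha : a ∈ 𝒜 i) (b : A) :
    𝓑.d (a * b) = 𝓑.d a * b + (-1 : ℤˣ) ^ i • (a * 𝓑.d b) := by
  refine homogeneous_induction 𝒜 (P := fun b => 𝓑.d (a * b)
    = 𝓑.d a * b + (-1 : ℤˣ) ^ i • (a * 𝓑.d b)) ?_ ?_ b
  · intro b c hb hc
    rw [mul_add, map_add, hb, hc, map_add, mul_add, mul_add, smul_add]; abel
  · intro j b hb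
    have h := LinearMap.congr_fun (𝓑.d_order i a ha j b hb) 1
    have hc := 𝓑.supercomm j (i + 1) b hb _ (𝓑.d_odd i a ha)
    rcases zmod2_cases i with rfl | rfl <;> rcases zmod2_cases j with rfl | rfl <;>
      simp [superComm, 𝓑.d_one, zmod2_one_add_one] at h hc ⊢ <;> rw [hc] at h <;>
      rw [← sub_eq_zero, ← h] <;> abel

/-- The operator `[Δ, a]`. -/
def X (i : ZMod 2) (a y : A) : A := 𝓑.Δ (a * y) - (-1 : ℤˣ) ^ i • (a * 𝓑.Δ y)

lemma X_add (i : ZMod 2) (a y z : A) : 𝓑.X i a (y + z) = 𝓑.X i a y + 𝓑.X i a z := by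
  simp only [X, mul_add, map_add, smul_add]; abel

lemma X_eq {i : ZMod 2} {a : A} (ha : a ∈ 𝒜 i) (y : A) :
    𝓑.X i a y = 𝓑.br a y + 𝓑.Δ a * y := by
  rw [X, 𝓑.br_apply ha]; abel

lemma Δ_mul (i : ZMod 2) (a y : A) : 𝓑.Δ (a * y) = 𝓑.X i a y + (-1 : ℤˣ) ^ i • (a * 𝓑.Δ y) := by
  rw [X]; abel

lemma Δ_X (i : ZMod 2) (a y : A) : 𝓑.Δ (𝓑.X i a y) = (-1 : ℤˣ) ^ (i + 1) • 𝓑.X i a (𝓑.Δ y) := by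
  rcases zmod2_cases i with rfl | rfl <;> simp [X, 𝓑.Δ_sq, zmod2_one_add_one]

lemma br_odd (i j : ZMod 2) (a : A) (ha : a ∈ 𝒜 i) (b : A) (hb : b ∈ 𝒜 j) :
    𝓑.br a b ∈ 𝒜 (i + j + 1) := by
  rw [𝓑.br_apply ha]
  have h1 := 𝓑.Δ_odd _ _ (SetLike.mul_mem_graded ha hb)
  have h2 := SetLike.mul_mem_graded (𝓑.Δ_odd _ _ ha) hb
  have h3 := SetLike.mul_mem_graded ha (𝓑.Δ_odd _ _ hb)
  rw [show i + 1 + j = i + j + 1 by ring] at h2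
  rw [← add_assoc] at h3
  refine sub_mem (sub_mem h1 h2) ?_
  rcases Int.units_eq_one_or ((-1 : ℤˣ) ^ i) with e | e <;> simpa [e] using h3

lemma br_symm (i j : ZMod 2) (a : A) (ha : a ∈ 𝒜 i) (b : A) (hb : b ∈ 𝒜 j) :
    𝓑.br a b = (-1 : ℤˣ) ^ (i * j) • 𝓑.br b a := by
  have h1 := 𝓑.supercomm i j a ha b hb
  have h2 := 𝓑.supercomm _ j _ (𝓑.Δ_odd i a ha) b hb
  have h3 := 𝓑.supercomm i _ a ha _ (𝓑.Δ_odd j b hb)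
  rw [𝓑.br_apply ha, 𝓑.br_apply hb]
  rcases zmod2_cases i with rfl | rfl <;> rcases zmod2_cases j with rfl | rfl <;>
    simp [zmod2_one_add_one] at h1 h2 h3 ⊢ <;> rw [h1, h2, h3] <;> (try simp) <;> abel

lemma X_mul {i j : ZMod 2} {a b : A} (ha : a ∈ 𝒜 i) (hb : b ∈ 𝒜 j) (y : A) :
    𝓑.X i a (b * y) = 𝓑.br a b * y + (-1 : ℤˣ) ^ ((i + 1) * j) • (b * 𝓑.X i a y) := by
  refine homogeneous_induction 𝒜 (P := fun y => 𝓑.X i a (b * y)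
    = 𝓑.br a b * y + (-1 : ℤˣ) ^ ((i + 1) * j) • (b * 𝓑.X i a y)) ?_ ?_ y
  · intro y z hy hz
    rw [mul_add, X_add, hy, hz, X_add, mul_add, mul_add, smul_add]; abel
  · intro k c hc
    have h : (𝓑.X i a (b * c) - (-1 : ℤˣ) ^ ((1 + i) * j) • (b * 𝓑.X i a c))
        - (-1 : ℤˣ) ^ ((1 + i + j) * k) • (c * (𝓑.X i a b
          - (-1 : ℤˣ) ^ ((1 + i) * j) • (b * 𝓑.X i a 1))) = 0 := by
      have h := LinearMap.congr_fun (𝓑.Δ_order i a ha j b hb k c hc) 1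
      have e : 𝓑.X i a = superComm 1 i 𝓑.Δ a := by funext y; simp [X, superComm]
      rw [e]
      generalize superComm 1 i 𝓑.Δ a = E at h ⊢
      simpa only [superComm_apply, mul_one, LinearMap.zero_apply] using h
    have e0 : 𝓑.X i a 1 = 𝓑.Δ a := by simp [X, 𝓑.Δ_one]
    have e1 := 𝓑.supercomm _ _ _ hc _ (𝓑.br_odd i j a ha b hb)
    have e2 := 𝓑.supercomm _ _ _ hb _ (𝓑.Δ_odd i a ha)
    rw [e0, e2, 𝓑.X_eq ha b, smul_smul, show j * (i + 1) = (1 + i) * j by ring,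
      Int.units_mul_self, one_smul, add_sub_cancel_right, e1, smul_smul,
      show k * (i + j + 1) = (1 + i + j) * k by ring, Int.units_mul_self, one_smul,
      sub_sub, sub_eq_zero, add_comm 1 i, add_comm (_ • _)] at h
    exact h

lemma X_br {i j : ZMod 2} {a b : A} (ha : a ∈ 𝒜 i) (hb : b ∈ 𝒜 j) (y : A) :
    𝓑.X (i + j + 1) (𝓑.br a b) y = (-1 : ℤˣ) ^ (i + 1) • (𝓑.X i a (𝓑.X j b y)
      - (-1 : ℤˣ) ^ ((i + 1) * (j + 1)) • 𝓑.X j b (𝓑.X i a y)) := by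
  have h1 := congrArg 𝓑.Δ (eq_sub_of_add_eq (𝓑.X_mul ha hb y).symm)
  have h2 := eq_sub_of_add_eq (𝓑.X_mul ha hb (𝓑.Δ y)).symm
  have h3 := 𝓑.Δ_mul j b (𝓑.X i a y)
  have h4 := 𝓑.Δ_X i a (b * y)
  rw [Δ_X] at h3
  rw [𝓑.Δ_mul j b y, X_add] at h4
  have h5 : 𝓑.X i a ((-1 : ℤˣ) ^ j • (b * 𝓑.Δ y)) = (-1 : ℤˣ) ^ j • 𝓑.X i a (b * 𝓑.Δ y) := by
    rcases zmod2_cases j with rfl | rfl <;> simp [X] <;> abel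
  rw [h5] at h4
  rw [X, h2, h1, map_sub, h4]
  rcases zmod2_cases i with rfl | rfl <;> rcases zmod2_cases j with rfl | rfl <;>
    simp [zmod2_one_add_one] at h3 ⊢ <;> rw [h3] <;> abel

lemma Δ_br {i j : ZMod 2} {a b : A} (ha : a ∈ 𝒜 i) (hb : b ∈ 𝒜 j) :
    𝓑.Δ (𝓑.br a b) = -𝓑.br (𝓑.Δ a) b - (-1 : ℤˣ) ^ i • 𝓑.br a (𝓑.Δ b) := by
  rw [𝓑.br_apply ha, 𝓑.br_apply (𝓑.Δ_odd i a ha), 𝓑.br_apply ha]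
  rcases zmod2_cases i with rfl | rfl <;> rcases zmod2_cases j with rfl | rfl <;>
    simp [zmod2_one_add_one, 𝓑.Δ_sq] <;> abel

lemma br_br {i j : ZMod 2} {a b : A} (ha : a ∈ 𝒜 i) (hb : b ∈ 𝒜 j) (c : A) :
    𝓑.br (𝓑.br a b) c = (-1 : ℤˣ) ^ (i + 1) • (𝓑.br a (𝓑.br b c)
      - (-1 : ℤˣ) ^ ((i + 1) * (j + 1)) • 𝓑.br b (𝓑.br a c)) := by
  have h := 𝓑.X_br ha hb c
  rw [𝓑.X_eq (𝓑.br_odd i j a ha b hb), 𝓑.X_eq ha c, 𝓑.X_eq hb c, X_add, X_add,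
    𝓑.X_mul ha (𝓑.Δ_odd j b hb), 𝓑.X_mul hb (𝓑.Δ_odd i a ha), 𝓑.X_eq ha, 𝓑.X_eq hb,
    𝓑.X_eq ha, 𝓑.X_eq hb, 𝓑.Δ_br ha hb,
    𝓑.br_symm _ _ _ (𝓑.Δ_odd i a ha) b hb] at h
  have e := 𝓑.supercomm _ _ _ (𝓑.Δ_odd i a ha) _ (𝓑.Δ_odd j b hb)
  rw [← sub_eq_zero] at h ⊢
  rw [← h]
  simp only [mul_add, ← mul_assoc, e]
  rcases zmod2_cases i with rfl | rfl <;> rcases zmod2_cases j with rfl | rfl <;>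
    simp [zmod2_one_add_one, add_mul, sub_mul] <;> abel

/-- The dg Lie algebra `(𝔤, d)`, `𝔤 = Π A`. -/
def toDGLie : DGLie 𝒜 where
  d := 𝓑.d
  br := 𝓑.br
  d_odd := 𝓑.d_odd
  d_sq := 𝓑.d_sq
  br_odd := 𝓑.br_odd
  br_symm := 𝓑.br_symm
  leibniz := by
    intro i a ha b
    have h : ∀ a, 𝓑.d (𝓑.Δ a) = -𝓑.Δ (𝓑.d a) := fun a => eq_neg_of_add_eq_zero_left (𝓑.d_Δ a)
    rw [𝓑.br_apply ha, 𝓑.br_apply (𝓑.d_odd i a ha), 𝓑.br_apply ha, map_sub, map_sub, h,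
      𝓑.d_mul ha, 𝓑.d_mul (𝓑.Δ_odd i a ha), h]
    have h2 := 𝓑.d_mul ha (𝓑.Δ b)
    rcases zmod2_cases i with rfl | rfl <;>
      (simp [zmod2_one_add_one, h] at h2 ⊢; rw [h2]; abel)
  jacobi := by
    intro i j k a ha b hb c hc
    have h1 := 𝓑.br_br ha hb c
    have h2 := 𝓑.br_symm _ _ _ ha _ (𝓑.br_odd j k b hb c hc)
    have h3 := 𝓑.br_symm _ _ _ hb _ (𝓑.br_odd i k a ha c hc)
    rw [h1, h2, h3]
    rcases zmod2_cases i with rfl | rfl <;> rcases zmod2_cases j with rfl | rfl <;>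
    rcases zmod2_cases k with rfl | rfl <;> simp [zmod2_one_add_one] <;> abel

end DGBV

end BV

/-! ### Formal super manifolds -/

section Formal

variable {K : Type u} [Field K] {V : Type v} [AddCommGroup V] [Module K V]
variable (𝒱 : ZMod 2 → Submodule K V)

/-- The space `∏ₙ Hom(Symⁿ V, K) = Hom(Sym V, K)` of formal power series on `V`, that is, of
functions on the formal neighbourhood of `0` in `V`. -/
def FormalFun : Type (max u v) := SSym 𝒱 →ₗ[K] K

namespace FormalFun

instance : AddCommGroup (FormalFun 𝒱) := inferInstanceAs (AddCommGroup (SSym 𝒱 →ₗ[K] K))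

instance : Module K (FormalFun 𝒱) := inferInstanceAs (Module K (SSym 𝒱 →ₗ[K] K))

/-- The topology of pointwise convergence, `K` being discrete. -/
instance : TopologicalSpace (FormalFun 𝒱) :=
  TopologicalSpace.induced (fun (f : SSym 𝒱 →ₗ[K] K) (x : SSym 𝒱) => f x)
    (@Pi.topologicalSpace (SSym 𝒱) (fun _ => K) (fun _ => ⊥))

variable {𝒱}

/-- A formal power series as a linear form on `Sym V`. -/
def toDual (f : FormalFun 𝒱) : SSym 𝒱 →ₗ[K] K := f

/-- The constant function `1`: the counit of `Sym V`. -/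
protected def one : FormalFun 𝒱 :=
  (SSym.lift 𝒱 (B := K) (0 : V →ₗ[K] K) (by simp)).toLinearMap

variable [DirectSum.Decomposition 𝒱]

/-- `f` is homogeneous of parity `i`. -/
def IsHom (i : ZMod 2) (f : FormalFun 𝒱) : Prop := ∀ x ∈ SSym.grading 𝒱 (i + 1), f.toDual x = 0

variable [CharZero K]

/-- The supercommutative product `(f g)(x) = ∑ (-1)^(|g||x'|) f(x') g(x'')`, dual to the
comultiplication `x ↦ ∑ x' ⊗ x''`. As `Sym V` is supercocommutative, this equals
`∑ g(x') f(x'')` without signs. -/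
protected def mul (f g : FormalFun 𝒱) : FormalFun 𝒱 :=
  LinearMap.mul' K K ∘ₗ TensorProduct.map g.toDual f.toDual ∘ₗ SSym.comul 𝒱

end FormalFun

variable {𝒱} [DirectSum.Decomposition 𝒱]

/-- The Chevalley–Eilenberg differential on `∏ₙ Hom(Symⁿ Π𝔤, K)`, up to a sign on each parity
component, which affects neither cocycles nor coboundaries. -/
def DGLie.ce (L : DGLie 𝒱) : FormalFun 𝒱 →ₗ[K] FormalFun 𝒱 :=
  LinearMap.lcomp K K L.Q

/-- The Lie algebra cohomology `H(𝔤, K)` with its subquotient topology: the functions on the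
moduli space `Mod(𝔤, d) = Spf H(𝔤, K)`. -/
abbrev DGLie.ModFun (L : DGLie 𝒱) : Type (max u v) := Coh L.ce

variable {W : Type w} [AddCommGroup W] [Module K W]

/-- An isomorphism of formal super manifolds from `Mod(𝔤, d) = Spf H(𝔤, K)` to the formal
neighbourhood of `0` in `W`: an isomorphism of topological superalgebras between the functions.
The product of `H(𝔤, K)` is induced by the product of cocycles. -/
structure FormalIso [CharZero K] (L : DGLie 𝒱) (𝒲 : ZMod 2 → Submodule K W)
    [DirectSum.Decomposition 𝒲] where
  pullback : FormalFun 𝒲 ≃L[K] L.ModFun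
  map_one : ∃ φ : LinearMap.ker L.ce,
    (φ : FormalFun 𝒱) = FormalFun.one ∧ pullback FormalFun.one = Coh.mk L.ce φ
  map_mul : ∀ f g : FormalFun 𝒲, ∀ φ ψ : LinearMap.ker L.ce,
    pullback f = Coh.mk L.ce φ → pullback g = Coh.mk L.ce ψ →
    ∃ χ : LinearMap.ker L.ce, (χ : FormalFun 𝒱) = FormalFun.mul (φ : FormalFun 𝒱) ψ ∧
      pullback (FormalFun.mul f g) = Coh.mk L.ce χ
  map_parity : ∀ i, ∀ f : FormalFun 𝒲, f.IsHom i → ∃ φ : LinearMap.ker L.ce,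
    (φ : FormalFun 𝒱).IsHom i ∧ pullback f = Coh.mk L.ce φ

/-- An `L_∞`-morphism of dg Lie algebras: a morphism of super coalgebras
`Sym(Π 𝔤) → Sym(Π 𝔥)` compatible with the codifferentials. `lin` is its linear part. -/
structure LInfHom [CharZero K] (L : DGLie 𝒱) {𝒲 : ZMod 2 → Submodule K W}
    [DirectSum.Decomposition 𝒲] (M : DGLie 𝒲) where
  toFun : SSym 𝒱 →ₗ[K] SSym 𝒲
  lin : V →ₗ[K] W
  map_par : ∀ x, toFun (SSym.par 𝒱 x) = SSym.par 𝒲 (toFun x)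
  map_one : toFun 1 = 1
  map_counit : FormalFun.one.toDual ∘ₗ toFun = FormalFun.one.toDual
  map_comul : SSym.comul 𝒲 ∘ₗ toFun = TensorProduct.map toFun toFun ∘ₗ SSym.comul 𝒱
  map_Q : ∀ x, toFun (L.Q x) = M.Q (toFun x)
  toFun_ι : ∀ v, toFun (SSym.ι 𝒱 v) = SSym.ι 𝒲 (lin v)

/-- The linear part induces a bijection on cohomology. -/
def LInfHom.IsQuasiIso [CharZero K] {L : DGLie 𝒱} {𝒲 : ZMod 2 → Submodule K W}
    [DirectSum.Decomposition 𝒲] {M : DGLie 𝒲} (F : LInfHom L M) : Prop :=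
  (∀ v, L.d v = 0 → (∃ w, F.lin v = M.d w) → ∃ v', v = L.d v') ∧
  (∀ w, M.d w = 0 → ∃ v, L.d v = 0 ∧ ∃ w', w = F.lin v + M.d w')

end Formal

/-! ### The formal parameter `u` -/

section FPS

/-- Formal power series `V[[u]]` with coefficients in a vector space. -/
def FPS (V : Type v) : Type v := ℕ → V

namespace FPS

/-- The coefficient of `u ^ n`. -/
def coeff {V : Type v} (n : ℕ) (f : FPS V) : V := f n

lemma ext {V : Type v} {f g : FPS V} (h : ∀ n, coeff n f = coeff n g) : f = g := funext h

variable {K : Type u} [Field K] {V : Type v} [AddCommGroup V] [Module K V]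

instance : AddCommGroup (FPS V) := inferInstanceAs (AddCommGroup (ℕ → V))

@[simp] lemma coeff_add (n : ℕ) (f g : FPS V) : coeff n (f + g) = coeff n f + coeff n g := rfl

@[simp] lemma coeff_zero (n : ℕ) : coeff n (0 : FPS V) = 0 := rfl

instance : SMul K⟦X⟧ (FPS V) where
  smul p f := fun n => ∑ x ∈ Finset.HasAntidiagonal.antidiagonal n, PowerSeries.coeff x.1 p • f x.2

lemma coeff_smul (n : ℕ) (p : K⟦X⟧) (f : FPS V) :
    coeff n (p • f) = ∑ x ∈ Finset.HasAntidiagonal.antidiagonal n, PowerSeries.coeff x.1 p • coeff x.2 f := rfl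

instance : Module K⟦X⟧ (FPS V) where
  one_smul f := by
    refine ext fun n => ?_
    rw [coeff_smul, Finset.sum_eq_single (0, n)]
    · simp
    · rintro ⟨a, b⟩ h h'
      have : a ≠ 0 := by rintro rfl; simp at h; simp [h] at h'
      simp [PowerSeries.coeff_one, this]
    · simp
  mul_smul p q f := by
    refine ext fun n => ?_
    simp only [coeff_smul, PowerSeries.coeff_mul, Finset.sum_smul, Finset.smul_sum,
      Finset.sum_sigma', smul_smul]
    refine Finset.sum_nbij' (fun ⟨⟨_, j⟩, ⟨k, l⟩⟩ => ⟨(k, l + j), (l, j)⟩)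
      (fun ⟨⟨i, _⟩, ⟨k, l⟩⟩ => ⟨(i + k, l), (i, k)⟩) ?_ ?_ ?_ ?_ ?_ <;>
      simp +contextual [add_assoc] <;>
      (try (rintro ⟨⟨a, b⟩, c, e⟩ h1 h2; dsimp only at h1 h2 ⊢; omega))
  smul_zero p := ext fun n => by simp [coeff_smul]
  smul_add p f g := ext fun n => by simp [coeff_smul, Finset.sum_add_distrib]
  add_smul p q f := ext fun n => by simp [coeff_smul, Finset.sum_add_distrib, add_smul]
  zero_smul f := ext fun n => by simp [coeff_smul]

/-- A linear map applied to each coefficient. -/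
def map (D : V →ₗ[K] V) : FPS V →ₗ[K⟦X⟧] FPS V where
  toFun f := fun n => D (coeff n f)
  map_add' f g := ext fun n => D.map_add _ _
  map_smul' p f := ext fun n => by
    change D (coeff n (p • f)) = ∑ x ∈ Finset.HasAntidiagonal.antidiagonal n, _ • D (coeff x.2 f)
    simp [coeff_smul]

end FPS

end FPS

section Degeneration

variable {K : Type u} [Field K] {A : Type v} [Ring A] [Algebra K A]
variable {𝒜 : ZMod 2 → Submodule K A} [GradedAlgebra 𝒜]

namespace DGBV

variable (𝓑 : DGBV 𝒜)

/-- The differential `d + u Δ` on `A[u]/(u ^ N)`. -/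
def diffMod (N : ℕ) :
    ((Polynomial K ⧸ Ideal.span {(Polynomial.X : Polynomial K) ^ N}) ⊗[K] A)
      →ₗ[Polynomial K ⧸ Ideal.span {(Polynomial.X : Polynomial K) ^ N}]
    ((Polynomial K ⧸ Ideal.span {(Polynomial.X : Polynomial K) ^ N}) ⊗[K] A) :=
  𝓑.d.baseChange _ + (Ideal.Quotient.mk _ Polynomial.X :
    Polynomial K ⧸ Ideal.span {(Polynomial.X : Polynomial K) ^ N}) • 𝓑.Δ.baseChange _

/-- `H(A[u]/(u ^ N), d + u Δ)` is a free `K[u]/(u ^ N)`-module for every `N ≥ 1`. -/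
def HasDegeneration : Prop :=
  ∀ N : ℕ, 1 ≤ N →
    Module.Free (Polynomial K ⧸ Ideal.span {(Polynomial.X : Polynomial K) ^ N})
      (Coh (𝓑.diffMod N))

/-- The differential `d + u Δ` on `A[[u]]`. -/
def diffU : FPS A →ₗ[K⟦X⟧] FPS A := FPS.map 𝓑.d + (PowerSeries.X : K⟦X⟧) • FPS.map 𝓑.Δ

/-- The cohomology `H(A, d)`; it is `Π H(𝔤, d)` for `𝔤 = Π A`. -/
abbrev H : Type v := Coh 𝓑.d

/-- The parity grading of `H(A, d)`. -/
abbrev HGrading : ZMod 2 → Submodule K 𝓑.H := cohGrading 𝒜 𝓑.d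

instance : DirectSum.Decomposition 𝓑.HGrading :=
  decompositionOfIsCompl _ (isCompl_cohGrading 𝒜 𝓑.d 𝓑.d_odd)

/-- A normalized degeneration isomorphism `T : H(A[[u]], d + u Δ) ≅ H(A, d)[[u]]`: an even
isomorphism of `K[[u]]`-modules with `T = id` at `u = 0`. Continuity for the `u`-adic topologies
is automatic from linearity over `K[[u]]`. -/
structure DegIso where
  toEquiv : Coh 𝓑.diffU ≃ₗ[K⟦X⟧] FPS 𝓑.H
  even : ∀ i, ∀ z : LinearMap.ker 𝓑.diffU, (∀ n, FPS.coeff n (z : FPS A) ∈ 𝒜 i) →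
    ∀ n, FPS.coeff n (toEquiv (Coh.mk 𝓑.diffU z)) ∈ 𝓑.HGrading i
  normalized : ∀ z : LinearMap.ker 𝓑.diffU, ∀ x : LinearMap.ker 𝓑.d,
    FPS.coeff 0 (z : FPS A) = x →
    FPS.coeff 0 (toEquiv (Coh.mk 𝓑.diffU z)) = Coh.mk 𝓑.d x

end DGBV

end Degeneration

/-! ### Families over parameter algebras -/

section Points

variable {K : Type u} [Field K]

/-- `(R, π)` is an augmented supercommutative algebra all of whose elements in the augmentation
ideal are nilpotent. If `R` is finite-dimensional, this says that `R` is a local Artinian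
superalgebra with residue field `K`. -/
structure IsParam {R : Type u} [Ring R] [Algebra K R] (ℛ : ZMod 2 → Submodule K R)
    (π : R →ₐ[K] K) : Prop where
  supercomm : ∀ i j, ∀ r ∈ ℛ i, ∀ s ∈ ℛ j, r * s = (-1 : ℤˣ) ^ (i * j) • (s * r)
  nilpotent : ∀ r, π r = 0 → IsNilpotent r

variable {R : Type u} [Ring R] [Algebra K R]

/-- The `R`-points `(V ⊗ 𝔪)^even` of the formal neighbourhood of `0` in `V`, `𝔪 = ker π`. -/
def points {V : Type v} [AddCommGroup V] [Module K V] (𝒱 : ZMod 2 → Submodule K V)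
    (ℛ : ZMod 2 → Submodule K R) (π : R →ₐ[K] K) : Submodule K (V ⊗[K] R) :=
  Submodule.span K {x | ∃ i, ∃ v ∈ 𝒱 i, ∃ r ∈ ℛ i, π r = 0 ∧ x = v ⊗ₜ[K] r}

/-- The coordinate `v ⊗ r ↦ ℓ(r) v` of an element of `V ⊗ R`. -/
def slice {V : Type v} [AddCommGroup V] [Module K V] (ℓ : R →ₗ[K] K) : V ⊗[K] R →ₗ[K] V :=
  (TensorProduct.rid K V).toLinearMap ∘ₗ ℓ.lTensor V

variable (ℛ : ZMod 2 → Submodule K R) [GradedAlgebra ℛ]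

/-- The value `f(a) = ∑ₙ fₙ(aⁿ) / n!` in `R` of a formal power series at an `R`-point `a`. -/
def evalAt [CharZero K] {V : Type v} [AddCommGroup V] [Module K V]
    {𝒱 : ZMod 2 → Submodule K V} [DirectSum.Decomposition 𝒱] (f : FormalFun 𝒱)
    (a : V ⊗[K] R) : R :=
  let x : GradedTensorProduct K (SSym.grading 𝒱) ℛ :=
    GradedTensorProduct.of K _ _ ((SSym.ι 𝒱).rTensor R a)
  TensorProduct.lid K R (f.toDual.rTensor R ((GradedTensorProduct.of K _ _).symm
    (∑ n ∈ Finset.range (nilpotencyClass x), (n.factorial : K)⁻¹ • x ^ n)))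

end Points

section Lifts

variable {K : Type u} [Field K] {A : Type v} [Ring A] [Algebra K A]
variable {𝒜 : ZMod 2 → Submodule K A} [GradedAlgebra 𝒜]
variable {R : Type u} [Ring R] [Algebra K R] (ℛ : ZMod 2 → Submodule K R) [GradedAlgebra ℛ]

/-- The `R`-linear extension of an operator on `A` to the superalgebra `A ⊗ R`. -/
def extOp (D : A →ₗ[K] A) : GradedTensorProduct K 𝒜 ℛ →ₗ[K] GradedTensorProduct K 𝒜 ℛ :=
  (GradedTensorProduct.of K 𝒜 ℛ).toLinearMap ∘ₗ D.rTensor R ∘ₗ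
    (GradedTensorProduct.of K 𝒜 ℛ).symm.toLinearMap

/-- The same on `(A ⊗ R)[[u]]`, coefficientwise. -/
def extU (D : A →ₗ[K] A) (x : PowerSeries (GradedTensorProduct K 𝒜 ℛ)) :
    PowerSeries (GradedTensorProduct K 𝒜 ℛ) :=
  PowerSeries.mk fun n => extOp ℛ D (PowerSeries.coeff n x)

namespace DGBV

variable (𝓑 : DGBV 𝒜)

/-- The Maurer–Cartan equation `d a + ½[a, a] = 0` for even `a ∈ A ⊗ R`, where
`[a, a] = Δ(a²) - Δ(a) a - a Δ(a)`. -/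
def IsMC (a : GradedTensorProduct K 𝒜 ℛ) : Prop :=
  extOp ℛ 𝓑.d a
    + (2⁻¹ : K) • (extOp ℛ 𝓑.Δ (a * a) - extOp ℛ 𝓑.Δ a * a - a * extOp ℛ 𝓑.Δ a) = 0

/-- The Maurer–Cartan equation `(d + u Δ) a + ½[a, a] = 0` for even `a ∈ (A ⊗ R)[[u]]`. -/
def IsMCU (a : PowerSeries (GradedTensorProduct K 𝒜 ℛ)) : Prop :=
  extU ℛ 𝓑.d a + PowerSeries.X * extU ℛ 𝓑.Δ a
    + (2⁻¹ : K) • (extU ℛ 𝓑.Δ (a * a) - extU ℛ 𝓑.Δ a * a - a * extU ℛ 𝓑.Δ a) = 0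

variable {ℛ}

/-- `u ^ N • u (exp(a / u) - 1) = ∑_{n = 1}^N u ^ (N + 1 - n) a ^ n / n!`, if `a ^ (N + 1) = 0`. -/
def expU (N : ℕ) (a : PowerSeries (GradedTensorProduct K 𝒜 ℛ)) :
    PowerSeries (GradedTensorProduct K 𝒜 ℛ) :=
  ∑ n ∈ Finset.range N, ((n + 1).factorial : K)⁻¹ • (PowerSeries.X ^ (N - n) * a ^ (n + 1))

/-- `a'` is a lift over `K[[u]]` of the Maurer–Cartan element `a` such that the class
`T[u (exp(a' / u) - 1)]` lies in `H(A, d)[u⁻¹] ⊗ R`, and `h` is the value of this class at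
`u = ∞`, that is, its coefficient at `u ^ 0`. -/
structure IsLift (T : 𝓑.DegIso) (π : R →ₐ[K] K) (a : A ⊗[K] R)
    (a' : PowerSeries (GradedTensorProduct K 𝒜 ℛ)) (h : 𝓑.H ⊗[K] R) : Prop where
  mem : ∀ n, (GradedTensorProduct.of K 𝒜 ℛ).symm (PowerSeries.coeff n a') ∈ points 𝒜 ℛ π
  mc : 𝓑.IsMCU ℛ a'
  reduction : PowerSeries.coeff 0 a' = GradedTensorProduct.of K 𝒜 ℛ a
  value_mem : h ∈ points 𝓑.HGrading ℛ π
  value : ∃ N : ℕ, a' ^ (N + 1) = 0 ∧ ∀ ℓ : R →ₗ[K] K, ∃ z : LinearMap.ker 𝓑.diffU,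
    (∀ n, FPS.coeff n (z : FPS A)
      = slice ℓ ((GradedTensorProduct.of K 𝒜 ℛ).symm (PowerSeries.coeff n (expU N a')))) ∧
    (∀ n, N < n → FPS.coeff n (T.toEquiv (Coh.mk 𝓑.diffU z)) = 0) ∧
    FPS.coeff N (T.toEquiv (Coh.mk 𝓑.diffU z)) = slice ℓ h

/-- Formal arcs `a(ε)` are the compatible systems of families over `R = K[ε]/(ε ^ n)`; families with
odd parameters are needed to see the odd directions of the moduli space.
`Φ` sends every Maurer–Cartan family `a`, over every parameter algebra `R`, to the value at
`u = ∞` of `T[u (exp(a' / u) - 1)]`, for any lift `a'` as in `IsLift`; such lifts exist. -/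
def IsCompatible [CharZero K] (T : 𝓑.DegIso) (Φ : FormalIso 𝓑.toDGLie 𝓑.HGrading) : Prop :=
  ∀ (R : Type u) [Ring R] [Algebra K R] [Module.Finite K R] (ℛ : ZMod 2 → Submodule K R)
    [GradedAlgebra ℛ] (π : R →ₐ[K] K), IsParam ℛ π →
    ∀ a ∈ points 𝒜 ℛ π, 𝓑.IsMC ℛ (GradedTensorProduct.of K 𝒜 ℛ a) →
      (∃ a' h, 𝓑.IsLift (ℛ := ℛ) T π a a' h) ∧
      ∀ a' h, 𝓑.IsLift (ℛ := ℛ) T π a a' h →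
        ∀ (f : FormalFun 𝓑.HGrading) (φ : LinearMap.ker 𝓑.toDGLie.ce),
          Φ.pullback f = Coh.mk 𝓑.toDGLie.ce φ →
            evalAt ℛ (φ : FormalFun 𝒜) a = evalAt ℛ f h

end DGBV

end Lifts

end BVModuli

end

/-!
Let `V` be a super vector space and `R` a parameter algebra with maximal ideal `𝔪`. An even element
`a` of `V ⊗ 𝔪` is recorded by the group-like element `exp(a)` of `Sym V ⊗ R` (`gexp`), and the value
at `a` of a linear map on `Sym V` is its value at `exp(a)` (`evl`). Morphisms of coalgebras preserve
group-like elements (`IsCoalgMap.evl_eq`), and `a` satisfies the Maurer–Cartan equation of a dg Lie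
algebra exactly when the Chevalley–Eilenberg codifferential annihilates `exp(a)`
(`DGLie.evl_Q_eq_zero_iff`, `DGBV.isMC_iff`). This turns statements about Maurer–Cartan elements and
formal power series into statements about the coalgebra `Sym V`. Coalgebra morphisms into `Sym W`
are the convolution exponentials of their corestrictions to `W` (`isCoalgMap_cexp`), so that they
are easy to construct and to compare.

*Sections.* Degeneration makes every obstruction to prolonging a `d`-cocycle to a
`(d + uΔ)`-cocycle of `A⟦u⟧` vanish (`DGBV.exists_prolongation`). Together with a contraction of `A`
onto its cohomology (`exists_isContraction`) this gives a section `s` of the reduction `A⟦u⟧ → A` at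
`u = 0` that intertwines `d` with `d + uΔ` (`DGBV.exists_isSection`). For a given degeneration
isomorphism `T`, the section can be chosen adapted to `T`: the series `T[s z]` is the constant `[z]`
for every cocycle `z` (`DGBV.DegIso.exists_isAdapted`).

*Linearization.* Up to powers of `u`, the exponential `u (exp(a / u) - 1)` takes the Maurer–Cartan
equation of `(A⟦u⟧, d + uΔ)` to the linear equation `(d + uΔ) b = 0`, but it involves negative powers
of `u`. The operator `ρ(p) = (p - s(p₀)) / u` commutes with `d + uΔ` and stays in `A⟦u⟧`; using it
instead of division by `u` gives the Taylor coefficients `∑ₙ ρⁿ(a₁ ⋯ aₙ₊₁)` (`linCoeff`). The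
contributions of the bracket telescope (`linCoeff_Q`), so that these are the Taylor coefficients of an
`L_∞`-isomorphism from the dg Lie algebra `A⟦u⟧` to the complex `(A⟦u⟧, d + uΔ)` with the zero bracket
(`linearize_Q`). The section, followed by the inverse of this linearization and by the reduction at
`u = 0`, is an `L_∞`-isomorphism from `(A, d)` with the zero bracket to the dg Lie algebra `A`
(`abelianize`). Composed with the contraction onto the cohomology it becomes the
quasi-isomorphism `model` from `H(A, d)` (`exists_lInfHom`); since the Chevalley–Eilenberg complex of
an abelian dg Lie algebra retracts onto the functions on its cohomology (`exists_primitive`), pullback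
along `model` identifies the moduli space with the formal neighbourhood of `0` in `H(A, d)`
(`exists_formalIso`).

*Lifts.* Let `s` be adapted to `T`. For a large `N` the operator `ρ ^ N` takes
`u ^ N • u (exp(a / u) - 1)` to the linearization of `a` (`rho_pow_evl_expCoeff`), whereas on
`T`-classes `ρ` drops the constant term and divides by `u` (`val_rho_pow`). Hence the coefficients of
`T[u (exp(ã / u) - 1)]` at `uⁿ`, `n ≥ 0`, are those of the `T`-class of the linearization of `ã`. If
those with `n > 0` vanish, the linearization is cohomologous to `s` applied to the harmonic
representative of the coefficient at `u ^ 0`, and therefore every function on the moduli space takes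
at `a` the value that it takes at this coefficient in the coordinates given by `model`
(`IsLift.evl_eq`). Applying the inverse of the linearization to the section produces lifts of all
Maurer–Cartan elements (`exists_isLift`).

*Uniqueness.* Every point of `H(A, d)` is the value at `u = ∞` for a Maurer–Cartan element, so a
compatible isomorphism is determined by its values at points. A linear form on `Sym V` that vanishes
at all points is zero: points with values in exterior algebras, whose coordinates are independent
square-zero parameters, detect every word (`eq_zero_of_evl`).
-/

noncomputable section

namespace BVModuli

universe u v w

set_option linter.unusedSectionVars false

/-! ### Signs and homogeneous induction -/

section Twist

variable {K : Type u} [Field K] {V : Type v} [AddCommGroup V] [Module K V]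
variable (𝒱 : ZMod 2 → Submodule K V) [DirectSum.Decomposition 𝒱]
variable {W : Type w} [AddCommGroup W] [Module K W]
variable (𝒲 : ZMod 2 → Submodule K W) [DirectSum.Decomposition 𝒲]

/-- The operator `v ↦ (-1)^(i |v|) v`, the Koszul sign for moving a symbol of parity `i` past `v`. -/
def twist (i : ZMod 2) : V →ₗ[K] V := if i = 0 then LinearMap.id else parity 𝒱

lemma twist_zero : twist 𝒱 0 = LinearMap.id := by simp [twist]

lemma twist_one : twist 𝒱 1 = parity 𝒱 := by simp [twist]

lemma twist_mem {i j : ZMod 2} {v : V} (hv : v ∈ 𝒱 j) :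
    twist 𝒱 i v = (-1 : ℤˣ) ^ (i * j) • v := by
  rcases zmod2_cases i with rfl | rfl
  · simp [twist_zero]
  · rw [twist_one, parity_mem 𝒱 hv, one_mul]

lemma sign_smul_mem {i j : ZMod 2} {v : V} (hv : v ∈ 𝒱 j) : (-1 : ℤˣ) ^ i • v ∈ 𝒱 j := by
  rcases Int.units_eq_one_or ((-1 : ℤˣ) ^ i) with e | e <;> simpa [e] using hv

/-- Linear maps agree when they agree on homogeneous vectors. -/
lemma hom_ext_homogeneous {M : Type*} [AddCommGroup M] [Module K M] {f g : V →ₗ[K] M}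
    (h : ∀ i, ∀ v ∈ 𝒱 i, f v = g v) : f = g :=
  LinearMap.ext fun v => homogeneous_induction 𝒱 (P := fun v => f v = g v)
    (fun v w hv hw => by rw [map_add, map_add, hv, hw]) h v

/-- Linear maps on a tensor product agree when they agree on homogeneous pure tensors. -/
lemma tensor_hom_ext {M : Type*} [AddCommGroup M] [Module K M] {f g : V ⊗[K] W →ₗ[K] M}
    (h : ∀ i j, ∀ v ∈ 𝒱 i, ∀ w ∈ 𝒲 j, f (v ⊗ₜ w) = g (v ⊗ₜ w)) : f = g := by
  refine TensorProduct.ext (hom_ext_homogeneous 𝒱 fun i v hv =>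
    hom_ext_homogeneous 𝒲 fun j w hw => ?_)
  exact h i j v hv w hw

lemma twist_twist (i : ZMod 2) : twist 𝒱 i ∘ₗ twist 𝒱 i = LinearMap.id :=
  hom_ext_homogeneous 𝒱 fun j v hv => by
    rw [LinearMap.comp_apply, twist_mem 𝒱 hv, LinearMap.map_smul_of_tower, twist_mem 𝒱 hv,
      smul_smul, Int.units_mul_self, one_smul, LinearMap.id_apply]

variable {𝒱 𝒲} in
/-- A linear map shifting parities by `j`. -/
def HasParity (𝒱 : ZMod 2 → Submodule K V) (𝒲 : ZMod 2 → Submodule K W) (j : ZMod 2)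
    (f : V →ₗ[K] W) : Prop := ∀ i, ∀ v ∈ 𝒱 i, f v ∈ 𝒲 (i + j)

variable {𝒱 𝒲} in
/-- An even linear map. -/
def IsEven (𝒱 : ZMod 2 → Submodule K V) (𝒲 : ZMod 2 → Submodule K W)
    (f : V →ₗ[K] W) : Prop := ∀ i, ∀ v ∈ 𝒱 i, f v ∈ 𝒲 i

variable {𝒱 𝒲}

lemma IsEven.comp {X : Type*} [AddCommGroup X] [Module K X] {𝒳 : ZMod 2 → Submodule K X}
    {g : W →ₗ[K] X} {f : V →ₗ[K] W} (hg : IsEven 𝒲 𝒳 g) (hf : IsEven 𝒱 𝒲 f) :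
    IsEven 𝒱 𝒳 (g ∘ₗ f) := fun i v hv => hg i _ (hf i v hv)

lemma IsEven.comp_hasParity {X : Type*} [AddCommGroup X] [Module K X]
    {𝒳 : ZMod 2 → Submodule K X}
    {g : W →ₗ[K] X} {f : V →ₗ[K] W} {j : ZMod 2} (hg : IsEven 𝒲 𝒳 g) (hf : HasParity 𝒱 𝒲 j f) :
    HasParity 𝒱 𝒳 j (g ∘ₗ f) := fun i v hv => hg _ _ (hf i v hv)

lemma IsEven.twist_comp {f : V →ₗ[K] W} (hf : IsEven 𝒱 𝒲 f) (i : ZMod 2) :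
    twist 𝒲 i ∘ₗ f = f ∘ₗ twist 𝒱 i :=
  hom_ext_homogeneous 𝒱 fun j v hv => by
    rw [LinearMap.comp_apply, LinearMap.comp_apply, twist_mem 𝒱 hv, twist_mem 𝒲 (hf j v hv),
      LinearMap.map_smul_of_tower]

lemma IsEven.twist_apply {f : V →ₗ[K] W} (hf : IsEven 𝒱 𝒲 f) (i : ZMod 2) (v : V) :
    twist 𝒲 i (f v) = f (twist 𝒱 i v) := LinearMap.congr_fun (hf.twist_comp i) v

lemma IsEven.parity_apply {f : V →ₗ[K] W} (hf : IsEven 𝒱 𝒲 f) (v : V) :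
    parity 𝒲 (f v) = f (parity 𝒱 v) := by
  rw [← twist_one, ← twist_one, hf.twist_apply]

lemma map_sign_smul_left {M N P Q : Type*} [AddCommGroup M] [Module K M] [AddCommGroup N]
    [Module K N] [AddCommGroup P] [Module K P] [AddCommGroup Q] [Module K Q]
    (s : ℤˣ) (f : M →ₗ[K] P) (g : N →ₗ[K] Q) :
    TensorProduct.map (s • f) g = s • TensorProduct.map f g := by
  rcases Int.units_eq_one_or s with rfl | rfl
  · simp
  · ext; simp [TensorProduct.neg_tmul]

lemma map_sign_smul_right {M N P Q : Type*} [AddCommGroup M] [Module K M] [AddCommGroup N]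
    [Module K N] [AddCommGroup P] [Module K P] [AddCommGroup Q] [Module K Q]
    (s : ℤˣ) (f : M →ₗ[K] P) (g : N →ₗ[K] Q) :
    TensorProduct.map f (s • g) = s • TensorProduct.map f g := by
  rcases Int.units_eq_one_or s with rfl | rfl
  · simp
  · ext; simp [TensorProduct.tmul_neg]

lemma sign_smul_tmul {M N : Type*} [AddCommGroup M] [Module K M] [AddCommGroup N]
    [Module K N] (s : ℤˣ) (m : M) (n : N) : (s • m) ⊗ₜ[K] n = s • (m ⊗ₜ[K] n) := by
  rcases Int.units_eq_one_or s with rfl | rfl <;> simp [TensorProduct.neg_tmul]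

lemma tmul_sign_smul {M N : Type*} [AddCommGroup M] [Module K M] [AddCommGroup N]
    [Module K N] (s : ℤˣ) (m : M) (n : N) : m ⊗ₜ[K] (s • n) = s • (m ⊗ₜ[K] n) := by
  rcases Int.units_eq_one_or s with rfl | rfl <;> simp [TensorProduct.tmul_neg]

lemma sign_smul_apply {M N : Type*} [AddCommGroup M] [Module K M] [AddCommGroup N]
    [Module K N] (s : ℤˣ) (f : M →ₗ[K] N) (m : M) : (s • f) m = s • f m := rfl

end Twist

/-! ### The supersymmetric algebra as a cocommutative coalgebra -/

namespace SSym

section Basic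

variable {K : Type u} [Field K] {V : Type v} [AddCommGroup V] [Module K V]
variable (𝒱 : ZMod 2 → Submodule K V)

/-- The augmentation of `Sym V`, which is the counit. -/
def eps : SSym 𝒱 →ₐ[K] K := lift 𝒱 (B := K) (0 : V →ₗ[K] K) (by simp)

@[simp] lemma eps_ι (v : V) : eps 𝒱 (ι 𝒱 v) = 0 := by simp [eps]

/-- Multiplication by `v` on `Sym V` modulo products of two vectors, that is, on `K ⊕ V`. -/
def tauStep : V →ₗ[K] Module.End K (K × V) :=
  LinearMap.mk₂ K (fun v s => (0, s.1 • v)) (by intros; simp) (by intro c v s; simp [smul_comm s.1 c v])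
    (by intros; simp [add_smul]) (by intros; simp [mul_smul])

lemma tauStep_apply (v : V) (s : K × V) : tauStep (K := K) v s = (0, s.1 • v) := rfl

/-- The action of `Sym V` on `K ⊕ V`. -/
def tauAlg : SSym 𝒱 →ₐ[K] Module.End K (K × V) :=
  lift 𝒱 (B := Module.End K (K × V)) tauStep (by
    intro i j v _ w _
    refine LinearMap.ext fun s => ?_
    have h : ∀ v w : V, (tauStep (K := K) v * tauStep w) = 0 := by
      intro v w; refine LinearMap.ext fun s => ?_
      rw [Module.End.mul_apply, tauStep_apply, tauStep_apply, zero_smul]; rfl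
    rw [h, h, smul_zero])

/-- The projection `Sym V → Sym¹ V = V`. -/
def tau : SSym 𝒱 →ₗ[K] V :=
  LinearMap.snd K _ _ ∘ₗ LinearMap.applyₗ ((1, 0) : K × V) ∘ₗ (tauAlg 𝒱).toLinearMap

lemma tauAlg_fst (x : SSym 𝒱) (s : K × V) : (tauAlg 𝒱 x s).1 = eps 𝒱 x * s.1 := by
  revert s
  refine SSym.induction 𝒱 (P := fun x => ∀ s, (tauAlg 𝒱 x s).1 = eps 𝒱 x * s.1) ?_ ?_ ?_ ?_ x
  · intro c s; simp [Module.algebraMap_end_apply]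
  · intro v s; rw [tauAlg, lift_ι]; simp [tauStep_apply]
  · intro x y hx hy s; rw [map_mul, Module.End.mul_apply, hx, hy, map_mul, mul_assoc]
  · intro x y hx hy s; rw [map_add, LinearMap.add_apply, Prod.fst_add, hx, hy, map_add, add_mul]

lemma tau_one : tau 𝒱 1 = 0 := by simp [tau]

lemma tau_ι_mul (v : V) (x : SSym 𝒱) : tau 𝒱 (ι 𝒱 v * x) = eps 𝒱 x • v := by
  have h : tau 𝒱 (ι 𝒱 v * x) = (tauAlg 𝒱 (ι 𝒱 v * x) (1, 0)).2 := rfl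
  rw [h, map_mul, Module.End.mul_apply]
  have h2 : tauAlg 𝒱 (ι 𝒱 v) = tauStep v := by rw [tauAlg, lift_ι]
  rw [h2, tauStep_apply, tauAlg_fst, mul_one]

@[simp] lemma tau_ι (v : V) : tau 𝒱 (ι 𝒱 v) = v := by
  have := tau_ι_mul 𝒱 v 1
  rwa [mul_one, map_one, one_smul] at this

variable [DirectSum.Decomposition 𝒱]

/-- Induction over products of homogeneous vectors. -/
lemma word_induction {P : SSym 𝒱 → Prop} (one : P 1) (smul : ∀ (c : K) x, P x → P (c • x))
    (add : ∀ x y, P x → P y → P (x + y))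
    (ι_mul : ∀ i, ∀ v ∈ 𝒱 i, ∀ x, P x → P (ι 𝒱 v * x)) (x : SSym 𝒱) : P x := by
  suffices h : ∀ y, P y → P (x * y) by simpa using h 1 one
  refine SSym.induction 𝒱 (P := fun x => ∀ y, P y → P (x * y)) ?_ ?_ ?_ ?_ x
  · intro c y hy; rw [← Algebra.smul_def]; exact smul c y hy
  · intro v y hy
    refine homogeneous_induction 𝒱 (P := fun v => P (ι 𝒱 v * y)) ?_ (fun i v hv => ι_mul i v hv y hy) v
    intro v w hv hw; rw [map_add, add_mul]; exact add _ _ hv hw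
  · intro x x' hx hx' y hy; rw [mul_assoc]; exact hx _ (hx' _ hy)
  · intro x x' hx hx' y hy; rw [add_mul]; exact add _ _ (hx _ hy) (hx' _ hy)

lemma lin_ext {M : Type*} [AddCommGroup M] [Module K M] {f g : SSym 𝒱 →ₗ[K] M} (h1 : f 1 = g 1)
    (h : ∀ i, ∀ v ∈ 𝒱 i, ∀ x, f x = g x → f (ι 𝒱 v * x) = g (ι 𝒱 v * x)) : f = g :=
  LinearMap.ext fun x => word_induction 𝒱 (P := fun x => f x = g x) h1
    (fun c x hx => by rw [map_smul, map_smul, hx]) (fun x y hx hy => by rw [map_add, map_add, hx, hy])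
    h x

/-- Multiplication by `v` on the left. -/
abbrev lmul (v : V) : SSym 𝒱 →ₗ[K] SSym 𝒱 := LinearMap.mulLeft K (ι 𝒱 v)

variable [CharZero K]

lemma parity_grading (x : SSym 𝒱) : parity (grading 𝒱) x = par 𝒱 x := by
  refine homogeneous_induction (grading 𝒱) (P := fun x => parity (grading 𝒱) x = par 𝒱 x) ?_ ?_ x
  · intro x y hx hy; rw [map_add, map_add, hx, hy]
  · intro i x hx; rw [parity_mem _ hx, (mem_grading 𝒱).1 hx]

lemma twist_mul (i : ZMod 2) (x y : SSym 𝒱) :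
    twist (grading 𝒱) i (x * y) = twist (grading 𝒱) i x * twist (grading 𝒱) i y := by
  rcases zmod2_cases i with rfl | rfl
  · simp [twist_zero]
  · simp [twist_one, parity_grading]

lemma twist_grading_one (i : ZMod 2) : twist (grading 𝒱) i (1 : SSym 𝒱) = 1 := by
  rcases zmod2_cases i with rfl | rfl
  · simp [twist_zero]
  · simp [twist_one, parity_grading]

lemma twist_ι {i j : ZMod 2} {v : V} (hv : v ∈ 𝒱 j) :
    twist (grading 𝒱) i (ι 𝒱 v) = (-1 : ℤˣ) ^ (i * j) • ι 𝒱 v := twist_mem _ (ι_mem 𝒱 hv)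

lemma eps_twist (i : ZMod 2) (x : SSym 𝒱) : eps 𝒱 (twist (grading 𝒱) i x) = eps 𝒱 x := by
  refine LinearMap.congr_fun (f := (eps 𝒱).toLinearMap ∘ₗ twist (grading 𝒱) i)
    (g := (eps 𝒱).toLinearMap) (lin_ext 𝒱 ?_ ?_) x
  · simp [twist_grading_one]
  · intro j v hv x _
    simp only [LinearMap.comp_apply, AlgHom.toLinearMap_apply, twist_mul, map_mul, twist_ι 𝒱 hv]
    rcases Int.units_eq_one_or ((-1 : ℤˣ) ^ (i * j)) with e | e <;> simp [e]

lemma eps_odd {x : SSym 𝒱} (hx : x ∈ grading 𝒱 1) : eps 𝒱 x = 0 := by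
  have h := eps_twist 𝒱 1 x
  rw [twist_mem _ hx] at h
  simp only [mul_one, uzpow_one, Units.neg_smul, one_smul, map_neg] at h
  exact self_eq_neg.1 h.symm

lemma isEven_ι : IsEven 𝒱 (grading 𝒱) (ι 𝒱) := fun _ _ hv => ι_mem 𝒱 hv

lemma tau_twist (i : ZMod 2) (x : SSym 𝒱) :
    tau 𝒱 (twist (grading 𝒱) i x) = twist 𝒱 i (tau 𝒱 x) := by
  refine LinearMap.congr_fun (f := tau 𝒱 ∘ₗ twist (grading 𝒱) i)
    (g := twist 𝒱 i ∘ₗ tau 𝒱) (lin_ext 𝒱 ?_ ?_) x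
  · simp [twist_grading_one, tau_one]
  · intro j v hv x _
    simp only [LinearMap.comp_apply, twist_mul, twist_ι 𝒱 hv, smul_mul_assoc,
      LinearMap.map_smul_of_tower, tau_ι_mul, eps_twist, twist_mem 𝒱 hv, map_smul]
    rw [smul_comm]

lemma isEven_tau : IsEven (grading 𝒱) 𝒱 (tau 𝒱) := by
  intro i x hx
  have h := tau_twist 𝒱 1 x
  rw [twist_mem _ hx, one_mul, LinearMap.map_smul_of_tower, twist_one] at h
  rw [← comp_add 𝒱 (tau 𝒱 x)] at h ⊢
  have h0 := comp_mem 𝒱 0 (tau 𝒱 x)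
  have h1 := comp_mem 𝒱 1 (tau 𝒱 x)
  have two : ∀ {y : V}, y = -y → y = 0 := fun {y} hy => by
    have : (2 : K) • y = 0 := by rw [two_smul]; nth_rw 1 [hy]; simp
    exact (smul_eq_zero.1 this).resolve_left two_ne_zero
  rw [map_add, parity_mem 𝒱 h0, parity_mem 𝒱 h1] at h
  rcases zmod2_cases i with rfl | rfl
  · simp only [uzpow_zero, one_smul, uzpow_one, Units.neg_smul, add_right_inj] at h
    rw [two h, add_zero]; exact h0
  · simp only [uzpow_zero, one_smul, uzpow_one, Units.neg_smul, neg_add, add_left_inj] at h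
    rw [two h.symm, zero_add]; exact h1

lemma mul_ι {j : ZMod 2} {w : V} (hw : w ∈ 𝒱 j) (x : SSym 𝒱) :
    x * ι 𝒱 w = ι 𝒱 w * twist (grading 𝒱) j x := by
  refine LinearMap.congr_fun (f := LinearMap.mulRight K (ι 𝒱 w))
    (g := LinearMap.mulLeft K (ι 𝒱 w) ∘ₗ twist (grading 𝒱) j) (lin_ext 𝒱 ?_ ?_) x
  · simp [twist_grading_one]
  · intro i v hv x hx
    simp only [LinearMap.mulRight_apply, LinearMap.comp_apply, LinearMap.mulLeft_apply] at hx ⊢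
    rw [mul_assoc, hx, twist_mul, twist_ι 𝒱 hv, ← mul_assoc, ι_comm 𝒱 hv hw, smul_mul_assoc,
      mul_assoc, smul_mul_assoc, mul_smul_comm, mul_comm i j]

/-- `Sym V` is supercommutative. -/
lemma supercomm (i j : ZMod 2) (x : SSym 𝒱) (hx : x ∈ grading 𝒱 i) (y : SSym 𝒱)
    (hy : y ∈ grading 𝒱 j) : x * y = (-1 : ℤˣ) ^ (i * j) • (y * x) := by
  suffices h : x * y = twist (grading 𝒱) i y * x by
    rw [h, twist_mem _ hy, smul_mul_assoc]
  clear hy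
  refine LinearMap.congr_fun (f := LinearMap.mulLeft K x)
    (g := LinearMap.mulRight K x ∘ₗ twist (grading 𝒱) i) (lin_ext 𝒱 ?_ ?_) y
  · simp [twist_grading_one]
  · intro k v hv y hy
    simp only [LinearMap.mulRight_apply, LinearMap.comp_apply, LinearMap.mulLeft_apply] at hy ⊢
    rw [← mul_assoc, mul_ι 𝒱 hv, twist_mem _ hx, twist_mul, twist_ι 𝒱 hv, mul_assoc (_ • _), ← hy,
      mul_smul_comm, smul_mul_assoc, smul_mul_assoc, mul_assoc, mul_comm i k]

/-! ### The comultiplication -/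

lemma comul_one : comul 𝒱 1 = 1 ⊗ₜ 1 := by
  simp only [comul, LinearMap.comp_apply, AlgHom.toLinearMap_apply, map_one]; rfl

lemma comul_lmul {i : ZMod 2} {v : V} (hv : v ∈ 𝒱 i) :
    comul 𝒱 ∘ₗ lmul 𝒱 v = (TensorProduct.map (lmul 𝒱 v) LinearMap.id
      + TensorProduct.map (twist (grading 𝒱) i) (lmul 𝒱 v)) ∘ₗ comul 𝒱 := by
  refine LinearMap.ext fun x => ?_
  have h : comulAlg 𝒱 (ι 𝒱 v) =
      GradedTensorProduct.includeLeft (grading 𝒱) (grading 𝒱) (ι 𝒱 v) +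
      GradedTensorProduct.includeRight (grading 𝒱) (grading 𝒱) (ι 𝒱 v) := by
    rw [comulAlg, lift_ι]; rfl
  simp only [LinearMap.comp_apply, comul, LinearMap.mulLeft_apply, AlgHom.toLinearMap_apply,
    map_mul, h, LinearEquiv.coe_coe, LinearMap.add_apply]
  generalize comulAlg 𝒱 x = y
  obtain ⟨y, rfl⟩ := (GradedTensorProduct.of K (grading 𝒱) (grading 𝒱)).surjective y
  refine LinearMap.congr_fun (f := (GradedTensorProduct.of K (grading 𝒱) (grading 𝒱)).symm.toLinearMap ∘ₗ
    LinearMap.mulLeft K (GradedTensorProduct.includeLeft (grading 𝒱) (grading 𝒱) (ι 𝒱 v) +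
      GradedTensorProduct.includeRight (grading 𝒱) (grading 𝒱) (ι 𝒱 v)) ∘ₗ
    (GradedTensorProduct.of K (grading 𝒱) (grading 𝒱)).toLinearMap)
    (g := TensorProduct.map (lmul 𝒱 v) LinearMap.id
      + TensorProduct.map (twist (grading 𝒱) i) (lmul 𝒱 v)) ?_ y
  refine tensor_hom_ext (grading 𝒱) (grading 𝒱) fun a b p hp q hq => ?_
  have h1 := GradedTensorProduct.tmul_coe_mul_coe_tmul (R := K) (grading 𝒱) (grading 𝒱)
        (ι 𝒱 v) ⟨1, SetLike.one_mem_graded (grading 𝒱)⟩ ⟨p, hp⟩ q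
  have h2 := GradedTensorProduct.tmul_coe_mul_coe_tmul (R := K) (grading 𝒱) (grading 𝒱)
        1 ⟨ι 𝒱 v, ι_mem 𝒱 hv⟩ ⟨p, hp⟩ q
  simp only [LinearMap.comp_apply, LinearEquiv.coe_coe, LinearMap.mulLeft_apply, add_mul, map_add,
    LinearMap.add_apply, TensorProduct.map_tmul, LinearMap.id_apply,
    GradedTensorProduct.includeLeft_apply, GradedTensorProduct.includeRight_apply]
  congr 1
  · simpa using congrArg (GradedTensorProduct.of K (grading 𝒱) (grading 𝒱)).symm h1
  · refine (congrArg (GradedTensorProduct.of K (grading 𝒱) (grading 𝒱)).symm h2).trans ?_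
    rw [twist_mem _ hp, one_mul]
    rcases Int.units_eq_one_or ((-1 : ℤˣ) ^ (i * a)) with e | e <;>
      simp [e, TensorProduct.neg_tmul, GradedTensorProduct.tmul]

lemma comul_ι_mul {i : ZMod 2} {v : V} (hv : v ∈ 𝒱 i) (x : SSym 𝒱) :
    comul 𝒱 (ι 𝒱 v * x) = TensorProduct.map (lmul 𝒱 v) LinearMap.id (comul 𝒱 x)
      + TensorProduct.map (twist (grading 𝒱) i) (lmul 𝒱 v) (comul 𝒱 x) :=
  LinearMap.congr_fun (comul_lmul 𝒱 hv) x

lemma comul_twist (i : ZMod 2) : comul 𝒱 ∘ₗ twist (grading 𝒱) i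
    = TensorProduct.map (twist (grading 𝒱) i) (twist (grading 𝒱) i) ∘ₗ comul 𝒱 := by
  refine lin_ext 𝒱 ?_ ?_
  · simp [twist_grading_one, comul_one]
  · intro j v hv x hx
    simp only [LinearMap.comp_apply] at hx ⊢
    have e1 : twist (grading 𝒱) i ∘ₗ lmul 𝒱 v
        = (-1 : ℤˣ) ^ (i * j) • (lmul 𝒱 v ∘ₗ twist (grading 𝒱) i) := by
      refine LinearMap.ext fun y => ?_
      simp only [LinearMap.comp_apply, LinearMap.mulLeft_apply, twist_mul, twist_ι 𝒱 hv,
        smul_mul_assoc, sign_smul_apply]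
    rw [twist_mul, twist_ι 𝒱 hv, smul_mul_assoc, LinearMap.map_smul_of_tower, comul_ι_mul 𝒱 hv,
      comul_ι_mul 𝒱 hv, hx, map_add, TensorProduct.map_map, TensorProduct.map_map,
      TensorProduct.map_map, TensorProduct.map_map, e1]
    have e2 : twist (grading 𝒱) i ∘ₗ twist (grading 𝒱) j
        = twist (grading 𝒱) j ∘ₗ twist (grading 𝒱) i := by
      rcases zmod2_cases i with rfl | rfl <;> rcases zmod2_cases j with rfl | rfl <;>
        simp [twist_zero]
    rw [e2, map_sign_smul_left, map_sign_smul_right, LinearMap.id_comp, LinearMap.comp_id, smul_add]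
    rfl

lemma comul_assoc : (TensorProduct.assoc K _ _ _).toLinearMap ∘ₗ (comul 𝒱).rTensor _ ∘ₗ comul 𝒱
    = (comul 𝒱).lTensor _ ∘ₗ comul 𝒱 := by
  refine lin_ext 𝒱 ?_ ?_
  · simp [comul_one]
  · intro i v hv x hx
    simp only [LinearMap.comp_apply, LinearEquiv.coe_coe] at hx ⊢
    have a1 : ∀ (a b c : SSym 𝒱 →ₗ[K] SSym 𝒱) (z),
        (TensorProduct.assoc K (SSym 𝒱) (SSym 𝒱) (SSym 𝒱)) (TensorProduct.map (TensorProduct.map a b) c z)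
        = TensorProduct.map a (TensorProduct.map b c) (TensorProduct.assoc K _ _ _ z) :=
      fun a b c z => LinearMap.congr_fun (TensorProduct.map_map_comp_assoc_eq a b c).symm z
    rw [comul_ι_mul 𝒱 hv, map_add, map_add, LinearMap.rTensor, TensorProduct.map_map,
      TensorProduct.map_map, comul_lmul 𝒱 hv, comul_twist, LinearMap.comp_id, LinearMap.lTensor, map_add,
      TensorProduct.map_map, TensorProduct.map_map, comul_lmul 𝒱 hv, LinearMap.comp_id]
    have b1 : ∀ (A : SSym 𝒱 ⊗[K] SSym 𝒱 →ₗ[K] SSym 𝒱 ⊗[K] SSym 𝒱) (c : SSym 𝒱 →ₗ[K] SSym 𝒱) (y),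
        TensorProduct.map (A ∘ₗ comul 𝒱) c y
        = TensorProduct.map A c ((comul 𝒱).rTensor _ y) := fun A c y => by
      rw [LinearMap.rTensor, TensorProduct.map_map, LinearMap.comp_id]
    have b2 : ∀ (A : SSym 𝒱 ⊗[K] SSym 𝒱 →ₗ[K] SSym 𝒱 ⊗[K] SSym 𝒱) (c : SSym 𝒱 →ₗ[K] SSym 𝒱) (y),
        TensorProduct.map c (A ∘ₗ comul 𝒱) y
        = TensorProduct.map c A ((comul 𝒱).lTensor _ y) := fun A c y => by
      rw [LinearMap.lTensor, TensorProduct.map_map, LinearMap.comp_id]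
    have b4 : TensorProduct.map (lmul 𝒱 v) (comul 𝒱) (comul 𝒱 x)
        = TensorProduct.map (lmul 𝒱 v) (TensorProduct.map LinearMap.id LinearMap.id)
          ((comul 𝒱).lTensor _ (comul 𝒱 x)) := by
      rw [LinearMap.lTensor, TensorProduct.map_map, TensorProduct.map_id, LinearMap.id_comp,
        LinearMap.comp_id]
    rw [LinearMap.id_comp, b1, b1, b2, b4, TensorProduct.map_add_left, TensorProduct.map_add_right,
      LinearMap.add_apply, LinearMap.add_apply, map_add, a1, a1, a1, hx, LinearMap.id_comp,
      TensorProduct.map_id, add_assoc]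

lemma rTensor_eps_comul (x : SSym 𝒱) :
    (eps 𝒱).toLinearMap.rTensor _ (comul 𝒱 x) = 1 ⊗ₜ x := by
  refine LinearMap.congr_fun (f := (eps 𝒱).toLinearMap.rTensor _ ∘ₗ comul 𝒱)
    (g := TensorProduct.mk K _ _ 1) (lin_ext 𝒱 ?_ ?_) x
  · simp [comul_one]
  · intro i v hv x hx
    simp only [LinearMap.comp_apply, TensorProduct.mk_apply] at hx ⊢
    have e1 : (eps 𝒱).toLinearMap ∘ₗ lmul 𝒱 v = 0 := LinearMap.ext fun y => by simp
    have e2 : (eps 𝒱).toLinearMap ∘ₗ twist (grading 𝒱) i = (eps 𝒱).toLinearMap :=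
      LinearMap.ext fun y => by simp [eps_twist]
    have e3 : TensorProduct.map (eps 𝒱).toLinearMap (lmul 𝒱 v) (comul 𝒱 x)
        = (lmul 𝒱 v).lTensor _ ((eps 𝒱).toLinearMap.rTensor _ (comul 𝒱 x)) := by
      rw [LinearMap.lTensor, LinearMap.rTensor, TensorProduct.map_map, LinearMap.id_comp,
        LinearMap.comp_id]
    rw [comul_ι_mul 𝒱 hv, map_add, LinearMap.rTensor, TensorProduct.map_map,
      TensorProduct.map_map, e1, e2, TensorProduct.map_zero_left, LinearMap.zero_apply, zero_add,
      LinearMap.id_comp, e3, hx]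
    simp

lemma lTensor_eps_comul (x : SSym 𝒱) :
    (eps 𝒱).toLinearMap.lTensor _ (comul 𝒱 x) = x ⊗ₜ 1 := by
  refine LinearMap.congr_fun (f := (eps 𝒱).toLinearMap.lTensor _ ∘ₗ comul 𝒱)
    (g := (TensorProduct.mk K _ _).flip 1) (lin_ext 𝒱 ?_ ?_) x
  · simp [comul_one]
  · intro i v hv x hx
    simp only [LinearMap.comp_apply, TensorProduct.mk_apply, LinearMap.flip_apply] at hx ⊢
    have e1 : (eps 𝒱).toLinearMap ∘ₗ lmul 𝒱 v = 0 := LinearMap.ext fun y => by simp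
    have e3 : TensorProduct.map (lmul 𝒱 v) (eps 𝒱).toLinearMap (comul 𝒱 x)
        = (lmul 𝒱 v).rTensor _ ((eps 𝒱).toLinearMap.lTensor _ (comul 𝒱 x)) := by
      rw [LinearMap.lTensor, LinearMap.rTensor, TensorProduct.map_map, LinearMap.id_comp,
        LinearMap.comp_id]
    rw [comul_ι_mul 𝒱 hv, map_add, LinearMap.lTensor, TensorProduct.map_map,
      TensorProduct.map_map, e1, TensorProduct.map_zero_right, LinearMap.zero_apply, add_zero,
      LinearMap.id_comp, LinearMap.comp_id, e3, hx]
    simp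

/-- `Sym V` is supercocommutative. -/
lemma comm_comulAlg (x : SSym 𝒱) :
    GradedTensorProduct.comm (R := K) (grading 𝒱) (grading 𝒱) (comulAlg 𝒱 x) = comulAlg 𝒱 x := by
  suffices h : (GradedTensorProduct.comm (R := K) (grading 𝒱) (grading 𝒱)).toAlgHom.comp (comulAlg 𝒱)
      = comulAlg 𝒱 from DFunLike.congr_fun h x
  refine algHom_ext 𝒱 fun v => ?_
  refine homogeneous_induction 𝒱 (P := fun v =>
    (GradedTensorProduct.comm (R := K) (grading 𝒱) (grading 𝒱)).toAlgHom.comp (comulAlg 𝒱) (ι 𝒱 v)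
      = comulAlg 𝒱 (ι 𝒱 v)) (fun v w hv hw => by simp only [map_add, hv, hw]) (fun i v hv => ?_) v
  have h1 := GradedTensorProduct.comm_coe_tmul_coe (R := K) (grading 𝒱) (grading 𝒱)
    ⟨ι 𝒱 v, ι_mem 𝒱 hv⟩ ⟨1, SetLike.one_mem_graded (grading 𝒱)⟩
  have h2 := GradedTensorProduct.comm_coe_tmul_coe (R := K) (grading 𝒱) (grading 𝒱)
    ⟨1, SetLike.one_mem_graded (grading 𝒱)⟩ ⟨ι 𝒱 v, ι_mem 𝒱 hv⟩
  have h : comulAlg 𝒱 (ι 𝒱 v) =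
      GradedTensorProduct.includeLeft (grading 𝒱) (grading 𝒱) (ι 𝒱 v) +
      GradedTensorProduct.includeRight (grading 𝒱) (grading 𝒱) (ι 𝒱 v) := by
    rw [comulAlg, lift_ι]; rfl
  rw [AlgHom.comp_apply, h, map_add, GradedTensorProduct.includeLeft_apply,
    GradedTensorProduct.includeRight_apply]
  refine (congrArg₂ (· + ·) h1 h2).trans ?_
  simp [add_comm]

end Basic

end SSym
/-! ### Convolution and exponentials -/

namespace SSym

section Filtration

variable {K : Type u} [Field K] {V : Type v} [AddCommGroup V] [Module K V]
variable (𝒱 : ZMod 2 → Submodule K V)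

/-- The span of products of fewer than `k` vectors. -/
def Fil : ℕ → Submodule K (SSym 𝒱)
  | 0 => ⊥
  | k + 1 => Submodule.span K {1} ⊔ LinearMap.range (ι 𝒱) * Fil k

lemma one_mem_fil (k : ℕ) : (1 : SSym 𝒱) ∈ Fil 𝒱 (k + 1) :=
  Submodule.mem_sup_left (Submodule.mem_span_singleton_self 1)

lemma ι_mul_mem_fil {k : ℕ} (v : V) {x : SSym 𝒱} (hx : x ∈ Fil 𝒱 k) :
    ι 𝒱 v * x ∈ Fil 𝒱 (k + 1) :=
  Submodule.mem_sup_right (Submodule.mul_mem_mul ⟨v, rfl⟩ hx)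

lemma ι_mem_fil (v : V) : ι 𝒱 v ∈ Fil 𝒱 2 := by
  simpa using ι_mul_mem_fil 𝒱 v (one_mem_fil 𝒱 0)

lemma fil_mono_succ (k : ℕ) : Fil 𝒱 k ≤ Fil 𝒱 (k + 1) := by
  induction k with
  | zero => exact bot_le
  | succ k ih => exact sup_le_sup le_rfl (Submodule.mul_le.2 fun _ ha _ hb => Submodule.mul_mem_mul ha (ih hb))

lemma fil_mono {k l : ℕ} (h : k ≤ l) : Fil 𝒱 k ≤ Fil 𝒱 l :=
  monotone_nat_of_le_succ (fil_mono_succ 𝒱) h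

variable [DirectSum.Decomposition 𝒱]

lemma fil_succ_le {k : ℕ} {p : Submodule K (SSym 𝒱)} (h1 : 1 ∈ p)
    (h : ∀ i, ∀ v ∈ 𝒱 i, ∀ x ∈ Fil 𝒱 k, ι 𝒱 v * x ∈ p) : Fil 𝒱 (k + 1) ≤ p := by
  refine sup_le ?_ (Submodule.mul_le.2 ?_)
  · rwa [Submodule.span_singleton_le_iff_mem]
  · rintro _ ⟨v, rfl⟩ x hx
    refine homogeneous_induction 𝒱 (P := fun v => ι 𝒱 v * x ∈ p) ?_ (fun i v hv => h i v hv x hx) v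
    intro v w hv hw; rw [map_add, add_mul]; exact add_mem hv hw

lemma exists_mem_fil (x : SSym 𝒱) : ∃ k, x ∈ Fil 𝒱 k := by
  refine word_induction 𝒱 (P := fun x => ∃ k, x ∈ Fil 𝒱 k) ⟨1, one_mem_fil 𝒱 0⟩ ?_ ?_ ?_ x
  · rintro c x ⟨k, hk⟩; exact ⟨k, Submodule.smul_mem _ _ hk⟩
  · rintro x y ⟨k, hk⟩ ⟨l, hl⟩
    exact ⟨max k l, add_mem (fil_mono 𝒱 (le_max_left k l) hk) (fil_mono 𝒱 (le_max_right k l) hl)⟩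
  · rintro i v _ x ⟨k, hk⟩; exact ⟨k + 1, ι_mul_mem_fil 𝒱 v hk⟩

/-- `Sym V ⊗ Fil k`. -/
def tensorFil (k : ℕ) : Submodule K (SSym 𝒱 ⊗[K] SSym 𝒱) :=
  LinearMap.range ((Fil 𝒱 k).subtype.lTensor (SSym 𝒱))

lemma tmul_mem_tensorFil {k : ℕ} (x : SSym 𝒱) {y : SSym 𝒱} (hy : y ∈ Fil 𝒱 k) :
    x ⊗ₜ[K] y ∈ tensorFil 𝒱 k := ⟨x ⊗ₜ ⟨y, hy⟩, rfl⟩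

lemma tensorFil_le {k : ℕ} {p : Submodule K (SSym 𝒱 ⊗[K] SSym 𝒱)}
    (h : ∀ x, ∀ y ∈ Fil 𝒱 k, x ⊗ₜ y ∈ p) : tensorFil 𝒱 k ≤ p := by
  rintro _ ⟨t, rfl⟩
  induction t using TensorProduct.induction_on with
  | zero => simp
  | tmul x y => exact h x _ y.2
  | add a b ha hb => rw [map_add]; exact add_mem ha hb

lemma map_mem_tensorFil {k l : ℕ} {a b : SSym 𝒱 →ₗ[K] SSym 𝒱}
    (hb : ∀ y ∈ Fil 𝒱 k, b y ∈ Fil 𝒱 l) {t : SSym 𝒱 ⊗[K] SSym 𝒱} (ht : t ∈ tensorFil 𝒱 k) :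
    TensorProduct.map a b t ∈ tensorFil 𝒱 l := by
  have h : tensorFil 𝒱 k ≤ (tensorFil 𝒱 l).comap (TensorProduct.map a b) :=
    tensorFil_le 𝒱 fun x y hy => tmul_mem_tensorFil 𝒱 _ (hb y hy)
  exact h ht

lemma tensorFil_mono {k l : ℕ} (h : k ≤ l) : tensorFil 𝒱 k ≤ tensorFil 𝒱 l :=
  tensorFil_le 𝒱 fun _ _ hy => tmul_mem_tensorFil 𝒱 _ (fil_mono 𝒱 h hy)

variable [CharZero K]

/-- The comultiplication is conilpotent: the second factors of `comul x - 1 ⊗ x` are shorter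
than `x`. -/
lemma comul_sub_mem {k : ℕ} {x : SSym 𝒱} (hx : x ∈ Fil 𝒱 (k + 1)) :
    comul 𝒱 x - 1 ⊗ₜ x ∈ tensorFil 𝒱 k := by
  have key : ∀ k, Fil 𝒱 (k + 1) ≤ (tensorFil 𝒱 k).comap (comul 𝒱 - TensorProduct.mk K _ _ 1) := by
    intro k
    induction k with
    | zero =>
      refine fil_succ_le 𝒱 (by simp [comul_one]) fun i v _ x hx => ?_
      rw [(Submodule.mem_bot K).1 hx]; simp
    | succ k ih =>
      refine fil_succ_le 𝒱 (by simp [comul_one]) fun i v hv x hx => ?_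
      have h1 : comul 𝒱 x - 1 ⊗ₜ x ∈ tensorFil 𝒱 k := ih hx
      have h2 : comul 𝒱 x ∈ tensorFil 𝒱 (k + 1) := by
        have := add_mem (tensorFil_mono 𝒱 (Nat.le_succ k) h1) (tmul_mem_tensorFil 𝒱 1 hx)
        simpa using this
      have h3 := map_mem_tensorFil 𝒱 (a := lmul 𝒱 v) (b := LinearMap.id) (fun _ h => h) h2
      have h4 := map_mem_tensorFil 𝒱 (a := twist (grading 𝒱) i) (b := lmul 𝒱 v)
        (fun y hy => ι_mul_mem_fil 𝒱 v hy) h1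
      have h5 := add_mem h3 h4
      simp only [map_sub, TensorProduct.map_tmul,
        twist_grading_one, LinearMap.mulLeft_apply] at h5
      simp only [Submodule.mem_comap, LinearMap.sub_apply, TensorProduct.mk_apply,
        comul_ι_mul 𝒱 hv]
      rwa [add_sub_assoc]
  exact key k hx

lemma comul_mem {k : ℕ} {x : SSym 𝒱} (hx : x ∈ Fil 𝒱 k) : comul 𝒱 x ∈ tensorFil 𝒱 k := by
  rcases k with - | k
  · rw [(Submodule.mem_bot K).1 hx, map_zero]; exact zero_mem _
  · have := add_mem (tensorFil_mono 𝒱 (Nat.le_succ k) (comul_sub_mem 𝒱 hx))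
      (tmul_mem_tensorFil 𝒱 1 hx)
    simpa using this

end Filtration

section Conv

variable {K : Type u} [Field K] [CharZero K] {V : Type v} [AddCommGroup V] [Module K V]
variable {𝒱 : ZMod 2 → Submodule K V} [DirectSum.Decomposition 𝒱]
variable {B : Type*} [Ring B] [Algebra K B]

/-- The convolution product `(f g)(x) = ∑ f(x') g(x'')` of linear maps from `Sym V` to an algebra;
it carries the right Koszul signs when `g` is even. -/
def conv : (SSym 𝒱 →ₗ[K] B) →ₗ[K] (SSym 𝒱 →ₗ[K] B) →ₗ[K] (SSym 𝒱 →ₗ[K] B) :=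
  LinearMap.mk₂ K (fun f g => LinearMap.mul' K B ∘ₗ TensorProduct.map f g ∘ₗ comul 𝒱)
    (fun f f' g => by ext; simp [TensorProduct.map_add_left])
    (fun c f g => by ext; simp [TensorProduct.map_smul_left])
    (fun f g g' => by ext; simp [TensorProduct.map_add_right])
    (fun c f g => by ext; simp [TensorProduct.map_smul_right])

lemma conv_apply (f g : SSym 𝒱 →ₗ[K] B) (x : SSym 𝒱) :
    conv f g x = LinearMap.mul' K B (TensorProduct.map f g (comul 𝒱 x)) := rfl

lemma conv_def (f g : SSym 𝒱 →ₗ[K] B) :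
    conv f g = LinearMap.mul' K B ∘ₗ TensorProduct.map f g ∘ₗ comul 𝒱 := rfl

/-- The unit of the convolution product. -/
def cone : SSym 𝒱 →ₗ[K] B := Algebra.linearMap K B ∘ₗ (eps 𝒱).toLinearMap

lemma cone_apply (x : SSym 𝒱) : (cone : SSym 𝒱 →ₗ[K] B) x = algebraMap K B (eps 𝒱 x) := rfl

lemma conv_assoc (f g h : SSym 𝒱 →ₗ[K] B) : conv (conv f g) h = conv f (conv g h) := by
  have key : ∀ z : (SSym 𝒱 ⊗[K] SSym 𝒱) ⊗[K] SSym 𝒱,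
      LinearMap.mul' K B (TensorProduct.map (LinearMap.mul' K B ∘ₗ TensorProduct.map f g) h z)
      = LinearMap.mul' K B (TensorProduct.map f (LinearMap.mul' K B ∘ₗ TensorProduct.map g h)
        (TensorProduct.assoc K _ _ _ z)) := by
    intro z
    induction z using TensorProduct.induction_on with
    | zero => simp
    | add a b ha hb => simp only [map_add, ha, hb]
    | tmul z c =>
      induction z using TensorProduct.induction_on with
      | zero => simp
      | add a b ha hb => simp only [TensorProduct.add_tmul, map_add, ha, hb]
      | tmul a b => simp [mul_assoc]
  refine LinearMap.ext fun x => ?_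
  have h1 := key ((comul 𝒱).rTensor _ (comul 𝒱 x))
  have h2 := LinearMap.congr_fun (comul_assoc 𝒱) x
  simp only [LinearMap.comp_apply, LinearEquiv.coe_coe] at h2
  rw [h2, LinearMap.rTensor, LinearMap.lTensor, TensorProduct.map_map, TensorProduct.map_map,
    LinearMap.comp_id, LinearMap.comp_id] at h1
  exact h1

lemma cone_conv (f : SSym 𝒱 →ₗ[K] B) : conv cone f = f := by
  refine LinearMap.ext fun x => ?_
  have h := congrArg (LinearMap.mul' K B ∘ₗ TensorProduct.map (Algebra.linearMap K B) f)
    (rTensor_eps_comul 𝒱 x)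
  rw [LinearMap.comp_apply, LinearMap.rTensor, TensorProduct.map_map, LinearMap.comp_id] at h
  refine h.trans ?_
  simp

lemma conv_cone (f : SSym 𝒱 →ₗ[K] B) : conv f cone = f := by
  refine LinearMap.ext fun x => ?_
  have h := congrArg (LinearMap.mul' K B ∘ₗ TensorProduct.map f (Algebra.linearMap K B))
    (lTensor_eps_comul 𝒱 x)
  rw [LinearMap.comp_apply, LinearMap.lTensor, TensorProduct.map_map, LinearMap.comp_id] at h
  refine h.trans ?_
  simp

lemma conv_mulLeft (b : B) (f g : SSym 𝒱 →ₗ[K] B) :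
    conv (LinearMap.mulLeft K b ∘ₗ f) g = LinearMap.mulLeft K b ∘ₗ conv f g := by
  refine LinearMap.ext fun x => ?_
  simp only [conv_apply, LinearMap.comp_apply]
  generalize comul 𝒱 x = t
  induction t using TensorProduct.induction_on with
  | zero => simp
  | add a b ha hb => simp only [map_add, ha, hb]
  | tmul a c => simp [mul_assoc]

lemma algHom_comp_conv {B' : Type*} [Ring B'] [Algebra K B'] (F : B →ₐ[K] B')
    (f g : SSym 𝒱 →ₗ[K] B) :
    F.toLinearMap ∘ₗ conv f g = conv (F.toLinearMap ∘ₗ f) (F.toLinearMap ∘ₗ g) := by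
  refine LinearMap.ext fun x => ?_
  simp only [conv_apply, LinearMap.comp_apply]
  generalize comul 𝒱 x = t
  induction t using TensorProduct.induction_on with
  | zero => simp
  | add a b ha hb => simp only [map_add, ha, hb]
  | tmul a c => simp

/-- `f g` on words of length `< k` depends on `g` only through words of length `< k`. -/
lemma conv_congr {k : ℕ} {f g g' : SSym 𝒱 →ₗ[K] B} (h : ∀ x ∈ Fil 𝒱 k, g x = g' x)
    {x : SSym 𝒱} (hx : x ∈ Fil 𝒱 k) : conv f g x = conv f g' x := by
  have h1 : tensorFil 𝒱 k ≤ LinearMap.eqLocus (LinearMap.mul' K B ∘ₗ TensorProduct.map f g)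
      (LinearMap.mul' K B ∘ₗ TensorProduct.map f g') :=
    tensorFil_le 𝒱 fun a b hb => by simp [LinearMap.mem_eqLocus, h b hb]
  exact h1 (comul_mem 𝒱 hx)

lemma conv_eq_zero {k : ℕ} {f g : SSym 𝒱 →ₗ[K] B} (hf : f 1 = 0) (h : ∀ x ∈ Fil 𝒱 k, g x = 0)
    {x : SSym 𝒱} (hx : x ∈ Fil 𝒱 (k + 1)) : conv f g x = 0 := by
  have h1 : tensorFil 𝒱 k ≤ LinearMap.ker (LinearMap.mul' K B ∘ₗ TensorProduct.map f g) :=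
    tensorFil_le 𝒱 fun a b hb => by simp [h b hb]
  have h2 := h1 (comul_sub_mem 𝒱 hx)
  rw [LinearMap.mem_ker, map_sub, sub_eq_zero] at h2
  rw [conv_apply]
  refine h2.trans ?_
  simp [hf]

/-- Supercommutativity of the convolution product. -/
lemma conv_comm {a b : SSym 𝒱 →ₗ[K] B} {j : ZMod 2}
    (h : ∀ i k, ∀ x ∈ grading 𝒱 i, ∀ y ∈ grading 𝒱 k,
      b y * a x = (-1 : ℤˣ) ^ ((k + j) * i) • (a x * b y)) :
    conv b a = conv (a ∘ₗ twist (grading 𝒱) j) b := by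
  refine LinearMap.ext fun z => ?_
  have h1 : LinearMap.mul' K B ∘ₗ TensorProduct.map b a ∘ₗ
      (GradedTensorProduct.of K (grading 𝒱) (grading 𝒱)).symm.toLinearMap ∘ₗ
      (GradedTensorProduct.comm (R := K) (grading 𝒱) (grading 𝒱)).toLinearMap ∘ₗ
      (GradedTensorProduct.of K (grading 𝒱) (grading 𝒱)).toLinearMap
      = LinearMap.mul' K B ∘ₗ TensorProduct.map (a ∘ₗ twist (grading 𝒱) j) b := by
    refine tensor_hom_ext (grading 𝒱) (grading 𝒱) fun i k x hx y hy => ?_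
    have h2 := GradedTensorProduct.comm_coe_tmul_coe (R := K) (grading 𝒱) (grading 𝒱)
      ⟨x, hx⟩ ⟨y, hy⟩
    refine (congrArg (LinearMap.mul' K B ∘ₗ TensorProduct.map b a ∘ₗ
      (GradedTensorProduct.of K (grading 𝒱) (grading 𝒱)).symm.toLinearMap) h2).trans ?_
    rw [LinearMap.map_smul_of_tower]
    simp only [LinearMap.comp_apply, TensorProduct.map_tmul, LinearMap.mul'_apply, twist_mem _ hx,
      LinearMap.map_smul_of_tower, LinearEquiv.coe_coe, GradedTensorProduct.tmul,
      GradedTensorProduct.of_symm_of, smul_mul_assoc, h i k x hx y hy, smul_smul]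
    rw [add_mul, uzpow_add, ← mul_assoc, Int.units_mul_self, one_mul]
  have h2 := LinearMap.congr_fun h1 (comul 𝒱 z)
  refine Eq.trans ?_ h2
  have h3 := comm_comulAlg 𝒱 z
  simp only [LinearMap.comp_apply, conv_apply]
  congr 2
  exact (congrArg (GradedTensorProduct.of K (grading 𝒱) (grading 𝒱)).symm h3).symm

/-- A coderivation `δ` of parity `j` of `Sym V`, that is, `comul δ = (δ ⊗ 1 + 1 ⊗ δ) comul`. The
Koszul sign for moving `δ` past the first factor is carried by `twist`, so that `δ` itself need not
be known to be homogeneous. -/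
def IsTwCoder (𝒱 : ZMod 2 → Submodule K V) [DirectSum.Decomposition 𝒱] (j : ZMod 2)
    (δ : SSym 𝒱 →ₗ[K] SSym 𝒱) : Prop :=
  comul 𝒱 ∘ₗ δ = (TensorProduct.map δ LinearMap.id
      + TensorProduct.map (twist (grading 𝒱) j) δ) ∘ₗ comul 𝒱

lemma conv_comp_coder {j : ZMod 2} {δ : SSym 𝒱 →ₗ[K] SSym 𝒱} (hδ : IsTwCoder 𝒱 j δ)
    (f g : SSym 𝒱 →ₗ[K] B) :
    conv f g ∘ₗ δ = conv (f ∘ₗ δ) g + conv (f ∘ₗ twist (grading 𝒱) j) (g ∘ₗ δ) := by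
  refine LinearMap.ext fun x => ?_
  have h := LinearMap.congr_fun hδ x
  simp only [LinearMap.comp_apply, LinearMap.add_apply] at h
  rw [LinearMap.comp_apply, conv_apply, h, map_add, map_add, TensorProduct.map_map,
    TensorProduct.map_map, LinearMap.comp_id]
  rfl

/-- Convolution powers. -/
def cpow (f : SSym 𝒱 →ₗ[K] B) : ℕ → (SSym 𝒱 →ₗ[K] B)
  | 0 => cone
  | n + 1 => conv f (cpow f n)

lemma cpow_eq_zero {f : SSym 𝒱 →ₗ[K] B} (hf : f 1 = 0) (n : ℕ) {x : SSym 𝒱}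
    (hx : x ∈ Fil 𝒱 n) : cpow f n x = 0 := by
  induction n generalizing x with
  | zero => rw [(Submodule.mem_bot K).1 hx, map_zero]
  | succ n ih => exact conv_eq_zero hf (fun x hx => ih hx) hx

lemma cpow_eq_zero_of_le {f : SSym 𝒱 →ₗ[K] B} (hf : f 1 = 0) {n k : ℕ} (hkn : k ≤ n)
    {x : SSym 𝒱} (hx : x ∈ Fil 𝒱 k) : cpow f n x = 0 :=
  cpow_eq_zero hf n (fil_mono 𝒱 hkn hx)

/-- The part of `f` that vanishes at `1`. -/
def reduced (f : SSym 𝒱 →ₗ[K] B) : SSym 𝒱 →ₗ[K] B :=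
  f - LinearMap.toSpanSingleton K B (f 1) ∘ₗ (eps 𝒱).toLinearMap

lemma reduced_one (f : SSym 𝒱 →ₗ[K] B) : reduced f 1 = 0 := by simp [reduced]

lemma reduced_eq {f : SSym 𝒱 →ₗ[K] B} (hf : f 1 = 0) : reduced f = f := by
  ext x; simp [reduced, hf]

lemma finite_support_cpow {f : SSym 𝒱 →ₗ[K] B} (hf : f 1 = 0) (x : SSym 𝒱) :
    (Function.support fun n : ℕ => (n.factorial : K)⁻¹ • cpow f n x).Finite := by
  obtain ⟨k, hk⟩ := exists_mem_fil 𝒱 x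
  refine (Set.finite_lt_nat k).subset fun n hn => ?_
  by_contra h
  exact hn (by simp only [cpow_eq_zero_of_le hf (not_lt.1 h) hk, smul_zero])

/-- The convolution exponential `∑ₙ fⁿ / n!` of a linear map vanishing at `1`; the sum is finite
at each element of `Sym V`. (A linear map `f` with `f 1 ≠ 0` is first made to vanish at `1`.) -/
def cexp (f : SSym 𝒱 →ₗ[K] B) : SSym 𝒱 →ₗ[K] B where
  toFun x := ∑ᶠ n : ℕ, (n.factorial : K)⁻¹ • cpow (reduced f) n x
  map_add' x y := by
    rw [← finsum_add_distrib (finite_support_cpow (reduced_one f) x)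
      (finite_support_cpow (reduced_one f) y)]
    exact finsum_congr fun n => by rw [map_add, smul_add]
  map_smul' c x := by
    rw [RingHom.id_apply, smul_finsum' _ (finite_support_cpow (reduced_one f) x)]
    exact finsum_congr fun n => by rw [map_smul, smul_comm]

lemma cexp_apply {f : SSym 𝒱 →ₗ[K] B} (hf : f 1 = 0) {k N : ℕ} (hkN : k ≤ N) {x : SSym 𝒱}
    (hx : x ∈ Fil 𝒱 k) :
    cexp f x = ∑ n ∈ Finset.range N, (n.factorial : K)⁻¹ • cpow f n x := by
  have h : cexp f x = ∑ᶠ n : ℕ, (n.factorial : K)⁻¹ • cpow f n x := by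
    rw [← reduced_eq hf]; simp [cexp, reduced_eq hf]
  rw [h]
  refine finsum_eq_sum_of_support_subset _ fun n hn => ?_
  by_contra h
  simp only [Finset.coe_range, Set.mem_Iio, not_lt] at h
  exact hn (by simp only [cpow_eq_zero_of_le hf (hkN.trans h) hx, smul_zero])

lemma cexp_one {f : SSym 𝒱 →ₗ[K] B} (hf : f 1 = 0) : cexp f 1 = 1 := by
  rw [cexp_apply hf le_rfl (one_mem_fil 𝒱 0)]
  simp [cpow, cone_apply]

/-- The power rule `δ (fⁿ⁺¹) = (n + 1) (δ f) fⁿ` for a superderivation `δ` of the convolution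
algebra with values in a supercommutative algebra. -/
lemma cpow_comp_coder {ℬ : ZMod 2 → Submodule K B}
    (hB : ∀ i j, ∀ a ∈ ℬ i, ∀ b ∈ ℬ j, a * b = (-1 : ℤˣ) ^ (i * j) • (b * a))
    {f : SSym 𝒱 →ₗ[K] B} (he : IsEven (grading 𝒱) ℬ f) {j : ZMod 2}
    {δ : SSym 𝒱 →ₗ[K] SSym 𝒱} (hδ : IsTwCoder 𝒱 j δ) (hδ1 : ∀ x, (eps 𝒱) (δ x) = 0)
    (hfδ : HasParity (grading 𝒱) ℬ j (f ∘ₗ δ)) (n : ℕ) :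
    cpow f (n + 1) ∘ₗ δ = ((n + 1 : ℕ) : K) • conv (f ∘ₗ δ) (cpow f n) := by
  have hcomm : conv (f ∘ₗ δ) f = conv (f ∘ₗ twist (grading 𝒱) j) (f ∘ₗ δ) := by
    refine conv_comm fun i k x hx y hy => ?_
    exact hB _ _ _ (hfδ k y hy) _ (he i x hx)
  induction n with
  | zero =>
    have h0 : (cone : SSym 𝒱 →ₗ[K] B) ∘ₗ δ = 0 := LinearMap.ext fun x => by
      simp [cone_apply, hδ1]
    have e : cpow f (0 + 1) = conv f cone := rfl
    rw [e, conv_comp_coder hδ, cpow, h0, map_zero, add_zero]; simp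
  | succ n ih =>
    have e : cpow f (n + 1 + 1) = conv f (cpow f (n + 1)) := rfl
    rw [e, conv_comp_coder hδ, ih, map_smul, ← conv_assoc, ← hcomm, conv_assoc]
    change _ + _ • conv (f ∘ₗ δ) (cpow f (n + 1)) = _
    push_cast
    module

/-- The chain rule `δ (exp f) = (δ f) exp f` for a superderivation `δ` of the convolution
algebra with values in a supercommutative algebra. -/
lemma cexp_comp_coder {ℬ : ZMod 2 → Submodule K B}
    (hB : ∀ i j, ∀ a ∈ ℬ i, ∀ b ∈ ℬ j, a * b = (-1 : ℤˣ) ^ (i * j) • (b * a))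
    {f : SSym 𝒱 →ₗ[K] B} (hf : f 1 = 0) (he : IsEven (grading 𝒱) ℬ f) {j : ZMod 2}
    {δ : SSym 𝒱 →ₗ[K] SSym 𝒱} (hδ : IsTwCoder 𝒱 j δ) (hδ1 : ∀ x, (eps 𝒱) (δ x) = 0)
    (hfδ : HasParity (grading 𝒱) ℬ j (f ∘ₗ δ)) :
    cexp f ∘ₗ δ = conv (f ∘ₗ δ) (cexp f) := by
  have hpow := cpow_comp_coder hB he hδ hδ1 hfδ
  refine LinearMap.ext fun x => ?_
  obtain ⟨k, hk⟩ := exists_mem_fil 𝒱 x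
  obtain ⟨l, hl⟩ := exists_mem_fil 𝒱 (δ x)
  have e1 : ∀ y ∈ Fil 𝒱 k, cexp f y
      = (∑ n ∈ Finset.range (max k l), (n.factorial : K)⁻¹ • cpow f n) y := fun y hy => by
    rw [cexp_apply hf (le_max_left k l) hy]; simp
  rw [conv_congr e1 hk, LinearMap.comp_apply,
    cexp_apply hf ((le_max_right k l).trans (Nat.le_succ _)) hl, Finset.sum_range_succ']
  simp only [map_sum, map_smul, LinearMap.sum_apply, LinearMap.smul_apply]
  have h0 : cpow f 0 (δ x) = 0 := by simp [cpow, cone_apply, hδ1]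
  rw [h0, smul_zero, add_zero]
  refine Finset.sum_congr rfl fun n _ => ?_
  have := LinearMap.congr_fun (hpow n) x
  rw [LinearMap.comp_apply] at this
  rw [this, LinearMap.smul_apply, smul_smul]
  congr 1
  rw [Nat.factorial_succ, Nat.cast_mul, mul_inv_rev, mul_assoc, inv_mul_cancel₀, mul_one]
  exact_mod_cast Nat.succ_ne_zero n

lemma isTwCoder_lmul {i : ZMod 2} {v : V} (hv : v ∈ 𝒱 i) : IsTwCoder 𝒱 i (lmul 𝒱 v) :=
  comul_lmul 𝒱 hv

/-- Two linear maps that satisfy the same linear differential equation `∂_v Φ = F_v Φ` for all `v`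
and agree at `1` are equal. -/
lemma eq_of_ode {Φ Ψ : SSym 𝒱 →ₗ[K] B} (h1 : Φ 1 = Ψ 1)
    (h : ∀ i, ∀ v ∈ 𝒱 i, ∃ F : SSym 𝒱 →ₗ[K] B,
      Φ ∘ₗ lmul 𝒱 v = conv F Φ ∧ Ψ ∘ₗ lmul 𝒱 v = conv F Ψ) : Φ = Ψ := by
  have key : ∀ k, Fil 𝒱 k ≤ LinearMap.eqLocus Φ Ψ := by
    intro k
    induction k with
    | zero => exact bot_le
    | succ k ih =>
      refine fil_succ_le 𝒱 h1 fun i v hv x hx => ?_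
      obtain ⟨F, h2, h3⟩ := h i v hv
      have h2 := LinearMap.congr_fun h2 x
      have h3 := LinearMap.congr_fun h3 x
      simp only [LinearMap.comp_apply, LinearMap.mulLeft_apply] at h2 h3
      rw [LinearMap.mem_eqLocus, h2, h3]
      exact conv_congr (fun y hy => ih hy) hx
  refine LinearMap.ext fun x => ?_
  obtain ⟨k, hk⟩ := exists_mem_fil 𝒱 x
  exact key k hk

lemma conv_comp_twist {B : Type*} [Ring B] [Algebra K B] (f g : SSym 𝒱 →ₗ[K] B) (i : ZMod 2) :
    conv f g ∘ₗ twist (grading 𝒱) i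
      = conv (f ∘ₗ twist (grading 𝒱) i) (g ∘ₗ twist (grading 𝒱) i) := by
  rw [conv_def, conv_def, TensorProduct.map_comp, LinearMap.comp_assoc, LinearMap.comp_assoc,
    comul_twist]
  rfl

end Conv

end SSym
/-! ### Morphisms of supersymmetric coalgebras -/

namespace SSym

section CoalgMap

variable {K : Type u} [Field K] [CharZero K] {V : Type v} [AddCommGroup V] [Module K V]
variable {𝒱 : ZMod 2 → Submodule K V} [DirectSum.Decomposition 𝒱]
variable {W : Type w} [AddCommGroup W] [Module K W]
variable {𝒲 : ZMod 2 → Submodule K W} [DirectSum.Decomposition 𝒲]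
variable {X : Type*} [AddCommGroup X] [Module K X]
variable {𝒳 : ZMod 2 → Submodule K X} [DirectSum.Decomposition 𝒳]

/-- An even morphism of augmented coalgebras. -/
structure IsCoalgMap (F : SSym 𝒱 →ₗ[K] SSym 𝒲) : Prop where
  even : IsEven (grading 𝒱) (grading 𝒲) F
  one : F 1 = 1
  eps : ∀ x, eps 𝒲 (F x) = eps 𝒱 x
  comul : comul 𝒲 ∘ₗ F = TensorProduct.map F F ∘ₗ comul 𝒱

lemma hasParity_of_twist {f : SSym 𝒱 →ₗ[K] SSym 𝒲} {j : ZMod 2}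
    (h : ∀ x, twist (grading 𝒲) 1 (f x) = (-1 : ℤˣ) ^ j • f (twist (grading 𝒱) 1 x)) :
    HasParity (grading 𝒱) (grading 𝒲) j f := by
  intro i x hx
  have h1 := h x
  rw [twist_mem _ hx, one_mul, LinearMap.map_smul_of_tower, twist_one, parity_grading, smul_smul] at h1
  rw [mem_grading, h1, add_comm, uzpow_add]

lemma isEven_of_twist {f : SSym 𝒱 →ₗ[K] SSym 𝒲}
    (h : ∀ x, twist (grading 𝒲) 1 (f x) = f (twist (grading 𝒱) 1 x)) :
    IsEven (grading 𝒱) (grading 𝒲) f := by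
  have := hasParity_of_twist (𝒱 := 𝒱) (𝒲 := 𝒲) (f := f) (j := 0) (fun x => by simp [h x])
  intro i x hx
  simpa using this i x hx

namespace IsCoalgMap

lemma id : IsCoalgMap (LinearMap.id : SSym 𝒱 →ₗ[K] SSym 𝒱) where
  even := fun _ _ h => h
  one := rfl
  eps := fun _ => rfl
  comul := by simp

lemma comp {G : SSym 𝒲 →ₗ[K] SSym 𝒳} {F : SSym 𝒱 →ₗ[K] SSym 𝒲} (hG : IsCoalgMap G)
    (hF : IsCoalgMap F) : IsCoalgMap (G ∘ₗ F) where
  even := hG.even.comp hF.even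
  one := by simp [hF.one, hG.one]
  eps := fun x => by simp [hF.eps, hG.eps]
  comul := by
    rw [← LinearMap.comp_assoc, hG.comul, LinearMap.comp_assoc, hF.comul, ← LinearMap.comp_assoc,
      TensorProduct.map_comp]

lemma symm {F : SSym 𝒱 ≃ₗ[K] SSym 𝒲} (hF : IsCoalgMap F.toLinearMap) :
    IsCoalgMap F.symm.toLinearMap where
  even := isEven_of_twist fun x => by
    have h := hF.even.twist_apply 1 (F.symm x)
    simp only [LinearEquiv.coe_coe, LinearEquiv.apply_symm_apply] at h
    simp [h]
  one := by
    have := hF.one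
    simp only [LinearEquiv.coe_coe] at this ⊢
    rw [LinearEquiv.symm_apply_eq, this]
  eps := fun x => by simpa using (hF.eps (F.symm x)).symm
  comul := by
    refine LinearMap.ext fun x => ?_
    have h := LinearMap.congr_fun hF.comul (F.symm x)
    simp only [LinearMap.comp_apply, LinearEquiv.coe_coe, LinearEquiv.apply_symm_apply] at h ⊢
    rw [h, TensorProduct.map_map]
    simp

variable {B : Type*} [Ring B] [Algebra K B]

lemma conv_comp {F : SSym 𝒱 →ₗ[K] SSym 𝒲} (hF : IsCoalgMap F) (f g : SSym 𝒲 →ₗ[K] B) :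
    conv f g ∘ₗ F = conv (f ∘ₗ F) (g ∘ₗ F) := by
  rw [conv_def, conv_def, TensorProduct.map_comp, LinearMap.comp_assoc, LinearMap.comp_assoc,
    hF.comul]
  rfl

lemma cpow_comp {F : SSym 𝒱 →ₗ[K] SSym 𝒲} (hF : IsCoalgMap F) (f : SSym 𝒲 →ₗ[K] B) (n : ℕ) :
    cpow f n ∘ₗ F = cpow (f ∘ₗ F) n := by
  induction n with
  | zero => exact LinearMap.ext fun x => by simp [cpow, cone_apply, hF.eps]
  | succ n ih => rw [cpow, hF.conv_comp, ih, cpow]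

lemma cexp_comp {F : SSym 𝒱 →ₗ[K] SSym 𝒲} (hF : IsCoalgMap F) {f : SSym 𝒲 →ₗ[K] B}
    (hf : f 1 = 0) : cexp f ∘ₗ F = cexp (f ∘ₗ F) := by
  refine LinearMap.ext fun x => ?_
  obtain ⟨k, hk⟩ := exists_mem_fil 𝒱 x
  obtain ⟨l, hl⟩ := exists_mem_fil 𝒲 (F x)
  rw [LinearMap.comp_apply, cexp_apply hf (le_max_right k l) hl,
    cexp_apply (f := f ∘ₗ F) (by simp [hF.one, hf]) (le_max_left k l) hk]
  refine Finset.sum_congr rfl fun n _ => ?_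
  rw [← hF.cpow_comp]; rfl

end IsCoalgMap

/-- `exp(τ) = id` for the projection `τ : Sym V → V ⊆ Sym V`. -/
lemma cexp_ι_tau : cexp (ι 𝒱 ∘ₗ tau 𝒱) = LinearMap.id := by
  have h0 : (ι 𝒱 ∘ₗ tau 𝒱) 1 = 0 := by simp [tau_one]
  refine lin_ext 𝒱 (by rw [cexp_one h0]; rfl) fun i v hv x hx => ?_
  have hp : (ι 𝒱 ∘ₗ tau 𝒱) ∘ₗ lmul 𝒱 v = LinearMap.mulLeft K (ι 𝒱 v) ∘ₗ cone := by
    refine LinearMap.ext fun y => ?_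
    simp [tau_ι_mul, cone_apply, Algebra.algebraMap_eq_smul_one]
  have h := cexp_comp_coder (ℬ := grading 𝒱) (supercomm 𝒱) h0 ((isEven_ι 𝒱).comp (isEven_tau 𝒱))
    (isTwCoder_lmul hv) (by simp) (by
      intro k y hy
      rw [add_comm]
      exact isEven_ι 𝒱 _ _ (isEven_tau 𝒱 _ _ (SetLike.mul_mem_graded (ι_mem 𝒱 hv) hy)))
  rw [hp, conv_mulLeft, cone_conv] at h
  have h := LinearMap.congr_fun h x
  simp only [LinearMap.comp_apply, LinearMap.mulLeft_apply] at h
  rw [h, hx]; rfl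

/-- A morphism of coalgebras is the exponential of its corestriction to `Sym¹`. -/
lemma IsCoalgMap.eq_cexp {F : SSym 𝒱 →ₗ[K] SSym 𝒲} (hF : IsCoalgMap F) :
    F = cexp (ι 𝒲 ∘ₗ tau 𝒲 ∘ₗ F) := by
  have h := hF.cexp_comp (f := ι 𝒲 ∘ₗ tau 𝒲) (by simp [tau_one])
  rw [cexp_ι_tau, LinearMap.id_comp] at h
  exact h

lemma IsCoalgMap.tau_one {F : SSym 𝒱 →ₗ[K] SSym 𝒲} (hF : IsCoalgMap F) :
    (ι 𝒲 ∘ₗ tau 𝒲 ∘ₗ F) 1 = 0 := by simp [hF.one, SSym.tau_one]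

lemma IsCoalgMap.isEven_tau {F : SSym 𝒱 →ₗ[K] SSym 𝒲} (hF : IsCoalgMap F) :
    IsEven (grading 𝒱) (grading 𝒲) (ι 𝒲 ∘ₗ tau 𝒲 ∘ₗ F) :=
  (isEven_ι 𝒲).comp ((SSym.isEven_tau 𝒲).comp hF.even)

lemma IsCoalgMap.comp_coder {F : SSym 𝒱 →ₗ[K] SSym 𝒲} (hF : IsCoalgMap F) {j : ZMod 2}
    {δ : SSym 𝒱 →ₗ[K] SSym 𝒱} (hδ : IsTwCoder 𝒱 j δ) (hδ1 : ∀ x, SSym.eps 𝒱 (δ x) = 0)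
    (hp : HasParity (grading 𝒱) (grading 𝒱) j δ) :
    F ∘ₗ δ = conv (ι 𝒲 ∘ₗ tau 𝒲 ∘ₗ F ∘ₗ δ) F := by
  have h := cexp_comp_coder (ℬ := grading 𝒲) (supercomm 𝒲) hF.tau_one hF.isEven_tau hδ hδ1
    (hF.isEven_tau.comp_hasParity hp)
  rw [← hF.eq_cexp] at h
  exact h

/-- A coderivation is determined by its corestriction to `Sym¹`; hence a morphism of coalgebras
intertwines two coderivations when it does so after projection to `Sym¹`. -/
lemma IsCoalgMap.intertwine {F : SSym 𝒱 →ₗ[K] SSym 𝒲} (hF : IsCoalgMap F) {j : ZMod 2}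
    {δ : SSym 𝒱 →ₗ[K] SSym 𝒱} (hδ : IsTwCoder 𝒱 j δ) (hδ1 : ∀ x, SSym.eps 𝒱 (δ x) = 0)
    (hp : HasParity (grading 𝒱) (grading 𝒱) j δ)
    {δ' : SSym 𝒲 →ₗ[K] SSym 𝒲} (hδ' : IsTwCoder 𝒲 j δ') (hδ1' : ∀ x, SSym.eps 𝒲 (δ' x) = 0)
    (hp' : HasParity (grading 𝒲) (grading 𝒲) j δ')
    (h : ∀ x, tau 𝒲 (F (δ x)) = tau 𝒲 (δ' (F x))) : F ∘ₗ δ = δ' ∘ₗ F := by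
  have h1 := IsCoalgMap.id.comp_coder hδ' hδ1' hp'
  rw [LinearMap.id_comp] at h1
  rw [hF.comp_coder hδ hδ1 hp, h1, hF.conv_comp, LinearMap.id_comp]
  congr 2
  refine LinearMap.ext fun x => ?_
  simp [h]

/-- The ODE satisfied by a convolution exponential with values in `Sym W`. -/
lemma cexp_lmul {g : SSym 𝒱 →ₗ[K] W} (hg : IsEven (grading 𝒱) 𝒲 g) (g1 : g 1 = 0) {i : ZMod 2}
    {v : V} (hv : v ∈ 𝒱 i) :
    cexp (ι 𝒲 ∘ₗ g) ∘ₗ lmul 𝒱 v = conv (ι 𝒲 ∘ₗ g ∘ₗ lmul 𝒱 v) (cexp (ι 𝒲 ∘ₗ g)) :=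
  cexp_comp_coder (ℬ := grading 𝒲) (supercomm 𝒲) (by simp [g1]) ((isEven_ι 𝒲).comp hg)
    (isTwCoder_lmul hv) (by simp) (by
      intro k y hy
      rw [add_comm]
      exact isEven_ι 𝒲 _ _ (hg _ _ (SetLike.mul_mem_graded (ι_mem 𝒱 hv) hy)))

lemma isEven_cexp {g : SSym 𝒱 →ₗ[K] W} (hg : IsEven (grading 𝒱) 𝒲 g) (g1 : g 1 = 0) :
    IsEven (grading 𝒱) (grading 𝒲) (cexp (ι 𝒲 ∘ₗ g)) := by
  refine isEven_of_twist fun x => ?_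
  have hpar : twist (grading 𝒲) 1 = (par 𝒲).toLinearMap :=
    LinearMap.ext fun x => by rw [twist_one, parity_grading]; rfl
  have hp : ∀ n, twist (grading 𝒲) 1 ∘ₗ cpow (ι 𝒲 ∘ₗ g) n
      = cpow (ι 𝒲 ∘ₗ g) n ∘ₗ twist (grading 𝒱) 1 := by
    intro n
    induction n with
    | zero =>
      refine LinearMap.ext fun x => ?_
      simp [cpow, cone_apply, eps_twist, Algebra.algebraMap_eq_smul_one, twist_grading_one]
    | succ n ih =>
      rw [cpow, conv_comp_twist, ← ih, hpar, algHom_comp_conv, ← hpar,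
        ← ((isEven_ι 𝒲).comp hg).twist_comp 1]
  obtain ⟨k, hk⟩ := exists_mem_fil 𝒱 x
  obtain ⟨l, hl⟩ := exists_mem_fil 𝒱 (twist (grading 𝒱) 1 x)
  have h0 : (ι 𝒲 ∘ₗ g) 1 = 0 := by simp [g1]
  rw [cexp_apply h0 (le_max_right k l) hl, cexp_apply h0 (le_max_left k l) hk, map_sum]
  refine Finset.sum_congr rfl fun n _ => ?_
  rw [map_smul]
  congr 1
  exact LinearMap.congr_fun (hp n) x

lemma comul_cexp {g : SSym 𝒱 →ₗ[K] W} (hg : IsEven (grading 𝒱) 𝒲 g) (g1 : g 1 = 0) :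
    comul 𝒲 ∘ₗ cexp (ι 𝒲 ∘ₗ g)
      = TensorProduct.map (cexp (ι 𝒲 ∘ₗ g)) (cexp (ι 𝒲 ∘ₗ g)) ∘ₗ comul 𝒱 := by
  set G := cexp (ι 𝒲 ∘ₗ g) with hG
  have hG1 : G 1 = 1 := cexp_one (by simp [g1])
  have hGe : IsEven (grading 𝒱) (grading 𝒲) G := isEven_cexp hg g1
  let iL := GradedTensorProduct.includeLeft (R := K) (grading 𝒲) (grading 𝒲)
  let iR := GradedTensorProduct.includeRight (R := K) (grading 𝒲) (grading 𝒲)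
  have hι : ∀ w, comulAlg 𝒲 (ι 𝒲 w) = iL (ι 𝒲 w) + iR (ι 𝒲 w) := fun w => by
    rw [comulAlg, lift_ι]; rfl
  have key : (comulAlg 𝒲).toLinearMap ∘ₗ G = conv (iL.toLinearMap ∘ₗ G) (iR.toLinearMap ∘ₗ G) := by
    refine eq_of_ode ?_ fun i v hv => ?_
    · rw [conv_apply, comul_one]; simp [hG1]
    · let F := ι 𝒲 ∘ₗ g ∘ₗ lmul 𝒱 v
      have hF : G ∘ₗ lmul 𝒱 v = conv F G := cexp_lmul hg g1 hv
      refine ⟨iL.toLinearMap ∘ₗ F + iR.toLinearMap ∘ₗ F, ?_, ?_⟩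
      · rw [LinearMap.comp_assoc, hF, algHom_comp_conv]
        congr 2
        exact LinearMap.ext fun x => hι _
      · have hc : conv (iR.toLinearMap ∘ₗ F) (iL.toLinearMap ∘ₗ G)
            = conv ((iL.toLinearMap ∘ₗ G) ∘ₗ twist (grading 𝒱) i) (iR.toLinearMap ∘ₗ F) := by
          refine conv_comm fun p q x hx y hy => ?_
          have hFy : F y ∈ grading 𝒲 (q + i) := by
            rw [add_comm]
            exact isEven_ι 𝒲 _ _ (hg _ _ (SetLike.mul_mem_graded (ι_mem 𝒱 hv) hy))
          have h1 := GradedTensorProduct.tmul_coe_mul_coe_tmul (R := K) (grading 𝒲) (grading 𝒲)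
            1 ⟨F y, hFy⟩ ⟨G x, hGe p x hx⟩ 1
          have h2 := GradedTensorProduct.tmul_one_mul_one_tmul (R := K) (grading 𝒲) (grading 𝒲)
            (G x) (F y)
          rw [one_mul, mul_one] at h1
          refine h1.trans ?_
          congr 1
          exact h2.symm
        rw [conv_comp_coder (isTwCoder_lmul hv), LinearMap.comp_assoc, LinearMap.comp_assoc _ _ iR.toLinearMap,
          hF, algHom_comp_conv, algHom_comp_conv, ← conv_assoc _ (iR.toLinearMap ∘ₗ F), ← hc,
          map_add, LinearMap.add_apply, conv_assoc, conv_assoc]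
  have h2 : conv (iL.toLinearMap ∘ₗ G) (iR.toLinearMap ∘ₗ G)
      = (GradedTensorProduct.of K (grading 𝒲) (grading 𝒲)).toLinearMap ∘ₗ
        TensorProduct.map G G ∘ₗ comul 𝒱 := by
    rw [conv_def, ← LinearMap.comp_assoc, ← LinearMap.comp_assoc]
    congr 1
    refine TensorProduct.ext' fun x y => ?_
    exact GradedTensorProduct.tmul_one_mul_one_tmul (R := K) (grading 𝒲) (grading 𝒲) _ _
  rw [comul, LinearMap.comp_assoc, key, h2, ← LinearMap.comp_assoc]
  rfl

/-- `Sym W` is the cofree conilpotent supercocommutative coalgebra: an even map `g : Sym V → W`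
vanishing at `1` is the corestriction of the coalgebra morphism `exp(g)`. -/
lemma isCoalgMap_cexp {g : SSym 𝒱 →ₗ[K] W} (hg : IsEven (grading 𝒱) 𝒲 g) (g1 : g 1 = 0) :
    IsCoalgMap (cexp (ι 𝒲 ∘ₗ g)) where
  even := isEven_cexp hg g1
  one := cexp_one (by simp [g1])
  eps := fun x => by
    obtain ⟨k, hk⟩ := exists_mem_fil 𝒱 x
    have hp : ∀ n, (eps 𝒲).toLinearMap ∘ₗ cpow (ι 𝒲 ∘ₗ g) (n + 1) = 0 := fun n => by
      rw [cpow, algHom_comp_conv, show (eps 𝒲).toLinearMap ∘ₗ ι 𝒲 ∘ₗ g = 0 from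
        LinearMap.ext fun y => by simp, map_zero, LinearMap.zero_apply]
    rw [cexp_apply (by simp [g1]) (Nat.le_succ k) hk, map_sum, Finset.sum_range_succ',
      Finset.sum_eq_zero, zero_add]
    · simp [cpow, cone_apply]
    · intro n _
      have := LinearMap.congr_fun (hp n) x
      simp only [LinearMap.comp_apply, AlgHom.toLinearMap_apply, LinearMap.zero_apply] at this
      rw [map_smul, this, smul_zero]
  comul := comul_cexp hg g1

lemma tau_cexp {g : SSym 𝒱 →ₗ[K] W} (g1 : g 1 = 0) (x : SSym 𝒱) :
    tau 𝒲 (cexp (ι 𝒲 ∘ₗ g) x) = g x := by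
  obtain ⟨k, hk⟩ := exists_mem_fil 𝒱 x
  have hp : ∀ n, (eps 𝒲).toLinearMap ∘ₗ cpow (ι 𝒲 ∘ₗ g) (n + 1) = 0 := fun n => by
    rw [cpow, algHom_comp_conv, show (eps 𝒲).toLinearMap ∘ₗ ι 𝒲 ∘ₗ g = 0 from
      LinearMap.ext fun y => by simp, map_zero, LinearMap.zero_apply]
  have ht : ∀ h : SSym 𝒱 →ₗ[K] SSym 𝒲, tau 𝒲 ∘ₗ conv (ι 𝒲 ∘ₗ g) h
      = (TensorProduct.rid K W).toLinearMap ∘ₗ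
        TensorProduct.map g ((eps 𝒲).toLinearMap ∘ₗ h) ∘ₗ comul 𝒱 := by
    intro h
    rw [conv_def, ← LinearMap.comp_assoc, ← LinearMap.comp_assoc, ← LinearMap.comp_assoc]
    congr 1
    refine TensorProduct.ext' fun x y => ?_
    simp [tau_ι_mul]
  rw [cexp_apply (by simp [g1]) (show k ≤ k + 2 by omega) hk, map_sum, Finset.sum_range_succ',
    Finset.sum_range_succ', Finset.sum_eq_zero]
  · simp [cpow, cone_apply, conv_cone, Algebra.algebraMap_eq_smul_one, tau_one]
  · intro n _
    have h1 : tau 𝒲 ∘ₗ cpow (ι 𝒲 ∘ₗ g) (n + 1 + 1) = 0 := by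
      rw [cpow, ht, hp, TensorProduct.map_zero_right, LinearMap.zero_comp, LinearMap.comp_zero]
    have := LinearMap.congr_fun h1 x
    simp only [LinearMap.comp_apply, LinearMap.zero_apply] at this
    rw [map_smul, this, smul_zero]

/-- A coalgebra endomorphism whose linear part is the identity is bijective: it is unipotent for
the length filtration. -/
lemma IsCoalgMap.bijective {F : SSym 𝒱 →ₗ[K] SSym 𝒱} (hF : IsCoalgMap F)
    (hι : ∀ v, F (ι 𝒱 v) = ι 𝒱 v) : Function.Bijective F := by
  have hode : ∀ i, ∀ v ∈ 𝒱 i, F ∘ₗ lmul 𝒱 v = conv (ι 𝒱 ∘ₗ (tau 𝒱 ∘ₗ F) ∘ₗ lmul 𝒱 v) F := by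
    intro i v hv
    have := cexp_lmul (𝒲 := 𝒱) (g := tau 𝒱 ∘ₗ F) ((SSym.isEven_tau 𝒱).comp hF.even)
      (by simp [hF.one, SSym.tau_one]) hv
    rwa [← hF.eq_cexp] at this
  have key : ∀ k, ∀ x ∈ Fil 𝒱 (k + 1), F x - x ∈ Fil 𝒱 k := by
    intro k
    induction k with
    | zero =>
      intro x hx
      have : Fil 𝒱 1 ≤ LinearMap.ker (F - LinearMap.id) := by
        refine fil_succ_le 𝒱 (by simp [hF.one]) fun i v _ x hx => ?_
        rw [(Submodule.mem_bot K).1 hx]; simp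
      have := this hx
      rw [LinearMap.mem_ker, LinearMap.sub_apply, LinearMap.id_apply] at this
      rw [this]; exact zero_mem _
    | succ k ih =>
      intro x hx
      have hFk : ∀ y ∈ Fil 𝒱 k, F y ∈ Fil 𝒱 k := fun y hy => by
        rcases k with - | k
        · rw [(Submodule.mem_bot K).1 hy, map_zero]; exact zero_mem _
        · have h2 := ih y (fil_mono_succ 𝒱 _ hy)
          have := add_mem h2 hy
          rwa [sub_add_cancel] at this
      have : Fil 𝒱 (k + 2) ≤ (Fil 𝒱 (k + 1)).comap (F - LinearMap.id) := by
        refine fil_succ_le 𝒱 (by simp [hF.one]) fun i v hv x hx => ?_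
        have h1 := LinearMap.congr_fun (hode i v hv) x
        simp only [LinearMap.comp_apply, LinearMap.mulLeft_apply] at h1
        have h2 : tensorFil 𝒱 k ≤ (Fil 𝒱 (k + 1)).comap
            (LinearMap.mul' K _ ∘ₗ TensorProduct.map (ι 𝒱 ∘ₗ (tau 𝒱 ∘ₗ F) ∘ₗ lmul 𝒱 v) F) :=
          tensorFil_le 𝒱 fun a b hb => ι_mul_mem_fil 𝒱 _ (hFk b hb)
        have h3 := h2 (comul_sub_mem 𝒱 hx)
        rw [Submodule.mem_comap, map_sub] at h3
        have h4 : (LinearMap.mul' K _ ∘ₗ TensorProduct.map (ι 𝒱 ∘ₗ (tau 𝒱 ∘ₗ F) ∘ₗ lmul 𝒱 v) F)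
            (1 ⊗ₜ x) = ι 𝒱 v * F x := by simp [hι]
        have h5 := ι_mul_mem_fil 𝒱 v (ih x hx)
        rw [h4] at h3
        have h6 := add_mem h3 h5
        rw [Submodule.mem_comap, LinearMap.sub_apply, LinearMap.id_apply, h1, conv_apply]
        convert h6 using 1
        rw [mul_sub]
        simp
      exact this hx
  constructor
  · rw [← LinearMap.ker_eq_bot, Submodule.eq_bot_iff]
    intro x hx
    obtain ⟨k, hk⟩ := exists_mem_fil 𝒱 x
    have : ∀ l, x ∈ Fil 𝒱 l → x = 0 := by
      intro l
      induction l with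
      | zero => exact fun h => (Submodule.mem_bot K).1 h
      | succ l ih =>
        intro h
        have := key l x h
        rw [LinearMap.mem_ker.1 hx, zero_sub, neg_mem_iff] at this
        exact ih this
    exact this k hk
  · have : ∀ l, Fil 𝒱 l ≤ LinearMap.range F := by
      intro l
      induction l with
      | zero => exact bot_le
      | succ l ih =>
        intro x hx
        have h := ih (key l x hx)
        have := sub_mem (LinearMap.mem_range_self F x) h
        rwa [sub_sub_cancel] at this
    intro x
    obtain ⟨k, hk⟩ := exists_mem_fil 𝒱 x
    exact this k hk

/-- The functoriality of `Sym` for even maps. -/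
def smap (l : V →ₗ[K] W) (hl : IsEven 𝒱 𝒲 l) : SSym 𝒱 →ₐ[K] SSym 𝒲 :=
  lift 𝒱 (ι 𝒲 ∘ₗ l) fun i j v hv w hw => ι_comm 𝒲 (hl i v hv) (hl j w hw)

@[simp] lemma smap_ι (l : V →ₗ[K] W) (hl : IsEven 𝒱 𝒲 l) (v : V) :
    smap l hl (ι 𝒱 v) = ι 𝒲 (l v) := by simp [smap]

lemma eps_smap (l : V →ₗ[K] W) (hl : IsEven 𝒱 𝒲 l) (x : SSym 𝒱) :
    eps 𝒲 (smap l hl x) = eps 𝒱 x := by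
  suffices h : (eps 𝒲).comp (smap l hl) = eps 𝒱 from DFunLike.congr_fun h x
  exact algHom_ext 𝒱 fun v => by simp

lemma tau_smap (l : V →ₗ[K] W) (hl : IsEven 𝒱 𝒲 l) (x : SSym 𝒱) :
    tau 𝒲 (smap l hl x) = l (tau 𝒱 x) := by
  refine LinearMap.congr_fun (f := tau 𝒲 ∘ₗ (smap l hl).toLinearMap) (g := l ∘ₗ tau 𝒱)
    (lin_ext 𝒱 (by simp [tau_one]) fun i v _ x _ => ?_) x
  simp [tau_ι_mul, eps_smap]

lemma smap_comp (m : W →ₗ[K] X) (hm : IsEven 𝒲 𝒳 m) (l : V →ₗ[K] W) (hl : IsEven 𝒱 𝒲 l)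
    (x : SSym 𝒱) : smap m hm (smap l hl x) = smap (m ∘ₗ l) (hm.comp hl) x := by
  suffices h : (smap m hm).comp (smap l hl) = smap (m ∘ₗ l) (hm.comp hl) from DFunLike.congr_fun h x
  exact algHom_ext 𝒱 fun v => by simp

lemma smap_id (l : V →ₗ[K] V) (hl : IsEven 𝒱 𝒱 l) (h : ∀ v, l v = v) (x : SSym 𝒱) :
    smap l hl x = x := by
  suffices h : smap l hl = AlgHom.id K _ from DFunLike.congr_fun h x
  exact algHom_ext 𝒱 fun v => by simp [h]

lemma isEven_smap (l : V →ₗ[K] W) (hl : IsEven 𝒱 𝒲 l) :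
    IsEven (grading 𝒱) (grading 𝒲) (smap l hl).toLinearMap := by
  refine isEven_of_twist fun x => ?_
  refine LinearMap.congr_fun (f := twist (grading 𝒲) 1 ∘ₗ (smap l hl).toLinearMap)
    (g := (smap l hl).toLinearMap ∘ₗ twist (grading 𝒱) 1) (lin_ext 𝒱 ?_ ?_) x
  · simp [twist_grading_one]
  · intro i v hv x hx
    simp only [LinearMap.comp_apply, AlgHom.toLinearMap_apply] at hx ⊢
    rw [map_mul, twist_mul, twist_mul, map_mul, hx, smap_ι, twist_ι 𝒲 (hl i v hv), twist_ι 𝒱 hv]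
    rcases Int.units_eq_one_or ((-1 : ℤˣ) ^ (1 * i)) with e | e <;> simp

lemma isCoalgMap_smap (l : V →ₗ[K] W) (hl : IsEven 𝒱 𝒲 l) :
    IsCoalgMap (smap l hl).toLinearMap where
  even := isEven_smap l hl
  one := map_one (smap l hl)
  eps := eps_smap l hl
  comul := by
    refine lin_ext 𝒱 (by simp [comul_one]) fun i v hv x hx => ?_
    simp only [LinearMap.comp_apply, AlgHom.toLinearMap_apply] at hx ⊢
    have e1 : (smap l hl).toLinearMap ∘ₗ lmul 𝒱 v = lmul 𝒲 (l v) ∘ₗ (smap l hl).toLinearMap :=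
      LinearMap.ext fun y => by simp
    rw [map_mul, smap_ι, comul_ι_mul 𝒲 (hl i v hv), comul_ι_mul 𝒱 hv, hx, map_add,
      TensorProduct.map_map, TensorProduct.map_map, TensorProduct.map_map, TensorProduct.map_map,
      e1, (isEven_smap l hl).twist_comp, LinearMap.id_comp, LinearMap.comp_id]

end CoalgMap

end SSym

/-! ### The Chevalley–Eilenberg codifferential -/

namespace DGLie

section Codifferential

variable {K : Type u} [Field K] [CharZero K] {V : Type v} [AddCommGroup V] [Module K V]
variable {𝒱 : ZMod 2 → Submodule K V} [DirectSum.Decomposition 𝒱]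
variable (L : DGLie 𝒱)

open SSym

lemma ad_lmul {i j : ZMod 2} {v w : V} (hv : v ∈ 𝒱 i) (hw : w ∈ 𝒱 j) :
    L.ad v ∘ₗ lmul 𝒱 w
      = lmul 𝒱 (L.br v w) + (-1 : ℤˣ) ^ ((i + 1) * j) • (lmul 𝒱 w ∘ₗ L.ad v) :=
  LinearMap.ext fun x => L.ad_ι_mul hv hw x

lemma Q_lmul {i : ZMod 2} {v : V} (hv : v ∈ 𝒱 i) :
    L.Q ∘ₗ lmul 𝒱 v = lmul 𝒱 (L.d v) + (-1 : ℤˣ) ^ i • (lmul 𝒱 v ∘ₗ L.Q) + L.ad v :=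
  LinearMap.ext fun x => by
    have := L.Q_ι_mul v x
    rw [parity_mem 𝒱 hv, LinearMap.map_smul_of_tower, smul_mul_assoc] at this
    exact this

lemma eps_ad {i : ZMod 2} {v : V} (hv : v ∈ 𝒱 i) (x : SSym 𝒱) : eps 𝒱 (L.ad v x) = 0 := by
  refine LinearMap.congr_fun (f := (eps 𝒱).toLinearMap ∘ₗ L.ad v) (g := 0)
    (lin_ext 𝒱 (by simp [L.ad_one]) fun j w hw x _ => ?_) x
  rw [LinearMap.comp_apply, L.ad_ι_mul hv hw, map_add, LinearMap.map_smul_of_tower]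
  simp

lemma eps_Q (x : SSym 𝒱) : eps 𝒱 (L.Q x) = 0 := by
  refine LinearMap.congr_fun (f := (eps 𝒱).toLinearMap ∘ₗ L.Q) (g := 0)
    (lin_ext 𝒱 (by simp [L.Q_one]) fun j w hw x _ => ?_) x
  rw [LinearMap.comp_apply, L.Q_ι_mul, map_add, map_add]
  simp [L.eps_ad hw]

lemma tau_ad {i : ZMod 2} {v : V} (hv : v ∈ 𝒱 i) (x : SSym 𝒱) :
    tau 𝒱 (L.ad v x) = L.br v (tau 𝒱 x) := by
  refine LinearMap.congr_fun (f := tau 𝒱 ∘ₗ L.ad v) (g := L.br v ∘ₗ tau 𝒱)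
    (lin_ext 𝒱 (by simp [L.ad_one, tau_one]) fun j w hw x _ => ?_) x
  rw [LinearMap.comp_apply, L.ad_ι_mul hv hw, map_add, LinearMap.map_smul_of_tower]
  simp [tau_ι_mul, L.eps_ad hv]

lemma tau_Q_ι_mul {i : ZMod 2} {v : V} (hv : v ∈ 𝒱 i) (x : SSym 𝒱) :
    tau 𝒱 (L.Q (ι 𝒱 v * x)) = eps 𝒱 x • L.d v + L.br v (tau 𝒱 x) := by
  rw [L.Q_ι_mul, map_add, map_add, tau_ι_mul, tau_ι_mul, L.eps_Q, zero_smul, add_zero,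
    L.tau_ad hv]

lemma ad_twist {i : ZMod 2} {v : V} (hv : v ∈ 𝒱 i) (k : ZMod 2) :
    twist (grading 𝒱) k ∘ₗ L.ad v
      = (-1 : ℤˣ) ^ (k * (i + 1)) • (L.ad v ∘ₗ twist (grading 𝒱) k) := by
  refine lin_ext 𝒱 (by simp [twist_grading_one, L.ad_one]) fun j w hw x hx => ?_
  simp only [LinearMap.comp_apply, sign_smul_apply] at hx ⊢
  rw [L.ad_ι_mul hv hw, map_add, LinearMap.map_smul_of_tower, twist_mul, twist_mul, hx, twist_mul,
    twist_ι 𝒱 hw, twist_ι 𝒱 (L.br_odd i j v hv w hw)]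
  simp only [smul_mul_assoc, mul_smul_comm, LinearMap.map_smul_of_tower]
  rw [L.ad_ι_mul hv hw]
  rcases zmod2_cases i with rfl | rfl <;> rcases zmod2_cases j with rfl | rfl <;>
    rcases zmod2_cases k with rfl | rfl <;> simp [zmod2_one_add_one]

lemma Q_twist (k : ZMod 2) :
    twist (grading 𝒱) k ∘ₗ L.Q = (-1 : ℤˣ) ^ k • (L.Q ∘ₗ twist (grading 𝒱) k) := by
  refine lin_ext 𝒱 (by simp [twist_grading_one, L.Q_one]) fun j w hw x hx => ?_
  have had := LinearMap.congr_fun (L.ad_twist hw k) x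
  simp only [LinearMap.comp_apply, sign_smul_apply] at hx had ⊢
  rw [L.Q_ι_mul, parity_mem 𝒱 hw, map_add, map_add, LinearMap.map_smul_of_tower, smul_mul_assoc,
    LinearMap.map_smul_of_tower, twist_mul, twist_mul, hx, twist_mul, had,
    twist_ι 𝒱 hw, twist_ι 𝒱 (L.d_odd j w hw)]
  simp only [smul_mul_assoc, mul_smul_comm, LinearMap.map_smul_of_tower]
  rw [L.Q_ι_mul, parity_mem 𝒱 hw, LinearMap.map_smul_of_tower, smul_mul_assoc]
  rcases zmod2_cases j with rfl | rfl <;>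
    rcases zmod2_cases k with rfl | rfl <;> simp [zmod2_one_add_one]

lemma hasParity_Q : HasParity (grading 𝒱) (grading 𝒱) 1 L.Q :=
  hasParity_of_twist fun x => LinearMap.congr_fun (L.Q_twist 1) x

lemma isTwCoder_ad {i : ZMod 2} {v : V} (hv : v ∈ 𝒱 i) : IsTwCoder 𝒱 (i + 1) (L.ad v) := by
  refine lin_ext 𝒱 (by simp [L.ad_one, comul_one]) fun j w hw x hx => ?_
  simp only [LinearMap.comp_apply, LinearMap.add_apply] at hx ⊢
  have ht : twist (grading 𝒱) (i + 1) ∘ₗ lmul 𝒱 w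
      = (-1 : ℤˣ) ^ ((i + 1) * j) • (lmul 𝒱 w ∘ₗ twist (grading 𝒱) (i + 1)) :=
    LinearMap.ext fun y => by
      simp only [LinearMap.comp_apply, LinearMap.mulLeft_apply, twist_mul, twist_ι 𝒱 hw,
        smul_mul_assoc, sign_smul_apply]
  have hc : L.ad v ∘ₗ twist (grading 𝒱) j
      = (-1 : ℤˣ) ^ ((i + 1) * j) • (twist (grading 𝒱) j ∘ₗ L.ad v) := by
    rw [L.ad_twist hv j, smul_smul, mul_comm j, Int.units_mul_self, one_smul]
  have hcc : twist (grading 𝒱) (i + 1) ∘ₗ twist (grading 𝒱) j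
      = twist (grading 𝒱) (i + j + 1) := by
    rcases zmod2_cases i with rfl | rfl <;> rcases zmod2_cases j with rfl | rfl <;>
      simp [twist_zero, zmod2_one_add_one, twist_twist]
  have hcc' : twist (grading 𝒱) j ∘ₗ twist (grading 𝒱) (i + 1)
      = twist (grading 𝒱) (i + j + 1) := by
    rcases zmod2_cases i with rfl | rfl <;> rcases zmod2_cases j with rfl | rfl <;>
      simp [twist_zero, zmod2_one_add_one, twist_twist]
  rw [L.ad_ι_mul hv hw, map_add, LinearMap.map_smul_of_tower, comul_ι_mul 𝒱 (L.br_odd i j v hv w hw),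
    comul_ι_mul 𝒱 hw, hx, comul_ι_mul 𝒱 hw]
  simp only [map_add, TensorProduct.map_map, L.ad_lmul hv hw, LinearMap.id_comp, LinearMap.comp_id,
    ht, hc, hcc, hcc', TensorProduct.map_add_left, TensorProduct.map_add_right, map_sign_smul_left,
    map_sign_smul_right, LinearMap.add_apply, sign_smul_apply, smul_add]
  abel

/-- The Chevalley–Eilenberg differential is a coderivation. -/
lemma isTwCoder_Q : IsTwCoder 𝒱 1 L.Q := by
  refine lin_ext 𝒱 (by simp [L.Q_one, comul_one]) fun j w hw x hx => ?_
  have had := LinearMap.congr_fun (L.isTwCoder_ad hw) x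
  simp only [LinearMap.comp_apply, LinearMap.add_apply] at hx had ⊢
  have ht : twist (grading 𝒱) 1 ∘ₗ lmul 𝒱 w
      = (-1 : ℤˣ) ^ j • (lmul 𝒱 w ∘ₗ twist (grading 𝒱) 1) :=
    LinearMap.ext fun y => by
      simp only [LinearMap.comp_apply, LinearMap.mulLeft_apply, twist_mul, twist_ι 𝒱 hw,
        smul_mul_assoc, sign_smul_apply, one_mul]
  have hc : L.Q ∘ₗ twist (grading 𝒱) j
      = (-1 : ℤˣ) ^ j • (twist (grading 𝒱) j ∘ₗ L.Q) := by
    rw [L.Q_twist j, smul_smul, Int.units_mul_self, one_smul]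
  have hcc : twist (grading 𝒱) 1 ∘ₗ twist (grading 𝒱) j = twist (grading 𝒱) (j + 1) := by
    rcases zmod2_cases j with rfl | rfl <;> simp [twist_zero, zmod2_one_add_one, twist_twist]
  have hcc' : twist (grading 𝒱) j ∘ₗ twist (grading 𝒱) 1 = twist (grading 𝒱) (j + 1) := by
    rcases zmod2_cases j with rfl | rfl <;> simp [twist_zero, zmod2_one_add_one, twist_twist]
  rw [L.Q_ι_mul, parity_mem 𝒱 hw, LinearMap.map_smul_of_tower, smul_mul_assoc, map_add, map_add,
    LinearMap.map_smul_of_tower, comul_ι_mul 𝒱 (L.d_odd j w hw),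
    comul_ι_mul 𝒱 hw, hx, had, comul_ι_mul 𝒱 hw]
  simp only [map_add, TensorProduct.map_map, L.Q_lmul hw, LinearMap.id_comp, LinearMap.comp_id,
    ht, hc, hcc, hcc', TensorProduct.map_add_left, TensorProduct.map_add_right, map_sign_smul_left,
    map_sign_smul_right, LinearMap.add_apply, sign_smul_apply, smul_add]
  abel

variable {W : Type w} [AddCommGroup W] [Module K W]
variable {𝒲 : ZMod 2 → Submodule K W} [DirectSum.Decomposition 𝒲] (M : DGLie 𝒲)

/-- A strict morphism of dg Lie algebras induces a morphism of Chevalley–Eilenberg coalgebras. -/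
lemma smap_Q {l : V →ₗ[K] W} (hl : IsEven 𝒱 𝒲 l) (hd : ∀ v, l (L.d v) = M.d (l v))
    (hbr : ∀ v w, l (L.br v w) = M.br (l v) (l w)) (x : SSym 𝒱) :
    smap l hl (L.Q x) = M.Q (smap l hl x) := by
  have had : ∀ i, ∀ v ∈ 𝒱 i, ∀ x, smap l hl (L.ad v x) = M.ad (l v) (smap l hl x) := by
    intro i v hv x
    refine LinearMap.congr_fun (f := (smap l hl).toLinearMap ∘ₗ L.ad v)
      (g := M.ad (l v) ∘ₗ (smap l hl).toLinearMap)
      (lin_ext 𝒱 (by simp [L.ad_one, M.ad_one]) fun j w hw x hx => ?_) x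
    simp only [LinearMap.comp_apply, AlgHom.toLinearMap_apply] at hx ⊢
    have e : smap l hl ((-1 : ℤˣ) ^ ((i + 1) * j) • (ι 𝒱 w * L.ad v x))
        = (-1 : ℤˣ) ^ ((i + 1) * j) • smap l hl (ι 𝒱 w * L.ad v x) :=
      LinearMap.map_smul_of_tower (smap l hl).toLinearMap _ _
    rw [L.ad_ι_mul hv hw, map_add, e, map_mul, map_mul, map_mul, hx, smap_ι, smap_ι,
      M.ad_ι_mul (hl i v hv) (hl j w hw), hbr]
  refine LinearMap.congr_fun (f := (smap l hl).toLinearMap ∘ₗ L.Q)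
      (g := M.Q ∘ₗ (smap l hl).toLinearMap)
      (lin_ext 𝒱 (by simp [L.Q_one, M.Q_one]) fun j w hw x hx => ?_) x
  simp only [LinearMap.comp_apply, AlgHom.toLinearMap_apply] at hx ⊢
  rw [L.Q_ι_mul, map_add, map_add, map_mul, map_mul, map_mul, hx, had j w hw, smap_ι, smap_ι,
    smap_ι, M.Q_ι_mul, hd, hl.parity_apply]

end Codifferential

end DGLie

/-! ### Cohomology of abelian dg Lie algebras -/

section Homotopy

variable {K : Type u} [Field K] {V : Type v} [AddCommGroup V] [Module K V]
variable (𝒱 : ZMod 2 → Submodule K V) [DirectSum.Decomposition 𝒱]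

lemma exists_pseudoInverse (D : V →ₗ[K] V) : ∃ κ : V →ₗ[K] V, D ∘ₗ κ ∘ₗ D = D := by
  obtain ⟨g, hg⟩ := LinearMap.exists_rightInverse_of_surjective D.rangeRestrict
    (LinearMap.range_rangeRestrict D)
  obtain ⟨κ, hκ⟩ := LinearMap.exists_extend g
  refine ⟨κ, LinearMap.ext fun v => ?_⟩
  have h1 : κ (D v) = g (D.rangeRestrict v) := LinearMap.congr_fun hκ (D.rangeRestrict v)
  have h2 := congrArg Subtype.val (LinearMap.congr_fun hg (D.rangeRestrict v))
  simp only [LinearMap.comp_apply, h1]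
  exact h2

/-- The component of parity `j` of a linear map. -/
def homComp (j : ZMod 2) (f : V →ₗ[K] V) : V →ₗ[K] V :=
  comp 𝒱 (0 + j) ∘ₗ f ∘ₗ comp 𝒱 0 + comp 𝒱 (1 + j) ∘ₗ f ∘ₗ comp 𝒱 1

lemma homComp_apply {i : ZMod 2} (j : ZMod 2) (f : V →ₗ[K] V) {v : V} (hv : v ∈ 𝒱 i) :
    homComp 𝒱 j f v = comp 𝒱 (i + j) (f v) := by
  rcases zmod2_cases i with rfl | rfl
  · simp [homComp, comp_same 𝒱 hv, comp_ne 𝒱 hv (show (0 : ZMod 2) ≠ 1 by decide)]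
  · simp [homComp, comp_same 𝒱 hv, comp_ne 𝒱 hv (show (1 : ZMod 2) ≠ 0 by decide)]

lemma hasParity_homComp (j : ZMod 2) (f : V →ₗ[K] V) : HasParity 𝒱 𝒱 j (homComp 𝒱 j f) :=
  fun i v hv => by rw [homComp_apply 𝒱 j f hv]; exact comp_mem 𝒱 _ _

/-- A contraction of `(V, D)` onto its cohomology: an odd operator `κ` such that `1 - Dκ - κD`
projects onto a complement of `im D` in `ker D`. -/
structure IsContraction (D κ : V →ₗ[K] V) : Prop where
  odd : ∀ i, ∀ v ∈ 𝒱 i, κ v ∈ 𝒱 (i + 1)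
  dkd : ∀ v, D (κ (D v)) = D v
  kdk : ∀ v, κ (D (κ v)) = κ v
  sq : ∀ v, κ (κ v) = 0

variable {𝒱}

lemma exists_isContraction {D : V →ₗ[K] V} (hD : ∀ i, ∀ v ∈ 𝒱 i, D v ∈ 𝒱 (i + 1))
    (hsq : ∀ v, D (D v) = 0) : ∃ κ, IsContraction 𝒱 D κ := by
  obtain ⟨κ, hκ⟩ := exists_pseudoInverse D
  have h1 : ∀ v, D (homComp 𝒱 1 κ (D v)) = D v := fun v => by
    refine LinearMap.congr_fun (f := D ∘ₗ homComp 𝒱 1 κ ∘ₗ D) (g := D)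
      (hom_ext_homogeneous 𝒱 fun i v hv => ?_) v
    have h := LinearMap.congr_fun hκ v
    simp only [LinearMap.comp_apply] at h ⊢
    rw [homComp_apply 𝒱 1 κ (hD i v hv), ← comp_odd 𝒱 hD, h, comp_same 𝒱]
    have := hD i v hv
    rwa [show i + 1 + 1 + 1 = i + 1 by rw [add_assoc i, zmod2_one_add_one, add_zero]]
  have o1 : ∀ i, ∀ v ∈ 𝒱 i, homComp 𝒱 1 κ v ∈ 𝒱 (i + 1) := hasParity_homComp 𝒱 1 κ
  generalize homComp 𝒱 1 κ = κ₁ at h1 o1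
  have shift : ∀ {i : ZMod 2} {v : V}, v ∈ 𝒱 (i + 1 + 1 + 1) → v ∈ 𝒱 (i + 1) := by
    intro i v hv
    rwa [show i + 1 + 1 + 1 = i + 1 by rw [add_assoc i, zmod2_one_add_one, add_zero]] at hv
  let κ₂ := κ₁ ∘ₗ D ∘ₗ κ₁
  have o2 : ∀ i, ∀ v ∈ 𝒱 i, κ₂ v ∈ 𝒱 (i + 1) := fun i v hv =>
    shift (o1 _ _ (hD _ _ (o1 i v hv)))
  have a2 : ∀ v, D (κ₂ (D v)) = D v := fun v => by simp [κ₂, h1]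
  have b2 : ∀ v, κ₂ (D (κ₂ v)) = κ₂ v := fun v => by simp [κ₂, h1]
  -- the correction by `κ₂ κ₂ D` makes the square vanish
  refine ⟨κ₂ - κ₂ ∘ₗ κ₂ ∘ₗ D, ?_, ?_, ?_, ?_⟩
  · intro i v hv
    exact sub_mem (o2 i v hv) (shift (o2 _ _ (o2 _ _ (hD i v hv))))
  · intro v; simp [hsq, a2]
  · intro v; simp [hsq, b2]
  · intro v; simp [b2]

/-- The projection `1 - Dκ - κD` onto the harmonic vectors of a contraction. -/
def harmonic (D κ : V →ₗ[K] V) : V →ₗ[K] V := LinearMap.id - D ∘ₗ κ - κ ∘ₗ D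

lemma harmonic_apply (D κ : V →ₗ[K] V) (v : V) : harmonic D κ v = v - D (κ v) - κ (D v) := rfl

lemma harmonic_diff {D κ : V →ₗ[K] V} (hsq : ∀ v, D (D v) = 0) (h : IsContraction 𝒱 D κ) (v : V) :
    harmonic D κ (D v) = 0 := by
  rw [harmonic_apply, h.dkd, hsq, map_zero, sub_self, sub_zero]

lemma diff_harmonic {D κ : V →ₗ[K] V} (hsq : ∀ v, D (D v) = 0) (h : IsContraction 𝒱 D κ) (v : V) :
    D (harmonic D κ v) = 0 := by
  rw [harmonic_apply, map_sub, map_sub, h.dkd, hsq, sub_zero, sub_self]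

lemma homotopy_harmonic {D κ : V →ₗ[K] V} (h : IsContraction 𝒱 D κ)
    (v : V) : κ (harmonic D κ v) = 0 := by
  rw [harmonic_apply, map_sub, map_sub, h.kdk, h.sq, sub_zero, sub_self]

lemma harmonic_harmonic {D κ : V →ₗ[K] V} (hsq : ∀ v, D (D v) = 0) (h : IsContraction 𝒱 D κ)
    (v : V) : harmonic D κ (harmonic D κ v) = harmonic D κ v := by
  rw [harmonic_apply D κ (harmonic D κ v), diff_harmonic hsq h, homotopy_harmonic h, map_zero,
    map_zero, sub_zero, sub_zero]

lemma isEven_harmonic {D κ : V →ₗ[K] V} (hD : ∀ i, ∀ v ∈ 𝒱 i, D v ∈ 𝒱 (i + 1))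
    (h : IsContraction 𝒱 D κ) : IsEven 𝒱 𝒱 (harmonic D κ) := by
  intro i v hv
  have e : i + 1 + 1 = i := by rw [add_assoc, zmod2_one_add_one, add_zero]
  have h1 := hD _ _ (h.odd i v hv)
  have h2 := h.odd _ _ (hD i v hv)
  rw [e] at h1 h2
  exact sub_mem (sub_mem hv h1) h2

end Homotopy

namespace DGLie

section Abelian

variable {K : Type u} [Field K] [CharZero K] {V : Type v} [AddCommGroup V] [Module K V]
variable {𝒱 : ZMod 2 → Submodule K V} [DirectSum.Decomposition 𝒱]

open SSym

/-- The abelian dg Lie algebra with differential `D`. -/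
@[simps] def ofDiff (D : V →ₗ[K] V) (hD : ∀ i, ∀ v ∈ 𝒱 i, D v ∈ 𝒱 (i + 1))
    (hsq : ∀ v, D (D v) = 0) : DGLie 𝒱 where
  d := D
  br := 0
  d_odd := hD
  d_sq := hsq
  br_odd := by simp
  br_symm := by simp
  leibniz := by simp
  jacobi := by simp

lemma ad_eq_zero (L : DGLie 𝒱) (hbr : ∀ v w, L.br v w = 0) {i : ZMod 2} {v : V} (hv : v ∈ 𝒱 i)
    (x : SSym 𝒱) : L.ad v x = 0 := by
  refine LinearMap.congr_fun (f := L.ad v) (g := 0)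
    (lin_ext 𝒱 (by simp [L.ad_one]) fun j w hw x hx => ?_) x
  rw [L.ad_ι_mul hv hw, hbr, hx]
  simp

lemma trivial_Q (x : SSym 𝒱) : (DGLie.trivial 𝒱).Q x = 0 := by
  refine LinearMap.congr_fun (f := (DGLie.trivial 𝒱).Q) (g := 0)
    (lin_ext 𝒱 (by simp [Q_one]) fun j w hw x hx => ?_) x
  rw [Q_ι_mul, ad_eq_zero _ (fun _ _ => rfl) hw, hx]
  simp [trivial]

lemma Q_ι_mul_abelian (L : DGLie 𝒱) (hbr : ∀ v w, L.br v w = 0) {i : ZMod 2} {v : V}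
    (hv : v ∈ 𝒱 i) (x : SSym 𝒱) :
    L.Q (ι 𝒱 v * x) = ι 𝒱 (L.d v) * x + (-1 : ℤˣ) ^ i • (ι 𝒱 v * L.Q x) := by
  rw [Q_ι_mul, L.ad_eq_zero hbr hv, add_zero, parity_mem 𝒱 hv, LinearMap.map_smul_of_tower,
    smul_mul_assoc]

/-- The anticommutator of two abelian codifferentials is the derivation extending the
anticommutator of the differentials. -/
lemma Q_anticomm_ι_mul (L M : DGLie 𝒱) (hL : ∀ v w, L.br v w = 0) (hM : ∀ v w, M.br v w = 0)
    (v : V) (x : SSym 𝒱) :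
    L.Q (M.Q (ι 𝒱 v * x)) + M.Q (L.Q (ι 𝒱 v * x))
      = ι 𝒱 (L.d (M.d v) + M.d (L.d v)) * x + ι 𝒱 v * (L.Q (M.Q x) + M.Q (L.Q x)) := by
  refine homogeneous_induction 𝒱 (P := fun v => L.Q (M.Q (ι 𝒱 v * x)) + M.Q (L.Q (ι 𝒱 v * x))
      = ι 𝒱 (L.d (M.d v) + M.d (L.d v)) * x + ι 𝒱 v * (L.Q (M.Q x) + M.Q (L.Q x)))
    (fun v w hv hw => ?_) (fun i v hv => ?_) v
  · rw [map_add, add_mul, map_add, map_add, map_add, map_add, add_add_add_comm, hv, hw]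
    simp only [map_add, add_mul]; abel
  · rw [L.Q_ι_mul_abelian hL hv, M.Q_ι_mul_abelian hM hv, map_add, map_add,
      LinearMap.map_smul_of_tower, LinearMap.map_smul_of_tower,
      L.Q_ι_mul_abelian hL (M.d_odd i v hv), M.Q_ι_mul_abelian hM (L.d_odd i v hv),
      L.Q_ι_mul_abelian hL hv, M.Q_ι_mul_abelian hM hv]
    rcases zmod2_cases i with rfl | rfl <;> simp [zmod2_one_add_one, add_mul, mul_add] <;> abel

lemma Q_Q_abelian (L : DGLie 𝒱) (hL : ∀ v w, L.br v w = 0) (x : SSym 𝒱) : L.Q (L.Q x) = 0 := by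
  refine LinearMap.congr_fun (f := L.Q ∘ₗ L.Q) (g := 0)
    (lin_ext 𝒱 (by simp [L.Q_one]) fun j w hw x hx => ?_) x
  simp only [LinearMap.comp_apply, LinearMap.zero_apply] at hx ⊢
  rw [L.Q_ι_mul_abelian hL hw, map_add, LinearMap.map_smul_of_tower,
    L.Q_ι_mul_abelian hL (L.d_odd _ _ hw), L.Q_ι_mul_abelian hL hw, hx, L.d_sq]
  rcases zmod2_cases j with rfl | rfl <;> simp [zmod2_one_add_one]

/-- `∏_{1 ≤ j ≤ k} (X - j)`. -/
def eigenPoly (K : Type u) [Field K] (k : ℕ) : Polynomial K :=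
  ∏ j ∈ Finset.range k, (Polynomial.X - Polynomial.C ((j : K) + 1))

lemma eigenPoly_comp (k : ℕ) :
    (eigenPoly K (k + 1)).comp (Polynomial.X + 1) = Polynomial.X * eigenPoly K k := by
  rw [eigenPoly, Finset.prod_range_succ', Polynomial.mul_comp, Polynomial.prod_comp, mul_comm]
  congr 1
  · simp
  · refine Finset.prod_congr rfl fun j _ => ?_
    simp only [Polynomial.sub_comp, Polynomial.X_comp, Polynomial.C_comp]
    push_cast
    simp only [map_add, map_one]
    ring

lemma eigenPoly_dvd {k l : ℕ} (h : k ≤ l) : eigenPoly K k ∣ eigenPoly K l :=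
  Finset.prod_dvd_prod_of_subset _ _ _ (Finset.range_mono h)

lemma eigenPoly_eval_zero (k : ℕ) : (eigenPoly K k).eval 0 ≠ 0 := by
  rw [eigenPoly, Polynomial.eval_prod, Finset.prod_ne_zero_iff]
  intro j _
  simp only [Polynomial.eval_sub, Polynomial.eval_X, Polynomial.eval_C, zero_sub, ne_eq,
    neg_eq_zero]
  exact_mod_cast Nat.succ_ne_zero j

lemma aeval_mul_of_semiconj {B : Type*} [Ring B] [Algebra K B] {S T f : B} (hST : S * f = f * T)
    (p : Polynomial K) : Polynomial.aeval S p * f = f * Polynomial.aeval T p := by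
  induction p using Polynomial.induction_on' with
  | add p q hp hq => rw [map_add, map_add, add_mul, mul_add, hp, hq]
  | monomial n c =>
    have h : SemiconjBy f (T ^ n) (S ^ n) := SemiconjBy.pow_right hST.symm n
    rw [Polynomial.aeval_monomial, Polynomial.aeval_monomial, ← Algebra.smul_def,
      ← Algebra.smul_def, smul_mul_assoc, mul_smul_comm, h.eq]

variable {D κ : V →ₗ[K] V} (hD : ∀ i, ∀ v ∈ 𝒱 i, D v ∈ 𝒱 (i + 1)) (hsq : ∀ v, D (D v) = 0)
  (h : IsContraction 𝒱 D κ)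

/-- The number operator counting the non-harmonic factors of a word. -/
def number : Module.End K (SSym 𝒱) :=
  (ofDiff D hD hsq).Q ∘ₗ (ofDiff κ h.odd h.sq).Q + (ofDiff κ h.odd h.sq).Q ∘ₗ (ofDiff D hD hsq).Q

lemma number_ι_mul (v : V) (x : SSym 𝒱) :
    number hD hsq h (ι 𝒱 v * x)
      = ι 𝒱 (D (κ v) + κ (D v)) * x + ι 𝒱 v * number hD hsq h x :=
  Q_anticomm_ι_mul _ _ (fun _ _ => rfl) (fun _ _ => rfl) v x

lemma Q_smap_harmonic (x : SSym 𝒱) :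
    (ofDiff D hD hsq).Q (smap (harmonic D κ) (isEven_harmonic hD h) x) = 0 := by
  rw [← smap_Q (DGLie.trivial 𝒱) (ofDiff D hD hsq) (isEven_harmonic hD h)
    (fun v => by simp [trivial, diff_harmonic hsq h]) (by simp [trivial]), trivial_Q,
    map_zero]

lemma number_smap_harmonic (x : SSym 𝒱) :
    number hD hsq h (smap (harmonic D κ) (isEven_harmonic hD h) x) = 0 := by
  have h2 : (ofDiff κ h.odd h.sq).Q (smap (harmonic D κ) (isEven_harmonic hD h) x) = 0 := by
    rw [← smap_Q (DGLie.trivial 𝒱) (ofDiff κ h.odd h.sq) (isEven_harmonic hD h)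
      (fun v => by simp [trivial, homotopy_harmonic h]) (by simp [trivial]), trivial_Q, map_zero]
  simp [number, Q_smap_harmonic hD hsq h, h2]

/-- Each word minus its harmonic part is annihilated by a polynomial in the number operator with
nonzero constant term. -/
lemma exists_eigenPoly (x : SSym 𝒱) : ∃ k, Polynomial.aeval (number hD hsq h) (eigenPoly K k)
    (x - smap (harmonic D κ) (isEven_harmonic hD h) x) = 0 := by
  have up : ∀ {k l : ℕ} {y : SSym 𝒱}, k ≤ l →
      Polynomial.aeval (number hD hsq h) (eigenPoly K k) y = 0 →
      Polynomial.aeval (number hD hsq h) (eigenPoly K l) y = 0 := by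
    intro k l y hkl hy
    obtain ⟨q, hq⟩ := eigenPoly_dvd (K := K) hkl
    rw [hq, mul_comm, map_mul, Module.End.mul_apply, hy, map_zero]
  refine word_induction 𝒱 (P := fun x => ∃ k, Polynomial.aeval (number hD hsq h) (eigenPoly K k)
    (x - smap (harmonic D κ) (isEven_harmonic hD h) x) = 0) ⟨0, by simp⟩ ?_ ?_ ?_ x
  · rintro c x ⟨k, hk⟩
    exact ⟨k, by rw [map_smul, ← smul_sub, map_smul, hk, smul_zero]⟩
  · rintro x y ⟨k, hk⟩ ⟨l, hl⟩
    refine ⟨max k l, ?_⟩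
    rw [map_add, add_sub_add_comm, map_add, up (le_max_left k l) hk, up (le_max_right k l) hl,
      add_zero]
  · rintro i v - x ⟨k, hk⟩
    set π := smap (harmonic D κ) (isEven_harmonic hD h) with hπ
    set N := number hD hsq h with hN
    have e1 : N * lmul 𝒱 (harmonic D κ v) = lmul 𝒱 (harmonic D κ v) * N := by
      refine LinearMap.ext fun y => ?_
      simp only [Module.End.mul_apply, LinearMap.mulLeft_apply]
      rw [hN, number_ι_mul, diff_harmonic hsq h, homotopy_harmonic h]
      simp
    have e2 : N * lmul 𝒱 (v - harmonic D κ v) = lmul 𝒱 (v - harmonic D κ v) * (N + 1) := by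
      refine LinearMap.ext fun y => ?_
      simp only [Module.End.mul_apply, LinearMap.mulLeft_apply, LinearMap.add_apply,
        Module.End.one_apply, mul_add]
      rw [hN, number_ι_mul, add_comm]
      congr 3
      rw [harmonic_apply]
      simp [hsq, h.sq, h.dkd, h.kdk]
      abel
    have p1 : ∀ p : Polynomial K, Polynomial.aeval N p * lmul 𝒱 (harmonic D κ v)
        = lmul 𝒱 (harmonic D κ v) * Polynomial.aeval N p := aeval_mul_of_semiconj e1
    have p2 : ∀ p : Polynomial K, Polynomial.aeval N p * lmul 𝒱 (v - harmonic D κ v)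
        = lmul 𝒱 (v - harmonic D κ v) * Polynomial.aeval N (p.comp (Polynomial.X + 1)) := by
      intro p
      rw [aeval_mul_of_semiconj e2, Polynomial.aeval_comp]
      simp
    refine ⟨k + 1, ?_⟩
    have e3 : ι 𝒱 v * x - π (ι 𝒱 v * x) = lmul 𝒱 (harmonic D κ v) (x - π x)
        + lmul 𝒱 (v - harmonic D κ v) x := by
      simp only [map_mul, hπ, smap_ι, LinearMap.mulLeft_apply, map_sub, sub_mul]
      abel
    have e4 : N x = N (x - π x) := by
      rw [map_sub, hN, hπ, number_smap_harmonic, sub_zero]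
    have q1 := LinearMap.congr_fun (p1 (eigenPoly K (k + 1))) (x - π x)
    have q2 := LinearMap.congr_fun (p2 (eigenPoly K (k + 1))) x
    rw [eigenPoly_comp, mul_comm Polynomial.X, map_mul, Polynomial.aeval_X] at q2
    simp only [Module.End.mul_apply] at q1 q2
    have e5 : Polynomial.aeval N (eigenPoly K k) (N (x - π x)) = 0 := by
      have := congrArg (fun f : Module.End K (SSym 𝒱) => f (x - π x))
        (congrArg (Polynomial.aeval N) (mul_comm (eigenPoly K k) Polynomial.X))
      simp only [map_mul, Polynomial.aeval_X, Module.End.mul_apply, hk, map_zero] at this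
      exact this
    rw [e3, map_add, q1, q2, e4, e5, up (Nat.le_succ k) hk, map_zero, map_zero, add_zero]

/-- The Chevalley–Eilenberg complex of an abelian dg Lie algebra retracts onto its harmonic part. -/
lemma sub_smap_harmonic_mem_range {y : SSym 𝒱} (hy : (ofDiff D hD hsq).Q y = 0) :
    y - smap (harmonic D κ) (isEven_harmonic hD h) y ∈ LinearMap.range (ofDiff D hD hsq).Q := by
  obtain ⟨k, hk⟩ := exists_eigenPoly hD hsq h y
  set π := smap (harmonic D κ) (isEven_harmonic hD h) with hπ
  set N := number hD hsq h with hN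
  set Q := (ofDiff D hD hsq).Q with hQ
  have hz : Q (y - π y) = 0 := by rw [map_sub, hy, hπ, hQ, Q_smap_harmonic hD hsq h, sub_zero]
  generalize y - π y = z at hk hz
  have c1 : ∀ x, Q (Q x) = 0 := Q_Q_abelian _ (fun _ _ => rfl)
  have comm : ∀ p : Polynomial K, Q * Polynomial.aeval N p = Polynomial.aeval N p * Q := fun p =>
    (aeval_mul_of_semiconj (LinearMap.ext fun x => by
      simp [hN, number, ← hQ, c1]) p).symm
  have e := Polynomial.X_mul_divX_add (eigenPoly K k)
  rw [← e, map_add, map_mul, Polynomial.aeval_X, Polynomial.aeval_C, LinearMap.add_apply,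
    Module.End.mul_apply, Module.algebraMap_end_apply] at hk
  have hc : (eigenPoly K k).coeff 0 ≠ 0 := by
    rw [Polynomial.coeff_zero_eq_eval_zero]; exact eigenPoly_eval_zero k
  have hr := LinearMap.congr_fun (comm (eigenPoly K k).divX) z
  rw [Module.End.mul_apply, Module.End.mul_apply, hz, map_zero] at hr
  generalize Polynomial.aeval N (eigenPoly K k).divX z = r at hk hr
  have hN2 : N r = Q ((ofDiff κ h.odd h.sq).Q r) := by
    rw [hN]; simp only [number, LinearMap.add_apply, LinearMap.comp_apply, ← hQ, hr, map_zero,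
      add_zero]
  rw [← (LinearMap.range Q).smul_mem_iff hc, eq_neg_of_add_eq_zero_right hk, hN2]
  exact neg_mem (LinearMap.mem_range_self _ _)

/-- A cocycle on an abelian dg Lie algebra is cohomologous to its harmonic part. -/
lemma exists_primitive {φ : SSym 𝒱 →ₗ[K] K} (hφ : φ ∘ₗ (ofDiff D hD hsq).Q = 0) :
    ∃ ψ : SSym 𝒱 →ₗ[K] K,
      φ - φ ∘ₗ (smap (harmonic D κ) (isEven_harmonic hD h)).toLinearMap
        = ψ ∘ₗ (ofDiff D hD hsq).Q := by
  set Q := (ofDiff D hD hsq).Q with hQ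
  set θ := φ - φ ∘ₗ (smap (harmonic D κ) (isEven_harmonic hD h)).toLinearMap with hθ
  have hk : θ ∈ (LinearMap.ker Q).dualAnnihilator := by
    rw [Submodule.mem_dualAnnihilator]
    intro y hy
    obtain ⟨z, hz⟩ := sub_smap_harmonic_mem_range hD hsq h (LinearMap.mem_ker.1 hy)
    have : θ y = φ (y - smap (harmonic D κ) (isEven_harmonic hD h) y) := by simp [hθ]
    rw [this, ← hz]
    exact LinearMap.congr_fun hφ z
  rw [← LinearMap.range_dualMap_eq_dualAnnihilator_ker] at hk
  obtain ⟨ψ, hψ⟩ := hk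
  exact ⟨ψ, hψ.symm⟩

end Abelian

end DGLie

/-! ### Exponentials of nilpotent elements -/

section Nilpotent

variable {K : Type u} [Field K] [CharZero K] {B : Type*} [Ring B] [Algebra K B]

/-- The exponential of a nilpotent element. -/
def nexp (K : Type u) [Field K] {B : Type*} [Ring B] [Algebra K B] (x : B) : B :=
  ∑ n ∈ Finset.range (nilpotencyClass x), (n.factorial : K)⁻¹ • x ^ n

lemma nexp_eq_exp (x : B) :
    nexp K x = @IsNilpotent.exp B _ (Module.compHom B (algebraMap ℚ K)) x := by
  refine Finset.sum_congr rfl fun n _ => ?_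
  change _ = algebraMap ℚ K _ • x ^ n
  rw [map_inv₀, map_natCast]

lemma nexp_eq_sum {x : B} {N : ℕ} (h : x ^ N = 0) :
    nexp K x = ∑ n ∈ Finset.range N, (n.factorial : K)⁻¹ • x ^ n := by
  let _ : Module ℚ B := Module.compHom B (algebraMap ℚ K)
  rw [nexp_eq_exp, IsNilpotent.exp_eq_sum h]
  refine Finset.sum_congr rfl fun n _ => ?_
  change algebraMap ℚ K _ • x ^ n = _
  rw [map_inv₀, map_natCast]

lemma nexp_add {x y : B} (h : Commute x y) (hx : IsNilpotent x) (hy : IsNilpotent y) :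
    nexp K (x + y) = nexp K x * nexp K y := by
  let _ : Module ℚ B := Module.compHom B (algebraMap ℚ K)
  rw [nexp_eq_exp, nexp_eq_exp, nexp_eq_exp, IsNilpotent.exp_add_of_commute h hx hy]

lemma map_nexp {C : Type*} [Ring C] [Algebra K C] (F : B →ₐ[K] C) {x : B} (hx : IsNilpotent x) :
    F (nexp K x) = nexp K (F x) := by
  obtain ⟨N, hN⟩ := hx
  rw [nexp_eq_sum hN, nexp_eq_sum (x := F x) (N := N) (by rw [← map_pow, hN, map_zero]), map_sum]
  simp

lemma nexp_zero : nexp K (0 : B) = 1 := by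
  rw [nexp_eq_sum (N := 1) (by simp)]; simp

/-- The element `(exp(x) - 1) / x`. -/
def nexpTail (K : Type u) [Field K] {B : Type*} [Ring B] [Algebra K B] (x : B) : B :=
  ∑ n ∈ Finset.range (nilpotencyClass x + 1), ((n + 1).factorial : K)⁻¹ • x ^ n

lemma nexp_eq_one_add {x : B} (hx : IsNilpotent x) : nexp K x = 1 + x * nexpTail K x := by
  rw [nexp_eq_sum (N := nilpotencyClass x + 2)
    (by rw [pow_add, pow_nilpotencyClass hx, zero_mul]), Finset.sum_range_succ', nexpTail,
    Finset.mul_sum, add_comm]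
  congr 1
  · simp
  · exact Finset.sum_congr rfl fun n _ => by rw [pow_succ', mul_smul_comm]

lemma map_nexpTail {C : Type*} [Ring C] [Algebra K C] (F : B →ₐ[K] C) {x : B} (hx : F x = 0) :
    F (nexpTail K x) = 1 := by
  rw [nexpTail, map_sum, Finset.sum_range_succ']
  simp [hx]

end Nilpotent

/-! ### Extension of scalars to a superalgebra -/

section Scalars

variable {K : Type u} [Field K] {R : Type u} [Ring R] [Algebra K R]
variable (ℛ : ZMod 2 → Submodule K R) [GradedAlgebra ℛ]
variable {M : Type*} [AddCommGroup M] [Module K M]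
variable {N : Type*} [AddCommGroup N] [Module K N]
variable {P : Type*} [AddCommGroup P] [Module K P]
variable (𝒩 : ZMod 2 → Submodule K N) [DirectSum.Decomposition 𝒩]

/-- The `R`-bilinear extension of a bilinear map `β`, with the Koszul sign rule:
`(m ⊗ r, n ⊗ s) ↦ (-1)^(|r| |n|) β(m, n) ⊗ r s`. -/
def kos (β : M →ₗ[K] N →ₗ[K] P) : M ⊗[K] R →ₗ[K] N ⊗[K] R →ₗ[K] P ⊗[K] R :=
  TensorProduct.lift (LinearMap.mk₂ K
    (fun m r => TensorProduct.map (β m ∘ₗ twist 𝒩 0) (LinearMap.mulLeft K (comp ℛ 0 r))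
      + TensorProduct.map (β m ∘ₗ twist 𝒩 1) (LinearMap.mulLeft K (comp ℛ 1 r)))
    (fun m m' r => by
      rw [map_add, LinearMap.add_comp, LinearMap.add_comp, TensorProduct.map_add_left,
        TensorProduct.map_add_left]; abel)
    (fun c m r => by
      rw [map_smul, LinearMap.smul_comp, LinearMap.smul_comp, TensorProduct.map_smul_left,
        TensorProduct.map_smul_left, smul_add])
    (fun m r r' => by
      have e : ∀ i, LinearMap.mulLeft K (comp ℛ i (r + r')) = LinearMap.mulLeft K (comp ℛ i r)
          + LinearMap.mulLeft K (comp ℛ i r') := fun i => by ext; simp [add_mul]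
      rw [e, e, TensorProduct.map_add_right, TensorProduct.map_add_right]; abel)
    (fun c m r => by
      have e : ∀ i, LinearMap.mulLeft K (comp ℛ i (c • r)) = c • LinearMap.mulLeft K (comp ℛ i r) :=
        fun i => by ext; simp
      rw [e, e, TensorProduct.map_smul_right, TensorProduct.map_smul_right, smul_add]))

variable {𝒩}

lemma kos_tmul (β : M →ₗ[K] N →ₗ[K] P) (m : M) {i : ZMod 2} {r : R} (hr : r ∈ ℛ i) :
    kos ℛ 𝒩 β (m ⊗ₜ r) = TensorProduct.map (β m ∘ₗ twist 𝒩 i) (LinearMap.mulLeft K r) := by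
  have h : kos ℛ 𝒩 β (m ⊗ₜ r)
    = TensorProduct.map (β m ∘ₗ twist 𝒩 0) (LinearMap.mulLeft K (comp ℛ 0 r))
      + TensorProduct.map (β m ∘ₗ twist 𝒩 1) (LinearMap.mulLeft K (comp ℛ 1 r)) := rfl
  have e : LinearMap.mulLeft K (0 : R) = 0 := by ext; simp
  rw [h]
  rcases zmod2_cases i with rfl | rfl
  · rw [comp_same ℛ hr, comp_ne ℛ hr (show (0 : ZMod 2) ≠ 1 by decide), e,
      TensorProduct.map_zero_right, add_zero]
  · rw [comp_same ℛ hr, comp_ne ℛ hr (show (1 : ZMod 2) ≠ 0 by decide), e,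
      TensorProduct.map_zero_right, zero_add]

lemma kos_tmul_tmul (β : M →ₗ[K] N →ₗ[K] P) (m : M) {i j : ZMod 2} {r : R} (hr : r ∈ ℛ i) {n : N}
    (hn : n ∈ 𝒩 j) (s : R) :
    kos ℛ 𝒩 β (m ⊗ₜ r) (n ⊗ₜ s) = (-1 : ℤˣ) ^ (i * j) • (β m n ⊗ₜ (r * s)) := by
  rw [kos_tmul ℛ β m hr, TensorProduct.map_tmul, LinearMap.comp_apply, twist_mem 𝒩 hn,
    LinearMap.map_smul_of_tower, sign_smul_tmul]
  rfl

variable (𝒩) in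
/-- Bilinear maps on `M ⊗ R` and `N ⊗ R` agree when they agree on homogeneous pure tensors. -/
lemma bilin_ext {β γ : M ⊗[K] R →ₗ[K] N ⊗[K] R →ₗ[K] P}
    (h : ∀ i j m, ∀ r ∈ ℛ i, ∀ n ∈ 𝒩 j, ∀ s, β (m ⊗ₜ r) (n ⊗ₜ s) = γ (m ⊗ₜ r) (n ⊗ₜ s)) :
    β = γ := by
  refine TensorProduct.ext (LinearMap.ext fun m => hom_ext_homogeneous ℛ fun i r hr => ?_)
  refine TensorProduct.ext (hom_ext_homogeneous 𝒩 fun j n hn => LinearMap.ext fun s => ?_)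
  exact h i j m r hr n hn s

/-- Post-composition. -/
lemma rTensor_kos {P' : Type*} [AddCommGroup P'] [Module K P'] (β : M →ₗ[K] N →ₗ[K] P)
    (f : P →ₗ[K] P') (x : M ⊗[K] R) (y : N ⊗[K] R) :
    f.rTensor R (kos ℛ 𝒩 β x y) = kos ℛ 𝒩 (β.compr₂ f) x y := by
  refine LinearMap.congr_fun₂ (f := (kos ℛ 𝒩 β).compr₂ (f.rTensor R))
    (g := kos ℛ 𝒩 (β.compr₂ f)) (bilin_ext ℛ 𝒩 fun i j m r hr n hn s => ?_) x y
  rw [LinearMap.compr₂_apply, kos_tmul_tmul ℛ _ _ hr hn, kos_tmul_tmul ℛ _ _ hr hn,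
    LinearMap.map_smul_of_tower]
  rfl

/-- Pre-composition with an even map in the second variable. -/
lemma kos_rTensor {M' : Type*} [AddCommGroup M'] [Module K M'] {N' : Type*} [AddCommGroup N']
    [Module K N'] {𝒩' : ZMod 2 → Submodule K N'} [DirectSum.Decomposition 𝒩']
    (β : M →ₗ[K] N →ₗ[K] P) (f : M' →ₗ[K] M)
    {g : N' →ₗ[K] N} (hg : IsEven 𝒩' 𝒩 g) (x : M' ⊗[K] R) (y : N' ⊗[K] R) :
    kos ℛ 𝒩 β (f.rTensor R x) (g.rTensor R y) = kos ℛ 𝒩' (β.compl₁₂ f g) x y := by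
  refine LinearMap.congr_fun₂ (f := (kos ℛ 𝒩 β).compl₁₂ (f.rTensor R) (g.rTensor R))
    (g := kos ℛ 𝒩' (β.compl₁₂ f g)) (bilin_ext ℛ 𝒩' fun i j m r hr n hn s => ?_) x y
  rw [LinearMap.compl₁₂_apply, LinearMap.rTensor_tmul, LinearMap.rTensor_tmul,
    kos_tmul_tmul ℛ _ _ hr hn, kos_tmul_tmul ℛ _ _ hr (hg j n hn)]
  rfl

section GradedAlgebras

variable {B : Type*} [Ring B] [Algebra K B] {ℬ : ZMod 2 → Submodule K B} [GradedAlgebra ℬ]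
variable {C : Type*} [Ring C] [Algebra K C] {𝒞 : ZMod 2 → Submodule K C} [GradedAlgebra 𝒞]

lemma gtmul_mul_gtmul {i j : ZMod 2} (b : B) {r : R} (hr : r ∈ ℛ i) {b' : B} (hb : b' ∈ ℬ j)
    (s : R) : (GradedTensorProduct.of K ℬ ℛ (b ⊗ₜ r)) * (GradedTensorProduct.of K ℬ ℛ (b' ⊗ₜ s))
      = (-1 : ℤˣ) ^ (i * j) • GradedTensorProduct.of K ℬ ℛ ((b * b') ⊗ₜ (r * s)) :=
  GradedTensorProduct.tmul_coe_mul_coe_tmul ℬ ℛ b ⟨r, hr⟩ ⟨b', hb⟩ s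

/-- The graded tensor product multiplication is the Koszul extension of the multiplication. -/
lemma of_mul_of (x y : B ⊗[K] R) :
    GradedTensorProduct.of K ℬ ℛ x * GradedTensorProduct.of K ℬ ℛ y
      = GradedTensorProduct.of K ℬ ℛ (kos ℛ ℬ (LinearMap.mul K B) x y) := by
  refine LinearMap.congr_fun₂ (f := (LinearMap.mul K (GradedTensorProduct K ℬ ℛ)).compl₁₂
    (GradedTensorProduct.of K ℬ ℛ).toLinearMap (GradedTensorProduct.of K ℬ ℛ).toLinearMap)
    (g := (kos ℛ ℬ (LinearMap.mul K B)).compr₂ (GradedTensorProduct.of K ℬ ℛ).toLinearMap)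
    (bilin_ext ℛ ℬ fun i j m r hr n hn s => ?_) x y
  refine (gtmul_mul_gtmul ℛ m hr hn s).trans ?_
  rw [LinearMap.compr₂_apply, kos_tmul_tmul ℛ _ _ hr hn, LinearMap.map_smul_of_tower]
  rfl

lemma of_symm_mul (x y : GradedTensorProduct K ℬ ℛ) :
    (GradedTensorProduct.of K ℬ ℛ).symm (x * y) = kos ℛ ℬ (LinearMap.mul K B)
      ((GradedTensorProduct.of K ℬ ℛ).symm x) ((GradedTensorProduct.of K ℬ ℛ).symm y) := by
  have := of_mul_of (ℬ := ℬ) ℛ ((GradedTensorProduct.of K ℬ ℛ).symm x)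
    ((GradedTensorProduct.of K ℬ ℛ).symm y)
  rw [GradedTensorProduct.symm_of_of, GradedTensorProduct.symm_of_of] at this
  rw [this, GradedTensorProduct.of_symm_of]

/-- The `R`-linear extension of an even algebra map. -/
def gmap (F : B →ₐ[K] C) (hF : IsEven ℬ 𝒞 F.toLinearMap) :
    GradedTensorProduct K ℬ ℛ →ₐ[K] GradedTensorProduct K 𝒞 ℛ :=
  GradedTensorProduct.lift ℬ ℛ ((GradedTensorProduct.includeLeft 𝒞 ℛ).comp F)
    (GradedTensorProduct.includeRight 𝒞 ℛ) (by
      rintro i j ⟨b, hb⟩ ⟨r, hr⟩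
      have h1 := gtmul_mul_gtmul (ℬ := 𝒞) ℛ (F b) (SetLike.GradedOne.one_mem (A := ℛ))
        (SetLike.GradedOne.one_mem (A := 𝒞)) r
      have h2 := gtmul_mul_gtmul (ℬ := 𝒞) ℛ 1 hr (hF i b hb) 1
      rw [zero_mul, uzpow_zero, one_smul, mul_one, one_mul] at h1
      rw [one_mul, mul_one, AlgHom.toLinearMap_apply] at h2
      change GradedTensorProduct.of K 𝒞 ℛ (F b ⊗ₜ 1) * GradedTensorProduct.of K 𝒞 ℛ (1 ⊗ₜ r)
        = _ • (GradedTensorProduct.of K 𝒞 ℛ (1 ⊗ₜ r) * GradedTensorProduct.of K 𝒞 ℛ (F b ⊗ₜ 1))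
      rw [h1, h2, smul_smul, Int.units_mul_self, one_smul])

lemma gmap_of (F : B →ₐ[K] C) (hF : IsEven ℬ 𝒞 F.toLinearMap) (x : B ⊗[K] R) :
    gmap ℛ F hF (GradedTensorProduct.of K ℬ ℛ x)
      = GradedTensorProduct.of K 𝒞 ℛ (F.toLinearMap.rTensor R x) := by
  induction x using TensorProduct.induction_on with
  | zero => simp
  | add x y hx hy => rw [map_add, map_add, hx, hy, map_add, map_add]
  | tmul b r =>
    have := GradedTensorProduct.tmul_one_mul_one_tmul (R := K) 𝒞 ℛ (F b) r
    exact this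

lemma of_symm_gmap (F : B →ₐ[K] C) (hF : IsEven ℬ 𝒞 F.toLinearMap)
    (x : GradedTensorProduct K ℬ ℛ) :
    (GradedTensorProduct.of K 𝒞 ℛ).symm (gmap ℛ F hF x)
      = F.toLinearMap.rTensor R ((GradedTensorProduct.of K ℬ ℛ).symm x) := by
  have := gmap_of ℛ F hF ((GradedTensorProduct.of K ℬ ℛ).symm x)
  rw [GradedTensorProduct.symm_of_of] at this
  rw [this, GradedTensorProduct.of_symm_of]

end GradedAlgebras

/-! ### Points with values in a parameter algebra -/

section Points

variable {ℛ} {π : R →ₐ[K] K} (hR : IsParam ℛ π)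
variable {V : Type*} [AddCommGroup V] [Module K V] {𝒱 : ZMod 2 → Submodule K V}
variable {W : Type*} [AddCommGroup W] [Module K W] {𝒲 : ZMod 2 → Submodule K W}
variable {B : Type*} [Ring B] [Algebra K B] {ℬ : ZMod 2 → Submodule K B} [GradedAlgebra ℬ]

lemma points_induction {P : V ⊗[K] R → Prop} (zero : P 0) (add : ∀ x y, P x → P y → P (x + y))
    (smul : ∀ (c : K) x, P x → P (c • x))
    (tmul : ∀ i, ∀ v ∈ 𝒱 i, ∀ r ∈ ℛ i, π r = 0 → P (v ⊗ₜ r)) {x : V ⊗[K] R}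
    (hx : x ∈ points 𝒱 ℛ π) : P x := by
  refine Submodule.span_induction (p := fun x _ => P x) ?_ zero (fun x y _ _ => add x y)
    (fun c x _ => smul c x) hx
  rintro x ⟨i, v, hv, r, hr, hπ, rfl⟩
  exact tmul i v hv r hr hπ

lemma tmul_mem_points {i : ZMod 2} {v : V} (hv : v ∈ 𝒱 i) {r : R} (hr : r ∈ ℛ i) (hπ : π r = 0) :
    v ⊗ₜ r ∈ points 𝒱 ℛ π := Submodule.subset_span ⟨i, v, hv, r, hr, hπ, rfl⟩

lemma rTensor_mem_points {f : V →ₗ[K] W} (hf : IsEven 𝒱 𝒲 f) {x : V ⊗[K] R}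
    (hx : x ∈ points 𝒱 ℛ π) : f.rTensor R x ∈ points 𝒲 ℛ π := by
  refine points_induction (P := fun x => f.rTensor R x ∈ points 𝒲 ℛ π) (by simp)
    (fun x y hx hy => by rw [map_add]; exact add_mem hx hy)
    (fun c x hx => by rw [map_smul]; exact Submodule.smul_mem _ _ hx)
    (fun i v hv r hr hπ => ?_) hx
  exact tmul_mem_points (hf i v hv) hr hπ

include hR in
/-- Even elements of supercommutative algebras commute. -/
lemma points_commute {f : V →ₗ[K] B} (hf : IsEven 𝒱 ℬ f) {g : W →ₗ[K] B} (hg : IsEven 𝒲 ℬ g)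
    (hfg : ∀ i j, ∀ v ∈ 𝒱 i, ∀ w ∈ 𝒲 j, f v * g w = (-1 : ℤˣ) ^ (i * j) • (g w * f v))
    {x : V ⊗[K] R} (hx : x ∈ points 𝒱 ℛ π) {y : W ⊗[K] R} (hy : y ∈ points 𝒲 ℛ π) :
    Commute (GradedTensorProduct.of K ℬ ℛ (f.rTensor R x))
      (GradedTensorProduct.of K ℬ ℛ (g.rTensor R y)) := by
  refine points_induction (P := fun x => Commute (GradedTensorProduct.of K ℬ ℛ (f.rTensor R x))
      (GradedTensorProduct.of K ℬ ℛ (g.rTensor R y))) (by simp)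
    (fun x y hx hy => by rw [map_add, map_add]; exact hx.add_left hy)
    (fun c x hx => by rw [map_smul, map_smul]; exact hx.smul_left c)
    (fun i v hv r hr _ => ?_) hx
  refine points_induction (P := fun y => Commute
      (GradedTensorProduct.of K ℬ ℛ (f.rTensor R (v ⊗ₜ r)))
      (GradedTensorProduct.of K ℬ ℛ (g.rTensor R y))) (by simp)
    (fun x y hx hy => by rw [map_add, map_add]; exact hx.add_right hy)
    (fun c x hx => by rw [map_smul, map_smul]; exact hx.smul_right c)
    (fun j w hw s hs _ => ?_) hy
  rw [LinearMap.rTensor_tmul, LinearMap.rTensor_tmul, Commute, SemiconjBy,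
    gtmul_mul_gtmul ℛ _ hr (hg j w hw), gtmul_mul_gtmul ℛ _ hs (hf i v hv), hfg i j v hv w hw,
    hR.supercomm i j r hr s hs, sign_smul_tmul, tmul_sign_smul, smul_smul, Int.units_mul_self,
    one_smul, mul_comm j i]

include hR in
lemma commute_of_mem_points
    (hB : ∀ i j, ∀ a ∈ ℬ i, ∀ b ∈ ℬ j, a * b = (-1 : ℤˣ) ^ (i * j) • (b * a))
    {x y : GradedTensorProduct K ℬ ℛ} (hx : (GradedTensorProduct.of K ℬ ℛ).symm x ∈ points ℬ ℛ π)
    (hy : (GradedTensorProduct.of K ℬ ℛ).symm y ∈ points ℬ ℛ π) : Commute x y := by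
  have := points_commute (ℬ := ℬ) hR (f := LinearMap.id) (g := LinearMap.id) (fun _ _ h => h)
    (fun _ _ h => h) hB hx hy
  simpa using this

lemma mul_mem_points {x y : GradedTensorProduct K ℬ ℛ}
    (hx : (GradedTensorProduct.of K ℬ ℛ).symm x ∈ points ℬ ℛ π)
    (hy : (GradedTensorProduct.of K ℬ ℛ).symm y ∈ points ℬ ℛ π) :
    (GradedTensorProduct.of K ℬ ℛ).symm (x * y) ∈ points ℬ ℛ π := by
  rw [of_symm_mul]
  refine points_induction (P := fun x => kos ℛ ℬ (LinearMap.mul K B) x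
    ((GradedTensorProduct.of K ℬ ℛ).symm y) ∈ points ℬ ℛ π) (by simp)
    (fun x y hx hy => by rw [map_add]; exact add_mem hx hy)
    (fun c x hx => by rw [map_smul]; exact Submodule.smul_mem _ _ hx)
    (fun i v hv r hr hπ => ?_) hx
  refine points_induction (P := fun y => kos ℛ ℬ (LinearMap.mul K B) (v ⊗ₜ r) y
     ∈ points ℬ ℛ π) (by simp)
    (fun x y hx hy => by rw [map_add]; exact add_mem hx hy)
    (fun c x hx => by rw [map_smul]; exact Submodule.smul_mem _ _ hx)
    (fun j w hw s hs _ => ?_) hy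
  rw [kos_tmul_tmul ℛ _ _ hr hw]
  have h := tmul_mem_points (π := π) (SetLike.mul_mem_graded hv hw) (SetLike.mul_mem_graded hr hs)
    (by rw [map_mul, hπ, zero_mul])
  rcases Int.units_eq_one_or ((-1 : ℤˣ) ^ (i * j)) with e | e
  · simpa [e] using h
  · simpa [e] using h

lemma pow_succ_mem_points {x : GradedTensorProduct K ℬ ℛ}
    (hx : (GradedTensorProduct.of K ℬ ℛ).symm x ∈ points ℬ ℛ π) (n : ℕ) :
    (GradedTensorProduct.of K ℬ ℛ).symm (x ^ (n + 1)) ∈ points ℬ ℛ π := by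
  induction n with
  | zero => simpa using hx
  | succ n ih => rw [pow_succ]; exact mul_mem_points ih hx

include hR in
lemma isNilpotent_of_mem_points
    (hB : ∀ i j, ∀ a ∈ ℬ i, ∀ b ∈ ℬ j, a * b = (-1 : ℤˣ) ^ (i * j) • (b * a))
    {x : GradedTensorProduct K ℬ ℛ} (hx : (GradedTensorProduct.of K ℬ ℛ).symm x ∈ points ℬ ℛ π) :
    IsNilpotent x := by
  refine Submodule.span_induction (p := fun x _ => IsNilpotent (GradedTensorProduct.of K ℬ ℛ x))
    ?_ (by simp) (fun x y hx hy h1 h2 => ?_) (fun c x _ h => ?_) hx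
  · rintro x ⟨i, b, hb, r, hr, hπ, rfl⟩
    have key : ∀ n : ℕ, ∃ s : ℤˣ, (GradedTensorProduct.of K ℬ ℛ (b ⊗ₜ r)) ^ n
        = s • GradedTensorProduct.of K ℬ ℛ ((b ^ n) ⊗ₜ (r ^ n)) := by
      intro n
      induction n with
      | zero => exact ⟨1, by simp; rfl⟩
      | succ n ih =>
        obtain ⟨s, hs⟩ := ih
        have h := gtmul_mul_gtmul (ℬ := ℬ) ℛ b hr (SetLike.pow_mem_graded n hb) (r ^ n)
        refine ⟨s * (-1 : ℤˣ) ^ (i * (n • i)), ?_⟩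
        rw [pow_succ', hs, mul_smul_comm, h, smul_smul, pow_succ', pow_succ']
    obtain ⟨n, hn⟩ := hR.nilpotent r hπ
    obtain ⟨s, hs⟩ := key n
    exact ⟨n, by rw [hs, hn]; simp⟩
  · rw [map_add]
    exact (commute_of_mem_points hR hB (x := GradedTensorProduct.of K ℬ ℛ x)
      (y := GradedTensorProduct.of K ℬ ℛ y) hx hy).isNilpotent_add h1 h2
  · rw [map_smul]
    exact h.smul c

end Points

end Scalars

/-! ### The superalgebra structure on the tensor square -/

section Involution

variable {K : Type u} [Field K] [CharZero K] {B : Type*} [Ring B] [Algebra K B]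

/-- The eigenspaces of an involution. -/
def involGrading (p : B →ₐ[K] B) (i : ZMod 2) : Submodule K B where
  carrier := {x | p x = (-1 : ℤˣ) ^ i • x}
  add_mem' {x y} hx hy := by
    simp only [Set.mem_ofPred_eq] at hx hy ⊢
    rw [map_add, hx, hy, smul_add]
  zero_mem' := by simp
  smul_mem' c x hx := by
    simp only [Set.mem_ofPred_eq] at hx ⊢
    rw [map_smul, hx, smul_comm]

lemma mem_involGrading {p : B →ₐ[K] B} {i : ZMod 2} {x : B} :
    x ∈ involGrading p i ↔ p x = (-1 : ℤˣ) ^ i • x := Iff.rfl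

lemma isCompl_involGrading {p : B →ₐ[K] B} (hp : ∀ x, p (p x) = x) :
    IsCompl (involGrading p 0) (involGrading p 1) := by
  constructor
  · rw [Submodule.disjoint_def]
    intro x h0 h1
    rw [mem_involGrading] at h0 h1
    rw [h0] at h1
    simp only [uzpow_zero, one_smul, uzpow_one, Units.neg_smul] at h1
    have h2 : (2 : K) • x = 0 := by rw [two_smul]; nth_rw 1 [h1]; simp
    exact (smul_eq_zero.1 h2).resolve_left two_ne_zero
  · rw [codisjoint_iff, eq_top_iff]
    rintro x -
    have h : x = (2⁻¹ : K) • (x + p x) + (2⁻¹ : K) • (x - p x) := by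
      rw [← smul_add, add_add_sub_cancel, ← two_smul K x, smul_smul, inv_mul_cancel₀ two_ne_zero,
        one_smul]
    rw [h]
    refine Submodule.add_mem_sup (Submodule.smul_mem _ _ ?_) (Submodule.smul_mem _ _ ?_)
    · simp [mem_involGrading, hp, add_comm]
    · simp [mem_involGrading, hp]

/-- An involution of an algebra defines a `ZMod 2`-grading. -/
@[reducible] def gradedAlgebraOfInvol {p : B →ₐ[K] B} (hp : ∀ x, p (p x) = x) :
    GradedAlgebra (involGrading p) where
  one_mem := by
    change p 1 = _
    simp
  mul_mem := by
    intro i j x y hx hy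
    rw [mem_involGrading] at hx hy ⊢
    rw [map_mul, hx, hy]
    rcases zmod2_cases i with rfl | rfl <;> rcases zmod2_cases j with rfl | rfl <;>
      simp [zmod2_one_add_one]
  toDecomposition := decompositionOfIsCompl _ (isCompl_involGrading hp)

end Involution

namespace SSym

section Square

variable {K : Type u} [Field K] [CharZero K] {V : Type v} [AddCommGroup V] [Module K V]
variable (𝒱 : ZMod 2 → Submodule K V) [DirectSum.Decomposition 𝒱]

/-- The graded tensor square of `Sym V`. -/
abbrev Sq : Type (max u v) := GradedTensorProduct K (grading 𝒱) (grading 𝒱)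

/-- The first inclusion. -/
abbrev incL : SSym 𝒱 →ₐ[K] Sq 𝒱 := GradedTensorProduct.includeLeft (grading 𝒱) (grading 𝒱)

/-- The second inclusion. -/
abbrev incR : SSym 𝒱 →ₐ[K] Sq 𝒱 := GradedTensorProduct.includeRight (grading 𝒱) (grading 𝒱)

lemma incR_mul_incL {i j : ZMod 2} {x y : SSym 𝒱} (hx : x ∈ grading 𝒱 i) (hy : y ∈ grading 𝒱 j) :
    incR 𝒱 x * incL 𝒱 y = (-1 : ℤˣ) ^ (i * j) • (incL 𝒱 y * incR 𝒱 x) := by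
  have h1 := GradedTensorProduct.tmul_coe_mul_coe_tmul (R := K) (grading 𝒱) (grading 𝒱)
    1 ⟨x, hx⟩ ⟨y, hy⟩ 1
  have h2 := GradedTensorProduct.tmul_one_mul_one_tmul (R := K) (grading 𝒱) (grading 𝒱) y x
  rw [one_mul, mul_one] at h1
  refine h1.trans ?_
  congr 1
  exact h2.symm

lemma incL_mul_incR (x y : SSym 𝒱) :
    incL 𝒱 x * incR 𝒱 y = GradedTensorProduct.of K (grading 𝒱) (grading 𝒱) (x ⊗ₜ y) :=
  GradedTensorProduct.tmul_one_mul_one_tmul (R := K) (grading 𝒱) (grading 𝒱) x y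

lemma par_mem {i : ZMod 2} {x : SSym 𝒱} (hx : x ∈ grading 𝒱 i) : par 𝒱 x ∈ grading 𝒱 i := by
  rw [(mem_grading 𝒱).1 hx]; exact sign_smul_mem _ hx

/-- The parity involution of the tensor square. -/
def sqPar : Sq 𝒱 →ₐ[K] Sq 𝒱 :=
  GradedTensorProduct.lift (grading 𝒱) (grading 𝒱) ((incL 𝒱).comp (par 𝒱))
    ((incR 𝒱).comp (par 𝒱)) (by
      rintro i j ⟨x, hx⟩ ⟨y, hy⟩
      have := incR_mul_incL 𝒱 (par_mem 𝒱 hy) (par_mem 𝒱 hx)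
      simp only [AlgHom.comp_apply]
      rw [this, smul_smul, Int.units_mul_self, one_smul])

lemma sqPar_incL (x : SSym 𝒱) : sqPar 𝒱 (incL 𝒱 x) = incL 𝒱 (par 𝒱 x) := by
  have : sqPar 𝒱 (incL 𝒱 x) = incL 𝒱 (par 𝒱 x) * incR 𝒱 (par 𝒱 1) :=
    GradedTensorProduct.lift_tmul _ _ _ _ _ _ _
  rw [this, map_one, map_one, mul_one]

lemma sqPar_incR (x : SSym 𝒱) : sqPar 𝒱 (incR 𝒱 x) = incR 𝒱 (par 𝒱 x) := by
  have : sqPar 𝒱 (incR 𝒱 x) = incL 𝒱 (par 𝒱 1) * incR 𝒱 (par 𝒱 x) :=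
    GradedTensorProduct.lift_tmul _ _ _ _ _ _ _
  rw [this, map_one, map_one, one_mul]

lemma sqPar_sqPar (t : Sq 𝒱) : sqPar 𝒱 (sqPar 𝒱 t) = t := by
  suffices h : (sqPar 𝒱).comp (sqPar 𝒱) = AlgHom.id K _ from DFunLike.congr_fun h t
  refine GradedTensorProduct.algHom_ext _ _ (AlgHom.ext fun x => ?_) (AlgHom.ext fun x => ?_)
  · change sqPar 𝒱 (sqPar 𝒱 (incL 𝒱 x)) = incL 𝒱 x
    rw [sqPar_incL, sqPar_incL, par_par]
  · change sqPar 𝒱 (sqPar 𝒱 (incR 𝒱 x)) = incR 𝒱 x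
    rw [sqPar_incR, sqPar_incR, par_par]

instance : GradedAlgebra (involGrading (sqPar 𝒱)) := gradedAlgebraOfInvol (sqPar_sqPar 𝒱)

lemma isEven_of_sqPar {F : SSym 𝒱 →ₐ[K] Sq 𝒱} (h : ∀ x, sqPar 𝒱 (F x) = F (par 𝒱 x)) :
    IsEven (grading 𝒱) (involGrading (sqPar 𝒱)) F.toLinearMap := by
  intro i x hx
  rw [mem_involGrading, AlgHom.toLinearMap_apply, h, (mem_grading 𝒱).1 hx]
  exact LinearMap.map_smul_of_tower F.toLinearMap _ _

lemma isEven_incL : IsEven (grading 𝒱) (involGrading (sqPar 𝒱)) (incL 𝒱).toLinearMap :=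
  isEven_of_sqPar 𝒱 (sqPar_incL 𝒱)

lemma isEven_incR : IsEven (grading 𝒱) (involGrading (sqPar 𝒱)) (incR 𝒱).toLinearMap :=
  isEven_of_sqPar 𝒱 (sqPar_incR 𝒱)

lemma comulAlg_ι (v : V) : comulAlg 𝒱 (ι 𝒱 v) = incL 𝒱 (ι 𝒱 v) + incR 𝒱 (ι 𝒱 v) := by
  rw [comulAlg, lift_ι]; rfl

lemma isEven_comulAlg : IsEven (grading 𝒱) (involGrading (sqPar 𝒱)) (comulAlg 𝒱).toLinearMap := by
  refine isEven_of_sqPar 𝒱 fun x => ?_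
  suffices h : (sqPar 𝒱).comp (comulAlg 𝒱) = (comulAlg 𝒱).comp (par 𝒱) from DFunLike.congr_fun h x
  refine algHom_ext 𝒱 fun v => ?_
  rw [AlgHom.comp_apply, AlgHom.comp_apply, comulAlg_ι, map_add, sqPar_incL, sqPar_incR, par_ι,
    comulAlg_ι]

end Square

/-! ### The group-like element of a point -/

section Grouplike

variable {K : Type u} [Field K] [CharZero K] {V : Type v} [AddCommGroup V] [Module K V]
variable {𝒱 : ZMod 2 → Submodule K V} [DirectSum.Decomposition 𝒱]
variable {W : Type w} [AddCommGroup W] [Module K W]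
variable {𝒲 : ZMod 2 → Submodule K W} [DirectSum.Decomposition 𝒲]
variable {M : Type*} [AddCommGroup M] [Module K M]
variable {N : Type*} [AddCommGroup N] [Module K N]
variable {P : Type*} [AddCommGroup P] [Module K P]
variable {R : Type u} [Ring R] [Algebra K R] {ℛ : ZMod 2 → Submodule K R} [GradedAlgebra ℛ]
variable {π : R →ₐ[K] K}

variable (𝒱 ℛ) in
/-- An element of `V ⊗ R` as an element of the superalgebra `Sym V ⊗ R`. -/
def vec (a : V ⊗[K] R) : GradedTensorProduct K (grading 𝒱) ℛ :=
  GradedTensorProduct.of K _ _ ((ι 𝒱).rTensor R a)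

variable (𝒱 ℛ) in
/-- The group-like element `exp(a)` of `Sym V ⊗ R`. -/
def gexp (a : V ⊗[K] R) : SSym 𝒱 ⊗[K] R :=
  (GradedTensorProduct.of K (grading 𝒱) ℛ).symm (nexp K (vec 𝒱 ℛ a))

variable (ℛ) in
/-- The value at the point `a` of a linear map on `Sym V`. -/
def evl (a : V ⊗[K] R) (f : SSym 𝒱 →ₗ[K] M) : M ⊗[K] R := f.rTensor R (gexp 𝒱 ℛ a)

lemma evalAt_eq (f : FormalFun 𝒱) (a : V ⊗[K] R) :
    evalAt ℛ f a = TensorProduct.lid K R (evl ℛ a f.toDual) := rfl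

lemma evl_comp (a : V ⊗[K] R) (f : SSym 𝒱 →ₗ[K] M) (g : M →ₗ[K] N) :
    evl ℛ a (g ∘ₗ f) = g.rTensor R (evl ℛ a f) := by
  rw [evl, evl, LinearMap.rTensor_comp]; rfl

lemma evl_add (a : V ⊗[K] R) (f g : SSym 𝒱 →ₗ[K] M) :
    evl ℛ a (f + g) = evl ℛ a f + evl ℛ a g := by
  rw [evl, LinearMap.rTensor_add]; rfl

lemma evl_sub (a : V ⊗[K] R) (f g : SSym 𝒱 →ₗ[K] M) :
    evl ℛ a (f - g) = evl ℛ a f - evl ℛ a g := by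
  rw [evl, LinearMap.rTensor_sub]; rfl

lemma evl_smul (a : V ⊗[K] R) (c : K) (f : SSym 𝒱 →ₗ[K] M) :
    evl ℛ a (c • f) = c • evl ℛ a f := by
  rw [evl, LinearMap.rTensor_smul]; rfl

lemma slice_rTensor (ℓ : R →ₗ[K] K) (f : M →ₗ[K] N) (x : M ⊗[K] R) :
    slice ℓ (f.rTensor R x) = f (slice ℓ x) := by
  induction x using TensorProduct.induction_on with
  | zero => simp
  | add x y hx hy => rw [map_add, map_add, hx, hy, map_add, map_add]
  | tmul m r => simp [slice]

lemma slice_tmul (ℓ : R →ₗ[K] K) (m : M) (r : R) : slice ℓ (m ⊗ₜ[K] r) = ℓ r • m := by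
  simp [slice]

/-- An element of `M ⊗ R` is determined by its slices. -/
lemma ext_slice {x y : M ⊗[K] R} (h : ∀ ℓ : R →ₗ[K] K, slice ℓ x = slice ℓ y) : x = y := by
  suffices h' : ∀ z : M ⊗[K] R, (∀ ℓ : R →ₗ[K] K, slice ℓ z = 0) → z = 0 by
    rw [← sub_eq_zero]
    exact h' _ fun ℓ => by rw [map_sub, sub_eq_zero]; exact h ℓ
  intro z hz
  classical
  let b := Module.Basis.ofVectorSpace K R
  have key : (TensorProduct.equivFinsuppOfBasisRight (M := M) b) z = 0 := by
    refine Finsupp.ext fun i => ?_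
    have h1 : ∀ z : M ⊗[K] R, (TensorProduct.equivFinsuppOfBasisRight (M := M) b) z i
        = slice (b.coord i) z := by
      intro z
      induction z using TensorProduct.induction_on with
      | zero => simp
      | add x y hx hy => simp only [map_add, Finsupp.add_apply, hx, hy]
      | tmul m r =>
        rw [slice_tmul, TensorProduct.equivFinsuppOfBasisRight_apply_tmul_apply]; rfl
    rw [h1, hz]; rfl
  exact (LinearEquiv.map_eq_zero_iff _).1 key

variable (hR : IsParam ℛ π)

lemma vec_mem {a : V ⊗[K] R} (ha : a ∈ points 𝒱 ℛ π) :
    (GradedTensorProduct.of K (grading 𝒱) ℛ).symm (vec 𝒱 ℛ a) ∈ points (grading 𝒱) ℛ π :=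
  rTensor_mem_points (isEven_ι 𝒱) ha

include hR

lemma isNilpotent_vec {a : V ⊗[K] R} (ha : a ∈ points 𝒱 ℛ π) : IsNilpotent (vec 𝒱 ℛ a) :=
  isNilpotent_of_mem_points hR (supercomm 𝒱) (vec_mem ha)

lemma gexp_add {a b : V ⊗[K] R} (ha : a ∈ points 𝒱 ℛ π) (hb : b ∈ points 𝒱 ℛ π) :
    GradedTensorProduct.of K (grading 𝒱) ℛ (gexp 𝒱 ℛ (a + b))
      = GradedTensorProduct.of K (grading 𝒱) ℛ (gexp 𝒱 ℛ a)
        * GradedTensorProduct.of K (grading 𝒱) ℛ (gexp 𝒱 ℛ b) := by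
  simp only [gexp, GradedTensorProduct.symm_of_of]
  rw [← nexp_add (commute_of_mem_points hR (supercomm 𝒱) (vec_mem ha) (vec_mem hb))
    (isNilpotent_vec hR ha) (isNilpotent_vec hR hb), vec, vec, vec, map_add, map_add]

lemma gexp_sub_one_mem {a : V ⊗[K] R} (ha : a ∈ points 𝒱 ℛ π) :
    gexp 𝒱 ℛ a - 1 ⊗ₜ 1 ∈ points (grading 𝒱) ℛ π := by
  obtain ⟨n, hn⟩ := isNilpotent_vec hR ha
  have h : (1 : SSym 𝒱) ⊗ₜ[K] (1 : R) = (GradedTensorProduct.of K (grading 𝒱) ℛ).symm 1 := rfl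
  rw [gexp, h, ← map_sub, nexp_eq_sum (N := n + 1) (by rw [pow_succ, hn, zero_mul]),
    Finset.sum_range_succ']
  simp only [Nat.factorial_zero, Nat.cast_one, inv_one, pow_zero, one_smul, add_sub_cancel_right,
    map_sum]
  exact sum_mem fun k _ => by
    rw [map_smul]; exact Submodule.smul_mem _ _ (pow_succ_mem_points (vec_mem ha) k)

/-- Even maps vanishing at `1` send points to points. -/
lemma evl_mem_points {a : V ⊗[K] R} (ha : a ∈ points 𝒱 ℛ π) {f : SSym 𝒱 →ₗ[K] W}
    (hf : IsEven (grading 𝒱) 𝒲 f) (f1 : f 1 = 0) : evl ℛ a f ∈ points 𝒲 ℛ π := by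
  have h := rTensor_mem_points hf (gexp_sub_one_mem hR ha)
  rw [map_sub, LinearMap.rTensor_tmul, f1, TensorProduct.zero_tmul, sub_zero] at h
  exact h

/-- The comultiplication of `exp(a)` is `exp(a) ⊗ exp(a)`. -/
lemma gmap_comulAlg {a : V ⊗[K] R} (ha : a ∈ points 𝒱 ℛ π) :
    gmap ℛ (comulAlg 𝒱) (isEven_comulAlg 𝒱) (nexp K (vec 𝒱 ℛ a))
      = gmap ℛ (incL 𝒱) (isEven_incL 𝒱) (nexp K (vec 𝒱 ℛ a))
        * gmap ℛ (incR 𝒱) (isEven_incR 𝒱) (nexp K (vec 𝒱 ℛ a)) := by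
  have hn := isNilpotent_vec hR ha
  rw [map_nexp _ hn, map_nexp _ hn, map_nexp _ hn, ← nexp_add _ (hn.map _) (hn.map _)]
  · congr 1
    rw [vec, gmap_of, gmap_of, gmap_of, ← map_add, ← LinearMap.rTensor_comp_apply,
      ← LinearMap.rTensor_comp_apply, ← LinearMap.rTensor_comp_apply, ← LinearMap.add_apply,
      ← LinearMap.rTensor_add]
    congr 3
    exact LinearMap.ext fun v => comulAlg_ι 𝒱 v
  · rw [vec, gmap_of, gmap_of, ← LinearMap.rTensor_comp_apply, ← LinearMap.rTensor_comp_apply]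
    refine points_commute hR ((isEven_incL 𝒱).comp (isEven_ι 𝒱))
      ((isEven_incR 𝒱).comp (isEven_ι 𝒱)) (fun i j v hv w hw => ?_) ha ha
    have := incR_mul_incL 𝒱 (ι_mem 𝒱 hw) (ι_mem 𝒱 hv)
    simp only [LinearMap.comp_apply, AlgHom.toLinearMap_apply]
    rw [this, smul_smul, mul_comm j, Int.units_mul_self, one_smul]

/-- `exp(a)` is group-like: bilinear expressions in the comultiplication evaluate to products. -/
lemma evl_comul {a : V ⊗[K] R} (ha : a ∈ points 𝒱 ℛ π) {𝒩 : ZMod 2 → Submodule K N}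
    [DirectSum.Decomposition 𝒩] (β : M →ₗ[K] N →ₗ[K] P) (f : SSym 𝒱 →ₗ[K] M)
    {g : SSym 𝒱 →ₗ[K] N} (hg : IsEven (grading 𝒱) 𝒩 g) :
    evl ℛ a (TensorProduct.lift β ∘ₗ TensorProduct.map f g ∘ₗ comul 𝒱)
      = kos ℛ 𝒩 β (evl ℛ a f) (evl ℛ a g) := by
  have h1 := congrArg (GradedTensorProduct.of K (involGrading (sqPar 𝒱)) ℛ).symm
    (gmap_comulAlg hR ha)
  rw [of_symm_gmap, of_symm_mul, of_symm_gmap, of_symm_gmap, kos_rTensor ℛ _ _ (isEven_incR 𝒱)]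
    at h1
  have h2 := congrArg ((TensorProduct.lift β ∘ₗ TensorProduct.map f g ∘ₗ
    (GradedTensorProduct.of K (grading 𝒱) (grading 𝒱)).symm.toLinearMap).rTensor R) h1
  rw [← LinearMap.rTensor_comp_apply, rTensor_kos] at h2
  rw [evl, evl, evl, kos_rTensor ℛ _ _ hg]
  refine h2.trans ?_
  have e : ((LinearMap.mul K (Sq 𝒱)).compl₁₂ (incL 𝒱).toLinearMap (incR 𝒱).toLinearMap).compr₂
      (TensorProduct.lift β ∘ₗ TensorProduct.map f g ∘ₗ
        (GradedTensorProduct.of K (grading 𝒱) (grading 𝒱)).symm.toLinearMap)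
      = β.compl₁₂ f g := by
    refine LinearMap.ext₂ fun x y => ?_
    have := incL_mul_incR 𝒱 x y
    simp only [LinearMap.compr₂_apply, LinearMap.compl₁₂_apply, AlgHom.toLinearMap_apply,
      LinearMap.mul_apply', this, LinearMap.comp_apply, LinearEquiv.coe_coe,
      GradedTensorProduct.of_symm_of, TensorProduct.map_tmul, TensorProduct.lift.tmul]
  rw [e]
  rfl

variable {B : Type*} [Ring B] [Algebra K B] {ℬ : ZMod 2 → Submodule K B} [GradedAlgebra ℬ]

lemma evl_conv {a : V ⊗[K] R} (ha : a ∈ points 𝒱 ℛ π) (f : SSym 𝒱 →ₗ[K] B)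
    {g : SSym 𝒱 →ₗ[K] B} (hg : IsEven (grading 𝒱) ℬ g) :
    GradedTensorProduct.of K ℬ ℛ (evl ℛ a (conv f g))
      = GradedTensorProduct.of K ℬ ℛ (evl ℛ a f) * GradedTensorProduct.of K ℬ ℛ (evl ℛ a g) := by
  rw [of_mul_of, ← evl_comul hR ha _ _ hg]
  rfl

lemma evl_algHom {a : V ⊗[K] R} (ha : a ∈ points 𝒱 ℛ π) {F : SSym 𝒱 →ₐ[K] B}
    (hF : IsEven (grading 𝒱) ℬ F.toLinearMap) :
    GradedTensorProduct.of K ℬ ℛ (evl ℛ a F.toLinearMap)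
      = nexp K (GradedTensorProduct.of K ℬ ℛ ((F.toLinearMap ∘ₗ ι 𝒱).rTensor R a)) := by
  have h := of_symm_gmap ℛ F hF (nexp K (vec 𝒱 ℛ a))
  rw [map_nexp _ (isNilpotent_vec hR ha), vec, gmap_of, ← LinearMap.rTensor_comp_apply] at h
  rw [← GradedTensorProduct.symm_of_of ℬ ℛ (nexp K _), h]
  rfl

omit hR in
lemma isEven_cone : IsEven (grading 𝒱) ℬ (cone : SSym 𝒱 →ₗ[K] B) := by
  intro i x hx
  rw [cone_apply]
  rcases zmod2_cases i with rfl | rfl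
  · exact SetLike.algebraMap_mem_graded ℬ _
  · rw [eps_odd 𝒱 hx, map_zero]; exact zero_mem _

lemma evl_cone {a : V ⊗[K] R} (ha : a ∈ points 𝒱 ℛ π) (ℬ : ZMod 2 → Submodule K B)
    [GradedAlgebra ℬ] : evl ℛ a (cone : SSym 𝒱 →ₗ[K] B) = 1 ⊗ₜ 1 := by
  let F : SSym 𝒱 →ₐ[K] B := (Algebra.ofId K B).comp (eps 𝒱)
  have hF : IsEven (grading 𝒱) ℬ F.toLinearMap := isEven_cone
  have h0 : F.toLinearMap ∘ₗ ι 𝒱 = 0 := LinearMap.ext fun v => by simp [F]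
  have h := evl_algHom hR ha hF
  rw [h0, LinearMap.rTensor_zero, LinearMap.zero_apply, map_zero, nexp_zero] at h
  exact h

omit hR in
lemma cpow_succ' (f : SSym 𝒱 →ₗ[K] B) (n : ℕ) : cpow f (n + 1) = conv (cpow f n) f := by
  induction n with
  | zero => change conv f cone = conv cone f; rw [conv_cone, cone_conv]
  | succ n ih =>
    change conv f (cpow f (n + 1)) = conv (conv f (cpow f n)) f
    rw [ih, conv_assoc]

lemma evl_cpow {a : V ⊗[K] R} (ha : a ∈ points 𝒱 ℛ π) {f : SSym 𝒱 →ₗ[K] B}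
    (hf : IsEven (grading 𝒱) ℬ f) (n : ℕ) :
    GradedTensorProduct.of K ℬ ℛ (evl ℛ a (cpow f n))
      = (GradedTensorProduct.of K ℬ ℛ (evl ℛ a f)) ^ n := by
  induction n with
  | zero => rw [cpow, evl_cone hR ha ℬ, pow_zero]; rfl
  | succ n ih => rw [cpow_succ', evl_conv hR ha _ hf, ih, pow_succ]

omit hR in
/-- An element of `Sym V ⊗ R` involves words of bounded length. -/
lemma exists_rTensor_congr (y : SSym 𝒱 ⊗[K] R) : ∃ k, y ∈ LinearMap.range
    ((Fil 𝒱 k).subtype.rTensor R) := by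
  have mono : ∀ {k l : ℕ}, k ≤ l → LinearMap.range ((Fil 𝒱 k).subtype.rTensor R)
      ≤ LinearMap.range ((Fil 𝒱 l).subtype.rTensor R) := by
    rintro k l h _ ⟨z, rfl⟩
    refine ⟨(Submodule.inclusion (fil_mono 𝒱 h)).rTensor R z, ?_⟩
    rw [← LinearMap.rTensor_comp_apply]; rfl
  induction y using TensorProduct.induction_on with
  | zero => exact ⟨0, zero_mem _⟩
  | add x y hx hy =>
    obtain ⟨k, hk⟩ := hx
    obtain ⟨l, hl⟩ := hy
    exact ⟨max k l, add_mem (mono (le_max_left k l) hk) (mono (le_max_right k l) hl)⟩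
  | tmul x r =>
    obtain ⟨k, hk⟩ := exists_mem_fil 𝒱 x
    exact ⟨k, ⟨x, hk⟩ ⊗ₜ r, rfl⟩

omit hR in
lemma rTensor_congr {k : ℕ} {y : SSym 𝒱 ⊗[K] R}
    (hy : y ∈ LinearMap.range ((Fil 𝒱 k).subtype.rTensor R)) {f g : SSym 𝒱 →ₗ[K] M}
    (h : ∀ x ∈ Fil 𝒱 k, f x = g x) : f.rTensor R y = g.rTensor R y := by
  obtain ⟨z, rfl⟩ := hy
  rw [← LinearMap.rTensor_comp_apply, ← LinearMap.rTensor_comp_apply]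
  congr 2
  exact LinearMap.ext fun x => h x x.2

/-- The exponential of a function evaluates to the exponential of its value. -/
lemma evl_cexp (hB : ∀ i j, ∀ a ∈ ℬ i, ∀ b ∈ ℬ j, a * b = (-1 : ℤˣ) ^ (i * j) • (b * a))
    {a : V ⊗[K] R} (ha : a ∈ points 𝒱 ℛ π) {f : SSym 𝒱 →ₗ[K] B}
    (hf : IsEven (grading 𝒱) ℬ f) (f1 : f 1 = 0) :
    GradedTensorProduct.of K ℬ ℛ (evl ℛ a (cexp f))
      = nexp K (GradedTensorProduct.of K ℬ ℛ (evl ℛ a f)) := by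
  obtain ⟨n, hn⟩ := isNilpotent_of_mem_points hR hB
    (x := GradedTensorProduct.of K ℬ ℛ (evl ℛ a f)) (evl_mem_points hR ha hf f1)
  obtain ⟨k, hk⟩ := exists_rTensor_congr (gexp 𝒱 ℛ a)
  have h1 : evl ℛ a (cexp f) = evl ℛ a
      (∑ m ∈ Finset.range (max k n), (m.factorial : K)⁻¹ • cpow f m) :=
    rTensor_congr hk fun x hx => by
      rw [cexp_apply f1 (le_max_left k n) hx]; simp
  have h2 : ∀ s : Finset ℕ, evl ℛ a (∑ m ∈ s, (m.factorial : K)⁻¹ • cpow f m)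
      = ∑ m ∈ s, (m.factorial : K)⁻¹ • evl ℛ a (cpow f m) := by
    intro s
    classical
    induction s using Finset.induction_on with
    | empty => simp [evl]
    | insert m s hm ih =>
      rw [Finset.sum_insert hm, Finset.sum_insert hm, evl_add, ih, evl_smul]
  rw [h1, h2, nexp_eq_sum (N := max k n) (pow_eq_zero_of_le (le_max_right k n) hn), map_sum]
  refine Finset.sum_congr rfl fun m _ => ?_
  rw [map_smul, evl_cpow hR ha hf]

/-- Coalgebra morphisms send group-like elements to group-like elements. -/
lemma IsCoalgMap.evl_eq {F : SSym 𝒱 →ₗ[K] SSym 𝒲} (hF : IsCoalgMap F) {a : V ⊗[K] R}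
    (ha : a ∈ points 𝒱 ℛ π) : evl ℛ a F = gexp 𝒲 ℛ (evl ℛ a (tau 𝒲 ∘ₗ F)) := by
  have h := evl_cexp hR (supercomm 𝒲) ha hF.isEven_tau hF.tau_one
  rw [← hF.eq_cexp, evl_comp] at h
  rw [gexp, vec, ← h]
  rfl

lemma IsCoalgMap.mem_points {F : SSym 𝒱 →ₗ[K] SSym 𝒲} (hF : IsCoalgMap F) {a : V ⊗[K] R}
    (ha : a ∈ points 𝒱 ℛ π) : evl ℛ a (tau 𝒲 ∘ₗ F) ∈ points 𝒲 ℛ π :=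
  evl_mem_points hR ha ((SSym.isEven_tau 𝒲).comp hF.even) (by simp [hF.one, SSym.tau_one])

lemma IsCoalgMap.evl_comp {F : SSym 𝒱 →ₗ[K] SSym 𝒲} (hF : IsCoalgMap F) {a : V ⊗[K] R}
    (ha : a ∈ points 𝒱 ℛ π) (f : SSym 𝒲 →ₗ[K] M) :
    evl ℛ a (f ∘ₗ F) = evl ℛ (evl ℛ a (tau 𝒲 ∘ₗ F)) f := by
  rw [SSym.evl_comp, hF.evl_eq hR ha]; rfl

omit hR in
lemma kos_smul_one {𝒩 : ZMod 2 → Submodule K N} [DirectSum.Decomposition 𝒩]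
    (β : M →ₗ[K] N →ₗ[K] M) {n : N} (hn : n ∈ 𝒩 0) (h : ∀ m, β m n = m) (x : M ⊗[K] R) :
    kos ℛ 𝒩 β x (n ⊗ₜ 1) = x := by
  refine LinearMap.congr_fun (f := (kos ℛ 𝒩 β).flip (n ⊗ₜ 1)) (g := LinearMap.id)
    (TensorProduct.ext (LinearMap.ext fun m => hom_ext_homogeneous ℛ fun i r hr => ?_)) x
  have := kos_tmul_tmul ℛ β m hr hn 1
  rw [mul_zero, uzpow_zero, one_smul, mul_one, h] at this
  exact this

/-- The linear part of `exp(a)` is `a`. -/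
lemma evl_tau {a : V ⊗[K] R} (ha : a ∈ points 𝒱 ℛ π) : evl ℛ a (tau 𝒱) = a := by
  let η : SSym 𝒱 →ₐ[K] SSym 𝒱 := (Algebra.ofId K (SSym 𝒱)).comp (eps 𝒱)
  have hη : IsEven (grading 𝒱) (grading 𝒱) η.toLinearMap := isEven_cone (ℬ := grading 𝒱)
  have hη' : ∀ x, η x = algebraMap K _ (eps 𝒱 x) := fun _ => rfl
  have h1 : gmap ℛ η hη (nexpTail K (vec 𝒱 ℛ a)) = 1 := by
    refine map_nexpTail _ ?_
    have h0 : η.toLinearMap ∘ₗ ι 𝒱 = 0 := LinearMap.ext fun v => by simp [η]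
    rw [vec, gmap_of, ← LinearMap.rTensor_comp_apply, h0, LinearMap.rTensor_zero]
    rfl
  have h2 := of_symm_gmap ℛ η hη (nexpTail K (vec 𝒱 ℛ a))
  rw [h1] at h2
  have h3 : gexp 𝒱 ℛ a = 1 ⊗ₜ 1 + kos ℛ (grading 𝒱) ((LinearMap.mul K (SSym 𝒱)).compl₁₂ (ι 𝒱)
      LinearMap.id) a
      ((GradedTensorProduct.of K (grading 𝒱) ℛ).symm (nexpTail K (vec 𝒱 ℛ a))) := by
    rw [gexp, nexp_eq_one_add (isNilpotent_vec hR ha), map_add, of_symm_mul,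
      ← kos_rTensor ℛ (𝒩 := grading 𝒱) _ _ (fun _ _ h => h), LinearMap.rTensor_id]
    rfl
  let β : V →ₗ[K] SSym 𝒱 →ₗ[K] V := (LinearMap.lsmul K V).flip.compl₁₂ LinearMap.id
    (eps 𝒱).toLinearMap
  have e : ((LinearMap.mul K (SSym 𝒱)).compl₁₂ (ι 𝒱) LinearMap.id).compr₂ (tau 𝒱)
      = β.compl₁₂ LinearMap.id η.toLinearMap := by
    refine LinearMap.ext₂ fun v q => ?_
    simp [β, tau_ι_mul, hη']
  rw [evl, h3, map_add, LinearMap.rTensor_tmul, tau_one, TensorProduct.zero_tmul, zero_add,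
    rTensor_kos, e, ← kos_rTensor ℛ (𝒩 := grading 𝒱) _ _ hη, ← h2, LinearMap.rTensor_id]
  exact kos_smul_one β (SetLike.GradedOne.one_mem (A := grading 𝒱)) (fun m => by simp [β]) a

end Grouplike

end SSym

/-! ### The Maurer–Cartan equation -/

section MaurerCartan

variable {K : Type u} [Field K] [CharZero K] {V : Type v} [AddCommGroup V] [Module K V]
variable {𝒱 : ZMod 2 → Submodule K V} [DirectSum.Decomposition 𝒱]
variable {R : Type u} [Ring R] [Algebra K R] {ℛ : ZMod 2 → Submodule K R} [GradedAlgebra ℛ]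
variable {π : R →ₐ[K] K}

open SSym

/-- The Taylor coefficients of the Chevalley–Eilenberg codifferential. -/
lemma DGLie.tau_comp_Q (L : DGLie 𝒱) : tau 𝒱 ∘ₗ L.Q = L.d ∘ₗ tau 𝒱
    + (2⁻¹ : K) • (TensorProduct.lift L.br ∘ₗ TensorProduct.map (tau 𝒱) (tau 𝒱) ∘ₗ comul 𝒱) := by
  refine lin_ext 𝒱 (by simp [L.Q_one, comul_one, tau_one]) fun i v hv x _ => ?_
  have e1 : TensorProduct.lift L.br ∘ₗ TensorProduct.map (tau 𝒱 ∘ₗ lmul 𝒱 v) (tau 𝒱)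
      = L.br v ∘ₗ tau 𝒱 ∘ₗ (TensorProduct.lid K _).toLinearMap ∘ₗ
        (eps 𝒱).toLinearMap.rTensor _ :=
    TensorProduct.ext' fun p q => by simp [tau_ι_mul]
  have e2 : TensorProduct.lift L.br ∘ₗ TensorProduct.map (tau 𝒱 ∘ₗ twist (grading 𝒱) i)
        (tau 𝒱 ∘ₗ lmul 𝒱 v)
      = L.br v ∘ₗ tau 𝒱 ∘ₗ (TensorProduct.rid K _).toLinearMap ∘ₗ
        (eps 𝒱).toLinearMap.lTensor _ := by
    refine tensor_hom_ext (grading 𝒱) (grading 𝒱) fun j k p hp q hq => ?_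
    simp only [LinearMap.comp_apply, TensorProduct.map_tmul, TensorProduct.lift.tmul,
      LinearMap.mulLeft_apply, tau_ι_mul, tau_twist, LinearMap.lTensor_tmul, LinearEquiv.coe_coe,
      TensorProduct.rid_tmul, AlgHom.toLinearMap_apply, map_smul]
    rw [twist_mem 𝒱 (isEven_tau 𝒱 j p hp), L.br_symm i j v hv _ (isEven_tau 𝒱 j p hp),
      LinearMap.map_smul_of_tower]
    rfl
  have h1 := LinearMap.congr_fun e1 (comul 𝒱 x)
  have h2 := LinearMap.congr_fun e2 (comul 𝒱 x)
  simp only [LinearMap.comp_apply, rTensor_eps_comul, lTensor_eps_comul, LinearEquiv.coe_coe,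
    TensorProduct.lid_tmul, TensorProduct.rid_tmul, one_smul] at h1 h2
  simp only [LinearMap.comp_apply, LinearMap.add_apply, LinearMap.smul_apply]
  rw [L.tau_Q_ι_mul hv, comul_ι_mul 𝒱 hv, map_add, TensorProduct.map_map, TensorProduct.map_map,
    LinearMap.comp_id, map_add, h1, h2, tau_ι_mul, map_smul, ← two_smul K, smul_smul,
    inv_mul_cancel₀ two_ne_zero, one_smul]

/-- A point `a` satisfies the Maurer–Cartan equation iff the codifferential annihilates `exp(a)`. -/
lemma DGLie.evl_Q_eq_zero_iff (L : DGLie 𝒱) (hR : IsParam ℛ π) {a : V ⊗[K] R}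
    (ha : a ∈ points 𝒱 ℛ π) :
    evl ℛ a L.Q = 0 ↔ L.d.rTensor R a + (2⁻¹ : K) • kos ℛ 𝒱 L.br a a = 0 := by
  have h1 : evl ℛ a (tau 𝒱 ∘ₗ L.Q) = L.d.rTensor R a + (2⁻¹ : K) • kos ℛ 𝒱 L.br a a := by
    rw [L.tau_comp_Q, evl_add, evl_smul, evl_comul hR ha L.br _ (isEven_tau 𝒱), evl_comp,
      evl_tau hR ha]
  have h2 := IsCoalgMap.id.comp_coder L.isTwCoder_Q L.eps_Q L.hasParity_Q
  simp only [LinearMap.id_comp] at h2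
  rw [← h1]
  constructor
  · intro h; rw [evl_comp, h, map_zero]
  · intro h
    have h3 := evl_conv (ℬ := grading 𝒱) hR ha (ι 𝒱 ∘ₗ tau 𝒱 ∘ₗ L.Q) (g := LinearMap.id)
      (fun _ _ h => h)
    rw [← h2, evl_comp, h, map_zero, map_zero, zero_mul] at h3
    exact h3

variable {A : Type v} [Ring A] [Algebra K A] {𝒜 : ZMod 2 → Submodule K A} [GradedAlgebra 𝒜]

lemma extOp_of (D : A →ₗ[K] A) (x : A ⊗[K] R) :
    extOp ℛ D (GradedTensorProduct.of K 𝒜 ℛ x) = GradedTensorProduct.of K 𝒜 ℛ (D.rTensor R x) := rfl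

/-- The extension of the Batalin–Vilkovisky bracket to points. -/
lemma DGBV.of_kos_br (𝓑 : DGBV 𝒜) {a : A ⊗[K] R} (ha : a ∈ points 𝒜 ℛ π) (b : A ⊗[K] R) :
    GradedTensorProduct.of K 𝒜 ℛ (kos ℛ 𝒜 𝓑.br a b)
      = extOp ℛ 𝓑.Δ (GradedTensorProduct.of K 𝒜 ℛ a * GradedTensorProduct.of K 𝒜 ℛ b)
        - extOp ℛ 𝓑.Δ (GradedTensorProduct.of K 𝒜 ℛ a) * GradedTensorProduct.of K 𝒜 ℛ b
        - GradedTensorProduct.of K 𝒜 ℛ a * extOp ℛ 𝓑.Δ (GradedTensorProduct.of K 𝒜 ℛ b) := by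
  simp only [extOp_of, of_mul_of, ← map_sub]
  congr 1
  refine points_induction (P := fun a => kos ℛ 𝒜 𝓑.br a b = 𝓑.Δ.rTensor R
    (kos ℛ 𝒜 (LinearMap.mul K A) a b) - kos ℛ 𝒜 (LinearMap.mul K A) (𝓑.Δ.rTensor R a) b
      - kos ℛ 𝒜 (LinearMap.mul K A) a (𝓑.Δ.rTensor R b)) (by simp) ?_ ?_ ?_ ha
  · intro x y hx hy
    simp only [map_add, LinearMap.add_apply, hx, hy]; abel
  · intro c x hx
    simp only [map_smul, LinearMap.smul_apply, hx, smul_sub]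
  · intro i v hv r hr _
    refine LinearMap.congr_fun (f := kos ℛ 𝒜 𝓑.br (v ⊗ₜ r))
      (g := 𝓑.Δ.rTensor R ∘ₗ kos ℛ 𝒜 (LinearMap.mul K A) (v ⊗ₜ r)
        - kos ℛ 𝒜 (LinearMap.mul K A) (𝓑.Δ.rTensor R (v ⊗ₜ r))
        - kos ℛ 𝒜 (LinearMap.mul K A) (v ⊗ₜ r) ∘ₗ 𝓑.Δ.rTensor R)
      (TensorProduct.ext (hom_ext_homogeneous 𝒜 fun j w hw => LinearMap.ext fun s => ?_)) b
    change kos ℛ 𝒜 𝓑.br (v ⊗ₜ r) (w ⊗ₜ s) = 𝓑.Δ.rTensor R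
      (kos ℛ 𝒜 (LinearMap.mul K A) (v ⊗ₜ r) (w ⊗ₜ s))
        - kos ℛ 𝒜 (LinearMap.mul K A) (𝓑.Δ v ⊗ₜ r) (w ⊗ₜ s)
        - kos ℛ 𝒜 (LinearMap.mul K A) (v ⊗ₜ r) (𝓑.Δ w ⊗ₜ s)
    rw [kos_tmul_tmul ℛ _ _ hr hw, kos_tmul_tmul ℛ _ _ hr hw, kos_tmul_tmul ℛ _ _ hr hw,
      kos_tmul_tmul ℛ _ _ hr (𝓑.Δ_odd j w hw), 𝓑.br_apply hv, LinearMap.map_smul_of_tower]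
    simp only [LinearMap.rTensor_tmul, LinearMap.mul_apply', TensorProduct.sub_tmul, smul_sub,
      sign_smul_tmul, smul_smul]
    rw [mul_add, mul_one, uzpow_add]

/-- The Maurer–Cartan equation in a Batalin–Vilkovisky algebra. -/
lemma DGBV.isMC_iff (𝓑 : DGBV 𝒜) (hR : IsParam ℛ π) {a : A ⊗[K] R} (ha : a ∈ points 𝒜 ℛ π) :
    𝓑.IsMC ℛ (GradedTensorProduct.of K 𝒜 ℛ a) ↔ evl ℛ a 𝓑.toDGLie.Q = 0 := by
  rw [𝓑.toDGLie.evl_Q_eq_zero_iff hR ha, DGBV.IsMC, ← 𝓑.of_kos_br ha, extOp_of, ← map_smul,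
    ← map_add]
  exact (LinearEquiv.map_eq_zero_iff _)

end MaurerCartan

/-! ### Formal families of Batalin–Vilkovisky algebras -/

section DiffOp

variable {K : Type u} [Field K] {A : Type v} [Ring A] [Algebra K A]
variable {𝒜 : ZMod 2 → Submodule K A}

lemma superComm_add (p i : ZMod 2) (D E : A →ₗ[K] A) (a : A) :
    superComm p i (D + E) a = superComm p i D a + superComm p i E a := by
  refine LinearMap.ext fun y => ?_
  simp only [superComm_apply, LinearMap.add_apply, mul_add, smul_add]; abel

lemma superComm_zero (p i : ZMod 2) (a : A) : superComm p i (0 : A →ₗ[K] A) a = 0 := by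
  refine LinearMap.ext fun y => ?_
  simp [superComm_apply]

lemma isDiffOp_zero (n : ℕ) (p : ZMod 2) : IsDiffOp 𝒜 n p 0 := by
  induction n generalizing p with
  | zero => exact fun i a _ => superComm_zero p i a
  | succ n ih => exact fun i a _ => by rw [superComm_zero]; exact ih _

lemma IsDiffOp.add {n : ℕ} {p : ZMod 2} {D E : A →ₗ[K] A} (hD : IsDiffOp 𝒜 n p D)
    (hE : IsDiffOp 𝒜 n p E) : IsDiffOp 𝒜 n p (D + E) := by
  induction n generalizing p D E with
  | zero => exact fun i a ha => by rw [superComm_add, hD i a ha, hE i a ha, add_zero]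
  | succ n ih => exact fun i a ha => by rw [superComm_add]; exact ih (hD i a ha) (hE i a ha)

lemma isDiffOp_sum {ι : Type*} (s : Finset ι) {n : ℕ} {p : ZMod 2} (D : ι → A →ₗ[K] A)
    (hD : ∀ i, IsDiffOp 𝒜 n p (D i)) : IsDiffOp 𝒜 n p (∑ i ∈ s, D i) := by
  classical
  induction s using Finset.induction_on with
  | empty => exact isDiffOp_zero n p
  | insert i s hi ih => rw [Finset.sum_insert hi]; exact (hD i).add ih

end DiffOp

section PS

variable {K : Type u} [Field K] {A : Type v} [Ring A] [Algebra K A]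
variable (𝒜 : ZMod 2 → Submodule K A) [GradedAlgebra 𝒜]

/-- The coefficient of `uⁿ` as a linear map. -/
def cf (K : Type u) [Field K] {A : Type v} [Ring A] [Algebra K A] (n : ℕ) : A⟦X⟧ →ₗ[K] A where
  toFun p := PowerSeries.coeff n p
  map_add' _ _ := map_add _ _ _
  map_smul' _ _ := rfl

lemma cf_apply (n : ℕ) (p : A⟦X⟧) : cf K n p = PowerSeries.coeff n p := rfl

lemma ps_ext (K : Type u) [Field K] {A : Type v} [Ring A] [Algebra K A] {p q : A⟦X⟧}
    (h : ∀ n, cf K n p = cf K n q) : p = q := PowerSeries.ext h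

/-- A linear map applied to all coefficients. -/
def mapC {A' : Type*} [Ring A'] [Algebra K A'] (D : A →ₗ[K] A') : A⟦X⟧ →ₗ[K] A'⟦X⟧ where
  toFun p := PowerSeries.mk fun n => D (PowerSeries.coeff n p)
  map_add' p q := PowerSeries.ext fun n => by simp
  map_smul' c p := PowerSeries.ext fun n => by
    change _ = c • PowerSeries.coeff n (PowerSeries.mk fun n => D (PowerSeries.coeff n p))
    rw [PowerSeries.coeff_mk, PowerSeries.coeff_mk]
    exact D.map_smul c (cf K n p)

lemma cf_mapC {A' : Type v} [Ring A'] [Algebra K A'] (D : A →ₗ[K] A') (n : ℕ) (p : A⟦X⟧) :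
    cf K n (mapC D p) = D (cf K n p) :=
  PowerSeries.coeff_mk n fun n => D (PowerSeries.coeff n p)

/-- Multiplication by `u`. -/
def mulX : A⟦X⟧ →ₗ[K] A⟦X⟧ := LinearMap.mulLeft K PowerSeries.X

lemma mulX_apply (p : A⟦X⟧) : mulX (K := K) p = PowerSeries.X * p := rfl

lemma cf_zero_mulX (p : A⟦X⟧) : cf K 0 (mulX (K := K) p) = 0 := PowerSeries.coeff_zero_X_mul p

lemma cf_succ_mulX (n : ℕ) (p : A⟦X⟧) : cf K (n + 1) (mulX (K := K) p) = cf K n p :=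
  PowerSeries.coeff_succ_X_mul n p

lemma mulX_mul (p q : A⟦X⟧) : mulX (K := K) p * q = mulX (K := K) (p * q) := mul_assoc _ _ _

lemma mul_mulX (p q : A⟦X⟧) : p * mulX (K := K) q = mulX (K := K) (p * q) := by
  rw [mulX_apply, mulX_apply, ← mul_assoc, (PowerSeries.commute_X p).eq, mul_assoc]

lemma mulX_injective : Function.Injective (mulX (K := K) (A := A)) := fun _ _ h =>
  PowerSeries.X_mul_cancel h

lemma mapC_mulX (D : A →ₗ[K] A) (p : A⟦X⟧) : mapC D (mulX (K := K) p) = mulX (K := K) (mapC D p) := by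
  refine ps_ext K fun n => ?_
  rcases n with - | n
  · rw [cf_mapC, cf_zero_mulX, cf_zero_mulX, map_zero]
  · rw [cf_mapC, cf_succ_mulX, cf_succ_mulX, cf_mapC]

/-- The parity grading of `A⟦u⟧`. -/
def psGrading (i : ZMod 2) : Submodule K A⟦X⟧ where
  carrier := {p | ∀ n, cf K n p ∈ 𝒜 i}
  add_mem' {_ _} hp hq n := by rw [map_add]; exact add_mem (hp n) (hq n)
  zero_mem' n := by rw [map_zero]; exact zero_mem _
  smul_mem' c p hp n := by rw [map_smul]; exact Submodule.smul_mem _ _ (hp n)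

lemma isCompl_psGrading : IsCompl (psGrading 𝒜 0) (psGrading 𝒜 1) := by
  constructor
  · rw [Submodule.disjoint_def]
    intro p h0 h1
    refine ps_ext K fun n => ?_
    rw [← comp_same 𝒜 (h0 n), comp_ne 𝒜 (h1 n) (by decide), map_zero]
  · rw [codisjoint_iff, eq_top_iff]
    rintro p -
    have h : p = mapC (comp 𝒜 0) p + mapC (comp 𝒜 1) p := ps_ext K fun n => by
      rw [map_add, cf_mapC, cf_mapC, comp_add]
    rw [h]
    exact Submodule.add_mem_sup (fun n => by rw [cf_mapC]; exact comp_mem 𝒜 0 _)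
      (fun n => by rw [cf_mapC]; exact comp_mem 𝒜 1 _)

lemma cf_mul (n : ℕ) (p q : A⟦X⟧) : cf K n (p * q)
    = ∑ x ∈ Finset.HasAntidiagonal.antidiagonal n, cf K x.1 p * cf K x.2 q :=
  PowerSeries.coeff_mul n p q

instance : GradedAlgebra (psGrading 𝒜) where
  one_mem n := by
    rw [cf_apply (K := K), PowerSeries.coeff_one]
    split
    · exact SetLike.GradedOne.one_mem
    · exact zero_mem _
  mul_mem i j p q hp hq n := by
    rw [cf_mul]
    exact sum_mem fun x _ => SetLike.mul_mem_graded (hp x.1) (hq x.2)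
  toDecomposition := decompositionOfIsCompl _ (isCompl_psGrading 𝒜)

variable {𝒜}

lemma hasParity_mapC {j : ZMod 2} {D : A →ₗ[K] A} (hD : ∀ i, ∀ a ∈ 𝒜 i, D a ∈ 𝒜 (i + j)) (i : ZMod 2)
    (p : A⟦X⟧) (hp : p ∈ psGrading 𝒜 i) : mapC D p ∈ psGrading 𝒜 (i + j) :=
  fun n => by rw [cf_mapC]; exact hD i _ (hp n)

lemma isEven_mulX : IsEven (psGrading 𝒜) (psGrading 𝒜) (mulX (K := K)) := fun i p hp n => by
  rcases n with - | n
  · rw [cf_zero_mulX]; exact zero_mem _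
  · rw [cf_succ_mulX]; exact hp n

lemma isEven_cf (n : ℕ) : IsEven (psGrading 𝒜) 𝒜 (cf K n) := fun _ _ hp => hp n

lemma parity_mulX (p : A⟦X⟧) :
    parity (psGrading 𝒜) (mulX (K := K) p) = mulX (K := K) (parity (psGrading 𝒜) p) :=
  isEven_mulX.parity_apply p

lemma cf_sign_smul (n : ℕ) (s : ℤˣ) (p : A⟦X⟧) : cf K n (s • p) = s • cf K n p :=
  LinearMap.map_smul_of_tower _ _ _

/-- Power series of operators act on power series. To see that this is an action, `A` is embedded
into its operators by left multiplication, and evaluation at `1` is a retraction. -/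
def psAct (D : (Module.End K A)⟦X⟧) : A⟦X⟧ →ₗ[K] A⟦X⟧ where
  toFun p := PowerSeries.mk fun n =>
    PowerSeries.coeff n (D * PowerSeries.map (Algebra.lmul K A).toRingHom p) 1
  map_add' p q := PowerSeries.ext fun n => by simp [mul_add]
  map_smul' c p := PowerSeries.ext fun n => by
    change _ = c • PowerSeries.coeff n (PowerSeries.mk fun n =>
      PowerSeries.coeff n (D * PowerSeries.map (Algebra.lmul K A).toRingHom p) 1)
    simp only [PowerSeries.coeff_mk, PowerSeries.coeff_mul, LinearMap.sum_apply,
      PowerSeries.coeff_map]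
    rw [Finset.smul_sum]
    refine Finset.sum_congr rfl fun x _ => ?_
    change PowerSeries.coeff x.1 D (cf K x.2 (c • p) * 1) = c • PowerSeries.coeff x.1 D (cf K x.2 p * 1)
    rw [map_smul, smul_mul_assoc, map_smul]

lemma cf_psAct (D : (Module.End K A)⟦X⟧) (n : ℕ) (p : A⟦X⟧) : cf K n (psAct D p)
    = PowerSeries.coeff n (D * PowerSeries.map (Algebra.lmul K A).toRingHom p) 1 :=
  PowerSeries.coeff_mk n fun n =>
    PowerSeries.coeff n (D * PowerSeries.map (Algebra.lmul K A).toRingHom p) 1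

lemma superComm_psAct (q i : ZMod 2) (D : (Module.End K A)⟦X⟧) (a : A⟦X⟧) :
    superComm q i (psAct D) a = psAct (D * PowerSeries.map (Algebra.lmul K A).toRingHom a
      - (-1 : ℤˣ) ^ (q * i) • (PowerSeries.map (Algebra.lmul K A).toRingHom a * D)) := by
  refine LinearMap.ext fun p => ps_ext K fun n => ?_
  have e : ∀ E : (Module.End K A)⟦X⟧, a * PowerSeries.mk (fun n => PowerSeries.coeff n E 1)
      = PowerSeries.mk fun n => PowerSeries.coeff n
        (PowerSeries.map (Algebra.lmul K A).toRingHom a * E) 1 := by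
    intro E
    refine PowerSeries.ext fun n => ?_
    simp only [PowerSeries.coeff_mk, PowerSeries.coeff_mul, LinearMap.sum_apply,
      PowerSeries.coeff_map]
    rfl
  have e2 : cf K n (a * psAct D p) = PowerSeries.coeff n
        (PowerSeries.map (Algebra.lmul K A).toRingHom a
          * (D * PowerSeries.map (Algebra.lmul K A).toRingHom p)) 1 := by
    have := congrArg (cf K n) (e (D * PowerSeries.map (Algebra.lmul K A).toRingHom p))
    rw [cf_apply (K := K) n (PowerSeries.mk _), PowerSeries.coeff_mk] at this
    exact this
  rw [superComm_apply, map_sub, cf_sign_smul, e2, cf_psAct, cf_psAct,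
    map_mul (PowerSeries.map (Algebra.lmul K A).toRingHom) a p, sub_mul, map_sub,
    LinearMap.sub_apply, mul_assoc, smul_mul_assoc, mul_assoc]
  rfl

lemma coeff_superComm_psAct (q i : ZMod 2) (D : (Module.End K A)⟦X⟧) (a : A⟦X⟧) (m : ℕ) :
    PowerSeries.coeff m
    (D * PowerSeries.map (Algebra.lmul K A).toRingHom a
      - (-1 : ℤˣ) ^ (q * i) • (PowerSeries.map (Algebra.lmul K A).toRingHom a * D))
    = ∑ x ∈ Finset.HasAntidiagonal.antidiagonal m,
      superComm q i (PowerSeries.coeff x.1 D) (PowerSeries.coeff x.2 a) := by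
  have h : PowerSeries.coeff m (PowerSeries.map (Algebra.lmul K A).toRingHom a * D)
      = ∑ x ∈ Finset.HasAntidiagonal.antidiagonal m,
        LinearMap.mulLeft K (PowerSeries.coeff x.2 a) ∘ₗ PowerSeries.coeff x.1 D := by
    rw [PowerSeries.coeff_mul, ← Finset.Nat.sum_antidiagonal_swap]
    rfl
  have hs : PowerSeries.coeff m ((-1 : ℤˣ) ^ (q * i) •
      (PowerSeries.map (Algebra.lmul K A).toRingHom a * D)) = (-1 : ℤˣ) ^ (q * i) •
      PowerSeries.coeff m (PowerSeries.map (Algebra.lmul K A).toRingHom a * D) := by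
    rcases Int.units_eq_one_or ((-1 : ℤˣ) ^ (q * i)) with e | e <;> simp [e]
  rw [map_sub, hs, h, PowerSeries.coeff_mul, Finset.smul_sum, ← Finset.sum_sub_distrib]
  rfl

lemma isDiffOp_psAct {n : ℕ} {q : ZMod 2} {D : (Module.End K A)⟦X⟧}
    (hD : ∀ k, IsDiffOp 𝒜 n q (PowerSeries.coeff k D)) : IsDiffOp (psGrading 𝒜) n q (psAct D) := by
  induction n generalizing q D with
  | zero =>
    intro i a ha
    rw [superComm_psAct]
    have : (D * PowerSeries.map (Algebra.lmul K A).toRingHom a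
        - (-1 : ℤˣ) ^ (q * i) • (PowerSeries.map (Algebra.lmul K A).toRingHom a * D)) = 0 := by
      refine PowerSeries.ext fun m => ?_
      rw [coeff_superComm_psAct, map_zero]
      exact Finset.sum_eq_zero fun x _ => hD x.1 i _ (ha x.2)
    rw [this]
    refine LinearMap.ext fun p => ps_ext K fun m => ?_
    rw [cf_psAct, zero_mul]; simp
  | succ n ih =>
    intro i a ha
    rw [superComm_psAct]
    refine ih fun k => ?_
    rw [coeff_superComm_psAct]
    exact isDiffOp_sum _ _ fun x => hD x.1 i _ (ha x.2)

lemma mapC_eq_psAct (D : A →ₗ[K] A) : mapC D = psAct (PowerSeries.C (R := Module.End K A) D) := by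
  refine LinearMap.ext fun p => ps_ext K fun n => ?_
  rw [cf_mapC, cf_psAct, PowerSeries.coeff_C_mul, PowerSeries.coeff_map]
  change _ = D (cf K n p * 1)
  rw [mul_one]

lemma IsDiffOp.mapC {n : ℕ} {q : ZMod 2} {D : A →ₗ[K] A} (hD : IsDiffOp 𝒜 n q D) :
    IsDiffOp (psGrading 𝒜) n q (mapC D) := by
  rw [mapC_eq_psAct]
  refine isDiffOp_psAct fun k => ?_
  rw [PowerSeries.coeff_C]
  split
  · exact hD
  · exact isDiffOp_zero n q

end PS

namespace DGBV

section PSBV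

variable {K : Type u} [Field K] {A : Type v} [Ring A] [Algebra K A]
variable {𝒜 : ZMod 2 → Submodule K A} [GradedAlgebra 𝒜] (𝓑 : DGBV 𝒜)

/-- The dg Batalin–Vilkovisky algebra `(A⟦u⟧, d, Δ)`. -/
def ps : DGBV (psGrading 𝒜) where
  supercomm i j p hp q hq := ps_ext K fun n => by
    rw [cf_sign_smul, cf_mul, cf_mul, ← Finset.Nat.sum_antidiagonal_swap, Finset.smul_sum]
    exact Finset.sum_congr rfl fun x _ => 𝓑.supercomm i j _ (hp _) _ (hq _)
  d := mapC 𝓑.d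
  Δ := mapC 𝓑.Δ
  d_odd := hasParity_mapC 𝓑.d_odd
  Δ_odd := hasParity_mapC 𝓑.Δ_odd
  d_one := ps_ext K fun n => by
    rw [cf_mapC, cf_apply (K := K) n 1, PowerSeries.coeff_one]
    split <;> simp [𝓑.d_one]
  Δ_one := ps_ext K fun n => by
    rw [cf_mapC, cf_apply (K := K) n 1, PowerSeries.coeff_one]
    split <;> simp [𝓑.Δ_one]
  d_order := 𝓑.d_order.mapC
  Δ_order := 𝓑.Δ_order.mapC
  d_sq p := ps_ext K fun n => by rw [cf_mapC, cf_mapC, 𝓑.d_sq, map_zero]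
  Δ_sq p := ps_ext K fun n => by rw [cf_mapC, cf_mapC, 𝓑.Δ_sq, map_zero]
  d_Δ p := ps_ext K fun n => by rw [map_add, cf_mapC, cf_mapC, cf_mapC, cf_mapC, 𝓑.d_Δ, map_zero]

lemma ps_d : 𝓑.ps.d = mapC 𝓑.d := rfl

lemma ps_Δ : 𝓑.ps.Δ = mapC 𝓑.Δ := rfl

lemma ps_br_apply (p q : A⟦X⟧) : 𝓑.ps.br p q
    = mapC 𝓑.Δ (p * q) - mapC 𝓑.Δ p * q - parity (psGrading 𝒜) p * mapC 𝓑.Δ q := rfl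

lemma br_mulX (p q : A⟦X⟧) : 𝓑.ps.br (mulX (K := K) p) q = mulX (K := K) (𝓑.ps.br p q) := by
  rw [ps_br_apply, ps_br_apply, parity_mulX, mapC_mulX, mulX_mul, mulX_mul, mulX_mul, mapC_mulX,
    map_sub, map_sub]

lemma br_mulX_right (p q : A⟦X⟧) : 𝓑.ps.br p (mulX (K := K) q) = mulX (K := K) (𝓑.ps.br p q) := by
  rw [ps_br_apply, ps_br_apply, mapC_mulX, mul_mulX, mul_mulX, mul_mulX, mapC_mulX, map_sub,
    map_sub]

/-- The dg Lie algebra `A⟦u⟧` with differential `d + uΔ`. -/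
def psLie : DGLie (psGrading 𝒜) where
  d := mapC 𝓑.d + mulX ∘ₗ mapC 𝓑.Δ
  br := 𝓑.ps.br
  d_odd i p hp := add_mem (𝓑.ps.d_odd i p hp) (isEven_mulX _ _ (𝓑.ps.Δ_odd i p hp))
  d_sq p := by
    have h := 𝓑.ps.d_Δ p
    have h1 := 𝓑.ps.d_sq p
    have h2 := 𝓑.ps.Δ_sq p
    rw [ps_d, ps_Δ] at h
    rw [ps_d] at h1
    rw [ps_Δ] at h2
    change mapC 𝓑.d (mapC 𝓑.d p + mulX (K := K) (mapC 𝓑.Δ p))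
      + mulX (K := K) (mapC 𝓑.Δ (mapC 𝓑.d p + mulX (K := K) (mapC 𝓑.Δ p))) = 0
    rw [map_add, map_add, mapC_mulX, mapC_mulX, h1, h2, map_zero, add_zero, zero_add, ← map_add, h,
      map_zero]
  br_odd := 𝓑.ps.br_odd
  br_symm := 𝓑.ps.br_symm
  leibniz i p hp q := by
    have h1 : mapC 𝓑.d (𝓑.ps.br p q) = -𝓑.ps.br (mapC 𝓑.d p) q
        - (-1 : ℤˣ) ^ i • 𝓑.ps.br p (mapC 𝓑.d q) := 𝓑.ps.toDGLie.leibniz i p hp q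
    have h2 : mapC 𝓑.Δ (𝓑.ps.br p q) = -𝓑.ps.br (mapC 𝓑.Δ p) q
        - (-1 : ℤˣ) ^ i • 𝓑.ps.br p (mapC 𝓑.Δ q) := by
      refine homogeneous_induction (psGrading 𝒜) (P := fun q => mapC 𝓑.Δ (𝓑.ps.br p q)
        = -𝓑.ps.br (mapC 𝓑.Δ p) q - (-1 : ℤˣ) ^ i • 𝓑.ps.br p (mapC 𝓑.Δ q))
        (fun q r hq hr => ?_) (fun j q hq => 𝓑.ps.Δ_br hp hq) q
      simp only [map_add, hq, hr, smul_add]; abel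
    simp only [LinearMap.add_apply, LinearMap.comp_apply, map_add, h1, h2, map_sub, map_neg,
      br_mulX, br_mulX_right, LinearMap.map_smul_of_tower, smul_add]
    abel
  jacobi := 𝓑.ps.toDGLie.jacobi

lemma psLie_d_apply (p : A⟦X⟧) : 𝓑.psLie.d p = mapC 𝓑.d p + mulX (K := K) (mapC 𝓑.Δ p) := rfl

lemma psLie_d_mulX (p : A⟦X⟧) : 𝓑.psLie.d (mulX (K := K) p) = mulX (K := K) (𝓑.psLie.d p) := by
  rw [psLie_d_apply, psLie_d_apply, mapC_mulX, mapC_mulX, map_add]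

lemma cf_zero_psLie_d (p : A⟦X⟧) : cf K 0 (𝓑.psLie.d p) = 𝓑.d (cf K 0 p) := by
  rw [psLie_d_apply, map_add, cf_zero_mulX, cf_mapC, add_zero]

lemma cf_succ_psLie_d (n : ℕ) (p : A⟦X⟧) :
    cf K (n + 1) (𝓑.psLie.d p) = 𝓑.d (cf K (n + 1) p) + 𝓑.Δ (cf K n p) := by
  rw [psLie_d_apply, map_add, cf_succ_mulX, cf_mapC, cf_mapC]

/-- The failure of `d + uΔ` to be a derivation is `u` times the bracket. -/
lemma psLie_d_mul {i : ZMod 2} {p : A⟦X⟧} (hp : p ∈ psGrading 𝒜 i) (q : A⟦X⟧) :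
    𝓑.psLie.d (p * q) = 𝓑.psLie.d p * q + (-1 : ℤˣ) ^ i • (p * 𝓑.psLie.d q)
      + mulX (K := K) (𝓑.ps.br p q) := by
  have h1 : mapC 𝓑.d (p * q) = mapC 𝓑.d p * q + (-1 : ℤˣ) ^ i • (p * mapC 𝓑.d q) :=
    𝓑.ps.d_mul hp q
  have h2 : mapC 𝓑.Δ (p * q) = 𝓑.ps.br p q + mapC 𝓑.Δ p * q + (-1 : ℤˣ) ^ i • (p * mapC 𝓑.Δ q) := by
    rw [𝓑.ps.br_apply hp, ps_Δ]; abel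
  rw [psLie_d_apply, psLie_d_apply, psLie_d_apply, h1, h2]
  simp only [map_add, add_mul, mul_add, smul_add, mulX_mul, mul_mulX, LinearMap.map_smul_of_tower]
  abel

/-- The bracket is a derivation in its second variable. -/
lemma br_mul {i j : ZMod 2} {a b : A} (ha : a ∈ 𝒜 i) (hb : b ∈ 𝒜 j) (y : A) :
    𝓑.br a (b * y) = 𝓑.br a b * y + (-1 : ℤˣ) ^ ((i + 1) * j) • (b * 𝓑.br a y) := by
  have h := 𝓑.X_mul ha hb y
  have hc := 𝓑.supercomm _ _ _ (𝓑.Δ_odd i a ha) _ hb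
  rw [𝓑.X_eq ha, 𝓑.X_eq ha, mul_add, smul_add, ← mul_assoc, ← mul_assoc, hc, smul_mul_assoc,
    ← add_assoc] at h
  exact add_right_cancel h

end PSBV

end DGBV

/-! ### Linearization of the dg Lie algebra `A⟦u⟧` -/

namespace SSym

section CoalgMapLinear

variable {K : Type u} [Field K] [CharZero K] {V : Type v} [AddCommGroup V] [Module K V]
variable {𝒱 : ZMod 2 → Submodule K V} [DirectSum.Decomposition 𝒱]
variable {W : Type w} [AddCommGroup W] [Module K W]
variable {𝒲 : ZMod 2 → Submodule K W} [DirectSum.Decomposition 𝒲]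

lemma cexp_ι {g : SSym 𝒱 →ₗ[K] W} (g1 : g 1 = 0) (v : V) :
    cexp (ι 𝒲 ∘ₗ g) (ι 𝒱 v) = ι 𝒲 (g (ι 𝒱 v)) := by
  have h0 : (ι 𝒲 ∘ₗ g) 1 = 0 := by simp [g1]
  rw [cexp_apply h0 le_rfl (ι_mem_fil 𝒱 v), Finset.sum_range_succ, Finset.sum_range_one]
  have h1 : cpow (ι 𝒲 ∘ₗ g) 1 = ι 𝒲 ∘ₗ g := conv_cone _
  rw [h1]
  simp [cpow, cone_apply]

end CoalgMapLinear

section DividedPower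

variable {K : Type u} [Field K] [CharZero K] {A : Type v} [Ring A] [Algebra K A]
variable (𝒜 : ZMod 2 → Submodule K A) [GradedAlgebra 𝒜]

/-- The map `Sym A → Symⁿ A → A`, `a₁ ⋯ aₙ ↦ a₁ ⋯ aₙ`, given by the product of `A`. -/
def prodLen (n : ℕ) : SSym 𝒜 →ₗ[K] A := (n.factorial : K)⁻¹ • cpow (tau 𝒜) n

lemma prodLen_zero : prodLen 𝒜 0 = cone := by simp [prodLen, cpow]

lemma prodLen_one_eq : prodLen 𝒜 1 = tau 𝒜 := by
  have : cpow (tau 𝒜) 1 = tau 𝒜 := conv_cone _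
  simp [prodLen, this]

lemma prodLen_eq_zero {n k : ℕ} (h : k ≤ n) {x : SSym 𝒜} (hx : x ∈ Fil 𝒜 k) :
    prodLen 𝒜 n x = 0 := by
  rw [prodLen, LinearMap.smul_apply, cpow_eq_zero_of_le (tau_one 𝒜) h hx, smul_zero]

lemma isEven_cpow {V : Type*} [AddCommGroup V] [Module K V] {𝒱 : ZMod 2 → Submodule K V}
    [DirectSum.Decomposition 𝒱] {f : SSym 𝒱 →ₗ[K] A} (hf : IsEven (grading 𝒱) 𝒜 f) (n : ℕ) :
    IsEven (grading 𝒱) 𝒜 (cpow f n) := by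
  have hp : ∀ n, twist 𝒜 1 ∘ₗ cpow f n = cpow f n ∘ₗ twist (grading 𝒱) 1 := by
    intro n
    induction n with
    | zero =>
      exact (isEven_cone (ℬ := 𝒜)).twist_comp 1
    | succ n ih =>
      have hm : ∀ x y : A, twist 𝒜 1 (x * y) = twist 𝒜 1 x * twist 𝒜 1 y := by
        intro x y
        refine homogeneous_induction 𝒜 (P := fun x => twist 𝒜 1 (x * y) = twist 𝒜 1 x * twist 𝒜 1 y)
          (fun a b ha hb => by rw [add_mul, map_add, ha, hb, map_add, add_mul]) (fun i x hx => ?_) x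
        refine homogeneous_induction 𝒜 (P := fun y => twist 𝒜 1 (x * y) = twist 𝒜 1 x * twist 𝒜 1 y)
          (fun a b ha hb => by rw [mul_add, map_add, ha, hb, map_add, mul_add]) (fun j y hy => ?_) y
        rw [twist_mem 𝒜 hx, twist_mem 𝒜 hy, twist_mem 𝒜 (SetLike.mul_mem_graded hx hy), one_mul,
          one_mul, one_mul, smul_mul_assoc, mul_smul_comm, smul_smul, uzpow_add]
      have h1 : twist 𝒜 1 ∘ₗ conv f (cpow f n) = conv (twist 𝒜 1 ∘ₗ f) (twist 𝒜 1 ∘ₗ cpow f n) := by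
        refine LinearMap.ext fun x => ?_
        rw [conv_def, conv_def, TensorProduct.map_comp]
        simp only [LinearMap.comp_apply]
        generalize TensorProduct.map f (cpow f n) (comul 𝒱 x) = t
        refine LinearMap.congr_fun (f := twist 𝒜 1 ∘ₗ LinearMap.mul' K A)
          (g := LinearMap.mul' K A ∘ₗ TensorProduct.map (twist 𝒜 1) (twist 𝒜 1))
          (TensorProduct.ext' fun a b => ?_) t
        simpa using hm a b
      rw [cpow, h1, ih, hf.twist_comp, ← conv_comp_twist]
  intro i x hx
  have h := LinearMap.congr_fun (hp n) x
  simp only [LinearMap.comp_apply] at h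
  rw [twist_mem _ hx, one_mul, LinearMap.map_smul_of_tower, twist_one] at h
  rw [← comp_add 𝒜 (cpow f n x)] at h ⊢
  rw [map_add, parity_mem 𝒜 (comp_mem 𝒜 0 _), parity_mem 𝒜 (comp_mem 𝒜 1 _)] at h
  have h2 : ∀ y : A, y = -y → y = 0 := fun y hy => by
    have h3 : (2 : K) • y = 0 := by rw [two_smul]; nth_rw 1 [hy]; exact neg_add_cancel y
    exact (smul_eq_zero.1 h3).resolve_left two_ne_zero
  rcases zmod2_cases i with rfl | rfl
  · simp only [uzpow_zero, one_smul, uzpow_one, Units.neg_smul] at h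
    rw [h2 _ (add_left_cancel h).symm, add_zero]; exact comp_mem 𝒜 0 _
  · simp only [uzpow_zero, one_smul, uzpow_one, Units.neg_smul, neg_add] at h
    rw [h2 _ (add_right_cancel h), zero_add]; exact comp_mem 𝒜 1 _

lemma isEven_prodLen (n : ℕ) : IsEven (grading 𝒜) 𝒜 (prodLen 𝒜 n) := fun i x hx =>
  Submodule.smul_mem _ _ (isEven_cpow 𝒜 (isEven_tau 𝒜) n i x hx)

variable {𝒜} (hA : ∀ i j, ∀ a ∈ 𝒜 i, ∀ b ∈ 𝒜 j, a * b = (-1 : ℤˣ) ^ (i * j) • (b * a))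

include hA in
lemma prodLen_ι_mul (n : ℕ) (v : A) (x : SSym 𝒜) :
    prodLen 𝒜 (n + 1) (ι 𝒜 v * x) = v * prodLen 𝒜 n x := by
  refine homogeneous_induction 𝒜 (P := fun v => prodLen 𝒜 (n + 1) (ι 𝒜 v * x) = v * prodLen 𝒜 n x)
    (fun v w hv hw => by rw [map_add, add_mul, map_add, hv, hw, add_mul]) (fun i v hv => ?_) v
  have hp : tau 𝒜 ∘ₗ lmul 𝒜 v = LinearMap.mulLeft K v ∘ₗ cone := by
    refine LinearMap.ext fun y => ?_
    simp [tau_ι_mul, cone_apply, Algebra.algebraMap_eq_smul_one]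
  have h := cpow_comp_coder (ℬ := 𝒜) hA (isEven_tau 𝒜) (isTwCoder_lmul hv) (by simp) (by
    intro k y hy
    rw [add_comm]
    exact isEven_tau 𝒜 _ _ (SetLike.mul_mem_graded (ι_mem 𝒜 hv) hy)) n
  rw [hp, conv_mulLeft, cone_conv] at h
  have h := LinearMap.congr_fun h x
  simp only [LinearMap.comp_apply, LinearMap.smul_apply, LinearMap.mulLeft_apply] at h
  rw [prodLen, LinearMap.smul_apply, h, prodLen, LinearMap.smul_apply, mul_smul_comm, smul_smul]
  congr 1
  rw [Nat.factorial_succ, Nat.cast_mul, mul_inv_rev, mul_assoc, inv_mul_cancel₀, mul_one]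
  exact_mod_cast Nat.succ_ne_zero n

lemma prodLen_zero_ι_mul (v : A) (x : SSym 𝒜) : prodLen 𝒜 0 (ι 𝒜 v * x) = 0 := by
  simp [prodLen_zero, cone_apply]

end DividedPower

end SSym

namespace DGBV

section Linearization

variable {K : Type u} [Field K] [CharZero K] {A : Type v} [Ring A] [Algebra K A]
variable {𝒜 : ZMod 2 → Submodule K A} [GradedAlgebra 𝒜] (𝓑 : DGBV 𝒜)

open SSym

lemma br_one (a : A) : 𝓑.br a 1 = 0 := by
  change 𝓑.Δ (a * 1) - 𝓑.Δ a * 1 - parity 𝒜 a * 𝓑.Δ 1 = 0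
  rw [𝓑.Δ_one, mul_one, mul_one, mul_zero, sub_self, sub_zero]

/-- The bracket is a derivation, so the products are compatible with the adjoint action. -/
lemma prodLen_ad (n : ℕ) (L : DGLie 𝒜) (hL : L.br = 𝓑.br) {i : ZMod 2} {a : A} (ha : a ∈ 𝒜 i)
    (x : SSym 𝒜) : prodLen 𝒜 n (L.ad a x) = 𝓑.br a (prodLen 𝒜 n x) := by
  refine word_induction 𝒜 (P := fun x => ∀ n, prodLen 𝒜 n (L.ad a x) = 𝓑.br a (prodLen 𝒜 n x))
    (fun n => ?_) (fun c x hx n => by simp only [map_smul, hx])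
    (fun x y hx hy n => by simp only [map_add, hx, hy]) (fun j b hb x hx n => ?_) x n
  · rw [L.ad_one, map_zero]
    rcases n with - | n
    · rw [prodLen_zero, cone_apply, map_one, map_one, br_one]
    · rw [prodLen_eq_zero 𝒜 (Nat.le_add_left 1 n) (one_mem_fil 𝒜 0), map_zero]
  · rw [L.ad_ι_mul ha hb, map_add, LinearMap.map_smul_of_tower, hL]
    rcases n with - | n
    · simp only [prodLen_zero_ι_mul, map_zero, smul_zero, add_zero]
    · rw [prodLen_ι_mul 𝓑.supercomm, prodLen_ι_mul 𝓑.supercomm, prodLen_ι_mul 𝓑.supercomm, hx,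
        𝓑.br_mul ha hb]

end Linearization

section FormalLinearization

variable {K : Type u} [Field K] [CharZero K] {A : Type v} [Ring A] [Algebra K A]
variable {𝒜 : ZMod 2 → Submodule K A} [GradedAlgebra 𝒜] (𝓑 : DGBV 𝒜)

open SSym

/-- The abelian dg Lie algebra `(A⟦u⟧, d + uΔ)`. -/
def psAb : DGLie (psGrading 𝒜) := DGLie.ofDiff 𝓑.psLie.d 𝓑.psLie.d_odd 𝓑.psLie.d_sq

/-- The part of the codifferential of `A⟦u⟧` that comes from the bracket. -/
def psQBr : SSym (psGrading 𝒜) →ₗ[K] SSym (psGrading 𝒜) := 𝓑.psLie.Q - 𝓑.psAb.Q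

lemma psQBr_one : 𝓑.psQBr 1 = 0 := by simp [psQBr, DGLie.Q_one]

lemma psQBr_ι_mul {i : ZMod 2} {p : A⟦X⟧} (hp : p ∈ psGrading 𝒜 i) (x : SSym (psGrading 𝒜)) :
    𝓑.psQBr (ι _ p * x) = (-1 : ℤˣ) ^ i • (ι _ p * 𝓑.psQBr x) + 𝓑.psLie.ad p x := by
  rw [psQBr, LinearMap.sub_apply, DGLie.Q_ι_mul, DGLie.Q_ι_mul_abelian _ (fun _ _ => rfl) hp,
    parity_mem _ hp, LinearMap.map_smul_of_tower, smul_mul_assoc, LinearMap.sub_apply, mul_sub,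
    smul_sub]
  change ι _ (𝓑.psLie.d p) * x + _ + _ - (ι _ (𝓑.psLie.d p) * x + _) = _
  abel

lemma prodLen_zero_psQBr (x : SSym (psGrading 𝒜)) : prodLen _ 0 (𝓑.psQBr x) = 0 := by
  rw [prodLen_zero, cone_apply, psQBr, LinearMap.sub_apply, map_sub, DGLie.eps_Q, DGLie.eps_Q,
    sub_self, map_zero]

/-- Up to `u` times the contribution of the bracket, the products are compatible with `d + uΔ`. -/
lemma prodLen_psAb_Q (n : ℕ) (x : SSym (psGrading 𝒜)) :
    prodLen _ (n + 1) (𝓑.psAb.Q x)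
      = 𝓑.psLie.d (prodLen _ (n + 1) x) - mulX (K := K) (prodLen _ n (𝓑.psQBr x)) := by
  have hE0 : ∀ x, prodLen _ 0 (𝓑.psAb.Q x) = 0 := fun x => by
    rw [prodLen_zero, cone_apply, DGLie.eps_Q, map_zero]
  have hd1 : 𝓑.psLie.d 1 = 0 := by
    have h1 := 𝓑.ps.d_one
    have h2 := 𝓑.ps.Δ_one
    rw [ps_d] at h1
    rw [ps_Δ] at h2
    rw [psLie_d_apply, h1, h2, map_zero, add_zero]
  have hD0 : ∀ x : SSym (psGrading 𝒜), 𝓑.psLie.d (prodLen _ 0 x) = 0 := fun x => by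
    rw [prodLen_zero, cone_apply, Algebra.algebraMap_eq_smul_one, map_smul, hd1, smul_zero]
  refine word_induction (psGrading 𝒜) (P := fun x => ∀ n, prodLen _ (n + 1) (𝓑.psAb.Q x)
      = 𝓑.psLie.d (prodLen _ (n + 1) x) - mulX (K := K) (prodLen _ n (𝓑.psQBr x)))
    (fun n => ?_) (fun c x hx n => by simp only [map_smul, hx, smul_sub])
    (fun x y hx hy n => by simp only [map_add, hx, hy]; abel) (fun i p hp x hx n => ?_) x n
  · rw [DGLie.Q_one, psQBr_one, map_zero, map_zero, map_zero, sub_zero,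
      prodLen_eq_zero _ (Nat.le_add_left 1 n) (one_mem_fil _ 0), map_zero]
  · have hs : (𝓑.psAb.Q (ι _ p * x)) = ι _ (𝓑.psLie.d p) * x + (-1 : ℤˣ) ^ i • (ι _ p * 𝓑.psAb.Q x) :=
      DGLie.Q_ι_mul_abelian _ (fun _ _ => rfl) hp x
    have had := 𝓑.ps.prodLen_ad n 𝓑.psLie rfl hp x
    rw [hs, 𝓑.psQBr_ι_mul hp, map_add, map_add, LinearMap.map_smul_of_tower,
      LinearMap.map_smul_of_tower, prodLen_ι_mul 𝓑.ps.supercomm, prodLen_ι_mul 𝓑.ps.supercomm,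
      prodLen_ι_mul 𝓑.ps.supercomm, 𝓑.psLie_d_mul hp, had, map_add, LinearMap.map_smul_of_tower]
    rcases n with - | n
    · rw [hE0, hD0, prodLen_zero_ι_mul, mul_zero, smul_zero, map_zero, smul_zero]
      abel
    · rw [prodLen_ι_mul 𝓑.ps.supercomm, hx n, mul_sub, smul_sub, mul_mulX]
      abel

/-- A section of `A⟦u⟧ → A`, `u ↦ 0`, over the differentials `d + uΔ` and `d`. -/
structure IsSection (s : A →ₗ[K] A⟦X⟧) : Prop where
  even : IsEven 𝒜 (psGrading 𝒜) s
  cf_zero : ∀ a, cf K 0 (s a) = a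
  closed : ∀ a, 𝓑.psLie.d (s a) = s (𝓑.d a)

/-- The operator `p ↦ (p - p₀) / u`. -/
def divX : A⟦X⟧ →ₗ[K] A⟦X⟧ where
  toFun p := PowerSeries.mk fun n => cf K (n + 1) p
  map_add' p q := PowerSeries.ext fun n => by
    simp only [map_add, PowerSeries.coeff_mk]
  map_smul' c p := PowerSeries.ext fun n => by
    change _ = c • PowerSeries.coeff n (PowerSeries.mk fun n => cf K (n + 1) p)
    rw [PowerSeries.coeff_mk, PowerSeries.coeff_mk, map_smul]

lemma cf_divX (n : ℕ) (p : A⟦X⟧) : cf K n (divX (K := K) p) = cf K (n + 1) p :=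
  PowerSeries.coeff_mk n fun n => cf K (n + 1) p

/-- The operator `p ↦ (p - s(p₀)) / u`. -/
def rho (s : A →ₗ[K] A⟦X⟧) : A⟦X⟧ →ₗ[K] A⟦X⟧ := divX ∘ₗ (LinearMap.id - s ∘ₗ cf K 0)

lemma cf_rho (s : A →ₗ[K] A⟦X⟧) (n : ℕ) (p : A⟦X⟧) :
    cf K n (rho s p) = cf K (n + 1) (p - s (cf K 0 p)) :=
  cf_divX n _

variable {𝓑} {s : A →ₗ[K] A⟦X⟧}

namespace IsSection

variable (hs : 𝓑.IsSection s)
include hs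

lemma mulX_rho (p : A⟦X⟧) : mulX (K := K) (rho s p) = p - s (cf K 0 p) := by
  refine ps_ext K fun n => ?_
  rcases n with - | n
  · rw [cf_zero_mulX, map_sub, hs.cf_zero, sub_self]
  · rw [cf_succ_mulX, cf_rho]

omit hs in
lemma rho_mulX (p : A⟦X⟧) : rho s (mulX (K := K) p) = p := by
  refine ps_ext K fun n => ?_
  rw [cf_rho, cf_zero_mulX, map_zero, sub_zero, cf_succ_mulX]

lemma d_rho (p : A⟦X⟧) : 𝓑.psLie.d (rho s p) = rho s (𝓑.psLie.d p) := by
  refine mulX_injective (K := K) ?_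
  rw [← psLie_d_mulX, hs.mulX_rho, hs.mulX_rho, map_sub, hs.closed, cf_zero_psLie_d]

lemma isEven_rho : IsEven (psGrading 𝒜) (psGrading 𝒜) (rho s) := fun i p hp n => by
  rw [cf_rho]
  exact sub_mem hp (hs.even i _ (hp 0)) (n + 1)

end IsSection

/-- The Taylor coefficients `∑ₙ ρⁿ(a₁ ⋯ aₙ₊₁)` of the linearization of `A⟦u⟧`: if `s` is a section,
it replaces `u (exp(a / u) - 1)` by a representative without negative powers of `u`. -/
def linCoeff (s : A →ₗ[K] A⟦X⟧) : SSym (psGrading 𝒜) →ₗ[K] A⟦X⟧ where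
  toFun x := ∑ᶠ n : ℕ, (rho s ^ n) (prodLen (psGrading 𝒜) (n + 1) x)
  map_add' x y := by
    have fin : ∀ x : SSym (psGrading 𝒜), (Function.support fun n : ℕ =>
        (rho s ^ n) (prodLen (psGrading 𝒜) (n + 1) x)).Finite := fun x => by
      obtain ⟨k, hk⟩ := exists_mem_fil _ x
      refine (Set.finite_lt_nat k).subset fun n hn => ?_
      by_contra h
      exact hn (by simp only [prodLen_eq_zero _ ((not_lt.1 h).trans n.le_succ) hk, map_zero])
    rw [← finsum_add_distrib (fin x) (fin y)]
    exact finsum_congr fun n => by rw [map_add, map_add]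
  map_smul' c x := by
    rw [RingHom.id_apply, smul_finsum c]
    exact finsum_congr fun n => by rw [map_smul, map_smul]

lemma linCoeff_apply {k N : ℕ} (hkN : k ≤ N) {x : SSym (psGrading 𝒜)}
    (hx : x ∈ Fil (psGrading 𝒜) k) : linCoeff s x
      = ∑ n ∈ Finset.range N, (rho s ^ n) (prodLen (psGrading 𝒜) (n + 1) x) := by
  refine finsum_eq_sum_of_support_subset _ fun n hn => ?_
  by_contra h
  simp only [Finset.coe_range, Set.mem_Iio, not_lt] at h
  exact hn (by simp only [prodLen_eq_zero _ ((hkN.trans h).trans n.le_succ) hx, map_zero])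

lemma linCoeff_one : linCoeff s (1 : SSym (psGrading 𝒜)) = 0 := by
  rw [linCoeff_apply le_rfl (one_mem_fil _ 0), Finset.sum_range_one,
    prodLen_eq_zero _ le_rfl (one_mem_fil _ 0), map_zero]

lemma linCoeff_ι (p : A⟦X⟧) : linCoeff s (ι (psGrading 𝒜) p) = p := by
  rw [linCoeff_apply le_rfl (ι_mem_fil _ p), Finset.sum_range_succ, Finset.sum_range_one,
    prodLen_eq_zero _ le_rfl (ι_mem_fil _ p), prodLen_one_eq, tau_ι, map_zero, add_zero]
  rfl

namespace IsSection

variable (hs : 𝓑.IsSection s)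
include hs

lemma isEven_linCoeff : IsEven (grading (psGrading 𝒜)) (psGrading 𝒜) (linCoeff s) := by
  intro i x hx
  obtain ⟨k, hk⟩ := exists_mem_fil _ x
  rw [linCoeff_apply le_rfl hk]
  refine sum_mem fun n _ => ?_
  have h : ∀ n p, p ∈ psGrading 𝒜 i → (rho s ^ n) p ∈ psGrading 𝒜 i := by
    intro n
    induction n with
    | zero => exact fun p hp => hp
    | succ n ih =>
      intro p hp
      rw [pow_succ, Module.End.mul_apply]
      exact ih _ (hs.isEven_rho i p hp)
  exact h n _ (isEven_prodLen _ _ i x hx)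

lemma d_rho_pow (n : ℕ) (p : A⟦X⟧) : 𝓑.psLie.d ((rho s ^ n) p) = (rho s ^ n) (𝓑.psLie.d p) := by
  induction n generalizing p with
  | zero => rfl
  | succ n ih => rw [pow_succ, Module.End.mul_apply, Module.End.mul_apply, ih, hs.d_rho]

/-- The contributions of the bracket telescope. -/
lemma linCoeff_Q (x : SSym (psGrading 𝒜)) :
    linCoeff s (𝓑.psLie.Q x) = 𝓑.psLie.d (linCoeff s x) := by
  obtain ⟨k, hk⟩ := exists_mem_fil _ x
  obtain ⟨l, hl⟩ := exists_mem_fil _ (𝓑.psLie.Q x)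
  obtain ⟨m, hm⟩ := exists_mem_fil _ (𝓑.psQBr x)
  set N := max k (max l m) with hN
  have hkN : k ≤ N := le_max_left _ _
  have hlN : l ≤ N := (le_max_left l m).trans (le_max_right _ _)
  have hmN : m ≤ N := (le_max_right l m).trans (le_max_right _ _)
  rw [linCoeff_apply hlN hl, linCoeff_apply hkN hk, map_sum]
  have hQ : 𝓑.psLie.Q x = 𝓑.psAb.Q x + 𝓑.psQBr x := by
    rw [psQBr, LinearMap.sub_apply]; abel
  let c : ℕ → A⟦X⟧ := fun n => (rho s ^ n) (mulX (K := K) (prodLen _ n (𝓑.psQBr x)))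
  have hc : ∀ n, (rho s ^ n) (prodLen _ (n + 1) (𝓑.psQBr x)) = c (n + 1) := fun n => by
    simp only [c]
    rw [pow_succ, Module.End.mul_apply, rho_mulX]
  have h0 : c 0 = 0 := by
    simp only [c]
    rw [prodLen_zero_psQBr, map_zero, map_zero]
  have hNz : c N = 0 := by
    simp only [c]
    rw [prodLen_eq_zero _ hmN hm, map_zero, map_zero]
  have ht : ∑ n ∈ Finset.range N, (c (n + 1) - c n) = 0 := by
    rw [Finset.sum_range_sub, hNz, h0, sub_zero]
  rw [← sub_eq_zero, ← Finset.sum_sub_distrib, ← ht]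
  refine Finset.sum_congr rfl fun n _ => ?_
  rw [hQ, map_add, map_add, hc, prodLen_psAb_Q, map_sub, hs.d_rho_pow]
  simp only [c]
  abel

end IsSection

/-- The linearization of the dg Lie algebra `A⟦u⟧` defined by a section. -/
def linearize (s : A →ₗ[K] A⟦X⟧) : SSym (psGrading 𝒜) →ₗ[K] SSym (psGrading 𝒜) :=
  cexp (ι (psGrading 𝒜) ∘ₗ linCoeff s)

namespace IsSection

variable (hs : 𝓑.IsSection s)
include hs

lemma isCoalgMap_linearize : IsCoalgMap (linearize (𝒜 := 𝒜) s) :=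
  isCoalgMap_cexp hs.isEven_linCoeff linCoeff_one

lemma linearize_bijective : Function.Bijective (linearize (𝒜 := 𝒜) s) :=
  hs.isCoalgMap_linearize.bijective fun p => by rw [linearize, cexp_ι linCoeff_one, linCoeff_ι]

lemma linearize_Q : linearize s ∘ₗ 𝓑.psLie.Q = 𝓑.psAb.Q ∘ₗ linearize s := by
  refine hs.isCoalgMap_linearize.intertwine 𝓑.psLie.isTwCoder_Q 𝓑.psLie.eps_Q 𝓑.psLie.hasParity_Q
    𝓑.psAb.isTwCoder_Q 𝓑.psAb.eps_Q 𝓑.psAb.hasParity_Q fun x => ?_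
  have h : tau _ ∘ₗ 𝓑.psAb.Q = 𝓑.psLie.d ∘ₗ tau _ := by
    refine lin_ext _ (by simp [DGLie.Q_one, tau_one]) fun i v hv x _ => ?_
    rw [LinearMap.comp_apply, DGLie.tau_Q_ι_mul _ hv, LinearMap.comp_apply, tau_ι_mul, map_smul]
    exact add_zero _
  have h' := LinearMap.congr_fun h (linearize s x)
  simp only [LinearMap.comp_apply] at h'
  rw [h', linearize, tau_cexp linCoeff_one, tau_cexp linCoeff_one, hs.linCoeff_Q]

end IsSection

end FormalLinearization

end DGBV

/-! ### Degeneration and sections -/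

section Truncated

variable {K : Type u} [Field K]

/-- The coefficient of `uᵏ` on `K[u]/(uᴺ)`, for `k < N`. -/
def truncCoeff (N k : ℕ) (hk : k < N) :
    (Polynomial K ⧸ Ideal.span {(Polynomial.X : Polynomial K) ^ N}) →ₗ[K] K :=
  ((Ideal.span {(Polynomial.X : Polynomial K) ^ N}).restrictScalars K).liftQ
      (Polynomial.lcoeff K k) (fun p hp => by
        obtain ⟨q, rfl⟩ := Ideal.mem_span_singleton.1 hp
        simp [Polynomial.coeff_X_pow_mul', hk]) ∘ₗ
    (Submodule.Quotient.restrictScalarsEquiv K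
      (Ideal.span {(Polynomial.X : Polynomial K) ^ N})).symm.toLinearMap

lemma truncCoeff_mk (N k : ℕ) (hk : k < N) (p : Polynomial K) :
    truncCoeff N k hk (Ideal.Quotient.mk _ p) = p.coeff k := rfl

/-- In a free module over `K[u]/(uᴺ⁺¹)`, the kernel of `uᴺ` is the image of `u`. -/
lemma exists_smul_of_pow_smul_eq_zero {N : ℕ} {M : Type*} [AddCommGroup M]
    [Module (Polynomial K ⧸ Ideal.span {(Polynomial.X : Polynomial K) ^ (N + 1)}) M]
    [Module.Free (Polynomial K ⧸ Ideal.span {(Polynomial.X : Polynomial K) ^ (N + 1)}) M] {x : M}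
    (hx : (Ideal.Quotient.mk (Ideal.span {(Polynomial.X : Polynomial K) ^ (N + 1)})
      Polynomial.X) ^ N • x = 0) :
    ∃ y : M, x = (Ideal.Quotient.mk (Ideal.span {(Polynomial.X : Polynomial K) ^ (N + 1)})
      Polynomial.X) • y := by
  set t := Ideal.Quotient.mk (Ideal.span {(Polynomial.X : Polynomial K) ^ (N + 1)}) Polynomial.X
    with ht
  have hdiv : ∀ r, t ^ N * r = 0 → ∃ s, r = t * s := by
    intro r hr
    obtain ⟨p, rfl⟩ := Ideal.Quotient.mk_surjective r
    rw [ht, ← map_pow, ← map_mul, Ideal.Quotient.eq_zero_iff_dvd, pow_succ] at hr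
    obtain ⟨q, rfl⟩ := (mul_dvd_mul_iff_left (pow_ne_zero N Polynomial.X_ne_zero)).1 hr
    exact ⟨Ideal.Quotient.mk _ q, by rw [map_mul]⟩
  let b := Module.Free.chooseBasis
    (Polynomial K ⧸ Ideal.span {(Polynomial.X : Polynomial K) ^ (N + 1)}) M
  have hb : ∀ i, ∃ s, b.repr x i = t * s := fun i => hdiv _ (by
    have := congrArg (fun y => b.repr y i) hx
    simpa using this)
  choose g hg using hb
  refine ⟨∑ i ∈ (b.repr x).support, g i • b i, ?_⟩
  conv_lhs => rw [← b.linearCombination_repr x, Finsupp.linearCombination_apply, Finsupp.sum]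
  rw [Finset.smul_sum]
  exact Finset.sum_congr rfl fun i _ => by rw [hg i, mul_smul]

end Truncated

namespace DGBV

section Degenerate

variable {K : Type u} [Field K] {A : Type v} [Ring A] [Algebra K A]
variable {𝒜 : ZMod 2 → Submodule K A} [GradedAlgebra 𝒜] (𝓑 : DGBV 𝒜)

/-- The coefficient of `uᵏ` on `A[u]/(uᴺ)`. -/
def truncCf (N k : ℕ) (hk : k < N) :
    ((Polynomial K ⧸ Ideal.span {(Polynomial.X : Polynomial K) ^ N}) ⊗[K] A) →ₗ[K] A :=
  (TensorProduct.lid K A).toLinearMap ∘ₗ (truncCoeff N k hk).rTensor A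

lemma truncCf_tmul (N k : ℕ) (hk : k < N) (p : Polynomial K) (a : A) :
    truncCf N k hk (Ideal.Quotient.mk _ p ⊗ₜ[K] a) = p.coeff k • a := by
  simp [truncCf, truncCoeff_mk]

lemma diffMod_tmul (N : ℕ) (p : Polynomial K) (a : A) :
    𝓑.diffMod N (Ideal.Quotient.mk _ p ⊗ₜ[K] a) = Ideal.Quotient.mk _ p ⊗ₜ[K] 𝓑.d a
      + Ideal.Quotient.mk _ (Polynomial.X * p) ⊗ₜ[K] 𝓑.Δ a := by
  rw [diffMod, LinearMap.add_apply, LinearMap.smul_apply, LinearMap.baseChange_tmul,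
    LinearMap.baseChange_tmul, TensorProduct.smul_tmul', map_mul, smul_eq_mul]

lemma trunc_induction {N : ℕ} {P : ((Polynomial K ⧸ Ideal.span {(Polynomial.X : Polynomial K) ^ N})
    ⊗[K] A) → Prop} (add : ∀ x y, P x → P y → P (x + y))
    (tmul : ∀ p a, P (Ideal.Quotient.mk _ p ⊗ₜ[K] a))
    (x : (Polynomial K ⧸ Ideal.span {(Polynomial.X : Polynomial K) ^ N}) ⊗[K] A) : P x := by
  induction x using TensorProduct.induction_on with
  | zero => simpa using tmul 0 0
  | add x y hx hy => exact add x y hx hy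
  | tmul r a =>
    obtain ⟨p, rfl⟩ := Ideal.Quotient.mk_surjective r
    exact tmul p a

lemma truncCf_diffMod (N k : ℕ) (hk : k + 1 < N)
    (x : (Polynomial K ⧸ Ideal.span {(Polynomial.X : Polynomial K) ^ N}) ⊗[K] A) :
    truncCf N (k + 1) hk (𝓑.diffMod N x)
      = 𝓑.d (truncCf N (k + 1) hk x) + 𝓑.Δ (truncCf N k (k.lt_succ_self.trans hk) x) := by
  refine trunc_induction (P := fun x => truncCf N (k + 1) hk (𝓑.diffMod N x)
      = 𝓑.d (truncCf N (k + 1) hk x) + 𝓑.Δ (truncCf N k (k.lt_succ_self.trans hk) x))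
    (fun x y hx hy => ?_) (fun p a => ?_) x
  · simp only [map_add, hx, hy]; abel
  · rw [diffMod_tmul, map_add, truncCf_tmul, truncCf_tmul, truncCf_tmul, truncCf_tmul, map_smul,
      map_smul, Polynomial.coeff_X_mul]

lemma truncCf_X_smul (N k : ℕ) (hk : k + 1 < N)
    (x : (Polynomial K ⧸ Ideal.span {(Polynomial.X : Polynomial K) ^ N}) ⊗[K] A) :
    truncCf N (k + 1) hk ((Ideal.Quotient.mk (Ideal.span {(Polynomial.X : Polynomial K) ^ N})
      Polynomial.X) • x) = truncCf (A := A) N k (k.lt_succ_self.trans hk) x := by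
  refine trunc_induction (P := fun x => truncCf N (k + 1) hk ((Ideal.Quotient.mk
      (Ideal.span {(Polynomial.X : Polynomial K) ^ N}) Polynomial.X) • x)
      = truncCf (A := A) N k (k.lt_succ_self.trans hk) x)
    (fun x y hx hy => ?_) (fun p a => ?_) x
  · simp only [smul_add, map_add, hx, hy]
  · rw [TensorProduct.smul_tmul', smul_eq_mul, ← map_mul, truncCf_tmul, truncCf_tmul,
      Polynomial.coeff_X_mul]

/-- Degeneration makes the obstruction to prolonging a `(d + uΔ)`-cocycle of finite order vanish. -/
lemma exists_prolongation (hdeg : 𝓑.HasDegeneration) (N : ℕ) (c : ℕ → A) (h0 : 𝓑.d (c 0) = 0)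
    (hc : ∀ k < N, 𝓑.d (c (k + 1)) + 𝓑.Δ (c k) = 0) : ∃ b, 𝓑.Δ (c N) = 𝓑.d b := by
  have := hdeg (N + 2) (by omega)
  set I := Ideal.span {(Polynomial.X : Polynomial K) ^ (N + 2)} with hI
  set t := Ideal.Quotient.mk I Polynomial.X with ht
  have htz : ∀ a : A, Ideal.Quotient.mk I (Polynomial.X ^ (N + 2)) ⊗ₜ[K] a = 0 := fun a => by
    rw [Ideal.Quotient.eq_zero_iff_mem.2 (Ideal.mem_span_singleton_self _),
      TensorProduct.zero_tmul]
  -- the cocycle `u (c₀ + ⋯ + c_N u ^ N)` modulo `u ^ (N + 2)`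
  let w : (Polynomial K ⧸ I) ⊗[K] A := ∑ k ∈ Finset.range (N + 1),
    Ideal.Quotient.mk I (Polynomial.X ^ (k + 1)) ⊗ₜ[K] c k
  have hw : 𝓑.diffMod (N + 2) w = 0 := by
    have e : ∀ n ≤ N, 𝓑.diffMod (N + 2) (∑ k ∈ Finset.range (n + 1),
        Ideal.Quotient.mk I (Polynomial.X ^ (k + 1)) ⊗ₜ[K] c k)
        = Ideal.Quotient.mk I (Polynomial.X ^ (n + 2)) ⊗ₜ[K] 𝓑.Δ (c n) := by
      intro n
      induction n with
      | zero =>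
        intro _
        rw [Finset.sum_range_one, diffMod_tmul, h0, TensorProduct.tmul_zero, zero_add, ← pow_succ']
      | succ n ih =>
        intro hn
        rw [Finset.sum_range_succ, map_add, ih (by omega), diffMod_tmul, ← add_assoc,
          ← TensorProduct.tmul_add, add_comm (𝓑.Δ _), hc n (by omega), TensorProduct.tmul_zero,
          zero_add, ← pow_succ']
    rw [e N le_rfl, htz]
  have hwk : (t ^ (N + 1)) • Coh.mk (𝓑.diffMod (N + 2)) ⟨w, hw⟩ = 0 := by
    rw [← map_smul]
    have : t ^ (N + 1) • (⟨w, hw⟩ : LinearMap.ker (𝓑.diffMod (N + 2))) = 0 := by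
      refine Subtype.ext ?_
      change t ^ (N + 1) • w = 0
      rw [Finset.smul_sum]
      refine Finset.sum_eq_zero fun k _ => ?_
      rw [TensorProduct.smul_tmul', smul_eq_mul, ht, ← map_pow, ← map_mul, ← pow_add,
        show N + 1 + (k + 1) = N + 2 + k by omega, pow_add, map_mul,
        Ideal.Quotient.eq_zero_iff_mem.2 (Ideal.mem_span_singleton_self _), zero_mul,
        TensorProduct.zero_tmul]
    rw [this, map_zero]
  obtain ⟨y, hy⟩ := exists_smul_of_pow_smul_eq_zero hwk
  obtain ⟨⟨b, hb⟩, rfl⟩ := Submodule.mkQ_surjective _ y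
  rw [← map_smul, ← sub_eq_zero, ← map_sub] at hy
  obtain ⟨e, he⟩ : ∃ e, 𝓑.diffMod (N + 2) e = w - t • b := (Submodule.Quotient.mk_eq_zero _).1 hy
  have h1 := congrArg (truncCf (N + 2) (N + 1) (by omega)) he
  rw [truncCf_diffMod, map_sub, truncCf_X_smul] at h1
  have h2 := congrArg (truncCf (N + 2) (N + 1) (by omega)) (LinearMap.mem_ker.1 hb)
  rw [truncCf_diffMod, map_zero] at h2
  have h3 : truncCf (N + 2) (N + 1) (by omega) w = c N := by
    simp only [w]
    rw [map_sum, Finset.sum_range_succ, Finset.sum_eq_zero, zero_add, truncCf_tmul]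
    · simp
    · intro k hk
      rw [truncCf_tmul, Polynomial.coeff_X_pow, if_neg, zero_smul]
      have := Finset.mem_range.1 hk
      omega
  rw [h3] at h1
  generalize truncCf (N + 2) (N + 1) _ e = e1 at h1
  generalize truncCf (N + 2) N _ e = e0 at h1
  generalize truncCf (N + 2) (N + 1) _ b = b1 at h2
  generalize truncCf (N + 2) N _ b = b0 at h1 h2
  have h4 := congrArg 𝓑.Δ h1
  rw [map_add, 𝓑.Δ_sq, add_zero, map_sub] at h4
  refine ⟨-b1 - 𝓑.Δ e1, ?_⟩
  have h5 := 𝓑.d_Δ e1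
  rw [map_sub, map_neg, eq_neg_of_add_eq_zero_left h2, eq_neg_of_add_eq_zero_left h5, h4]
  abel

/-- Elements of `A` as constant power series. -/
def constC : A →ₗ[K] A⟦X⟧ where
  toFun a := PowerSeries.C a
  map_add' a b := map_add _ a b
  map_smul' c a := ps_ext K fun n => by
    change PowerSeries.coeff n (PowerSeries.C (c • a)) = c • PowerSeries.coeff n (PowerSeries.C a)
    rw [PowerSeries.coeff_C, PowerSeries.coeff_C, smul_ite, smul_zero]

lemma cf_constC (n : ℕ) (a : A) : cf K n (constC (K := K) a) = if n = 0 then a else 0 :=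
  PowerSeries.coeff_C n a

lemma isEven_constC : IsEven 𝒜 (psGrading 𝒜) (constC (K := K)) := fun i a ha n => by
  rw [cf_constC]; split
  · exact ha
  · exact zero_mem _

variable {𝓑} {κ : A →ₗ[K] A}

/-- A lift of the harmonic vectors to `(d + uΔ)`-cocycles extends to a section. -/
lemma isSection_of_harmonic (hκ : IsContraction 𝒜 𝓑.d κ) {s₀ : A →ₗ[K] A⟦X⟧}
    (even : IsEven 𝒜 (psGrading 𝒜) s₀)
    (hcf : ∀ a, 𝓑.d a = 0 → cf K 0 (s₀ a) = a) (hd : ∀ a, 𝓑.d a = 0 → 𝓑.psLie.d (s₀ a) = 0) :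
    𝓑.IsSection (constC ∘ₗ κ ∘ₗ 𝓑.d + 𝓑.psLie.d ∘ₗ constC ∘ₗ κ + s₀ ∘ₗ harmonic 𝓑.d κ) where
  even i a ha := by
    have e : i + 1 + 1 = i := by rw [add_assoc, zmod2_one_add_one, add_zero]
    have h1 := isEven_constC (K := K) _ _ (hκ.odd _ _ (𝓑.d_odd i a ha))
    have h2 := 𝓑.psLie.d_odd _ _ (isEven_constC (K := K) _ _ (hκ.odd i a ha))
    rw [e] at h1 h2
    exact add_mem (add_mem h1 h2) (even i _ (isEven_harmonic 𝓑.d_odd hκ i a ha))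
  cf_zero a := by
    simp only [LinearMap.add_apply, LinearMap.comp_apply, map_add]
    rw [cf_zero_psLie_d, cf_constC, cf_constC, if_pos rfl, if_pos rfl,
      hcf _ (diff_harmonic 𝓑.d_sq hκ a), harmonic_apply]
    abel
  closed a := by
    simp only [LinearMap.add_apply, LinearMap.comp_apply, map_add]
    rw [hd _ (diff_harmonic 𝓑.d_sq hκ a), harmonic_diff 𝓑.d_sq hκ, 𝓑.psLie.d_sq, 𝓑.d_sq]
    simp

lemma exists_isSection (hdeg : 𝓑.HasDegeneration) : ∃ s : A →ₗ[K] A⟦X⟧, 𝓑.IsSection s := by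
  obtain ⟨κ, hκ⟩ := exists_isContraction 𝓑.d_odd 𝓑.d_sq
  let τ : Module.End K A := -(κ ∘ₗ 𝓑.Δ)
  let s₀ : A →ₗ[K] A⟦X⟧ :=
    { toFun := fun a => PowerSeries.mk fun n => (τ ^ n) a
      map_add' := fun a b => PowerSeries.ext fun n => by simp
      map_smul' := fun c a => PowerSeries.ext fun n => by
        change _ = c • PowerSeries.coeff n (PowerSeries.mk fun n => (τ ^ n) a)
        rw [PowerSeries.coeff_mk, PowerSeries.coeff_mk, map_smul] }
  have hs₀ : ∀ n a, cf K n (s₀ a) = (τ ^ n) a := fun n a =>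
    PowerSeries.coeff_mk n fun n => (τ ^ n) a
  have hτ : ∀ n a, (τ ^ (n + 1)) a = -κ (𝓑.Δ ((τ ^ n) a)) := fun n a => by
    rw [pow_succ', Module.End.mul_apply]; rfl
  have key : ∀ a, 𝓑.d a = 0 → ∀ n, 𝓑.d ((τ ^ (n + 1)) a) + 𝓑.Δ ((τ ^ n) a) = 0 := by
    intro a ha n
    induction n using Nat.strong_induction_on with
    | _ n ih =>
      obtain ⟨b, hb⟩ := 𝓑.exists_prolongation hdeg n (fun k => (τ ^ k) a) ha ih
      rw [hτ, map_neg]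
      rw [hb, hκ.dkd, neg_add_cancel]
  refine ⟨_, isSection_of_harmonic hκ (s₀ := s₀) (fun i a ha n => ?_) (fun a _ => ?_)
    fun a ha => ps_ext K fun n => ?_⟩
  · rw [hs₀]
    induction n with
    | zero => exact ha
    | succ n ih =>
      rw [hτ]
      have e : i + 1 + 1 = i := by rw [add_assoc, zmod2_one_add_one, add_zero]
      have := hκ.odd _ _ (𝓑.Δ_odd i _ ih)
      rw [e] at this
      exact neg_mem this
  · rw [hs₀]; rfl
  · rw [map_zero]
    rcases n with - | n
    · rw [cf_zero_psLie_d, hs₀]; exact ha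
    · rw [cf_succ_psLie_d, hs₀, hs₀]; exact key a ha n

end Degenerate

end DGBV

/-! ### Degeneration isomorphisms -/

section FPSLemmas

variable {K : Type u} [Field K] {V : Type v} [AddCommGroup V] [Module K V]

lemma FPS.coeff_zero_X_smul (f : FPS V) : FPS.coeff 0 ((PowerSeries.X : K⟦X⟧) • f) = 0 := by
  rw [FPS.coeff_smul]; simp

lemma FPS.coeff_succ_X_smul (n : ℕ) (f : FPS V) :
    FPS.coeff (n + 1) ((PowerSeries.X : K⟦X⟧) • f) = FPS.coeff n f := by
  rw [FPS.coeff_smul, Finset.sum_eq_single (1, n)]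
  · simp
  · rintro ⟨i, j⟩ h h'
    have : i ≠ 1 := by
      rintro rfl
      rw [Finset.HasAntidiagonal.mem_antidiagonal] at h
      exact h' (by simp only [Prod.mk.injEq, true_and]; omega)
    simp [PowerSeries.coeff_X, this]
  · intro h
    exact absurd (Finset.HasAntidiagonal.mem_antidiagonal.2 (Nat.add_comm 1 n)) h

lemma FPS.coeff_C_smul (n : ℕ) (c : K) (f : FPS V) :
    FPS.coeff n ((PowerSeries.C c : K⟦X⟧) • f) = c • FPS.coeff n f := by
  rw [FPS.coeff_smul, Finset.sum_eq_single (0, n)]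
  · simp
  · rintro ⟨i, j⟩ h h'
    have : i ≠ 0 := by
      rintro rfl
      rw [Finset.HasAntidiagonal.mem_antidiagonal] at h
      exact h' (by simp only [Prod.mk.injEq, true_and]; omega)
    simp [PowerSeries.coeff_C, this]
  · intro h
    exact absurd (Finset.HasAntidiagonal.mem_antidiagonal.2 (Nat.zero_add n)) h

end FPSLemmas

namespace DGBV

section DegIsoLemmas

variable {K : Type u} [Field K] {A : Type v} [Ring A] [Algebra K A]
variable {𝒜 : ZMod 2 → Submodule K A} [GradedAlgebra 𝒜] {𝓑 : DGBV 𝒜}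

/-- A power series over `A` as a sequence of coefficients. -/
def toFPS (K : Type u) [Field K] {A : Type v} [Ring A] [Algebra K A] (p : A⟦X⟧) : FPS A :=
  fun n => cf K n p

lemma coeff_toFPS (n : ℕ) (p : A⟦X⟧) : FPS.coeff n (toFPS K p) = cf K n p := rfl

variable (𝓑) in
lemma diffU_toFPS (p : A⟦X⟧) : 𝓑.diffU (toFPS K p) = toFPS K (𝓑.psLie.d p) := by
  refine FPS.ext fun n => ?_
  rw [diffU, LinearMap.add_apply, LinearMap.smul_apply, FPS.coeff_add, coeff_toFPS]
  rcases n with - | n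
  · rw [FPS.coeff_zero_X_smul, cf_zero_psLie_d, add_zero]; rfl
  · rw [FPS.coeff_succ_X_smul, cf_succ_psLie_d]; rfl

variable (𝓑) in
/-- Cocycles of `A⟦u⟧` as sequences of coefficients. -/
def toCocycle (p : LinearMap.ker 𝓑.psLie.d) : LinearMap.ker 𝓑.diffU :=
  ⟨toFPS K p.1, by rw [LinearMap.mem_ker, diffU_toFPS, p.2]; rfl⟩

lemma exists_toCocycle (z : LinearMap.ker 𝓑.diffU) : ∃ p, 𝓑.toCocycle p = z := by
  have h : toFPS K (PowerSeries.mk fun n => FPS.coeff n (z : FPS A)) = z :=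
    FPS.ext fun n => PowerSeries.coeff_mk n fun n => FPS.coeff n (z : FPS A)
  refine ⟨⟨PowerSeries.mk fun n => FPS.coeff n (z : FPS A), ?_⟩, Subtype.ext h⟩
  refine ps_ext K fun n => ?_
  have h1 := congrArg (FPS.coeff n) (𝓑.diffU_toFPS (PowerSeries.mk fun n => FPS.coeff n (z : FPS A)))
  rw [h, z.2, coeff_toFPS] at h1
  rw [← h1, map_zero]; rfl

namespace DegIso

variable (T : 𝓑.DegIso)

/-- The coefficient of `uⁿ` in `T[p]`, for a cocycle `p`. -/
def val (n : ℕ) : LinearMap.ker 𝓑.psLie.d →ₗ[K] 𝓑.H where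
  toFun p := FPS.coeff n (T.toEquiv (Coh.mk 𝓑.diffU (𝓑.toCocycle p)))
  map_add' p q := by
    have : 𝓑.toCocycle (p + q) = 𝓑.toCocycle p + 𝓑.toCocycle q :=
      Subtype.ext (FPS.ext fun n => map_add (cf K n) p.1 q.1)
    rw [this, map_add, map_add, FPS.coeff_add]
  map_smul' c p := by
    have : 𝓑.toCocycle (c • p) = (PowerSeries.C c : K⟦X⟧) • 𝓑.toCocycle p :=
      Subtype.ext (FPS.ext fun n => (map_smul (cf K n) c p.1).trans (FPS.coeff_C_smul n c (toFPS K p.1)).symm)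
    rw [this, map_smul, map_smul, FPS.coeff_C_smul, RingHom.id_apply]

lemma val_apply (n : ℕ) (p : LinearMap.ker 𝓑.psLie.d) :
    T.val n p = FPS.coeff n (T.toEquiv (Coh.mk 𝓑.diffU (𝓑.toCocycle p))) := rfl

lemma val_zero (p : LinearMap.ker 𝓑.psLie.d) (x : LinearMap.ker 𝓑.d) (h : cf K 0 p.1 = x) :
    T.val 0 p = Coh.mk 𝓑.d x := T.normalized _ x h

lemma val_mem {i : ZMod 2} (p : LinearMap.ker 𝓑.psLie.d) (hp : p.1 ∈ psGrading 𝒜 i) (n : ℕ) :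
    T.val n p ∈ 𝓑.HGrading i := T.even i (𝓑.toCocycle p) hp n

lemma mulX_mem {p : A⟦X⟧} (hp : p ∈ LinearMap.ker 𝓑.psLie.d) :
    mulX (K := K) p ∈ LinearMap.ker 𝓑.psLie.d := by
  rw [LinearMap.mem_ker, psLie_d_mulX, LinearMap.mem_ker.1 hp, map_zero]

lemma toCocycle_mulX (p : LinearMap.ker 𝓑.psLie.d) :
    𝓑.toCocycle ⟨mulX (K := K) p.1, mulX_mem p.2⟩ = (PowerSeries.X : K⟦X⟧) • 𝓑.toCocycle p := by
  refine Subtype.ext (FPS.ext fun n => ?_)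
  rcases n with - | n
  · exact (cf_zero_mulX p.1).trans (FPS.coeff_zero_X_smul (K := K) (toFPS K p.1)).symm
  · exact (cf_succ_mulX n p.1).trans (FPS.coeff_succ_X_smul (K := K) n (toFPS K p.1)).symm

lemma val_succ_mulX (n : ℕ) (p : LinearMap.ker 𝓑.psLie.d) :
    T.val (n + 1) ⟨mulX (K := K) p.1, mulX_mem p.2⟩ = T.val n p := by
  rw [val_apply, toCocycle_mulX, map_smul, map_smul, FPS.coeff_succ_X_smul, val_apply]

lemma exists_primitive_iff (p : LinearMap.ker 𝓑.psLie.d) :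
    (∀ n, T.val n p = 0) ↔ ∃ e, p.1 = 𝓑.psLie.d e := by
  have h1 : (∀ n, T.val n p = 0) ↔ Coh.mk 𝓑.diffU (𝓑.toCocycle p) = 0 := by
    rw [← map_eq_zero_iff T.toEquiv T.toEquiv.injective]
    exact ⟨fun h => FPS.ext h, fun h n => by rw [val_apply, h, FPS.coeff_zero]⟩
  rw [h1]
  refine (Submodule.Quotient.mk_eq_zero _).trans ⟨?_, ?_⟩
  · rintro ⟨e, he⟩
    refine ⟨PowerSeries.mk fun n => FPS.coeff n e, ps_ext K fun n => ?_⟩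
    have h : toFPS K (PowerSeries.mk fun n => FPS.coeff n e) = e :=
      FPS.ext fun n => PowerSeries.coeff_mk n fun n => FPS.coeff n e
    rw [← coeff_toFPS n (𝓑.psLie.d _), ← diffU_toFPS, h, he]; rfl
  · rintro ⟨e, he⟩
    refine ⟨toFPS K e, ?_⟩
    rw [diffU_toFPS, ← he]; rfl

lemma exists_val_eq (f : FPS 𝓑.H) : ∃ p, ∀ n, T.val n p = FPS.coeff n f := by
  obtain ⟨z, hz⟩ := Submodule.mkQ_surjective _ (T.toEquiv.symm f)
  obtain ⟨p, rfl⟩ := exists_toCocycle z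
  refine ⟨p, fun n => ?_⟩
  rw [val_apply]
  have : T.toEquiv (Coh.mk 𝓑.diffU (𝓑.toCocycle p)) = f :=
    (congrArg T.toEquiv hz).trans (T.toEquiv.apply_symm_apply f)
  rw [this]

lemma val_const_primitive (n : ℕ) (e : A⟦X⟧) (he : 𝓑.psLie.d e ∈ LinearMap.ker 𝓑.psLie.d) :
    T.val n ⟨𝓑.psLie.d e, he⟩ = 0 := (T.exists_primitive_iff _).2 ⟨e, rfl⟩ n

lemma comp_mem_ker (i : ZMod 2) {p : A⟦X⟧} (hp : p ∈ LinearMap.ker 𝓑.psLie.d) :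
    comp (psGrading 𝒜) i p ∈ LinearMap.ker 𝓑.psLie.d := by
  rw [LinearMap.mem_ker]
  exact comp_ker (psGrading 𝒜) 𝓑.psLie.d_odd i hp

lemma comp_val (i : ZMod 2) (n : ℕ) (p : LinearMap.ker 𝓑.psLie.d) :
    T.val n ⟨comp (psGrading 𝒜) i p.1, comp_mem_ker i p.2⟩ = comp 𝓑.HGrading i (T.val n p) := by
  have h : p = ⟨comp (psGrading 𝒜) 0 p.1, comp_mem_ker 0 p.2⟩
      + ⟨comp (psGrading 𝒜) 1 p.1, comp_mem_ker 1 p.2⟩ :=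
    Subtype.ext (comp_add (psGrading 𝒜) p.1).symm
  have h0 := T.val_mem ⟨comp (psGrading 𝒜) 0 p.1, comp_mem_ker 0 p.2⟩ (comp_mem _ 0 p.1) n
  have h1 := T.val_mem ⟨comp (psGrading 𝒜) 1 p.1, comp_mem_ker 1 p.2⟩ (comp_mem _ 1 p.1) n
  conv_rhs => rw [h]
  rw [map_add, map_add]
  rcases zmod2_cases i with rfl | rfl
  · rw [comp_same _ h0, comp_ne _ h1 (by decide), add_zero]
  · rw [comp_ne _ h0 (by decide), comp_same _ h1, zero_add]

lemma comp_cf (i : ZMod 2) (n : ℕ) (p : A⟦X⟧) :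
    cf K n (comp (psGrading 𝒜) i p) = comp 𝒜 i (cf K n p) := by
  have h0 : cf K n (comp (psGrading 𝒜) 0 p) ∈ 𝒜 0 := comp_mem (psGrading 𝒜) 0 p n
  have h1 : cf K n (comp (psGrading 𝒜) 1 p) ∈ 𝒜 1 := comp_mem (psGrading 𝒜) 1 p n
  conv_rhs => rw [← comp_add (psGrading 𝒜) p]
  rw [map_add, map_add]
  rcases zmod2_cases i with rfl | rfl
  · rw [comp_same _ h0, comp_ne _ h1 (by decide), add_zero]
  · rw [comp_ne _ h0 (by decide), comp_same _ h1, zero_add]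

/-- A section is adapted to `T` if `T[s z] = [z]` is constant for every cocycle `z`. -/
def IsAdapted (s : A →ₗ[K] A⟦X⟧) : Prop :=
  ∀ p : LinearMap.ker 𝓑.psLie.d, (∃ z, 𝓑.d z = 0 ∧ p.1 = s z) → ∀ n, T.val (n + 1) p = 0

/-- The cocycles `p` of `A⟦u⟧` for which `T[p]` is constant. -/
def constCocycles : Submodule K (LinearMap.ker 𝓑.psLie.d) :=
  ⨅ n : ℕ, LinearMap.ker (T.val (n + 1))

lemma mem_constCocycles {p : LinearMap.ker 𝓑.psLie.d} :
    p ∈ T.constCocycles ↔ ∀ n, T.val (n + 1) p = 0 := by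
  simp [constCocycles, Submodule.mem_iInf]

/-- Every cocycle is the constant term of a cocycle `p` of `A⟦u⟧` with `T[p]` constant. -/
lemma exists_constCocycle (z : LinearMap.ker 𝓑.d) :
    ∃ p ∈ T.constCocycles, cf K 0 p.1 = (z : A) := by
  obtain ⟨p, hp'⟩ := T.exists_val_eq fun n => if n = 0 then Coh.mk 𝓑.d z else 0
  have hp : ∀ n, T.val n p = if n = 0 then Coh.mk 𝓑.d z else 0 := hp'
  have hp0 : 𝓑.d (cf K 0 p.1) = 0 := by
    rw [← cf_zero_psLie_d, LinearMap.mem_ker.1 p.2, map_zero]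
  have h0 := hp 0
  rw [T.val_zero p ⟨cf K 0 p.1, hp0⟩ rfl, if_pos rfl, ← sub_eq_zero, ← map_sub] at h0
  obtain ⟨e, he⟩ : ∃ e, 𝓑.d e = cf K 0 p.1 - z := (Submodule.Quotient.mk_eq_zero _).1 h0
  have hk : 𝓑.psLie.d (constC (K := K) e) ∈ LinearMap.ker 𝓑.psLie.d := 𝓑.psLie.d_sq _
  refine ⟨p - ⟨𝓑.psLie.d (constC (K := K) e), hk⟩, T.mem_constCocycles.2 fun n => ?_, ?_⟩
  · rw [map_sub, hp, if_neg n.succ_ne_zero, T.val_const_primitive, sub_zero]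
  · rw [Submodule.coe_sub, map_sub, cf_zero_psLie_d, cf_constC, if_pos rfl, he, sub_sub_cancel]

/-- There is a section adapted to a given degeneration isomorphism. -/
lemma exists_isAdapted : ∃ s : A →ₗ[K] A⟦X⟧, 𝓑.IsSection s ∧ T.IsAdapted s := by
  obtain ⟨κ, hκ⟩ := exists_isContraction 𝓑.d_odd 𝓑.d_sq
  -- a linear choice of constant cocycles
  let ev : T.constCocycles →ₗ[K] LinearMap.ker 𝓑.d :=
    ((cf K 0 ∘ₗ (LinearMap.ker 𝓑.psLie.d).subtype) ∘ₗ T.constCocycles.subtype).codRestrict _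
      (fun p => by
        rw [LinearMap.mem_ker]
        change 𝓑.d (cf K 0 p.1.1) = 0
        rw [← cf_zero_psLie_d, LinearMap.mem_ker.1 p.1.2, map_zero])
  have hev : LinearMap.range ev = ⊤ := by
    rw [LinearMap.range_eq_top]
    intro z
    obtain ⟨p, hp, h⟩ := T.exists_constCocycle z
    exact ⟨⟨p, hp⟩, Subtype.ext h⟩
  obtain ⟨g, hg⟩ := LinearMap.exists_rightInverse_of_surjective ev hev
  obtain ⟨t, ht⟩ := LinearMap.exists_extend
    ((LinearMap.ker 𝓑.psLie.d).subtype ∘ₗ T.constCocycles.subtype ∘ₗ g)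
  -- its even part
  let s₀ : A →ₗ[K] A⟦X⟧ := comp (psGrading 𝒜) 0 ∘ₗ t ∘ₗ comp 𝒜 0
    + comp (psGrading 𝒜) 1 ∘ₗ t ∘ₗ comp 𝒜 1
  have hs₀ : ∀ a, s₀ a = comp (psGrading 𝒜) 0 (t (comp 𝒜 0 a))
    + comp (psGrading 𝒜) 1 (t (comp 𝒜 1 a)) := fun a => rfl
  have htz : ∀ z (hz : 𝓑.d z = 0), t z = (g ⟨z, hz⟩).1.1 := fun z hz =>
    LinearMap.congr_fun ht ⟨z, hz⟩
  have htk : ∀ z, 𝓑.d z = 0 → t z ∈ LinearMap.ker 𝓑.psLie.d := fun z hz => by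
    rw [htz z hz]; exact (g ⟨z, hz⟩).1.2
  have htv : ∀ z (hz : 𝓑.d z = 0) (n : ℕ), T.val (n + 1) ⟨t z, htk z hz⟩ = 0 := fun z hz n => by
    have := T.mem_constCocycles.1 (g ⟨z, hz⟩).2 n
    rw [← this]
    congr 1
    exact Subtype.ext (htz z hz)
  have ht0 : ∀ z, 𝓑.d z = 0 → cf K 0 (t z) = z := fun z hz => by
    rw [htz z hz]
    exact congrArg Subtype.val (LinearMap.congr_fun hg ⟨z, hz⟩)
  have hcomp : ∀ i z, 𝓑.d z = 0 → 𝓑.d (comp 𝒜 i z) = 0 := fun i z hz =>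
    comp_ker 𝒜 𝓑.d_odd i hz
  have hs₀k : ∀ z, 𝓑.d z = 0 → 𝓑.psLie.d (s₀ z) = 0 := fun z hz =>
    add_mem (comp_mem_ker 0 (htk _ (hcomp 0 z hz))) (comp_mem_ker 1 (htk _ (hcomp 1 z hz)))
  have hs₀v : ∀ z (hz : 𝓑.d z = 0) (n : ℕ), T.val (n + 1) ⟨s₀ z, hs₀k z hz⟩ = 0 := by
    intro z hz n
    have e : (⟨s₀ z, hs₀k z hz⟩ : LinearMap.ker 𝓑.psLie.d)
      = ⟨comp (psGrading 𝒜) 0 (t (comp 𝒜 0 z)), comp_mem_ker 0 (htk _ (hcomp 0 z hz))⟩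
        + ⟨comp (psGrading 𝒜) 1 (t (comp 𝒜 1 z)), comp_mem_ker 1 (htk _ (hcomp 1 z hz))⟩ := rfl
    rw [e, map_add, T.comp_val 0 (n + 1) ⟨_, htk _ (hcomp 0 z hz)⟩,
      T.comp_val 1 (n + 1) ⟨_, htk _ (hcomp 1 z hz)⟩, htv _ (hcomp 0 z hz), htv _ (hcomp 1 z hz),
      map_zero, map_zero, add_zero]
  refine ⟨_, isSection_of_harmonic hκ (s₀ := s₀) (fun i a ha => ?_) (fun a ha => ?_) hs₀k, ?_⟩
  · rw [hs₀]
    rcases zmod2_cases i with rfl | rfl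
    · rw [comp_ne 𝒜 ha (show (0 : ZMod 2) ≠ 1 by decide), map_zero, map_zero, add_zero]
      exact comp_mem _ _ _
    · rw [comp_ne 𝒜 ha (show (1 : ZMod 2) ≠ 0 by decide), map_zero, map_zero, zero_add]
      exact comp_mem _ _ _
  · rw [hs₀, map_add, comp_cf, comp_cf, ht0 _ (hcomp 0 a ha), ht0 _ (hcomp 1 a ha),
      comp_same 𝒜 (comp_mem 𝒜 0 a), comp_same 𝒜 (comp_mem 𝒜 1 a), comp_add]
  · rintro p ⟨z, hz, hp⟩ n
    have hπ := diff_harmonic 𝓑.d_sq hκ z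
    have hk : 𝓑.psLie.d (constC (K := K) (κ z)) ∈ LinearMap.ker 𝓑.psLie.d := 𝓑.psLie.d_sq _
    have e : p = ⟨𝓑.psLie.d (constC (K := K) (κ z)), hk⟩ + ⟨s₀ (harmonic 𝓑.d κ z), hs₀k _ hπ⟩ := by
      refine Subtype.ext ?_
      rw [hp]
      simp only [LinearMap.add_apply, LinearMap.comp_apply, hz, map_zero, zero_add]
      rfl
    rw [e, map_add, T.val_const_primitive, hs₀v _ hπ, add_zero]

end DegIso

end DegIsoLemmas

end DGBV

/-! ### Homotopy abelianity and the moduli space -/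

namespace SSym

section Precomposition

variable {K : Type u} [Field K] [CharZero K] {V : Type v} [AddCommGroup V] [Module K V]
variable {𝒱 : ZMod 2 → Submodule K V} [DirectSum.Decomposition 𝒱]
variable {W : Type w} [AddCommGroup W] [Module K W]
variable {𝒲 : ZMod 2 → Submodule K W} [DirectSum.Decomposition 𝒲]

/-- Pullback of functions along a map of coalgebras. -/
def pull (F : SSym 𝒱 →ₗ[K] SSym 𝒲) : FormalFun 𝒲 →ₗ[K] FormalFun 𝒱 := LinearMap.lcomp K K F

lemma continuous_pull (F : SSym 𝒱 →ₗ[K] SSym 𝒲) : Continuous (pull F) := by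
  let _ : TopologicalSpace K := ⊥
  refine continuous_induced_rng.2 (continuous_pi fun x => ?_)
  exact (continuous_apply (F x)).comp continuous_induced_dom

lemma mul_sub_mul (f g f' g' : FormalFun 𝒱) : FormalFun.mul f g - FormalFun.mul f' g'
    = FormalFun.mul (f - f') g + FormalFun.mul f' (g - g') := by
  have h : ∀ a b a' b' : SSym 𝒱 →ₗ[K] K,
      conv b a - conv b' a' = conv b (a - a') + conv (b - b') a' := fun a b a' b' => by
    rw [map_sub, map_sub, LinearMap.sub_apply, sub_add_sub_cancel]
  exact h f.toDual g.toDual f'.toDual g'.toDual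

lemma IsCoalgMap.pull_mul {F : SSym 𝒱 →ₗ[K] SSym 𝒲} (hF : IsCoalgMap F) (f g : FormalFun 𝒲) :
    pull F (FormalFun.mul f g) = FormalFun.mul (pull F f) (pull F g) := hF.conv_comp _ _

lemma IsCoalgMap.pull_one {F : SSym 𝒱 →ₗ[K] SSym 𝒲} (hF : IsCoalgMap F) :
    pull F FormalFun.one = FormalFun.one := LinearMap.ext fun x => hF.eps x

lemma IsCoalgMap.pull_isHom {F : SSym 𝒱 →ₗ[K] SSym 𝒲} (hF : IsCoalgMap F) {i : ZMod 2}
    {f : FormalFun 𝒲} (hf : f.IsHom i) : (pull F f).IsHom i := fun x hx => hf _ (hF.even _ x hx)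

end Precomposition

end SSym

namespace DGLie

section Moduli

variable {K : Type u} [Field K] [CharZero K] {V : Type v} [AddCommGroup V] [Module K V]
variable {𝒱 : ZMod 2 → Submodule K V} [DirectSum.Decomposition 𝒱] (L : DGLie 𝒱)
variable {W : Type w} [AddCommGroup W] [Module K W]
variable {𝒲 : ZMod 2 → Submodule K W} [DirectSum.Decomposition 𝒲]

open SSym

lemma mem_ker_ce {f : FormalFun 𝒱} : f ∈ LinearMap.ker L.ce ↔ f.toDual ∘ₗ L.Q = 0 := Iff.rfl

lemma mul_mem_ker_ce {f g : FormalFun 𝒱} (hf : f ∈ LinearMap.ker L.ce)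
    (hg : g ∈ LinearMap.ker L.ce) : FormalFun.mul f g ∈ LinearMap.ker L.ce := by
  rw [mem_ker_ce] at hf hg ⊢
  have h := conv_comp_coder L.isTwCoder_Q g.toDual f.toDual
  rw [hf, hg, map_zero, map_zero, LinearMap.zero_apply, add_zero] at h
  exact h

lemma mul_coboundary_left {f g : FormalFun 𝒱} (hg : g ∈ LinearMap.ker L.ce)
    (hf : f ∈ LinearMap.range L.ce) : FormalFun.mul f g ∈ LinearMap.range L.ce := by
  obtain ⟨ρ, rfl⟩ := hf
  rw [mem_ker_ce] at hg
  have h := conv_comp_coder L.isTwCoder_Q (g.toDual ∘ₗ twist (grading 𝒱) 1) ρ.toDual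
  rw [LinearMap.comp_assoc, L.Q_twist, LinearMap.comp_assoc, twist_twist, LinearMap.comp_id] at h
  have h0 : g.toDual ∘ₗ ((-1 : ℤˣ) ^ (1 : ZMod 2) • (L.Q ∘ₗ twist (grading 𝒱) 1)) = 0 := by
    refine LinearMap.ext fun x => ?_
    have := LinearMap.congr_fun hg (twist (grading 𝒱) 1 x)
    simp only [LinearMap.comp_apply, LinearMap.zero_apply] at this
    rw [LinearMap.comp_apply, sign_smul_apply, LinearMap.map_smul_of_tower, LinearMap.comp_apply,
      this, smul_zero, LinearMap.zero_apply]
  rw [h0, map_zero, LinearMap.zero_apply, zero_add] at h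
  exact ⟨conv (g.toDual ∘ₗ twist (grading 𝒱) 1) ρ.toDual, h⟩

lemma mul_coboundary_right {f g : FormalFun 𝒱} (hf : f ∈ LinearMap.ker L.ce)
    (hg : g ∈ LinearMap.range L.ce) : FormalFun.mul f g ∈ LinearMap.range L.ce := by
  obtain ⟨ρ, rfl⟩ := hg
  rw [mem_ker_ce] at hf
  have h := conv_comp_coder L.isTwCoder_Q ρ.toDual f.toDual
  rw [hf, map_zero, add_zero] at h
  exact ⟨conv ρ.toDual f.toDual, h⟩

/-- A homotopy equivalence of the Chevalley–Eilenberg coalgebra with `Sym W` identifies the moduli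
space with the formal neighbourhood of `0` in `W`. -/
lemma exists_formalIso {P : SSym 𝒱 →ₗ[K] SSym 𝒲} {J : SSym 𝒲 →ₗ[K] SSym 𝒱} (hP : IsCoalgMap P)
    (hPQ : P ∘ₗ L.Q = 0) (hJQ : L.Q ∘ₗ J = 0) (hPJ : P ∘ₗ J = LinearMap.id)
    (hJP : ∀ f ∈ LinearMap.ker L.ce, f - pull P (pull J f) ∈ LinearMap.range L.ce) :
    ∃ Φ : FormalIso L 𝒲, ∀ (f : FormalFun 𝒲) (φ : LinearMap.ker L.ce),
      (φ : FormalFun 𝒱) = pull P f → Φ.pullback f = Coh.mk L.ce φ := by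
  have hk : ∀ f, pull P f ∈ LinearMap.ker L.ce := fun f => by
    rw [mem_ker_ce]
    change (f.toDual ∘ₗ P) ∘ₗ L.Q = 0
    rw [LinearMap.comp_assoc, hPQ, LinearMap.comp_zero]
  let p : FormalFun 𝒲 →ₗ[K] L.ModFun := Coh.mk L.ce ∘ₗ (pull P).codRestrict _ hk
  have hjk : (LinearMap.range L.ce).submoduleOf (LinearMap.ker L.ce)
      ≤ LinearMap.ker (pull J ∘ₗ (LinearMap.ker L.ce).subtype) := by
    rintro ⟨_, hf⟩ ⟨ρ, rfl⟩
    change (ρ.toDual ∘ₗ L.Q) ∘ₗ J = 0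
    rw [LinearMap.comp_assoc, hJQ, LinearMap.comp_zero]
  let j : L.ModFun →ₗ[K] FormalFun 𝒲 := Submodule.liftQ _ _ hjk
  have hpj : ∀ x, p (j x) = x := by
    intro x
    obtain ⟨φ, rfl⟩ := Submodule.mkQ_surjective _ x
    refine (sub_eq_zero.1 ?_).symm
    have : Coh.mk L.ce φ - p (j (Coh.mk L.ce φ))
        = Coh.mk L.ce (φ - ⟨pull P (pull J φ), hk _⟩) := by rw [map_sub]; rfl
    rw [this]
    exact (Submodule.Quotient.mk_eq_zero _).2 (hJP φ φ.2)
  have hjp : ∀ f, j (p f) = f := by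
    intro f
    change (f.toDual ∘ₗ P) ∘ₗ J = f.toDual
    rw [LinearMap.comp_assoc, hPJ, LinearMap.comp_id]
  let e : FormalFun 𝒲 ≃L[K] L.ModFun :=
    { toFun := p
      map_add' := map_add p
      map_smul' := map_smul p
      invFun := j
      left_inv := hjp
      right_inv := hpj
      continuous_toFun := continuous_quot_mk.comp ((continuous_pull P).subtype_mk hk)
      continuous_invFun := continuous_quot_lift _ ((continuous_pull J).comp continuous_subtype_val) }
  have he : ∀ (f : FormalFun 𝒲) (φ : LinearMap.ker L.ce),
      (φ : FormalFun 𝒱) = pull P f → e f = Coh.mk L.ce φ := fun f φ h =>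
    congrArg (Coh.mk L.ce) (Subtype.ext h.symm : (⟨pull P f, hk f⟩ : LinearMap.ker L.ce) = φ)
  have hcob : ∀ (f : FormalFun 𝒲) (φ : LinearMap.ker L.ce), e f = Coh.mk L.ce φ →
      pull P f - φ ∈ LinearMap.range L.ce := fun f φ h => by
    rw [he f ⟨pull P f, hk f⟩ rfl, ← sub_eq_zero, ← map_sub] at h
    exact (Submodule.Quotient.mk_eq_zero
      ((LinearMap.range L.ce).submoduleOf (LinearMap.ker L.ce))).1 h
  refine ⟨⟨e, ⟨⟨FormalFun.one, by rw [← hP.pull_one]; exact hk _⟩, rfl, he _ _ hP.pull_one.symm⟩,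
    fun f g φ ψ hφ hψ => ⟨⟨_, L.mul_mem_ker_ce φ.2 ψ.2⟩, rfl, ?_⟩,
    fun i f hf => ⟨⟨pull P f, hk f⟩, hP.pull_isHom hf, he _ _ rfl⟩⟩, he⟩
  rw [he (FormalFun.mul f g) ⟨_, L.mul_mem_ker_ce (hk f) (hk g)⟩ (hP.pull_mul f g).symm,
    ← sub_eq_zero, ← map_sub]
  refine (Submodule.Quotient.mk_eq_zero _).2 ?_
  change FormalFun.mul (pull P f) (pull P g) - FormalFun.mul (φ : FormalFun 𝒱) ψ
    ∈ LinearMap.range L.ce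
  rw [mul_sub_mul]
  exact add_mem (L.mul_coboundary_left (hk g) (hcob f φ hφ))
    (L.mul_coboundary_right φ.2 (hcob g ψ hψ))

end Moduli

end DGLie

namespace DGBV

section HomotopyAbelian

variable {K : Type u} [Field K] [CharZero K] {A : Type v} [Ring A] [Algebra K A]
variable {𝒜 : ZMod 2 → Submodule K A} [GradedAlgebra 𝒜] {𝓑 : DGBV 𝒜}

open SSym

variable (𝓑) in
lemma cf_zero_br (p q : A⟦X⟧) : cf K 0 (𝓑.ps.br p q) = 𝓑.br (cf K 0 p) (cf K 0 q) := by
  have hm : ∀ p q : A⟦X⟧, cf K 0 (p * q) = cf K 0 p * cf K 0 q := fun p q => by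
    rw [cf_mul]; simp
  rw [ps_br_apply, map_sub, map_sub, cf_mapC, hm, hm, hm, cf_mapC, cf_mapC,
    ← (isEven_cf (𝒜 := 𝒜) (K := K) 0).parity_apply]
  rfl

variable (𝓑) in
/-- The abelian dg Lie algebra `(A, d)`. -/
def ab : DGLie 𝒜 := DGLie.ofDiff 𝓑.d 𝓑.d_odd 𝓑.d_sq

/-- Reduction at `u = 0`, on Chevalley–Eilenberg coalgebras. -/
def redU (𝒜 : ZMod 2 → Submodule K A) [GradedAlgebra 𝒜] : SSym (psGrading 𝒜) →ₗ[K] SSym 𝒜 :=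
  (smap (cf K 0) (isEven_cf 0)).toLinearMap

lemma isCoalgMap_redU : IsCoalgMap (redU (K := K) 𝒜) := isCoalgMap_smap _ _

variable (𝓑) in
lemma redU_Q : redU 𝒜 ∘ₗ 𝓑.psLie.Q = 𝓑.toDGLie.Q ∘ₗ redU 𝒜 := LinearMap.ext fun x =>
  DGLie.smap_Q 𝓑.psLie 𝓑.toDGLie (isEven_cf 0) 𝓑.cf_zero_psLie_d 𝓑.cf_zero_br x

variable {s : A →ₗ[K] A⟦X⟧} (hs : 𝓑.IsSection s)

namespace IsSection

/-- The linearization as an automorphism. -/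
def linEquiv : SSym (psGrading 𝒜) ≃ₗ[K] SSym (psGrading 𝒜) :=
  LinearEquiv.ofBijective (linearize s) hs.linearize_bijective

lemma linEquiv_apply (x : SSym (psGrading 𝒜)) : hs.linEquiv x = linearize s x := rfl

lemma isCoalgMap_linEquiv_symm : IsCoalgMap hs.linEquiv.symm.toLinearMap :=
  IsCoalgMap.symm (F := hs.linEquiv) hs.isCoalgMap_linearize

lemma linEquiv_symm_Q :
    hs.linEquiv.symm.toLinearMap ∘ₗ 𝓑.psAb.Q = 𝓑.psLie.Q ∘ₗ hs.linEquiv.symm.toLinearMap := by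
  refine LinearMap.ext fun x => hs.linEquiv.injective ?_
  have h := LinearMap.congr_fun hs.linearize_Q (hs.linEquiv.symm x)
  simp only [LinearMap.comp_apply, ← hs.linEquiv_apply, LinearEquiv.apply_symm_apply] at h
  simp [h]

lemma linEquiv_symm_ι (p : A⟦X⟧) :
    hs.linEquiv.symm (ι (psGrading 𝒜) p) = ι (psGrading 𝒜) p := by
  rw [LinearEquiv.symm_apply_eq, linEquiv_apply, linearize, cexp_ι linCoeff_one, linCoeff_ι]

/-- The section on Chevalley–Eilenberg coalgebras. -/
def lift : SSym 𝒜 →ₗ[K] SSym (psGrading 𝒜) := (smap s hs.even).toLinearMap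

lemma isCoalgMap_lift : IsCoalgMap hs.lift := isCoalgMap_smap _ _

lemma lift_Q : hs.lift ∘ₗ 𝓑.ab.Q = 𝓑.psAb.Q ∘ₗ hs.lift := LinearMap.ext fun x =>
  DGLie.smap_Q 𝓑.ab 𝓑.psAb hs.even (fun a => (hs.closed a).symm) (fun _ _ => map_zero s) x

/-- The `L_∞`-isomorphism from `(A, d)` with the zero bracket to the dg Lie algebra `A`: a section,
the inverse of the linearization, and the reduction at `u = 0`. -/
def abelianize : SSym 𝒜 →ₗ[K] SSym 𝒜 := redU 𝒜 ∘ₗ hs.linEquiv.symm.toLinearMap ∘ₗ hs.lift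

lemma isCoalgMap_abelianize : IsCoalgMap hs.abelianize :=
  isCoalgMap_redU.comp (hs.isCoalgMap_linEquiv_symm.comp hs.isCoalgMap_lift)

lemma abelianize_ι (a : A) : hs.abelianize (ι 𝒜 a) = ι 𝒜 a := by
  simp only [abelianize, lift, redU, LinearMap.comp_apply, AlgHom.toLinearMap_apply, smap_ι,
    LinearEquiv.coe_coe, hs.linEquiv_symm_ι, hs.cf_zero]

lemma abelianize_Q : hs.abelianize ∘ₗ 𝓑.ab.Q = 𝓑.toDGLie.Q ∘ₗ hs.abelianize := by
  rw [abelianize, LinearMap.comp_assoc, LinearMap.comp_assoc, hs.lift_Q, ← LinearMap.comp_assoc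
    hs.lift, hs.linEquiv_symm_Q, LinearMap.comp_assoc, ← LinearMap.comp_assoc, redU_Q]
  rfl

/-- `abelianize` as an isomorphism. -/
def abEquiv : SSym 𝒜 ≃ₗ[K] SSym 𝒜 := LinearEquiv.ofBijective hs.abelianize
  (hs.isCoalgMap_abelianize.bijective hs.abelianize_ι)

lemma abEquiv_apply (x : SSym 𝒜) : hs.abEquiv x = hs.abelianize x := rfl

lemma isCoalgMap_abEquiv_symm : IsCoalgMap hs.abEquiv.symm.toLinearMap :=
  IsCoalgMap.symm (F := hs.abEquiv) hs.isCoalgMap_abelianize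

lemma abEquiv_symm_Q :
    hs.abEquiv.symm.toLinearMap ∘ₗ 𝓑.toDGLie.Q = 𝓑.ab.Q ∘ₗ hs.abEquiv.symm.toLinearMap := by
  refine LinearMap.ext fun x => hs.abEquiv.injective ?_
  have h := LinearMap.congr_fun hs.abelianize_Q (hs.abEquiv.symm x)
  simp only [LinearMap.comp_apply, ← hs.abEquiv_apply, LinearEquiv.apply_symm_apply] at h
  simp [h]

end IsSection

variable {κ : A →ₗ[K] A} (hκ : IsContraction 𝒜 𝓑.d κ)

/-- The class of the harmonic part. -/
def toH : A →ₗ[K] 𝓑.H :=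
  Coh.mk 𝓑.d ∘ₗ (harmonic 𝓑.d κ).codRestrict _ (fun a => diff_harmonic 𝓑.d_sq hκ a)

/-- The harmonic representative of a class. -/
def ofH : 𝓑.H →ₗ[K] A :=
  Submodule.liftQ _ (harmonic 𝓑.d κ ∘ₗ (LinearMap.ker 𝓑.d).subtype) (by
    rintro ⟨_, _⟩ ⟨e, rfl⟩
    exact harmonic_diff 𝓑.d_sq hκ e)

lemma ofH_mk (z : LinearMap.ker 𝓑.d) : ofH hκ (Coh.mk 𝓑.d z) = harmonic 𝓑.d κ z := rfl

lemma toH_apply (a : A) :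
    toH hκ a = Coh.mk 𝓑.d ⟨harmonic 𝓑.d κ a, diff_harmonic 𝓑.d_sq hκ a⟩ := rfl

lemma ofH_toH (a : A) : ofH hκ (toH hκ a) = harmonic 𝓑.d κ a := by
  rw [toH_apply, ofH_mk, harmonic_harmonic 𝓑.d_sq hκ]

lemma toH_of_mem_ker (z : LinearMap.ker 𝓑.d) : toH hκ z = Coh.mk 𝓑.d z := by
  rw [toH_apply, ← sub_eq_zero, ← map_sub]
  refine (Submodule.Quotient.mk_eq_zero _).2 ⟨-κ z, ?_⟩
  change _ = harmonic 𝓑.d κ z - (z : A)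
  rw [harmonic_apply, LinearMap.mem_ker.1 z.2, map_zero, map_neg]
  abel

lemma d_ofH (h : 𝓑.H) : 𝓑.d (ofH hκ h) = 0 := by
  obtain ⟨z, rfl⟩ := Submodule.mkQ_surjective _ h
  exact diff_harmonic 𝓑.d_sq hκ z

lemma toH_d (a : A) : toH hκ (𝓑.d a) = 0 := by
  have h : (⟨harmonic 𝓑.d κ (𝓑.d a), diff_harmonic 𝓑.d_sq hκ _⟩ : LinearMap.ker 𝓑.d) = 0 :=
    Subtype.ext (harmonic_diff 𝓑.d_sq hκ a)
  rw [toH_apply, h, map_zero]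

lemma toH_ofH (h : 𝓑.H) : toH hκ (ofH hκ h) = h := by
  obtain ⟨z, rfl⟩ := Submodule.mkQ_surjective _ h
  have : toH hκ (ofH hκ (Coh.mk 𝓑.d z)) = toH hκ z := by
    rw [ofH_mk, harmonic_apply, LinearMap.mem_ker.1 z.2, map_zero, sub_zero, map_sub, toH_d,
      sub_zero]
  exact this.trans (toH_of_mem_ker hκ z)

lemma isEven_toH : IsEven 𝒜 𝓑.HGrading (toH hκ) := fun i a ha =>
  Submodule.mem_map_of_mem (f := Coh.mk 𝓑.d) (isEven_harmonic 𝓑.d_odd hκ i a ha :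
    (⟨harmonic 𝓑.d κ a, diff_harmonic 𝓑.d_sq hκ a⟩ : LinearMap.ker 𝓑.d)
      ∈ (𝒜 i).submoduleOf (LinearMap.ker 𝓑.d))

lemma isEven_ofH : IsEven 𝓑.HGrading 𝒜 (ofH hκ) := by
  rintro i _ ⟨z, hz, rfl⟩
  exact isEven_harmonic 𝓑.d_odd hκ i z hz

/-- The minimal model of the dg Lie algebra `A`. -/
def model : SSym 𝓑.HGrading →ₗ[K] SSym 𝒜 :=
  hs.abelianize ∘ₗ (smap (ofH hκ) (isEven_ofH hκ)).toLinearMap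

/-- The coordinates on the moduli space, as a homotopy inverse of `model`. -/
def coords : SSym 𝒜 →ₗ[K] SSym 𝓑.HGrading :=
  (smap (toH hκ) (isEven_toH hκ)).toLinearMap ∘ₗ hs.abEquiv.symm.toLinearMap

lemma isCoalgMap_model : IsCoalgMap (model hs hκ) :=
  hs.isCoalgMap_abelianize.comp (isCoalgMap_smap _ _)

lemma isCoalgMap_coords : IsCoalgMap (coords hs hκ) :=
  (isCoalgMap_smap _ _).comp hs.isCoalgMap_abEquiv_symm

lemma Q_model : 𝓑.toDGLie.Q ∘ₗ model hs hκ = 0 := by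
  rw [model, ← LinearMap.comp_assoc, ← hs.abelianize_Q, LinearMap.comp_assoc]
  refine LinearMap.ext fun x => ?_
  have h := DGLie.smap_Q (DGLie.trivial 𝓑.HGrading) 𝓑.ab (isEven_ofH hκ)
    (fun h => (map_zero (ofH hκ)).trans (d_ofH hκ h).symm) (fun _ _ => map_zero (ofH hκ)) x
  rw [DGLie.trivial_Q, map_zero] at h
  simp only [LinearMap.comp_apply, AlgHom.toLinearMap_apply, ← h, map_zero, LinearMap.zero_apply]

lemma coords_Q : coords hs hκ ∘ₗ 𝓑.toDGLie.Q = 0 := by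
  rw [coords, LinearMap.comp_assoc, hs.abEquiv_symm_Q]
  refine LinearMap.ext fun x => ?_
  have h := DGLie.smap_Q 𝓑.ab (DGLie.trivial 𝓑.HGrading) (isEven_toH hκ)
    (fun a => toH_d hκ a) (fun _ _ => map_zero (toH hκ)) (hs.abEquiv.symm x)
  rw [DGLie.trivial_Q] at h
  exact h

lemma coords_model : coords hs hκ ∘ₗ model hs hκ = LinearMap.id := by
  refine LinearMap.ext fun x => ?_
  simp only [coords, model, LinearMap.comp_apply, ← hs.abEquiv_apply, LinearEquiv.coe_coe,
    LinearEquiv.symm_apply_apply, AlgHom.toLinearMap_apply, LinearMap.id_apply]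
  rw [smap_comp]
  exact smap_id _ _ (toH_ofH hκ) x

lemma sub_pull_mem_range {f : FormalFun 𝒜} (hf : f ∈ LinearMap.ker 𝓑.toDGLie.ce) :
    f - pull (coords hs hκ) (pull (model hs hκ) f) ∈ LinearMap.range 𝓑.toDGLie.ce := by
  rw [DGLie.mem_ker_ce] at hf
  have h0 : (f.toDual ∘ₗ hs.abelianize) ∘ₗ 𝓑.ab.Q = 0 := by
    rw [LinearMap.comp_assoc, hs.abelianize_Q, ← LinearMap.comp_assoc, hf, LinearMap.zero_comp]
  obtain ⟨ψ, hψ⟩ := DGLie.exists_primitive 𝓑.d_odd 𝓑.d_sq hκ h0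
  refine ⟨ψ ∘ₗ hs.abEquiv.symm.toLinearMap, LinearMap.ext fun x => ?_⟩
  have h1 := LinearMap.congr_fun hψ (hs.abEquiv.symm x)
  have h2 := LinearMap.congr_fun hs.abEquiv_symm_Q x
  simp only [LinearMap.comp_apply, LinearMap.sub_apply, ← hs.abEquiv_apply,
    LinearEquiv.apply_symm_apply, LinearEquiv.coe_coe, AlgHom.toLinearMap_apply] at h1 h2
  change ψ (hs.abEquiv.symm (𝓑.toDGLie.Q x)) = f.toDual x - f.toDual (hs.abEquiv (smap (ofH hκ)
    (isEven_ofH hκ) (smap (toH hκ) (isEven_toH hκ) (hs.abEquiv.symm x))))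
  rw [h2, smap_comp]
  refine h1.symm.trans ?_
  congr 3
  refine DFunLike.congr_fun (algHom_ext 𝒜 fun a => ?_) _
  rw [smap_ι, smap_ι, LinearMap.comp_apply, ofH_toH]

include hs hκ in
/-- A dg Batalin–Vilkovisky algebra with a section is homotopy abelian. -/
lemma exists_lInfHom : ∃ F : LInfHom (DGLie.trivial 𝓑.HGrading) 𝓑.toDGLie, F.IsQuasiIso := by
  have hF := isCoalgMap_model hs hκ
  refine ⟨⟨model hs hκ, ofH hκ, fun x => ?_, hF.one, LinearMap.ext fun x => hF.eps x, hF.comul,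
    fun x => ?_, fun h => ?_⟩, fun h _ hd => ?_, fun a ha => ?_⟩
  · rw [← parity_grading, ← parity_grading, hF.even.parity_apply]
  · rw [DGLie.trivial_Q, map_zero]
    exact (LinearMap.congr_fun (Q_model hs hκ) x).symm
  · simp only [model, LinearMap.comp_apply, AlgHom.toLinearMap_apply, smap_ι, hs.abelianize_ι]
  · obtain ⟨w, hw⟩ := hd
    refine ⟨0, ?_⟩
    rw [map_zero, ← toH_ofH hκ h]
    exact (congrArg (toH hκ) hw).trans (toH_d hκ w)
  · refine ⟨toH hκ a, rfl, κ a, ?_⟩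
    change a = ofH hκ (toH hκ a) + 𝓑.d (κ a)
    have ha' : 𝓑.d a = 0 := ha
    rw [ofH_toH, harmonic_apply, ha', map_zero]
    abel

lemma exists_formalIso_pull : ∃ Φ : FormalIso 𝓑.toDGLie 𝓑.HGrading,
    ∀ (f : FormalFun 𝓑.HGrading) (φ : LinearMap.ker 𝓑.toDGLie.ce),
      (φ : FormalFun 𝒜) = pull (coords hs hκ) f → Φ.pullback f = Coh.mk 𝓑.toDGLie.ce φ :=
  𝓑.toDGLie.exists_formalIso (isCoalgMap_coords hs hκ) (coords_Q hs hκ) (Q_model hs hκ)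
    (coords_model hs hκ) fun _ hf => sub_pull_mem_range hs hκ hf

end HomotopyAbelian

end DGBV

/-! ### Power series of points -/

section SeriesPoints

variable {K : Type u} [Field K] [CharZero K] {A : Type v} [Ring A] [Algebra K A]
variable {𝒜 : ZMod 2 → Submodule K A} [GradedAlgebra 𝒜]
variable {R : Type u} [Ring R] [Algebra K R] {ℛ : ZMod 2 → Submodule K R} [GradedAlgebra ℛ]
variable {π : R →ₐ[K] K}

open SSym

variable (𝒜 ℛ) in
/-- The map `A⟦u⟧ ⊗ R → (A ⊗ R)⟦u⟧`. -/
def toPS : A⟦X⟧ ⊗[K] R →ₗ[K] PowerSeries (GradedTensorProduct K 𝒜 ℛ) where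
  toFun x := PowerSeries.mk fun n => GradedTensorProduct.of K 𝒜 ℛ ((cf K n).rTensor R x)
  map_add' x y := PowerSeries.ext fun n => by simp only [map_add, PowerSeries.coeff_mk]
  map_smul' c x := PowerSeries.ext fun n => by
    have h := (cf K (A := GradedTensorProduct K 𝒜 ℛ) n).map_smul c (PowerSeries.mk fun n =>
      GradedTensorProduct.of K 𝒜 ℛ ((cf K n).rTensor R x))
    simp only [cf_apply (K := K), PowerSeries.coeff_mk] at h
    rw [RingHom.id_apply, h, PowerSeries.coeff_mk, map_smul, map_smul]

lemma coeff_toPS (n : ℕ) (x : A⟦X⟧ ⊗[K] R) : PowerSeries.coeff n (toPS 𝒜 ℛ x)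
    = GradedTensorProduct.of K 𝒜 ℛ ((cf K n).rTensor R x) :=
  PowerSeries.coeff_mk n fun n => GradedTensorProduct.of K 𝒜 ℛ ((cf K n).rTensor R x)

lemma toPS_injective : Function.Injective (toPS 𝒜 ℛ) := by
  intro x y h
  refine ext_slice fun ℓ => ps_ext K fun n => ?_
  rw [← slice_rTensor, ← slice_rTensor]
  have := congrArg (PowerSeries.coeff n) h
  rw [coeff_toPS, coeff_toPS] at this
  rw [(GradedTensorProduct.of K 𝒜 ℛ).injective this]

/-- The map `A⟦u⟧ ⊗ R → (A ⊗ R)⟦u⟧` is multiplicative. -/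
lemma toPS_kos (x y : A⟦X⟧ ⊗[K] R) :
    toPS 𝒜 ℛ (kos ℛ (psGrading 𝒜) (LinearMap.mul K _) x y) = toPS 𝒜 ℛ x * toPS 𝒜 ℛ y := by
  refine LinearMap.congr_fun₂ (f := (kos ℛ (psGrading 𝒜) (LinearMap.mul K _)).compr₂ (toPS 𝒜 ℛ))
    (g := (LinearMap.mul K (PowerSeries (GradedTensorProduct K 𝒜 ℛ))).compl₁₂ (toPS 𝒜 ℛ)
      (toPS 𝒜 ℛ)) (bilin_ext ℛ (psGrading 𝒜) fun i j p r hr q hq s => ?_) x y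
  rw [LinearMap.compr₂_apply, LinearMap.compl₁₂_apply, LinearMap.mul_apply',
    kos_tmul_tmul ℛ _ _ hr hq, LinearMap.mul_apply']
  have hs : ∀ (ε : ℤˣ) (y : A ⊗[K] R), GradedTensorProduct.of K 𝒜 ℛ (ε • y)
      = ε • GradedTensorProduct.of K 𝒜 ℛ y := fun ε y =>
    LinearMap.map_smul_of_tower (GradedTensorProduct.of K 𝒜 ℛ).toLinearMap ε y
  refine PowerSeries.ext fun n => ?_
  rw [PowerSeries.coeff_mul, coeff_toPS, LinearMap.map_smul_of_tower, LinearMap.rTensor_tmul,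
    hs, cf_mul, TensorProduct.sum_tmul, map_sum, Finset.smul_sum]
  refine Finset.sum_congr rfl fun k _ => ?_
  rw [coeff_toPS, coeff_toPS, LinearMap.rTensor_tmul, LinearMap.rTensor_tmul,
    gtmul_mul_gtmul ℛ _ hr (hq k.2)]

lemma toPS_symm_mul (x y : GradedTensorProduct K (psGrading 𝒜) ℛ) :
    toPS 𝒜 ℛ ((GradedTensorProduct.of K (psGrading 𝒜) ℛ).symm (x * y))
      = toPS 𝒜 ℛ ((GradedTensorProduct.of K (psGrading 𝒜) ℛ).symm x)
        * toPS 𝒜 ℛ ((GradedTensorProduct.of K (psGrading 𝒜) ℛ).symm y) := by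
  rw [of_symm_mul, toPS_kos]

lemma toPS_one : toPS 𝒜 ℛ (1 ⊗ₜ 1) = 1 := by
  refine PowerSeries.ext fun n => ?_
  rw [coeff_toPS, LinearMap.rTensor_tmul, cf_apply (K := K), PowerSeries.coeff_one,
    PowerSeries.coeff_one]
  split
  · rfl
  · rw [TensorProduct.zero_tmul, map_zero]

lemma toPS_symm_pow (x : GradedTensorProduct K (psGrading 𝒜) ℛ) (n : ℕ) :
    toPS 𝒜 ℛ ((GradedTensorProduct.of K (psGrading 𝒜) ℛ).symm (x ^ n))
      = toPS 𝒜 ℛ ((GradedTensorProduct.of K (psGrading 𝒜) ℛ).symm x) ^ n := by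
  induction n with
  | zero => rw [pow_zero, pow_zero]; exact toPS_one
  | succ n ih => rw [pow_succ, toPS_symm_mul, ih, pow_succ]

lemma toPS_mapC (D : A →ₗ[K] A) (x : A⟦X⟧ ⊗[K] R) :
    toPS 𝒜 ℛ ((mapC D).rTensor R x) = extU ℛ D (toPS 𝒜 ℛ x) := by
  refine PowerSeries.ext fun n => ?_
  rw [extU, PowerSeries.coeff_mk, coeff_toPS, coeff_toPS, extOp_of, ← LinearMap.rTensor_comp_apply,
    ← LinearMap.rTensor_comp_apply]
  congr 3
  exact LinearMap.ext fun p => cf_mapC D n p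

lemma toPS_mulX (x : A⟦X⟧ ⊗[K] R) :
    toPS 𝒜 ℛ ((mulX (K := K)).rTensor R x) = PowerSeries.X * toPS 𝒜 ℛ x := by
  refine PowerSeries.ext fun n => ?_
  rw [coeff_toPS, ← LinearMap.rTensor_comp_apply]
  rcases n with - | n
  · rw [PowerSeries.coeff_zero_X_mul,
      show cf K 0 ∘ₗ mulX (K := K) (A := A) = 0 from LinearMap.ext cf_zero_mulX,
      LinearMap.rTensor_zero, LinearMap.zero_apply, map_zero]
  · rw [PowerSeries.coeff_succ_X_mul, coeff_toPS,
      show cf K (n + 1) ∘ₗ mulX (K := K) (A := A) = cf K n from LinearMap.ext (cf_succ_mulX n)]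

lemma toPS_mulX_pow (n : ℕ) (x : A⟦X⟧ ⊗[K] R) :
    toPS 𝒜 ℛ ((mulX (K := K) ^ n).rTensor R x) = PowerSeries.X ^ n * toPS 𝒜 ℛ x := by
  induction n with
  | zero => rw [pow_zero, pow_zero, one_mul, Module.End.one_eq_id, LinearMap.rTensor_id]; rfl
  | succ n ih =>
    rw [pow_succ', Module.End.mul_eq_comp, LinearMap.rTensor_comp_apply, toPS_mulX, ih, pow_succ',
      mul_assoc]

variable (𝒜 ℛ π) in
/-- If `R` is finite-dimensional, finitely many parameters suffice to write all points. -/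
lemma exists_parameters [Module.Finite K R] :
    ∃ (I : Type) (_ : Fintype I) (i : I → ZMod 2) (r : I → R),
      (∀ k, r k ∈ ℛ (i k) ∧ π (r k) = 0) ∧
      ∀ x ∈ points 𝒜 ℛ π, ∃ c : I → A, (∀ k, c k ∈ 𝒜 (i k)) ∧ x = ∑ k, c k ⊗ₜ[K] r k := by
  classical
  let m : ZMod 2 → Submodule K R := fun i => ℛ i ⊓ LinearMap.ker π.toLinearMap
  let b : ∀ i, Module.Basis (Fin (Module.finrank K (m i))) K (m i) := fun i =>
    Module.finBasis K (m i)
  refine ⟨Σ i : ZMod 2, Fin (Module.finrank K (m i)),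
    (inferInstance : Fintype (Σ i : Fin 2, Fin (Module.finrank K (m i)))), fun k => k.1,
    fun k => b k.1 k.2, fun k => ⟨(b k.1 k.2).2.1, (b k.1 k.2).2.2⟩, fun x hx => ?_⟩
  let _ : Fintype (Σ i : ZMod 2, Fin (Module.finrank K (m i))) :=
    (inferInstance : Fintype (Σ i : Fin 2, Fin (Module.finrank K (m i))))
  refine points_induction (P := fun x => ∃ c : (Σ i : ZMod 2, Fin (Module.finrank K (m i))) → A,
    (∀ k, c k ∈ 𝒜 k.1) ∧ x = ∑ k, c k ⊗ₜ[K] (b k.1 k.2 : R)) ?_ ?_ ?_ ?_ hx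
  · exact ⟨fun _ => 0, fun _ => zero_mem _, by simp⟩
  · rintro _ _ ⟨c, hc, rfl⟩ ⟨c', hc', rfl⟩
    refine ⟨fun k => c k + c' k, fun k => add_mem (hc k) (hc' k), ?_⟩
    rw [← Finset.sum_add_distrib]
    exact Finset.sum_congr rfl fun k _ => (TensorProduct.add_tmul _ _ _).symm
  · rintro a _ ⟨c, hc, rfl⟩
    refine ⟨fun k => a • c k, fun k => Submodule.smul_mem _ _ (hc k), ?_⟩
    rw [Finset.smul_sum]
    exact Finset.sum_congr rfl fun k _ => TensorProduct.smul_tmul' _ _ _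
  · intro i v hv r hr hπ
    let r' : m i := ⟨r, hr, hπ⟩
    refine ⟨fun k => if h : k.1 = i then (b i).repr r' (h ▸ k.2) • v else 0, fun k => ?_, ?_⟩
    · by_cases h : k.1 = i
      · simp only [dif_pos h]
        exact (congrArg 𝒜 h).symm.le (Submodule.smul_mem (𝒜 i) _ hv)
      · simp only [dif_neg h]
        exact zero_mem _
    · have h1 : r = ∑ j, (b i).repr r' j • (b i j : R) := by
        have := congrArg Subtype.val ((b i).sum_repr r')
        rw [Submodule.coe_sum] at this
        exact this.symm
      let F : (Σ i : ZMod 2, Fin (Module.finrank K (m i))) → A ⊗[K] R := fun k =>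
        (if h : k.1 = i then (b i).repr r' (h ▸ k.2) • v else 0) ⊗ₜ[K] (b k.1 k.2 : R)
      have h3 : v ⊗ₜ r = ∑ l, ∑ j, F ⟨l, j⟩ := by
        rw [Finset.sum_eq_single i (fun l _ hl => Finset.sum_eq_zero fun j _ => by
          simp only [F]; rw [dif_neg hl, TensorProduct.zero_tmul])
          (fun h => absurd (Finset.mem_univ i) h)]
        conv_lhs => rw [h1]
        rw [TensorProduct.tmul_sum]
        refine Finset.sum_congr rfl fun j _ => ?_
        simp only [F]
        rw [dif_pos trivial, TensorProduct.smul_tmul]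
      exact h3.trans (Fintype.sum_sigma F).symm

/-- Over a finite-dimensional parameter algebra, power series of points are points of `A⟦u⟧`. -/
lemma exists_toPS_eq [Module.Finite K R] {a' : PowerSeries (GradedTensorProduct K 𝒜 ℛ)}
    (h : ∀ n, (GradedTensorProduct.of K 𝒜 ℛ).symm (PowerSeries.coeff n a') ∈ points 𝒜 ℛ π) :
    ∃ x ∈ points (psGrading 𝒜) ℛ π, toPS 𝒜 ℛ x = a' := by
  obtain ⟨I, _, i, r, hr, hc⟩ := exists_parameters 𝒜 ℛ π
  choose c hc1 hc2 using fun n => hc _ (h n)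
  refine ⟨∑ k, (PowerSeries.mk fun n => c n k) ⊗ₜ[K] r k, sum_mem fun k _ => tmul_mem_points
    (fun n => ?_) (hr k).1 (hr k).2, PowerSeries.ext fun n => ?_⟩
  · rw [cf_apply (K := K), PowerSeries.coeff_mk]; exact hc1 n k
  · rw [coeff_toPS, ← LinearEquiv.eq_symm_apply, hc2, map_sum]
    refine Finset.sum_congr rfl fun k _ => ?_
    rw [LinearMap.rTensor_tmul, cf_apply (K := K), PowerSeries.coeff_mk]

lemma mem_points_of_toPS {x : A⟦X⟧ ⊗[K] R} (hx : x ∈ points (psGrading 𝒜) ℛ π) (n : ℕ) :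
    (GradedTensorProduct.of K 𝒜 ℛ).symm (PowerSeries.coeff n (toPS 𝒜 ℛ x)) ∈ points 𝒜 ℛ π := by
  rw [coeff_toPS, GradedTensorProduct.of_symm_of]
  exact rTensor_mem_points (isEven_cf n) hx

end SeriesPoints

namespace DGBV

section Exponentials

variable {K : Type u} [Field K] [CharZero K] {A : Type v} [Ring A] [Algebra K A]
variable {𝒜 : ZMod 2 → Submodule K A} [GradedAlgebra 𝒜] (𝓑 : DGBV 𝒜)
variable {R : Type u} [Ring R] [Algebra K R] {ℛ : ZMod 2 → Submodule K R} [GradedAlgebra ℛ]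
variable {π : R →ₐ[K] K} (hR : IsParam ℛ π)

open SSym

include hR in
/-- The Maurer–Cartan equation over `K⟦u⟧` in terms of the codifferential of `A⟦u⟧`. -/
lemma isMCU_iff {x : A⟦X⟧ ⊗[K] R} (hx : x ∈ points (psGrading 𝒜) ℛ π) :
    𝓑.IsMCU ℛ (toPS 𝒜 ℛ x) ↔ evl ℛ x 𝓑.psLie.Q = 0 := by
  have hbr : kos ℛ (psGrading 𝒜) 𝓑.psLie.br x x
      = (mapC 𝓑.Δ).rTensor R (kos ℛ (psGrading 𝒜) (LinearMap.mul K _) x x)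
        - kos ℛ (psGrading 𝒜) (LinearMap.mul K _) ((mapC 𝓑.Δ).rTensor R x) x
        - kos ℛ (psGrading 𝒜) (LinearMap.mul K _) x ((mapC 𝓑.Δ).rTensor R x) := by
    have h := 𝓑.ps.of_kos_br hx x
    rw [of_mul_of, extOp_of, extOp_of, of_mul_of, of_mul_of, ← map_sub, ← map_sub] at h
    exact (GradedTensorProduct.of K (psGrading 𝒜) ℛ).injective h
  have hd : 𝓑.psLie.d.rTensor R x
      = (mapC 𝓑.d).rTensor R x + (mulX (K := K)).rTensor R ((mapC 𝓑.Δ).rTensor R x) := by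
    rw [← LinearMap.rTensor_comp_apply, ← LinearMap.add_apply, ← LinearMap.rTensor_add]
    rfl
  rw [𝓑.psLie.evl_Q_eq_zero_iff hR hx, ← map_eq_zero_iff (toPS 𝒜 ℛ) toPS_injective, map_add,
    map_smul, hd, hbr, map_add, map_sub, map_sub, toPS_kos, toPS_kos, toPS_mulX, toPS_mapC,
    toPS_mapC, toPS_mapC, toPS_kos]
  rfl

variable (𝒜) in
/-- The Taylor coefficients of `u ^ N • u (exp(a / u) - 1)`, up to words of length `N`. -/
def expCoeff (N : ℕ) : SSym (psGrading 𝒜) →ₗ[K] A⟦X⟧ :=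
  ∑ n ∈ Finset.range N, (mulX ^ (N - n) : Module.End K A⟦X⟧) ∘ₗ prodLen (psGrading 𝒜) (n + 1)

lemma evl_sum {V M ι : Type*} [AddCommGroup V] [Module K V] [AddCommGroup M] [Module K M]
    {𝒱 : ZMod 2 → Submodule K V} [DirectSum.Decomposition 𝒱] (x : V ⊗[K] R) (t : Finset ι)
    (f : ι → SSym 𝒱 →ₗ[K] M) : evl ℛ x (∑ i ∈ t, f i) = ∑ i ∈ t, evl ℛ x (f i) := by
  classical
  induction t using Finset.induction_on with
  | empty => simp [evl]
  | insert i t hi ih => rw [Finset.sum_insert hi, Finset.sum_insert hi, evl_add, ih]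

include hR in
lemma toPS_evl_prodLen {x : A⟦X⟧ ⊗[K] R} (hx : x ∈ points (psGrading 𝒜) ℛ π) (n : ℕ) :
    toPS 𝒜 ℛ (evl ℛ x (prodLen (psGrading 𝒜) n)) = (n.factorial : K)⁻¹ • toPS 𝒜 ℛ x ^ n := by
  have h := evl_cpow (ℬ := psGrading 𝒜) hR hx (isEven_tau (psGrading 𝒜)) n
  rw [evl_tau hR hx, ← LinearEquiv.eq_symm_apply] at h
  rw [prodLen, evl_smul, map_smul, h, toPS_symm_pow, GradedTensorProduct.of_symm_of]

include hR in
lemma expU_toPS {x : A⟦X⟧ ⊗[K] R} (hx : x ∈ points (psGrading 𝒜) ℛ π) (N : ℕ) :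
    expU N (toPS 𝒜 ℛ x) = toPS 𝒜 ℛ (evl ℛ x (expCoeff 𝒜 N)) := by
  rw [expCoeff, evl_sum, map_sum, expU]
  refine Finset.sum_congr rfl fun n _ => ?_
  rw [evl_comp, toPS_mulX_pow, toPS_evl_prodLen hR hx, mul_smul_comm]

include hR in
lemma evl_prodLen_eq_zero {x : A⟦X⟧ ⊗[K] R} (hx : x ∈ points (psGrading 𝒜) ℛ π) {N n : ℕ}
    (hN : toPS 𝒜 ℛ x ^ (N + 1) = 0) (hn : N < n) : evl ℛ x (prodLen (psGrading 𝒜) n) = 0 := by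
  refine toPS_injective (𝒜 := 𝒜) (ℛ := ℛ) ?_
  rw [toPS_evl_prodLen hR hx, pow_eq_zero_of_le hn hN, smul_zero, map_zero]

lemma slice_expU_toPS (ℓ : R →ₗ[K] K) {x : A⟦X⟧ ⊗[K] R} (hR : IsParam ℛ π)
    (hx : x ∈ points (psGrading 𝒜) ℛ π) (N n : ℕ) :
    slice ℓ ((GradedTensorProduct.of K 𝒜 ℛ).symm (PowerSeries.coeff n (expU N (toPS 𝒜 ℛ x))))
      = cf K n (slice ℓ (evl ℛ x (expCoeff 𝒜 N))) := by
  rw [expU_toPS hR hx, coeff_toPS, GradedTensorProduct.of_symm_of, slice_rTensor]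

variable {𝓑} {s : A →ₗ[K] A⟦X⟧}

lemma rho_pow_mulX_pow (s : A →ₗ[K] A⟦X⟧) (n : ℕ) (p : A⟦X⟧) :
    (rho s ^ n) ((mulX (K := K) ^ n) p) = p := by
  induction n generalizing p with
  | zero => rfl
  | succ n ih =>
    rw [pow_succ (rho s), pow_succ' (mulX (K := K)), Module.End.mul_apply, Module.End.mul_apply,
      IsSection.rho_mulX, ih]

include hR in
/-- The linearization of `a` is the representative of `u (exp(a / u) - 1)` without negative powers
of `u`. -/
lemma rho_pow_evl_expCoeff {x : A⟦X⟧ ⊗[K] R} (hx : x ∈ points (psGrading 𝒜) ℛ π) {N : ℕ}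
    (hN : toPS 𝒜 ℛ x ^ (N + 1) = 0) :
    (rho s ^ N).rTensor R (evl ℛ x (expCoeff 𝒜 N)) = evl ℛ x (linCoeff (𝒜 := 𝒜) s) := by
  obtain ⟨k, hk⟩ := exists_rTensor_congr (gexp (psGrading 𝒜) ℛ x)
  have h1 : evl ℛ x (linCoeff (𝒜 := 𝒜) s) = evl ℛ x (∑ n ∈ Finset.range (max k N),
      (rho s ^ n : Module.End K A⟦X⟧) ∘ₗ prodLen (psGrading 𝒜) (n + 1)) :=
    rTensor_congr hk fun y hy => by
      rw [linCoeff_apply (le_max_left k N) hy, LinearMap.sum_apply]; rfl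
  rw [h1, evl_sum, ← Finset.sum_subset (Finset.range_mono (le_max_right k N)), ← evl_sum,
    ← evl_comp]
  · congr 1
    refine LinearMap.ext fun y => ?_
    rw [LinearMap.comp_apply, expCoeff, LinearMap.sum_apply, LinearMap.sum_apply, map_sum]
    refine Finset.sum_congr rfl fun n hn => ?_
    have hn' : N = n + (N - n) := (Nat.add_sub_cancel' (Finset.mem_range.1 hn).le).symm
    rw [LinearMap.comp_apply, LinearMap.comp_apply]
    nth_rw 1 [hn']
    rw [pow_add, Module.End.mul_apply, rho_pow_mulX_pow]
  · intro n _ hn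
    rw [evl_comp, evl_prodLen_eq_zero hR hx hN (by simpa using hn), map_zero]

variable (𝓑) in
/-- The failure of the exponential to be a chain map is divisible by a high power. -/
lemma d_expCoeff (N : ℕ) : 𝓑.psLie.d ∘ₗ expCoeff 𝒜 N = expCoeff 𝒜 N ∘ₗ 𝓑.psLie.Q
    - mulX (K := K) ∘ₗ prodLen (psGrading 𝒜) N ∘ₗ 𝓑.psQBr := by
  refine LinearMap.ext fun x => ?_
  let c : ℕ → A⟦X⟧ := fun n => (mulX (K := K) ^ (N + 1 - n)) (prodLen _ n (𝓑.psQBr x))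
  have h0 : c 0 = 0 := by
    simp only [c]
    rw [prodLen_zero_psQBr, map_zero]
  have hNc : c N = mulX (K := K) (prodLen _ N (𝓑.psQBr x)) := by
    simp only [c]
    rw [Nat.add_sub_cancel_left, pow_one]
  have hd : ∀ n p, 𝓑.psLie.d ((mulX (K := K) ^ n) p) = (mulX (K := K) ^ n) (𝓑.psLie.d p) := by
    intro n
    induction n with
    | zero => exact fun p => rfl
    | succ n ih =>
      intro p
      rw [pow_succ', Module.End.mul_apply, Module.End.mul_apply, psLie_d_mulX, ih]
  have hQ : 𝓑.psLie.Q x = 𝓑.psAb.Q x + 𝓑.psQBr x := by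
    rw [psQBr, LinearMap.sub_apply]; abel
  have ht : ∑ n ∈ Finset.range N, (c (n + 1) - c n) = c N := by
    rw [Finset.sum_range_sub, h0, sub_zero]
  rw [LinearMap.sub_apply, LinearMap.comp_apply, LinearMap.comp_apply, LinearMap.comp_apply,
    LinearMap.comp_apply, ← hNc, ← ht, expCoeff, LinearMap.sum_apply, LinearMap.sum_apply, map_sum,
    ← Finset.sum_sub_distrib]
  refine Finset.sum_congr rfl fun n hn => ?_
  have e1 : N + 1 - (n + 1) = N - n := by omega
  have e2 : N + 1 - n = (N - n) + 1 := by have := Finset.mem_range.1 hn; omega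
  simp only [c, LinearMap.comp_apply]
  rw [hd, hQ, map_add, prodLen_psAb_Q, e1, e2, pow_succ, Module.End.mul_apply, ← map_sub,
    ← map_sub]
  congr 1
  abel

end Exponentials

end DGBV

namespace DGBV

/-! ### Lifts of Maurer–Cartan elements -/

section Lifting

variable {K : Type u} [Field K] [CharZero K] {A : Type v} [Ring A] [Algebra K A]
variable {𝒜 : ZMod 2 → Submodule K A} [GradedAlgebra 𝒜] {𝓑 : DGBV 𝒜}
variable {R : Type u} [Ring R] [Algebra K R] {ℛ : ZMod 2 → Submodule K R} [GradedAlgebra ℛ]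
variable {π : R →ₐ[K] K} (hR : IsParam ℛ π)
variable {s : A →ₗ[K] A⟦X⟧} (hs : 𝓑.IsSection s)
variable {κ : A →ₗ[K] A} (hκ : IsContraction 𝒜 𝓑.d κ)

open SSym

section Adapted

variable {T : 𝓑.DegIso}

omit [CharZero K] in
lemma IsSection.section_mem (hs : 𝓑.IsSection s) {z : A} (hz : 𝓑.d z = 0) :
    s z ∈ LinearMap.ker 𝓑.psLie.d := by
  rw [LinearMap.mem_ker, hs.closed, hz, map_zero]

omit [CharZero K] in
lemma cf_zero_closed {p : A⟦X⟧} (hp : p ∈ LinearMap.ker 𝓑.psLie.d) : 𝓑.d (cf K 0 p) = 0 := by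
  rw [← cf_zero_psLie_d, LinearMap.mem_ker.1 hp, map_zero]

lemma rho_pow_mem (hs : 𝓑.IsSection s) {p : A⟦X⟧} (hp : p ∈ LinearMap.ker 𝓑.psLie.d) (N : ℕ) :
    (rho s ^ N) p ∈ LinearMap.ker 𝓑.psLie.d := by
  rw [LinearMap.mem_ker, hs.d_rho_pow, LinearMap.mem_ker.1 hp, map_zero]

/-- For an adapted section, `ρ` drops the constant term of `T[p]` and divides by `u`. -/
lemma val_rho (hs : 𝓑.IsSection s) (hT : T.IsAdapted s) (p : LinearMap.ker 𝓑.psLie.d) (n : ℕ)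
    (h : rho s p.1 ∈ LinearMap.ker 𝓑.psLie.d) : T.val n ⟨rho s p.1, h⟩ = T.val (n + 1) p := by
  have hz := cf_zero_closed p.2
  have e : p = ⟨mulX (K := K) (rho s p.1), DegIso.mulX_mem h⟩
      + ⟨s (cf K 0 p.1), hs.section_mem hz⟩ := Subtype.ext (by
    change p.1 = mulX (K := K) (rho s p.1) + s (cf K 0 p.1)
    rw [hs.mulX_rho, sub_add_cancel])
  have h1 := T.val_succ_mulX n ⟨rho s p.1, h⟩
  have h2 := hT ⟨s (cf K 0 p.1), hs.section_mem hz⟩ ⟨_, hz, rfl⟩ n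
  conv_rhs => rw [e]
  rw [map_add, h2, add_zero, ← h1]

lemma val_rho_pow (hs : 𝓑.IsSection s) (hT : T.IsAdapted s) (p : LinearMap.ker 𝓑.psLie.d)
    (N n : ℕ) (h : (rho s ^ N) p.1 ∈ LinearMap.ker 𝓑.psLie.d) :
    T.val n ⟨(rho s ^ N) p.1, h⟩ = T.val (n + N) p := by
  induction N generalizing n with
  | zero => rfl
  | succ N ih =>
    have h' := rho_pow_mem hs p.2 N
    have e : (rho s ^ (N + 1)) p.1 = rho s ((rho s ^ N) p.1) := by
      rw [pow_succ', Module.End.mul_apply]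
    have h2 := val_rho hs hT ⟨_, h'⟩ n (by rw [← e]; exact h)
    have h3 := ih (n + 1) h'
    simp only [e]
    rw [h2, h3, Nat.add_right_comm, Nat.add_assoc]

end Adapted

include hR in
lemma evl_Q_ofDiff_eq_zero_iff {V : Type w} [AddCommGroup V] [Module K V]
    {𝒱 : ZMod 2 → Submodule K V} [DirectSum.Decomposition 𝒱] {D : V →ₗ[K] V}
    {hD : ∀ i, ∀ v ∈ 𝒱 i, D v ∈ 𝒱 (i + 1)} {hsq : ∀ v, D (D v) = 0} {b : V ⊗[K] R}
    (hb : b ∈ points 𝒱 ℛ π) :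
    evl ℛ b (DGLie.ofDiff D hD hsq).Q = 0 ↔ D.rTensor R b = 0 := by
  have h0 : kos ℛ 𝒱 (0 : V →ₗ[K] V →ₗ[K] V) b b = 0 := by
    refine LinearMap.congr_fun₂ (f := kos ℛ 𝒱 (0 : V →ₗ[K] V →ₗ[K] V)) (g := 0)
      (bilin_ext ℛ 𝒱 fun i j m r hr n hn s => ?_) b b
    rw [kos_tmul_tmul ℛ _ _ hr hn]
    simp
  rw [DGLie.evl_Q_eq_zero_iff _ hR hb]
  change D.rTensor R b + (2⁻¹ : K) • kos ℛ 𝒱 (0 : V →ₗ[K] V →ₗ[K] V) b b = 0 ↔ _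
  rw [h0, smul_zero, add_zero]

include hR in
/-- Cocycles on an abelian dg Lie algebra take the same values at cohomologous points. -/
lemma evl_eq_of_cohomologous {V : Type w} [AddCommGroup V] [Module K V]
    {𝒱 : ZMod 2 → Submodule K V} [DirectSum.Decomposition 𝒱] {D : V →ₗ[K] V}
    {hD : ∀ i, ∀ v ∈ 𝒱 i, D v ∈ 𝒱 (i + 1)} {hsq : ∀ v, D (D v) = 0} {φ : SSym 𝒱 →ₗ[K] K}
    (hφ : φ ∘ₗ (DGLie.ofDiff D hD hsq).Q = 0) {b c : V ⊗[K] R} (hb : b ∈ points 𝒱 ℛ π)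
    (hc : c ∈ points 𝒱 ℛ π) (hDb : D.rTensor R b = 0) (hDc : D.rTensor R c = 0)
    (h : ∀ ℓ : R →ₗ[K] K, ∃ e, slice ℓ b - slice ℓ c = D e) : evl ℛ b φ = evl ℛ c φ := by
  obtain ⟨κ, hκ⟩ := exists_isContraction hD hsq
  obtain ⟨ψ, hψ⟩ := DGLie.exists_primitive hD hsq hκ hφ
  have key : ∀ x ∈ points 𝒱 ℛ π, D.rTensor R x = 0 →
      evl ℛ x φ = evl ℛ ((harmonic D κ).rTensor R x) φ := by
    intro x hx hDx
    have h1 := (evl_Q_ofDiff_eq_zero_iff (hD := hD) (hsq := hsq) hR hx).2 hDx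
    have h2 : evl ℛ x (tau 𝒱 ∘ₗ (smap (harmonic D κ) (isEven_harmonic hD hκ)).toLinearMap)
        = (harmonic D κ).rTensor R x := by
      have : tau 𝒱 ∘ₗ (smap (harmonic D κ) (isEven_harmonic hD hκ)).toLinearMap
          = harmonic D κ ∘ₗ tau 𝒱 := LinearMap.ext fun y => tau_smap _ _ y
      rw [this, evl_comp, evl_tau hR hx]
    rw [← h2, ← (isCoalgMap_smap (harmonic D κ) (isEven_harmonic hD hκ)).evl_comp hR hx,
      ← sub_eq_zero, ← evl_sub, hψ, evl_comp, h1, map_zero]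
  rw [key b hb hDb, key c hc hDc]
  congr 1
  refine ext_slice fun ℓ => ?_
  obtain ⟨e, he⟩ := h ℓ
  rw [slice_rTensor, slice_rTensor, ← sub_eq_zero, ← map_sub, he, harmonic_diff hsq hκ]

/-- The Maurer–Cartan equation over `K⟦u⟧` says that the linearization is closed. -/
lemma d_evl_linCoeff (hs : 𝓑.IsSection s) {x : A⟦X⟧ ⊗[K] R} (hmc : evl ℛ x 𝓑.psLie.Q = 0) :
    𝓑.psLie.d.rTensor R (evl ℛ x (linCoeff (𝒜 := 𝒜) s)) = 0 := by
  have h : 𝓑.psLie.d ∘ₗ linCoeff (𝒜 := 𝒜) s = linCoeff s ∘ₗ 𝓑.psLie.Q :=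
    LinearMap.ext fun y => (hs.linCoeff_Q y).symm
  rw [← evl_comp, h, evl_comp, hmc, map_zero]

/-- Functions on the moduli space take at a Maurer–Cartan element the value prescribed by the
coordinates `h` of any of its lifts. -/
lemma IsLift.evl_eq [Module.Finite K R] {T : 𝓑.DegIso} (hR : IsParam ℛ π) (hs : 𝓑.IsSection s)
    (hT : T.IsAdapted s) {a : A ⊗[K] R} {a' : PowerSeries (GradedTensorProduct K 𝒜 ℛ)}
    {h : 𝓑.H ⊗[K] R} (hl : 𝓑.IsLift (ℛ := ℛ) T π a a' h) {φ : SSym 𝒜 →ₗ[K] K}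
    (hφ : φ ∘ₗ 𝓑.toDGLie.Q = 0) : evl ℛ a φ = evl ℛ h (φ ∘ₗ model hs hκ) := by
  obtain ⟨x, hx, rfl⟩ := exists_toPS_eq hl.mem
  have hmc := (𝓑.isMCU_iff hR hx).1 hl.mc
  have ha : (cf K 0).rTensor R x = a := by
    have := hl.reduction
    rw [coeff_toPS] at this
    exact (GradedTensorProduct.of K 𝒜 ℛ).injective this
  obtain ⟨N, hN, hval⟩ := hl.value
  set b : A⟦X⟧ ⊗[K] R := evl ℛ x (linCoeff (𝒜 := 𝒜) s) with hbdef
  have hb : b ∈ points (psGrading 𝒜) ℛ π := evl_mem_points hR hx hs.isEven_linCoeff linCoeff_one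
  have hDb : 𝓑.psLie.d.rTensor R b = 0 := d_evl_linCoeff hs hmc
  -- the harmonic representative of the coordinates, spread out over `K⟦u⟧`
  set c : A⟦X⟧ ⊗[K] R := (s ∘ₗ ofH hκ).rTensor R h with hcdef
  have hc : c ∈ points (psGrading 𝒜) ℛ π :=
    rTensor_mem_points (hs.even.comp (isEven_ofH hκ)) hl.value_mem
  have hDc : 𝓑.psLie.d.rTensor R c = 0 := by
    rw [hcdef, ← LinearMap.rTensor_comp_apply,
      show 𝓑.psLie.d ∘ₗ s ∘ₗ ofH hκ = 0 from LinearMap.ext fun y => hs.section_mem (d_ofH hκ y),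
      LinearMap.rTensor_zero, LinearMap.zero_apply]
  let Φ : SSym (psGrading 𝒜) →ₗ[K] K := φ ∘ₗ redU 𝒜 ∘ₗ hs.linEquiv.symm.toLinearMap
  have hΦ : Φ ∘ₗ 𝓑.psAb.Q = 0 := by
    simp only [Φ]
    rw [LinearMap.comp_assoc, LinearMap.comp_assoc, hs.linEquiv_symm_Q, ← LinearMap.comp_assoc
      hs.linEquiv.symm.toLinearMap, redU_Q, ← LinearMap.comp_assoc, ← LinearMap.comp_assoc, hφ,
      LinearMap.zero_comp, LinearMap.zero_comp]
  -- `b` and `c` have the same image under `T`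
  have hbc : evl ℛ b Φ = evl ℛ c Φ := by
    refine evl_eq_of_cohomologous hR hΦ hb hc hDb hDc fun ℓ => ?_
    obtain ⟨z, hz, hzN, hzh⟩ := hval ℓ
    obtain ⟨p, rfl⟩ := exists_toCocycle z
    have hp : p.1 = slice ℓ (evl ℛ x (expCoeff 𝒜 N)) := ps_ext K fun n => by
      rw [← slice_expU_toPS ℓ hR hx, ← hz n]; rfl
    have hbp : slice ℓ b = (rho s ^ N) p.1 := by
      rw [hp, ← slice_rTensor, rho_pow_evl_expCoeff hR hx hN]
    have hck : slice ℓ c = s (ofH hκ (slice ℓ h)) := slice_rTensor ℓ (s ∘ₗ ofH hκ) h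
    have hd := d_ofH hκ (slice ℓ h)
    have hk1 := rho_pow_mem hs p.2 N
    have hk2 := hs.section_mem hd
    have hv : ∀ n, T.val n (⟨(rho s ^ N) p.1, hk1⟩ - ⟨s (ofH hκ (slice ℓ h)), hk2⟩) = 0 := by
      intro n
      rw [map_sub, val_rho_pow hs hT p N n hk1]
      rcases n with - | n
      · have h1 : T.val (0 + N) p = slice ℓ h := by rw [Nat.zero_add]; exact hzh
        rw [h1, T.val_zero _ ⟨ofH hκ (slice ℓ h), hd⟩ (hs.cf_zero _),
          ← toH_of_mem_ker hκ ⟨ofH hκ (slice ℓ h), hd⟩, toH_ofH, sub_self]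
      · have h1 : T.val (n + 1 + N) p = 0 := hzN _ (by omega)
        rw [h1, hT ⟨s (ofH hκ (slice ℓ h)), hk2⟩ ⟨_, hd, rfl⟩, sub_self]
    obtain ⟨e, he⟩ := (T.exists_primitive_iff _).1 hv
    exact ⟨e, by rw [hbp, hck]; exact he⟩
  have h1 : evl ℛ a φ = evl ℛ b Φ := by
    have e1 : tau 𝒜 ∘ₗ redU 𝒜 = cf K 0 ∘ₗ tau (psGrading 𝒜) := LinearMap.ext fun y => tau_smap _ _ y
    have e2 : tau (psGrading 𝒜) ∘ₗ linearize (𝒜 := 𝒜) s = linCoeff s :=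
      LinearMap.ext fun y => tau_cexp linCoeff_one y
    have e3 : Φ ∘ₗ linearize (𝒜 := 𝒜) s = φ ∘ₗ redU 𝒜 := LinearMap.ext fun y => by
      simp only [Φ, LinearMap.comp_apply, LinearEquiv.coe_coe, ← hs.linEquiv_apply,
        LinearEquiv.symm_apply_apply]
    have h2 := isCoalgMap_redU.evl_comp hR hx φ
    rw [e1, SSym.evl_comp x (tau _) (cf K 0), evl_tau hR hx, ha, ← e3, hs.isCoalgMap_linearize.evl_comp hR hx, e2] at h2
    exact h2.symm
  have h2 : evl ℛ h (φ ∘ₗ model hs hκ) = evl ℛ c Φ := by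
    have hsm := isCoalgMap_smap (s ∘ₗ ofH hκ) (hs.even.comp (isEven_ofH hκ))
    have e1 : tau (psGrading 𝒜) ∘ₗ (smap (s ∘ₗ ofH hκ) (hs.even.comp (isEven_ofH hκ))).toLinearMap
        = (s ∘ₗ ofH hκ) ∘ₗ tau 𝓑.HGrading := LinearMap.ext fun y => tau_smap _ _ y
    have e2 : Φ ∘ₗ (smap (s ∘ₗ ofH hκ) (hs.even.comp (isEven_ofH hκ))).toLinearMap
        = φ ∘ₗ model hs hκ := LinearMap.ext fun y => by
      simp only [Φ, model, IsSection.abelianize, IsSection.lift, LinearMap.comp_apply,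
        AlgHom.toLinearMap_apply, smap_comp]
    have h3 := hsm.evl_comp hR hl.value_mem Φ
    rw [e2, e1, SSym.evl_comp h (tau _) (s ∘ₗ ofH hκ), evl_tau hR hl.value_mem] at h3
    exact h3
  rw [h1, hbc, h2]

/-- The family `A → A⟦u⟧` of lifts of Maurer–Cartan elements. -/
def liftMC : SSym 𝒜 →ₗ[K] SSym (psGrading 𝒜) :=
  hs.linEquiv.symm.toLinearMap ∘ₗ hs.lift ∘ₗ hs.abEquiv.symm.toLinearMap

lemma isCoalgMap_liftMC : IsCoalgMap (liftMC hs) :=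
  hs.isCoalgMap_linEquiv_symm.comp (hs.isCoalgMap_lift.comp hs.isCoalgMap_abEquiv_symm)

lemma liftMC_Q : 𝓑.psLie.Q ∘ₗ liftMC hs = liftMC hs ∘ₗ 𝓑.toDGLie.Q := by
  rw [liftMC, ← LinearMap.comp_assoc, ← hs.linEquiv_symm_Q, LinearMap.comp_assoc,
    ← LinearMap.comp_assoc _ _ 𝓑.psAb.Q, ← hs.lift_Q, LinearMap.comp_assoc, ← hs.abEquiv_symm_Q]
  rfl

lemma redU_liftMC : redU 𝒜 ∘ₗ liftMC hs = LinearMap.id := LinearMap.ext fun x =>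
  hs.abEquiv.apply_symm_apply x

lemma linCoeff_liftMC :
    linCoeff (𝒜 := 𝒜) s ∘ₗ liftMC hs = s ∘ₗ tau 𝒜 ∘ₗ hs.abEquiv.symm.toLinearMap := by
  refine LinearMap.ext fun x => ?_
  have h1 := tau_cexp (𝒲 := psGrading 𝒜) (linCoeff_one (𝒜 := 𝒜) (s := s)) (liftMC hs x)
  have h2 : cexp (ι (psGrading 𝒜) ∘ₗ linCoeff s) (liftMC hs x) = hs.lift (hs.abEquiv.symm x) :=
    hs.linEquiv.apply_symm_apply _
  rw [h2] at h1
  exact h1.symm.trans (tau_smap s hs.even _)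

/-- Every Maurer–Cartan element has a lift, with the expected coordinates. -/
lemma exists_isLift {T : 𝓑.DegIso} (hR : IsParam ℛ π) (hT : T.IsAdapted s) {a : A ⊗[K] R}
    (ha : a ∈ points 𝒜 ℛ π) (hmc : evl ℛ a 𝓑.toDGLie.Q = 0) :
    ∃ a', 𝓑.IsLift (ℛ := ℛ) T π a a' (evl ℛ a (tau 𝓑.HGrading ∘ₗ coords hs hκ)) := by
  have hG := isCoalgMap_liftMC hs
  set x : A⟦X⟧ ⊗[K] R := evl ℛ a (tau (psGrading 𝒜) ∘ₗ liftMC hs) with hxdef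
  have hx : x ∈ points (psGrading 𝒜) ℛ π := hG.mem_points hR ha
  have hxmc : evl ℛ x 𝓑.psLie.Q = 0 := by
    rw [hxdef, ← hG.evl_comp hR ha, liftMC_Q, evl_comp, hmc, map_zero]
  -- the image of `a` in the abelian dg Lie algebra `A`
  set α : A ⊗[K] R := evl ℛ a (tau 𝒜 ∘ₗ hs.abEquiv.symm.toLinearMap) with hαdef
  have hα : α ∈ points 𝒜 ℛ π := hs.isCoalgMap_abEquiv_symm.mem_points hR ha
  have hdα : 𝓑.d.rTensor R α = 0 := by
    refine (evl_Q_ofDiff_eq_zero_iff (hD := 𝓑.d_odd) (hsq := 𝓑.d_sq) hR hα).1 ?_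
    have h := hs.isCoalgMap_abEquiv_symm.evl_comp hR ha 𝓑.ab.Q
    rw [← hs.abEquiv_symm_Q, evl_comp, hmc, map_zero] at h
    exact h.symm
  have hb : evl ℛ x (linCoeff (𝒜 := 𝒜) s) = s.rTensor R α := by
    rw [hxdef, ← hG.evl_comp hR ha, linCoeff_liftMC, evl_comp]
  have hred : (cf K 0).rTensor R x = a := by
    have e : cf K 0 ∘ₗ tau (psGrading 𝒜) ∘ₗ liftMC hs = tau 𝒜 := LinearMap.ext fun y => by
      have h1 : tau 𝒜 (redU 𝒜 (liftMC hs y)) = cf K 0 (tau (psGrading 𝒜) (liftMC hs y)) :=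
        tau_smap _ _ _
      have h2 := LinearMap.congr_fun (redU_liftMC hs) y
      rw [LinearMap.comp_apply] at h2
      rw [LinearMap.comp_apply, LinearMap.comp_apply, ← h1, h2, LinearMap.id_apply]
    rw [hxdef, ← evl_comp, e, evl_tau hR ha]
  have hcoord : evl ℛ a (tau 𝓑.HGrading ∘ₗ coords hs hκ) = (toH hκ).rTensor R α := by
    have e : tau 𝓑.HGrading ∘ₗ coords hs hκ
        = toH hκ ∘ₗ tau 𝒜 ∘ₗ hs.abEquiv.symm.toLinearMap := LinearMap.ext fun y => tau_smap _ _ _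
    rw [e, evl_comp]
  obtain ⟨n, hn⟩ := isNilpotent_of_mem_points hR 𝓑.ps.supercomm
    (x := GradedTensorProduct.of K (psGrading 𝒜) ℛ x) hx
  obtain ⟨k, hk⟩ := exists_rTensor_congr (evl ℛ x 𝓑.psQBr)
  -- both the power and the error term of the exponential vanish for large `N`
  set N := max n k with hNdef
  have hN : toPS 𝒜 ℛ x ^ (N + 1) = 0 := by
    have h1 := toPS_symm_pow (𝒜 := 𝒜) (GradedTensorProduct.of K (psGrading 𝒜) ℛ x) (N + 1)
    rw [pow_eq_zero_of_le ((le_max_left n k).trans N.le_succ) hn, map_zero, map_zero,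
      GradedTensorProduct.of_symm_of] at h1
    exact h1.symm
  have hDp : 𝓑.psLie.d.rTensor R (evl ℛ x (expCoeff 𝒜 N)) = 0 := by
    have h0 : evl ℛ x (prodLen (psGrading 𝒜) N ∘ₗ 𝓑.psQBr) = 0 := by
      rw [evl_comp, rTensor_congr (g := 0) hk fun y hy => by
        rw [prodLen_eq_zero _ (le_max_right n k) hy, LinearMap.zero_apply], LinearMap.rTensor_zero,
        LinearMap.zero_apply]
    rw [← evl_comp, d_expCoeff, evl_sub, evl_comp, hxmc, map_zero, evl_comp, h0, map_zero, sub_zero]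
  refine ⟨toPS 𝒜 ℛ x, mem_points_of_toPS hx, (𝓑.isMCU_iff hR hx).2 hxmc, ?_,
    (isCoalgMap_coords hs hκ).mem_points hR ha, N, hN, fun ℓ => ?_⟩
  · rw [coeff_toPS, hred]
  · have hpk : slice ℓ (evl ℛ x (expCoeff 𝒜 N)) ∈ LinearMap.ker 𝓑.psLie.d := by
      rw [LinearMap.mem_ker, ← slice_rTensor, hDp, map_zero]
    let p : LinearMap.ker 𝓑.psLie.d := ⟨_, hpk⟩
    have hdℓ : 𝓑.d (slice ℓ α) = 0 := by rw [← slice_rTensor, hdα, map_zero]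
    have hrho : (rho s ^ N) p.1 = s (slice ℓ α) := by
      rw [← slice_rTensor, rho_pow_evl_expCoeff hR hx hN, hb, slice_rTensor]
    have hk1 := rho_pow_mem hs p.2 N
    have hv : ∀ m, T.val (m + N) p = T.val m ⟨s (slice ℓ α), hs.section_mem hdℓ⟩ := fun m => by
      rw [← val_rho_pow hs hT p N m hk1]
      congr 1
      exact Subtype.ext hrho
    refine ⟨𝓑.toCocycle p, fun m => (slice_expU_toPS ℓ hR hx N m).symm, fun m hm => ?_, ?_⟩
    · obtain ⟨j, rfl⟩ : ∃ j, m = j + 1 + N := ⟨m - N - 1, by omega⟩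
      exact (hv (j + 1)).trans (hT ⟨s (slice ℓ α), _⟩ ⟨_, hdℓ, rfl⟩ j)
    · have h1 := hv 0
      rw [Nat.zero_add, T.val_zero _ ⟨slice ℓ α, hdℓ⟩ (hs.cf_zero _),
        ← toH_of_mem_ker hκ ⟨slice ℓ α, hdℓ⟩] at h1
      rw [hcoord, slice_rTensor]
      exact h1

end Lifting

end DGBV

/-! ### Exterior algebras as parameter algebras -/

section Exterior

variable {K : Type u} [Field K] {M : Type u} [AddCommGroup M] [Module K M]

open CliffordAlgebra in
lemma exterior_supercomm (i j : ZMod 2) (r : ExteriorAlgebra K M)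
    (hr : r ∈ evenOdd (0 : QuadraticForm K M) i) (s : ExteriorAlgebra K M)
    (hs : s ∈ evenOdd (0 : QuadraticForm K M) j) : r * s = (-1 : ℤˣ) ^ (i * j) • (s * r) := by
  have h := map_mul_map_of_isOrtho_of_mem_evenOdd (QuadraticMap.Isometry.id (0 : QuadraticForm K M))
    (QuadraticMap.Isometry.id (0 : QuadraticForm K M)) (fun x y => by simp [QuadraticMap.IsOrtho])
    r s hr hs
  rw [CliffordAlgebra.map_id, AlgHom.id_apply, AlgHom.id_apply, mul_comm j i] at h
  exact h

open CliffordAlgebra in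
lemma exists_isNilpotent_sub (r : ExteriorAlgebra K M)
    (hr : r ∈ evenOdd (0 : QuadraticForm K M) 0) :
    ∃ c : K, IsNilpotent (r - algebraMap K _ c) := by
  induction r, hr using even_induction with
  | algebraMap c => exact ⟨c, by rw [sub_self]; exact IsNilpotent.zero⟩
  | add x y hx hy h1 h2 =>
    obtain ⟨c, hc⟩ := h1
    obtain ⟨c', hc'⟩ := h2
    refine ⟨c + c', ?_⟩
    rw [map_add, add_sub_add_comm]
    refine Commute.isNilpotent_add ?_ hc hc'
    have hxy : Commute x y := (exterior_supercomm 0 0 x hx y hy).trans (by simp)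
    exact (hxy.sub_left (Algebra.commute_algebraMap_left c y)).sub_right
      (Algebra.commute_algebraMap_right c' _)
  | ι_mul_ι_mul m n x hx _ =>
    refine ⟨0, 2, ?_⟩
    have h : ι (0 : QuadraticForm K M) m * ι _ n * x * (ι _ m * ι _ n * x)
        = ι (0 : QuadraticForm K M) m * ι _ n * (ι _ m * ι _ n) * (x * x) := by
      have hc := exterior_supercomm 0 0 x hx _ (ι_mul_ι_mem_evenOdd_zero (0 : QuadraticForm K M) m n)
      rw [mul_zero, uzpow_zero, one_smul] at hc
      rw [mul_assoc _ x, ← mul_assoc x, hc]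
      simp only [mul_assoc]
    have h0 : ι (0 : QuadraticForm K M) m * ι _ n * (ι _ m * ι _ n) = 0 := by
      have h1 : ι (0 : QuadraticForm K M) n * ι _ m = -(ι _ m * ι _ n) := by
        have := ExteriorAlgebra.ι_add_mul_swap (R := K) n m
        exact eq_neg_of_add_eq_zero_left this
      rw [mul_assoc, ← mul_assoc (ι _ n), h1, neg_mul, mul_assoc, mul_neg, ← mul_assoc,
        ι_sq_scalar]
      simp
    rw [map_zero, sub_zero, pow_two, h, h0, zero_mul]

open CliffordAlgebra in
/-- The exterior algebra, with its parity grading and augmentation, is a parameter algebra. -/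
lemma isParam_exterior : IsParam (evenOdd (0 : QuadraticForm K M))
    (ExteriorAlgebra.algebraMapInv : ExteriorAlgebra K M →ₐ[K] K) where
  supercomm := exterior_supercomm
  nilpotent r hr := by
    have hodd : ∀ x ∈ evenOdd (0 : QuadraticForm K M) 1,
        (ExteriorAlgebra.algebraMapInv : ExteriorAlgebra K M →ₐ[K] K) x = 0 := by
      intro x hx
      induction x, hx using odd_induction with
      | ι v => exact ExteriorAlgebra.lift_ι_apply K _ _ v
      | add x y hx hy h1 h2 => rw [map_add, h1, h2, add_zero]
      | ι_mul_ι_mul m n x hx h => rw [map_mul, h, mul_zero]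
    have h0 := comp_mem (evenOdd (0 : QuadraticForm K M)) 0 r
    have h1 := comp_mem (evenOdd (0 : QuadraticForm K M)) 1 r
    rw [← comp_add (evenOdd (0 : QuadraticForm K M)) r] at hr ⊢
    rw [map_add, hodd _ h1, add_zero] at hr
    obtain ⟨c, hc⟩ := exists_isNilpotent_sub _ h0
    have hc0 : c = 0 := by
      have := hc.map (ExteriorAlgebra.algebraMapInv : ExteriorAlgebra K M →ₐ[K] K)
      rw [map_sub, hr, AlgHom.commutes, zero_sub] at this
      simpa using this.eq_zero
    rw [hc0, map_zero, sub_zero] at hc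
    refine Commute.isNilpotent_add ?_ hc ⟨2, ?_⟩
    · have := exterior_supercomm 0 1 _ h0 _ h1
      rw [zero_mul, uzpow_zero, one_smul] at this
      exact this
    · -- odd elements anticommute and their generators square to zero
      generalize comp (evenOdd (0 : QuadraticForm K M)) 1 r = x at h1
      induction x, h1 using odd_induction with
      | ι v => rw [pow_two]; exact ExteriorAlgebra.ι_sq_zero v
      | add x y hx hy h2 h3 =>
        have := exterior_supercomm 1 1 _ hx _ hy
        rw [mul_one, uzpow_one, Units.neg_smul, one_smul] at this
        rw [pow_two] at h2 h3 ⊢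
        rw [mul_add, add_mul, add_mul, h2, h3, this]
        abel
      | ι_mul_ι_mul m n x hx h =>
        have hc := exterior_supercomm 1 0 x hx _ (ι_mul_ι_mem_evenOdd_zero (0 : QuadraticForm K M) m n)
        rw [mul_zero, uzpow_zero, one_smul] at hc
        rw [pow_two] at h ⊢
        rw [mul_assoc _ x, ← mul_assoc x, hc, mul_assoc _ x, h, mul_zero, mul_zero]

/-- The coordinate vectors of `Kᴺ`, continued by `0`. -/
def coordVec (K : Type u) [Field K] (N n : ℕ) : Fin N → K :=
  fun i => if (i : ℕ) = n then 1 else 0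

variable {N : ℕ}

/-- The `n`-th square-zero parameter of parity `i` in the exterior algebra of `Kᴺ`: a generator if
`i` is odd, and a product of two generators if `i` is even. -/
def sqZero (K : Type u) [Field K] (N n : ℕ) (i : ZMod 2) : ExteriorAlgebra K (Fin N → K) :=
  if i = 0 then ExteriorAlgebra.ι K (coordVec K N (2 * n)) *
    ExteriorAlgebra.ι K (coordVec K N (2 * n + 1))
  else ExteriorAlgebra.ι K (coordVec K N (2 * n))

open CliffordAlgebra in
lemma sqZero_mem (n : ℕ) (i : ZMod 2) :
    sqZero K N n i ∈ evenOdd (0 : QuadraticForm K (Fin N → K)) i := by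
  rcases zmod2_cases i with rfl | rfl
  · exact ι_mul_ι_mem_evenOdd_zero _ _ _
  · exact ι_mem_evenOdd_one _ _

lemma augmentation_sqZero (n : ℕ) (i : ZMod 2) :
    (ExteriorAlgebra.algebraMapInv : ExteriorAlgebra K (Fin N → K) →ₐ[K] K) (sqZero K N n i) = 0 := by
  have h : ∀ v, (ExteriorAlgebra.algebraMapInv : ExteriorAlgebra K (Fin N → K) →ₐ[K] K)
    (ExteriorAlgebra.ι K v) = 0 := fun v => ExteriorAlgebra.lift_ι_apply K _ _ v
  rw [sqZero]
  split
  · rw [map_mul, h, zero_mul]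
  · rw [h]

lemma sqZero_mul_self (n : ℕ) (i : ZMod 2) : sqZero K N n i * sqZero K N n i = 0 := by
  rw [sqZero]
  split
  · rw [mul_assoc, ← mul_assoc (ExteriorAlgebra.ι K (coordVec K N (2 * n + 1))),
      eq_neg_of_add_eq_zero_left (ExteriorAlgebra.ι_add_mul_swap (R := K)
        (coordVec K N (2 * n + 1)) (coordVec K N (2 * n))), neg_mul, mul_assoc, mul_neg, ← mul_assoc,
      ExteriorAlgebra.ι_sq_zero, zero_mul, neg_zero]
  · exact ExteriorAlgebra.ι_sq_zero _

/-- The product of distinct square-zero parameters of prescribed parities. -/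
def sqZeroProd (K : Type u) [Field K] (N : ℕ) : List (ZMod 2) → ExteriorAlgebra K (Fin N → K)
  | [] => 1
  | i :: l => sqZero K N l.length i * sqZeroProd K N l

open CliffordAlgebra in
lemma contract_sqZeroProd (l : List (ZMod 2)) {n : ℕ} (hn : n < N) (h : 2 * l.length ≤ n) :
    contractLeft (Q := (0 : QuadraticForm K (Fin N → K))) (LinearMap.proj ⟨n, hn⟩)
      (sqZeroProd K N l) = 0 := by
  have hc : ∀ m, m ≠ n → (LinearMap.proj ⟨n, hn⟩ : (Fin N → K) →ₗ[K] K) (coordVec K N m) = 0 :=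
    fun m hm => if_neg hm.symm
  induction l with
  | nil => exact contractLeft_one _ _
  | cons i l ih =>
    have ih' := ih (by simp only [List.length_cons] at h; omega)
    have h1 := hc (2 * l.length) (by simp only [List.length_cons] at h; omega)
    have h2 := hc (2 * l.length + 1) (by simp only [List.length_cons] at h; omega)
    rw [sqZeroProd, sqZero]
    split
    · rw [mul_assoc]
      refine (contractLeft_ι_mul _ _ _).trans ?_
      rw [h1, zero_smul, zero_sub, neg_eq_zero]
      refine mul_eq_zero_of_right _ ((contractLeft_ι_mul _ _ _).trans ?_)
      rw [h2, zero_smul, ih', mul_zero, sub_zero]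
    · refine (contractLeft_ι_mul _ _ _).trans ?_
      rw [h1, zero_smul, ih', mul_zero, sub_zero]

open CliffordAlgebra in
/-- Contraction with coordinates recovers the factors one after the other. -/
lemma sqZeroProd_ne_zero (l : List (ZMod 2)) (h : 2 * l.length ≤ N) : sqZeroProd K N l ≠ 0 := by
  induction l with
  | nil =>
    intro h0
    have := congrArg (ExteriorAlgebra.algebraMapInv : ExteriorAlgebra K (Fin N → K) →ₐ[K] K) h0
    rw [sqZeroProd, map_one, map_zero] at this
    exact one_ne_zero this
  | cons i l ih =>
    simp only [List.length_cons] at h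
    intro h0
    refine ih (by omega) ?_
    have hn1 : 2 * l.length < N := by omega
    have hn2 : 2 * l.length + 1 < N := by omega
    have e1 : (LinearMap.proj ⟨_, hn1⟩ : (Fin N → K) →ₗ[K] K) (coordVec K N (2 * l.length)) = 1 :=
      if_pos rfl
    have e2 : (LinearMap.proj ⟨_, hn2⟩ : (Fin N → K) →ₗ[K] K) (coordVec K N (2 * l.length + 1)) = 1 :=
      if_pos rfl
    have e3 : (LinearMap.proj ⟨_, hn1⟩ : (Fin N → K) →ₗ[K] K) (coordVec K N (2 * l.length + 1)) = 0 :=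
      if_neg (by simp)
    have c1 := contract_sqZeroProd (K := K) l hn1 le_rfl
    have c2 := contract_sqZeroProd (K := K) l hn2 (Nat.le_succ _)
    rw [sqZeroProd, sqZero] at h0
    split at h0
    · have h1 := congrArg (contractLeft (Q := (0 : QuadraticForm K (Fin N → K)))
        (LinearMap.proj ⟨_, hn1⟩)) h0
      rw [mul_assoc] at h1
      have h2 := (contractLeft_ι_mul _ _ _).symm.trans h1
      have h3 : contractLeft (Q := (0 : QuadraticForm K (Fin N → K))) (LinearMap.proj ⟨_, hn1⟩)
          (ExteriorAlgebra.ι K (coordVec K N (2 * l.length + 1)) * sqZeroProd K N l) = 0 := by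
        refine (contractLeft_ι_mul _ _ _).trans ?_
        rw [e3, zero_smul, c1, mul_zero, sub_zero]
      rw [e1, one_smul, h3, mul_zero, sub_zero, map_zero] at h2
      have h4 := congrArg (contractLeft (Q := (0 : QuadraticForm K (Fin N → K)))
        (LinearMap.proj ⟨_, hn2⟩)) h2
      have h5 := (contractLeft_ι_mul _ _ _).symm.trans h4
      rw [e2, one_smul, c2, mul_zero, sub_zero, map_zero] at h5
      exact h5
    · have h1 := congrArg (contractLeft (Q := (0 : QuadraticForm K (Fin N → K)))
        (LinearMap.proj ⟨_, hn1⟩)) h0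
      have h2 := (contractLeft_ι_mul _ _ _).symm.trans h1
      rw [e1, one_smul, c1, mul_zero, sub_zero, map_zero] at h2
      exact h2

instance : Module.Finite K (ExteriorAlgebra K (Fin N → K)) :=
  Module.Finite.of_basis (Pi.basisFun K (Fin N)).ExteriorAlgebra

end Exterior

/-! ### Functions are determined by their values at points -/

section Separation

variable {K : Type u} [Field K] [CharZero K] {V : Type v} [AddCommGroup V] [Module K V]
variable {𝒱 : ZMod 2 → Submodule K V} [DirectSum.Decomposition 𝒱]

open SSym

variable (𝒱) in
/-- The words in homogeneous letters span `Sym V`. -/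
lemma span_words (x : SSym 𝒱) : x ∈ Submodule.span K {x | ∃ l : List (ZMod 2 × V),
    (∀ p ∈ l, p.2 ∈ 𝒱 p.1) ∧ x = (l.map fun p => ι 𝒱 p.2).prod} := by
  refine word_induction 𝒱 (P := fun x => x ∈ Submodule.span K {x | ∃ l : List (ZMod 2 × V),
    (∀ p ∈ l, p.2 ∈ 𝒱 p.1) ∧ x = (l.map fun p => ι 𝒱 p.2).prod})
    (Submodule.subset_span ⟨[], by simp, by simp⟩)
    (fun c x hx => Submodule.smul_mem _ c hx) (fun x y hx hy => add_mem hx hy)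
    (fun i v hv x hx => ?_) x
  refine Submodule.span_induction (p := fun x _ => ι 𝒱 v * x ∈ _) ?_ (by simp)
    (fun x y _ _ h1 h2 => by rw [mul_add]; exact add_mem h1 h2)
    (fun c x _ h => by rw [mul_smul_comm]; exact Submodule.smul_mem _ c h) hx
  rintro _ ⟨l, hl, rfl⟩
  refine Submodule.subset_span ⟨(i, v) :: l, ?_, by simp⟩
  intro p hp
  rcases List.mem_cons.1 hp with rfl | hp
  · exact hv
  · exact hl p hp

variable {R : Type u} [Ring R] [Algebra K R] {ℛ : ZMod 2 → Submodule K R} [GradedAlgebra ℛ]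
variable {π : R →ₐ[K] K}

/-- Since `exp(a + v ⊗ r) = exp(a) (1 + v ⊗ r)` if `r² = 0`, linear forms that vanish at all points
vanish on products of such tensors. -/
lemma rTensor_prod_eq_zero (hR : IsParam ℛ π) {k : SSym 𝒱 →ₗ[K] K}
    (hk : ∀ a ∈ points 𝒱 ℛ π, evl ℛ a k = 0) (l : List (V ⊗[K] R))
    (hl : ∀ x ∈ l, x ∈ points 𝒱 ℛ π ∧ vec 𝒱 ℛ x * vec 𝒱 ℛ x = 0) :
    ∀ a ∈ points 𝒱 ℛ π, k.rTensor R ((GradedTensorProduct.of K (grading 𝒱) ℛ).symm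
      (GradedTensorProduct.of K (grading 𝒱) ℛ (gexp 𝒱 ℛ a) * (l.map (vec 𝒱 ℛ)).prod)) = 0 := by
  induction l with
  | nil =>
    intro a ha
    rw [List.map_nil, List.prod_nil, mul_one, GradedTensorProduct.of_symm_of]
    exact hk a ha
  | cons x l ih =>
    intro a ha
    obtain ⟨hx, hxx⟩ := hl x List.mem_cons_self
    have ih' := ih fun y hy => hl y (List.mem_cons_of_mem x hy)
    have hexp : GradedTensorProduct.of K (grading 𝒱) ℛ (gexp 𝒱 ℛ x) = 1 + vec 𝒱 ℛ x := by
      rw [gexp, GradedTensorProduct.symm_of_of, nexp_eq_sum (N := 2) (by rw [pow_two, hxx])]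
      simp [Finset.sum_range_succ]
    have h1 := ih' (a + x) (add_mem ha hx)
    rw [gexp_add hR ha hx, hexp, mul_add, mul_one, add_mul, map_add, map_add, ih' a ha, zero_add,
      mul_assoc] at h1
    rw [List.map_cons, List.prod_cons]
    exact h1

end Separation

section SeparationExterior

variable {K : Type u} [Field K] [CharZero K] {V : Type v} [AddCommGroup V] [Module K V]
variable {𝒱 : ZMod 2 → Submodule K V} [DirectSum.Decomposition 𝒱]

open SSym CliffordAlgebra

/-- The letters of a word, each multiplied by its own square-zero parameter. -/
def paramWord (N : ℕ) : List (ZMod 2 × V) → List (V ⊗[K] ExteriorAlgebra K (Fin N → K))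
  | [] => []
  | p :: l => (p.2 ⊗ₜ sqZero K N l.length p.1) :: paramWord N l

lemma mem_paramWord {N : ℕ} {l : List (ZMod 2 × V)} (hl : ∀ p ∈ l, p.2 ∈ 𝒱 p.1)
    {x : V ⊗[K] ExteriorAlgebra K (Fin N → K)} (hx : x ∈ paramWord N l) :
    x ∈ points 𝒱 (evenOdd (0 : QuadraticForm K (Fin N → K))) ExteriorAlgebra.algebraMapInv ∧
    vec 𝒱 (evenOdd (0 : QuadraticForm K (Fin N → K))) x
      * vec 𝒱 (evenOdd (0 : QuadraticForm K (Fin N → K))) x = 0 := by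
  induction l with
  | nil => exact absurd hx List.not_mem_nil
  | cons p l ih =>
    rcases List.mem_cons.1 hx with rfl | hx
    · have hp := hl p List.mem_cons_self
      refine ⟨tmul_mem_points hp (sqZero_mem _ _) (augmentation_sqZero _ _), ?_⟩
      have h := gtmul_mul_gtmul (ℬ := grading 𝒱) (evenOdd (0 : QuadraticForm K (Fin N → K)))
        (ι 𝒱 p.2) (sqZero_mem (K := K) (N := N) l.length p.1) (ι_mem 𝒱 hp) (sqZero K N l.length p.1)
      rw [sqZero_mul_self, TensorProduct.tmul_zero, map_zero, smul_zero] at h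
      exact h
    · exact ih (fun q hq => hl q (List.mem_cons_of_mem p hq)) hx

lemma prod_paramWord {N : ℕ} {l : List (ZMod 2 × V)} (hl : ∀ p ∈ l, p.2 ∈ 𝒱 p.1) :
    ∃ ε : ℤˣ, ((paramWord N l).map (vec 𝒱 (evenOdd (0 : QuadraticForm K (Fin N → K))))).prod
      = ε • GradedTensorProduct.of K (grading 𝒱) (evenOdd (0 : QuadraticForm K (Fin N → K)))
        ((l.map fun p => ι 𝒱 p.2).prod ⊗ₜ sqZeroProd K N (l.map Prod.fst)) ∧
      ∃ j, (l.map fun p => ι 𝒱 p.2).prod ∈ grading 𝒱 j := by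
  induction l with
  | nil => exact ⟨1, by rw [one_smul]; rfl, 0, SetLike.GradedOne.one_mem (A := grading 𝒱)⟩
  | cons p l ih =>
    obtain ⟨ε, h1, j, hj⟩ := ih fun q hq => hl q (List.mem_cons_of_mem p hq)
    have hp := hl p List.mem_cons_self
    have h := gtmul_mul_gtmul (ℬ := grading 𝒱) (evenOdd (0 : QuadraticForm K (Fin N → K)))
      (ι 𝒱 p.2) (sqZero_mem (K := K) (N := N) l.length p.1) hj (sqZeroProd K N (l.map Prod.fst))
    refine ⟨ε * (-1 : ℤˣ) ^ (p.1 * j), ?_, p.1 + j, ?_⟩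
    · rw [paramWord, List.map_cons, List.prod_cons, h1, mul_smul_comm, mul_smul]
      congr 1
      refine h.trans ?_
      rw [List.map_cons, List.prod_cons, List.map_cons, sqZeroProd, List.length_map]
    · rw [List.map_cons, List.prod_cons]
      exact SetLike.mul_mem_graded (ι_mem 𝒱 hp) hj

/-- A linear form on `Sym V` that vanishes at all points with values in finite-dimensional
parameter algebras is zero. -/
lemma eq_zero_of_evl {k : SSym 𝒱 →ₗ[K] K}
    (hk : ∀ (R : Type u) [Ring R] [Algebra K R] [Module.Finite K R] (ℛ : ZMod 2 → Submodule K R)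
      [GradedAlgebra ℛ] (π : R →ₐ[K] K), IsParam ℛ π → ∀ a ∈ points 𝒱 ℛ π, evl ℛ a k = 0) :
    k = 0 := by
  refine LinearMap.ext fun x => Submodule.span_induction (p := fun x _ => k x = 0) ?_ (map_zero k)
    (fun x y _ _ hx hy => by rw [map_add, hx, hy, add_zero])
    (fun c x _ hx => by rw [map_smul, hx, smul_zero]) (span_words 𝒱 x)
  rintro _ ⟨l, hl, rfl⟩
  set N := 2 * l.length with hN
  let ℛ := evenOdd (0 : QuadraticForm K (Fin N → K))
  have h := rTensor_prod_eq_zero (ℛ := ℛ) isParam_exterior (k := k)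
    (hk (ExteriorAlgebra K (Fin N → K)) ℛ ExteriorAlgebra.algebraMapInv isParam_exterior)
    (paramWord N l) (fun x hx => mem_paramWord hl hx) 0 (zero_mem _)
  obtain ⟨ε, h1, -⟩ := prod_paramWord (N := N) hl
  have h0 : GradedTensorProduct.of K (grading 𝒱) ℛ (gexp 𝒱 ℛ 0) = 1 := by
    rw [gexp, GradedTensorProduct.symm_of_of, vec, map_zero, map_zero, nexp_zero]
  rw [h0, one_mul, h1] at h
  have h2 : k.rTensor _ ((GradedTensorProduct.of K (grading 𝒱) ℛ).symm
      (GradedTensorProduct.of K (grading 𝒱) ℛ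
        ((l.map fun p => ι 𝒱 p.2).prod ⊗ₜ sqZeroProd K N (l.map Prod.fst)))) = 0 := by
    rcases Int.units_eq_one_or ε with e | e
    · rw [e, one_smul] at h; exact h
    · rw [e, Units.neg_smul, one_smul, map_neg, map_neg, neg_eq_zero] at h; exact h
  rw [GradedTensorProduct.of_symm_of, LinearMap.rTensor_tmul] at h2
  have h3 := congrArg (TensorProduct.lid K _) h2
  rw [TensorProduct.lid_tmul, map_zero] at h3
  exact (smul_eq_zero.1 h3).resolve_right (sqZeroProd_ne_zero _ (by rw [List.length_map]))

end SeparationExterior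

/-! ### The coordinates defined by a degeneration isomorphism -/

namespace DGBV

section Compatible

variable {K : Type u} [Field K] [CharZero K] {A : Type v} [Ring A] [Algebra K A]
variable {𝒜 : ZMod 2 → Submodule K A} [GradedAlgebra 𝒜] {𝓑 : DGBV 𝒜}

open SSym

lemma formalIso_ext {L : DGLie 𝒜} {W : Type w} [AddCommGroup W] [Module K W]
    {𝒲 : ZMod 2 → Submodule K W} [DirectSum.Decomposition 𝒲] {Φ Ψ : FormalIso L 𝒲}
    (h : ∀ f, Φ.pullback f = Ψ.pullback f) : Φ = Ψ := by
  obtain ⟨e, h1, h2, h3⟩ := Φ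
  obtain ⟨e', h1', h2', h3'⟩ := Ψ
  obtain rfl : e = e' := ContinuousLinearEquiv.ext (funext h)
  rfl

/-- The isomorphism is pullback along the model defined by an adapted section. It is compatible
since the model computes the values of functions at Maurer–Cartan elements from the coordinates of
any lift, and it is the only one since functions are determined by their values at points. -/
lemma existsUnique_isCompatible (T : 𝓑.DegIso) :
    ∃! Φ : FormalIso 𝓑.toDGLie 𝓑.HGrading, 𝓑.IsCompatible T Φ := by
  obtain ⟨s, hs, hT⟩ := T.exists_isAdapted
  obtain ⟨κ, hκ⟩ := exists_isContraction 𝓑.d_odd 𝓑.d_sq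
  obtain ⟨Φ, hΦ⟩ := exists_formalIso_pull hs hκ
  -- the pullback of `f` along `Φ` is represented by `φ` iff `φ` restricts to `f` on the model
  have hmodel : ∀ (f : FormalFun 𝓑.HGrading) (φ : LinearMap.ker 𝓑.toDGLie.ce),
      Φ.pullback f = Coh.mk 𝓑.toDGLie.ce φ ↔ pull (model hs hκ) φ = f := by
    intro f φ
    have hk : pull (coords hs hκ) f ∈ LinearMap.ker 𝓑.toDGLie.ce := by
      rw [DGLie.mem_ker_ce]
      change (f.toDual ∘ₗ coords hs hκ) ∘ₗ 𝓑.toDGLie.Q = 0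
      rw [LinearMap.comp_assoc, coords_Q, LinearMap.comp_zero]
    have hcm : pull (model hs hκ) (pull (coords hs hκ) f) = f := by
      change (f.toDual ∘ₗ coords hs hκ) ∘ₗ model hs hκ = f.toDual
      rw [LinearMap.comp_assoc, coords_model, LinearMap.comp_id]
    rw [hΦ f ⟨_, hk⟩ rfl]
    constructor
    · intro h
      rw [← sub_eq_zero, ← map_sub] at h
      obtain ⟨ψ, hψ⟩ : (pull (coords hs hκ) f - φ : FormalFun 𝒜) ∈ LinearMap.range 𝓑.toDGLie.ce :=
        (Submodule.Quotient.mk_eq_zero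
          ((LinearMap.range 𝓑.toDGLie.ce).submoduleOf (LinearMap.ker 𝓑.toDGLie.ce))).1 h
      have h0 : pull (model hs hκ) (𝓑.toDGLie.ce ψ) = 0 := by
        change (ψ.toDual ∘ₗ 𝓑.toDGLie.Q) ∘ₗ model hs hκ = 0
        rw [LinearMap.comp_assoc, Q_model, LinearMap.comp_zero]
      rw [hψ, map_sub, hcm, sub_eq_zero] at h0
      exact h0.symm
    · rintro rfl
      refine (sub_eq_zero.1 ?_).symm
      rw [← map_sub]
      exact (Submodule.Quotient.mk_eq_zero _).2 (sub_pull_mem_range hs hκ φ.2)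
  have hcocycle : ∀ φ : LinearMap.ker 𝓑.toDGLie.ce,
      (φ : FormalFun 𝒜).toDual ∘ₗ 𝓑.toDGLie.Q = 0 := fun φ => (𝓑.toDGLie.mem_ker_ce).1 φ.2
  refine ⟨Φ, ?_, fun Ψ hΨ => formalIso_ext fun f => ?_⟩
  · intro R _ _ _ ℛ _ π hR a ha hmc
    obtain ⟨a', hl⟩ := exists_isLift hs hκ hR hT ha ((𝓑.isMC_iff hR ha).1 hmc)
    refine ⟨⟨a', _, hl⟩, fun a' h hl f φ hf => ?_⟩
    rw [evalAt_eq, evalAt_eq, ← (hmodel f φ).1 hf, hl.evl_eq hκ hR hs hT (hcocycle φ)]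
    rfl
  · obtain ⟨φ, hφ⟩ := Submodule.mkQ_surjective _ (Ψ.pullback f)
    refine hφ.symm.trans ((hmodel f φ).2 ?_).symm
    have key : (pull (model hs hκ) φ).toDual - f.toDual = 0 := by
      refine eq_zero_of_evl fun R _ _ _ ℛ _ π hR h hh => ?_
      -- every point of the cohomology comes from a Maurer–Cartan element
      have hm := isCoalgMap_model hs hκ
      have ha := hm.mem_points hR hh
      have hmc : evl ℛ (evl ℛ h (tau 𝒜 ∘ₗ model hs hκ)) 𝓑.toDGLie.Q = 0 := by
        rw [← hm.evl_comp hR hh, Q_model]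
        simp [evl]
      obtain ⟨a', hl⟩ := exists_isLift hs hκ hR hT ha hmc
      have hval : evl ℛ (evl ℛ h (tau 𝒜 ∘ₗ model hs hκ)) (tau 𝓑.HGrading ∘ₗ coords hs hκ) = h := by
        rw [← hm.evl_comp hR hh, LinearMap.comp_assoc, coords_model, LinearMap.comp_id,
          evl_tau hR hh]
      rw [hval] at hl
      have h1 := (hΨ R ℛ π hR _ ha ((𝓑.isMC_iff hR ha).2 hmc)).2 a' h hl f φ hφ.symm
      rw [evalAt_eq, evalAt_eq, hl.evl_eq hκ hR hs hT (hcocycle φ)] at h1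
      rw [evl_sub, sub_eq_zero]
      exact (TensorProduct.lid K R).injective h1
    exact sub_eq_zero.1 key

end Compatible

end DGBV

end BVModuli

end

theorem mainTheorem2 {K : Type*} [Field K] [CharZero K] {A : Type*} [Ring A] [Algebra K A]
    (𝒜 : ZMod 2 → Submodule K A) [GradedAlgebra 𝒜] (𝓑 : BVModuli.DGBV 𝒜)
    (hdeg : 𝓑.HasDegeneration) :
    (∃ F : BVModuli.LInfHom (BVModuli.DGLie.trivial 𝓑.HGrading) 𝓑.toDGLie, F.IsQuasiIso) ∧
    Nonempty (BVModuli.FormalIso 𝓑.toDGLie 𝓑.HGrading) ∧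
    ∀ T : 𝓑.DegIso, ∃! Φ : BVModuli.FormalIso 𝓑.toDGLie 𝓑.HGrading, 𝓑.IsCompatible T Φ := by
  obtain ⟨s, hs⟩ := BVModuli.DGBV.exists_isSection hdeg
  obtain ⟨κ, hκ⟩ := BVModuli.exists_isContraction 𝓑.d_odd 𝓑.d_sq
  refine ⟨BVModuli.DGBV.exists_lInfHom hs hκ,
    ⟨(BVModuli.DGBV.exists_formalIso_pull hs hκ).choose⟩, BVModuli.DGBV.existsUnique_isCompatible⟩
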